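/- Let $d\ge 1$, $\lambda_1\ge\dots\ge\lambda_d>0$, $\sigma>0$, $\alpha\in(0,1)$, $0<\epsilon<\alpha$ and $\tau>0$ be fixed. For every ambient dimension $n\ge d$ let $U=U^{(n)}\in\mathbb R^{n\times d}$ be a deterministic matrix with orthonormal columns, and let samples $s_k=Uc_k+a_k\in\mathbb R^n$, $k=0,1,2,\dots$, be observed through $y_k=\Omega_k s_k$, $\Omega_k=\mathrm{diag}(v_{k,1},\dots,v_{k,n})$, where the $c_k\in\mathbb R^d$ are i.i.d. with mean zero, covariance $\mathrm{diag}(\lambda_1^2,\dots,\lambda_d^2)$ and finite moments of all orders; the entries of the noise vectors $a_k$ are i.i.d. with mean zero, variance $\sigma^2$ and finite moments of all orders; the $v_{k,i}\in\{0,1\}$ are i.i.d. with $\mathbb P(v_{k,i}=1)=\alpha$; the laws of $c_k$ and of the noise entries do not depend on $n$ or $k$. Let $X_0=X_0^{(n)}\in\mathbb R^{n\times d}$ be a (possibly random) initial guess with $X_0^\top X_0=I_d$ almost surely, and let $X_0$, $(c_k)_k$, $(a_k)_k$, $(v_{k,i})_{k,i}$ be independent. Assume that there is a constant $C$, independent of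 $n$, with $\sum_{i,j}U_{ij}^4\le C/n$ and, almost surely, $\sum_{i,j}(X_0)_{ij}^4\le C/n$, and that $U^\top X_0$ converges entrywise in probability, as $n\to\infty$, to a deterministic invertible matrix $Q(0)$. Let $(X_k)_{k\ge0}$ be the iterates of either of the following two algorithms with constant step size $\tau$. If the smallest eigenvalue of $X_k^\top\Omega_kX_k$ is at most $\epsilon$, then $X_{k+1}=X_k$. Otherwise, put $\hat w_k=\arg\min_w\|y_k-\Omega_kX_kw\|^2$ and * (Oja's method with imputation) $\hat y_k=y_k+(I_n-\Omega_k)X_k\hat w_k$, $\tilde X_k=X_k+\frac{\tau}{n}\hat y_k\hat w_k^\top$, $X_{k+1}=\tilde X_k(\tilde X_k^\top\tilde X_k)^{-1/2}$; * (GROUSE) $p_k=X_k\hat w_k$, $r_k=y_k-\Omega_kp_k$, $\vartheta_k=\frac{\tau}{n}\|r_k\|\,\|p_k\|$, $X_{k+1}=X_k+\Big[(\cos\vartheta_k-1)\frac{p_k}{\|p_k\|}+\sin\vartheta_k\frac{r_k}{\|r_k\|}\Big]\frac{\hat w_k^\top}{\|\hat w_k\|}$ (and $X_{k+1}=X_k$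 if $p_k=0$ or $r_k=0$). For $t\ge0$ let $0\le\theta^{(n)}_1(t)\le\dots\le\theta^{(n)}_d(t)\le\pi/2$ be the principal angles between the column spaces of $U$ and of $X_{\lfloor nt\rfloor}$, i.e. $\cos\theta^{(n)}_\ell(t)$ is the $\ell$-th largest singular value of $U^\top X_{\lfloor nt\rfloor}$. Then for each of the two algorithms and every $1\le\ell\le d$, $$\lim_{t\to\infty}\lim_{n\to\infty}\cos^2\theta^{(n)}_\ell(t)=\max\Big\{0,\ \frac{2\alpha\lambda_\ell^2-\tau\sigma^4}{\alpha\lambda_\ell^2(2+\tau\sigma^2)}\Big\},$$ where the inner limit exists, for every fixed $t\ge0$, as a limit in probability to a constant. Consequently, each of the two algorithms provides asymptotically informative solutions, that is, $\lim_{t\to\infty}\lim_{n\to\infty}\cos^2\theta^{(n)}_\ell(t)>0$ for all $1\le\ell\le d$, if and only if $$\tau<\frac{2\alpha}{\sigma^4}\min_{1\le\ell\le d}\lambda_\ell^2.$$ -/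

import Mathlib

open MeasureTheory ProbabilityTheory Filter Topology Matrix

namespace SubspaceTracking

noncomputable section

/-! ### Linear algebra -/

/-- The Euclidean norm of a vector of real numbers. -/
def l2norm {m : ℕ} (x : Fin m → ℝ) : ℝ := ‖WithLp.toLp 2 x‖

/-- `A ^ (-1/2)`: the inverse of the principal square root of a positive definite matrix `A`. -/
def invSqrt {d : ℕ} (A : Matrix (Fin d) (Fin d) ℝ) : Matrix (Fin d) (Fin d) ℝ :=
  cfc (fun x : ℝ => (Real.sqrt x)⁻¹) A

/-- The orthonormalization `X (Xᵀ X) ^ (-1/2)` of an `n × d` matrix of rank `d`. -/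
def orthonormalize {n d : ℕ} (X : Matrix (Fin n) (Fin d) ℝ) : Matrix (Fin n) (Fin d) ℝ :=
  X * invSqrt (Xᵀ * X)

/-- The smallest eigenvalue of a real symmetric matrix. -/
def lambdaMin {d : ℕ} (A : Matrix (Fin d) (Fin d) ℝ) : ℝ := sInf (spectrum ℝ A)

/-- The minimizer of `w ↦ ‖y - M w‖ ^ 2`, written through the normal equations. It is the unique
minimizer as soon as `Mᵀ M` is invertible, see `leastSquares_lt`. -/
def leastSquares {n d : ℕ} (M : Matrix (Fin n) (Fin d) ℝ) (y : Fin n → ℝ) : Fin d → ℝ :=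
  (Mᵀ * M)⁻¹ *ᵥ (Mᵀ *ᵥ y)

theorem l2norm_sq {m : ℕ} (x : Fin m → ℝ) : l2norm x ^ 2 = x ⬝ᵥ x := by
  rw [l2norm, EuclideanSpace.norm_sq_eq]
  simp [dotProduct, sq]

theorem leastSquares_lt {n d : ℕ} (M : Matrix (Fin n) (Fin d) ℝ) (y : Fin n → ℝ)
    (hM : IsUnit (Mᵀ * M).det) (w : Fin d → ℝ) (hw : w ≠ leastSquares M y) :
    l2norm (y - M *ᵥ leastSquares M y) ^ 2 < l2norm (y - M *ᵥ w) ^ 2 := by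
  set u := leastSquares M y with hu
  have hnormal : Mᵀ *ᵥ (y - M *ᵥ u) = 0 := by
    rw [mulVec_sub, hu, leastSquares, mulVec_mulVec, mulVec_mulVec,
      Matrix.mul_nonsing_inv _ hM, one_mulVec, sub_self]
  have hsplit : y - M *ᵥ w = (y - M *ᵥ u) + M *ᵥ (u - w) := by
    rw [mulVec_sub]; abel
  have hcross : (y - M *ᵥ u) ⬝ᵥ (M *ᵥ (u - w)) = 0 := by
    rw [dotProduct_mulVec, ← mulVec_transpose, hnormal, zero_dotProduct]
  have hne : M *ᵥ (u - w) ≠ 0 := by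
    intro h0
    have h1 : (Mᵀ * M) *ᵥ (u - w) = 0 := by rw [← mulVec_mulVec, h0, mulVec_zero]
    have h2 : (Mᵀ * M)⁻¹ *ᵥ ((Mᵀ * M) *ᵥ (u - w)) = u - w := by
      rw [mulVec_mulVec, Matrix.nonsing_inv_mul _ hM, one_mulVec]
    rw [h1, mulVec_zero] at h2
    exact hw (sub_eq_zero.mp h2.symm).symm
  have hpos : 0 < (M *ᵥ (u - w)) ⬝ᵥ (M *ᵥ (u - w)) :=
    lt_of_le_of_ne (Finset.sum_nonneg fun i _ => mul_self_nonneg _)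
      (fun h => hne (dotProduct_self_eq_zero.mp h.symm))
  have hcross' : (M *ᵥ (u - w)) ⬝ᵥ (y - M *ᵥ u) = 0 := by rw [dotProduct_comm, hcross]
  rw [l2norm_sq, l2norm_sq, hsplit, add_dotProduct, dotProduct_add, dotProduct_add, hcross,
    hcross']
  linarith

/-! ### The two algorithms -/

/-- The diagonal subsampling matrix of an observation pattern. -/
def maskMatrix {n : ℕ} (v : Fin n → Bool) : Matrix (Fin n) (Fin n) ℝ :=
  Matrix.diagonal fun i => if v i then 1 else 0

/-- One update of Oja's method with imputation, from the estimate `X`, when the sample `s` is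
observed on the entries marked by `v`. Here `τ` is the step size of this step (it enters as `τ / n`)
and `ε` is the threshold of the test for having enough observed entries. -/
def ojaStep {n d : ℕ} (ε τ : ℝ) (X : Matrix (Fin n) (Fin d) ℝ) (v : Fin n → Bool)
    (s : Fin n → ℝ) : Matrix (Fin n) (Fin d) ℝ :=
  let Om := maskMatrix v
  let y := Om *ᵥ s
  let w := leastSquares (Om * X) y
  let yhat := y + (1 - Om) *ᵥ (X *ᵥ w)
  if ε < lambdaMin (Xᵀ * Om * X) then
    orthonormalize (X + (τ / n) • Matrix.vecMulVec yhat w)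
  else X

/-- One update of GROUSE. (When `p` or `r` vanishes then so does the angle, and with it the whole
increment; this agrees with the convention `x / 0 = 0`.) -/
def grouseStep {n d : ℕ} (ε τ : ℝ) (X : Matrix (Fin n) (Fin d) ℝ) (v : Fin n → Bool)
    (s : Fin n → ℝ) : Matrix (Fin n) (Fin d) ℝ :=
  let Om := maskMatrix v
  let y := Om *ᵥ s
  let w := leastSquares (Om * X) y
  let p := X *ᵥ w
  let r := y - Om *ᵥ p
  let θ := (τ / n) * (l2norm r * l2norm p)
  if ε < lambdaMin (Xᵀ * Om * X) then
    X + Matrix.vecMulVec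
      (((Real.cos θ - 1) / l2norm p) • p + (Real.sin θ / l2norm r) • r) ((l2norm w)⁻¹ • w)
  else X

/-- The two algorithms under study. -/
inductive Algorithm
  | oja
  | grouse

/-- One update of the given algorithm. -/
def Algorithm.step {n d : ℕ} : Algorithm → ℝ → ℝ → Matrix (Fin n) (Fin d) ℝ → (Fin n → Bool) →
    (Fin n → ℝ) → Matrix (Fin n) (Fin d) ℝ
  | .oja => ojaStep
  | .grouse => grouseStep

/-- The iterates `X_k` of the algorithm with step sizes `τ k`, started at `X₀` and fed with the
samples `s k` observed on the entries marked by `v k`. -/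
def iterate {n d : ℕ} (alg : Algorithm) (ε : ℝ) (τ : ℕ → ℝ) (X₀ : Matrix (Fin n) (Fin d) ℝ)
    (v : ℕ → Fin n → Bool) (s : ℕ → Fin n → ℝ) : ℕ → Matrix (Fin n) (Fin d) ℝ
  | 0 => X₀
  | k + 1 => alg.step ε (τ k) (iterate alg ε τ X₀ v s k) (v k) (s k)

/-! ### Cosine similarity and principal angles -/

/-- The cosine similarity matrix of `U` (with orthonormal columns) and of an estimate `X`. -/
def cosineSimilarity {n d : ℕ} (U X : Matrix (Fin n) (Fin d) ℝ) : Matrix (Fin d) (Fin d) ℝ :=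
  Uᵀ * orthonormalize X

/-- The principal angles between the column spaces of `U` and `X`, in nondecreasing order: their
cosines are the singular values of the cosine similarity matrix, in nonincreasing order. -/
def principalAngle {n d : ℕ} (U X : Matrix (Fin n) (Fin d) ℝ) (l : Fin d) : ℝ :=
  Real.arccos ((Matrix.toEuclideanLin (cosineSimilarity U X)).singularValues (l : ℕ))

/-- The principal angles `θ_l^{(n)}(t)` between the true subspace and the estimate at the rescaled
time `t`, that is after `⌊n t⌋` steps, for the samples `s_k = U c_k + a_k` and a constant step
size `τ`. -/
def angleAt {n d : ℕ} (alg : Algorithm) (ε τ : ℝ) (U X₀ : Matrix (Fin n) (Fin d) ℝ)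
    (c : ℕ → Fin d → ℝ) (a : ℕ → Fin n → ℝ) (v : ℕ → Fin n → Bool) (t : ℝ) (l : Fin d) : ℝ :=
  principalAngle U
    (iterate alg ε (fun _ => τ) X₀ v (fun k => U *ᵥ c k + a k) ⌊(n : ℝ) * t⌋₊) l

/-! ### The probabilistic model -/

/-- The law of the coefficient vectors: centered, with covariance `diag (lam l ^ 2)`, and with
finite moments of all orders. -/
structure IsCoefficientLaw {d : ℕ} (lam : Fin d → ℝ) (ν : Measure (Fin d → ℝ)) : Prop where
  prob : IsProbabilityMeasure ν
  moments : ∀ (p : ℕ) (i : Fin d), Integrable (fun x : Fin d → ℝ => |x i| ^ p) ν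
  mean : ∀ i, ∫ x, x i ∂ν = 0
  cov : ∀ i j, ∫ x, x i * x j ∂ν = if i = j then lam i ^ 2 else 0

/-- The law of the entries of the noise: centered, with variance `σ ^ 2`, and with finite moments of
all orders. -/
structure IsNoiseLaw (σ : ℝ) (ν : Measure ℝ) : Prop where
  prob : IsProbabilityMeasure ν
  moments : ∀ p : ℕ, Integrable (fun x : ℝ => |x| ^ p) ν
  mean : ∫ x, x ∂ν = 0
  var : ∫ x, x ^ 2 ∂ν = σ ^ 2

/-- The joint law of the (possibly random) initial guess `X₀`, the coefficient vectors `c k`, the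
noise vectors `a k` and the observation patterns `v k` in ambient dimension `n`: the `c k` are
i.i.d. with law `νc`, the entries of all `a k` are i.i.d. with law `νa`, the entries of all `v k`
are i.i.d. Bernoulli variables with parameter `α`, and `X₀`, `c`, `a`, `v` are independent. -/
structure IsDataStream {n d : ℕ} {Ω : Type*} [MeasurableSpace Ω] (μ : Measure Ω)
    (νc : Measure (Fin d → ℝ)) (νa : Measure ℝ) (α : ℝ)
    (X₀ : Ω → Matrix (Fin n) (Fin d) ℝ) (c : ℕ → Ω → Fin d → ℝ) (a : ℕ → Ω → Fin n → ℝ)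
    (v : ℕ → Ω → Fin n → Bool) : Prop where
  measurable_X₀ : ∀ i j, Measurable fun ω => X₀ ω i j
  measurable_c : ∀ k, Measurable (c k)
  measurable_a : ∀ k, Measurable (a k)
  measurable_v : ∀ k, Measurable (v k)
  law_c : ∀ k, μ.map (c k) = νc
  law_a : ∀ k i, μ.map (fun ω => a k ω i) = νa
  law_v : ∀ k i, μ {ω | v k ω i = true} = ENNReal.ofReal α
  indep_c : iIndepFun c μ
  indep_a : iIndepFun (fun (q : ℕ × Fin n) ω => a q.1 ω q.2) μ
  indep_v : iIndepFun (fun (q : ℕ × Fin n) ω => v q.1 ω q.2) μ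
  indep_X₀_cav : IndepFun (fun ω i j => X₀ ω i j)
    (fun ω => (fun k => c k ω, fun k => a k ω, fun k => v k ω)) μ
  indep_c_av : IndepFun (fun ω k => c k ω) (fun ω => (fun k => a k ω, fun k => v k ω)) μ
  indep_a_v : IndepFun (fun ω k => a k ω) (fun ω k => v k ω) μ

/-! ### Limits -/

/-- Convergence in probability of random variables `Y n`, each on its own probability space, to a
constant `y`. -/
def ConvergesInProbability {Ω : ℕ → Type*} [∀ n, MeasurableSpace (Ω n)]
    (μ : ∀ n, Measure (Ω n)) (Y : ∀ n, Ω n → ℝ) (y : ℝ) : Prop :=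
  ∀ δ : ℝ, 0 < δ → Tendsto (fun n => μ n {ω | δ ≤ |Y n ω - y|}) atTop (𝓝 0)

/-- `lim_{t → ∞} lim_{n → ∞} Y n t = L`: for every time `t ≥ 0` the random variables `Y n t` converge
in probability to a constant as `n → ∞`, and these constants converge to `L` as `t → ∞`. -/
def HasIteratedLimit {Ω : ℕ → Type*} [∀ n, MeasurableSpace (Ω n)]
    (μ : ∀ n, Measure (Ω n)) (Y : ∀ n, ℝ → Ω n → ℝ) (L : ℝ) : Prop :=
  ∃ y : ℝ → ℝ, (∀ t : ℝ, 0 ≤ t → ConvergesInProbability μ (fun n => Y n t) (y t)) ∧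
    Tendsto y atTop (𝓝 L)

/-- An asymptotically informative solution: the iterated limits of the squared cosines of all
principal angles `θ l` exist and are positive. -/
def AsymptoticallyInformative {d : ℕ} {Ω : ℕ → Type*} [∀ n, MeasurableSpace (Ω n)]
    (μ : ∀ n, Measure (Ω n)) (θ : Fin d → ∀ n, ℝ → Ω n → ℝ) : Prop :=
  ∀ l, ∃ L : ℝ, 0 < L ∧ HasIteratedLimit μ (fun n t ω => Real.cos (θ l n t ω) ^ 2) L

end

end SubspaceTracking

open SubspaceTracking

namespace SubspaceTracking

noncomputable section

/-! ### Explicit form of the updates -/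

/-! Both updates have the form `X + (A • Xw + B • r) wᵀ`, where `w` is the fitted coefficient
vector, `r` the observed residual, which is orthogonal to the columns of `X`, and `A`, `B` are
scalars that depend on the sample through `‖w‖` and `‖r‖` only (`step_eq_closedStep`). For both
algorithms `B = τ/n` and `A = -τ²ρ/(2n)` with `ρ = ‖r‖²/n`, up to errors of order `n⁻²`
(`coeff_bounds`); this is why they share one limit.

The sample has covariance `U diag(lam²) Uᵀ + σ²`, the observed Gram matrices are close to `α` times
the full ones, and `ρ` concentrates at `ασ²`. So the mean increment of `Q = UᵀX` is close to
`driftField / n` (`exists_drift_bound`). It follows that `P = QQᵀ`, whose sorted eigenvalues are the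
squared cosines, obeys in the time `t = k/n` the Riccati equation `P' = aP + Pa - PgP` with diagonal
`a = τ(α lam² - τσ⁴/2)` and `g = 2τα(1 + τσ²/2) lam²` (`driftField_mul_transpose`). The inverse `R =
P⁻¹` solves the linear equation `R' = -aR - Ra + g`. It is therefore explicit, it lies between two
diagonal solutions, and `P(t)` tends to the diagonal matrix with entries `max 0 (2a/g)`, which are
the claimed limits (`exists_riccati_solution`).

The comparison of the iterates with the differential equation rests on one function, `lyapunov`: the
squared Frobenius distance of `QQᵀ` from `P(k/n)` plus the sum of the fourth powers of the entries
of `X`. The second summand is there because the error made by the masks has a mean square bounded by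
the fourth moments of `U` and `X` plus `1/n` (`IsPatternLaw.integral_patternError_le`). It stays
small because the mean drift of a row of `X` is controlled by that row and the corresponding row of
`U` (`exists_fourthMoment_bound`). Averaging over the sample and then over the mask gives `E V_{k+1}
≤ (1 + K/n) E V_k + K/n²` (`exists_lyapunov_step_bound`). A discrete Grönwall argument over at most
`nT` steps bounds `E V` by a multiple of its initial value plus `1/n`, and both vanish as `n → ∞`.
Markov's inequality and Weyl's perturbation bound (`IsSortedSpectrum.abs_sub_le`) then give
convergence in probability at each fixed time, with no tightness argument.

The criterion for informative solutions follows from the sign of the limit, because limits in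
probability are unique. -/

theorem l2norm_nonneg {m : ℕ} (x : Fin m → ℝ) : 0 ≤ l2norm x := norm_nonneg _

theorem maskMatrix_transpose {n : ℕ} (v : Fin n → Bool) : (maskMatrix v)ᵀ = maskMatrix v := by
  simp [maskMatrix]

theorem maskMatrix_mul_self {n : ℕ} (v : Fin n → Bool) :
    maskMatrix v * maskMatrix v = maskMatrix v := by
  simp only [maskMatrix, diagonal_mul_diagonal]
  congr 1; ext i; split_ifs <;> simp

/-- The Gram matrix of the observed rows. -/
def gram {n d : ℕ} (X : Matrix (Fin n) (Fin d) ℝ) (v : Fin n → Bool) :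
    Matrix (Fin d) (Fin d) ℝ := Xᵀ * maskMatrix v * X

/-- The matrix that maps a sample to its coefficients fitted on the observed rows. -/
def fitMatrix {n d : ℕ} (X : Matrix (Fin n) (Fin d) ℝ) (v : Fin n → Bool) :
    Matrix (Fin d) (Fin n) ℝ := (gram X v)⁻¹ * (Xᵀ * maskMatrix v)

/-- The matrix that maps a sample to the residual of the fit. -/
def residualMatrix {n d : ℕ} (X : Matrix (Fin n) (Fin d) ℝ) (v : Fin n → Bool) :
    Matrix (Fin n) (Fin n) ℝ := maskMatrix v * (1 - X * fitMatrix X v)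

theorem gram_transpose {n d : ℕ} (X : Matrix (Fin n) (Fin d) ℝ) (v : Fin n → Bool) :
    (gram X v)ᵀ = gram X v := by
  simp [gram, maskMatrix_transpose, Matrix.mul_assoc]

theorem leastSquares_eq {n d : ℕ} (X : Matrix (Fin n) (Fin d) ℝ) (v : Fin n → Bool)
    (s : Fin n → ℝ) :
    leastSquares (maskMatrix v * X) (maskMatrix v *ᵥ s) = fitMatrix X v *ᵥ s := by
  have h1 : (maskMatrix v * X)ᵀ * (maskMatrix v * X) = gram X v := by
    rw [transpose_mul, maskMatrix_transpose, Matrix.mul_assoc, ← Matrix.mul_assoc (maskMatrix v),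
      maskMatrix_mul_self, gram, Matrix.mul_assoc]
  have h2 : (maskMatrix v * X)ᵀ * maskMatrix v = Xᵀ * maskMatrix v := by
    rw [transpose_mul, maskMatrix_transpose, Matrix.mul_assoc, maskMatrix_mul_self]
  rw [leastSquares, h1, mulVec_mulVec, mulVec_mulVec, Matrix.mul_assoc, h2, fitMatrix]

theorem residual_eq {n d : ℕ} (X : Matrix (Fin n) (Fin d) ℝ) (v : Fin n → Bool)
    (s : Fin n → ℝ) :
    maskMatrix v *ᵥ s - maskMatrix v *ᵥ (X *ᵥ (fitMatrix X v *ᵥ s)) = residualMatrix X v *ᵥ s := by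
  rw [residualMatrix, Matrix.mul_sub, sub_mulVec, Matrix.mul_one, mulVec_mulVec, mulVec_mulVec,
    Matrix.mul_assoc]

/-! ### Scalar coefficients of the two updates and their common expansion -/

/-- The coefficient of the fitted vector in the increment of an update with step size `h`, where
`x` is the length of the coefficient vector and `y` that of the residual. -/
def fitCoeff : Algorithm → ℝ → ℝ → ℝ → ℝ
  | .oja, h, x, y =>
    h / √(1 + (2 * h + h ^ 2 * (x ^ 2 + y ^ 2)) * x ^ 2)
      - (2 * h + h ^ 2 * (x ^ 2 + y ^ 2)) /
        (√(1 + (2 * h + h ^ 2 * (x ^ 2 + y ^ 2)) * x ^ 2) *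
          (√(1 + (2 * h + h ^ 2 * (x ^ 2 + y ^ 2)) * x ^ 2) + 1))
  | .grouse, h, x, y => -(h ^ 2 * y ^ 2 / 2) * Real.sinc (h * x * y / 2) ^ 2

/-- The coefficient of the residual in the increment of an update. -/
def residualCoeff : Algorithm → ℝ → ℝ → ℝ → ℝ
  | .oja, h, x, y => h / √(1 + (2 * h + h ^ 2 * (x ^ 2 + y ^ 2)) * x ^ 2)
  | .grouse, h, x, y => h * Real.sinc (h * x * y)

theorem sq_sub_one_le_sinc {x : ℝ} : 1 - x ^ 2 / 6 ≤ Real.sinc x := by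
  wlog hx : 0 ≤ x generalizing x
  · have := this (x := -x) (by linarith)
    rwa [Real.sinc_neg, neg_sq] at this
  rcases hx.eq_or_lt with rfl | hx
  · simp
  · rw [Real.sinc_of_ne_zero hx.ne', le_div_iff₀ hx]
    have := Real.sin_ge_sub_cube hx.le
    nlinarith

theorem mul_sinc (x : ℝ) : x * Real.sinc x = Real.sin x := by
  rcases eq_or_ne x 0 with rfl | hx
  · simp
  · rw [Real.sinc_of_ne_zero hx]; field_simp

/-- This is orthonormality in scalar form: with `x = ‖w‖`, `y = ‖r‖`, the update sends the unit
vector `Xw/x` to `(1 + Ax²) Xw/x + (Bx) r`, whose squared length is the left side. For GROUSE it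
reads `cos² + sin² = 1`. -/
theorem coeff_sq_add_sq (alg : Algorithm) {h : ℝ} (hh : 0 ≤ h) (x y : ℝ) :
    (1 + fitCoeff alg h x y * x ^ 2) ^ 2 + residualCoeff alg h x y ^ 2 * x ^ 2 * y ^ 2 = 1 := by
  cases alg with
  | oja =>
    simp only [fitCoeff, residualCoeff]
    set β := 2 * h + h ^ 2 * (x ^ 2 + y ^ 2) with hβ
    have hβ0 : 0 ≤ β := by positivity
    set u := √(1 + β * x ^ 2) with hu
    have hu2 : u ^ 2 = 1 + β * x ^ 2 := Real.sq_sqrt (by positivity)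
    have hupos : 0 < u := Real.sqrt_pos.2 (by positivity)
    have h1 : 1 + (h / u - β / (u * (u + 1))) * x ^ 2 = (1 + h * x ^ 2) / u := by
      have : β * x ^ 2 = (u - 1) * (u + 1) := by linear_combination -hu2
      field_simp
      linear_combination (-1 : ℝ) * this
    rw [h1]
    field_simp
    rw [hu2, hβ]; ring
  | grouse =>
    simp only [fitCoeff, residualCoeff]
    have e1 := mul_sinc (h * x * y)
    have e2 := mul_sinc (h * x * y / 2)
    have e3 : Real.cos (h * x * y) = 1 - 2 * Real.sin (h * x * y / 2) ^ 2 := by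
      have := Real.cos_sq' (h * x * y / 2)
      have h2 := Real.cos_two_mul (h * x * y / 2)
      rw [show 2 * (h * x * y / 2) = h * x * y by ring] at h2
      rw [h2, this]; ring
    have e4 := Real.sin_sq_add_cos_sq (h * x * y)
    have : 1 + -(h ^ 2 * y ^ 2 / 2) * Real.sinc (h * x * y / 2) ^ 2 * x ^ 2
        = Real.cos (h * x * y) := by
      rw [e3, ← e2]; ring
    rw [this, ← e4, ← e1]; ring

/-- Here `x` and `y` stand for the squared lengths. After the leading term `-h²y/2` is removed,
every term carries a factor `u - 1` or `h²x`, which makes it of second order. -/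
theorem fitCoeff_oja_aux (h x y : ℝ) {u : ℝ} (hu : 0 < u) :
    h / u - (2 * h + h ^ 2 * (x + y)) / (u * (u + 1)) + h ^ 2 * y / 2
      = h * (u - 1) / (u * (u + 1)) - h ^ 2 * x / (u * (u + 1))
        + h ^ 2 * y * (u - 1) * ((u + 2) / (2 * (u * (u + 1)))) := by
  field_simp
  ring

/-- The residual of a sample has squared length of order `n`, so the variable of order one is
`y²/N`. In these terms the two algorithms agree up to `N⁻²`, and only this expansion enters the
limit. -/
theorem coeff_bounds (alg : Algorithm) {τ : ℝ} (hτ : 0 < τ) :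
    ∃ K : ℝ, 0 < K ∧ ∀ N : ℝ, 1 ≤ N → ∀ x y : ℝ,
      |residualCoeff alg (τ / N) x y - τ / N| ≤ K / N ^ 2 * (1 + x ^ 2 + y ^ 2 / N) ^ 3 ∧
      |fitCoeff alg (τ / N) x y + τ ^ 2 * (y ^ 2 / N) / (2 * N)|
        ≤ K / N ^ 2 * (1 + x ^ 2 + y ^ 2 / N) ^ 3 := by
  cases alg with
  | oja =>
    refine ⟨τ * (τ * (2 + τ)) + τ ^ 2 + τ ^ 2 * (τ * (2 + τ)), by positivity, fun N hN x y => ?_⟩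
    have hN0 : 0 < N := by linarith
    simp only [fitCoeff, residualCoeff]
    set h := τ / N with hh
    have hh0 : 0 < h := by positivity
    set ρ := y ^ 2 / N with hρ
    have hρ0 : 0 ≤ ρ := by positivity
    have hy : y ^ 2 = N * ρ := by rw [hρ]; field_simp
    have hhy : h ^ 2 * y ^ 2 = τ ^ 2 * ρ / N := by rw [hy, hh]; field_simp
    set Z := 1 + x ^ 2 + ρ with hZ
    clear_value Z ρ h
    have hx2 : x ^ 2 ≤ Z := by rw [hZ]; linarith
    have hρZ : ρ ≤ Z := by rw [hZ]; linarith only [sq_nonneg x]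
    have hZ1 : 1 ≤ Z := by rw [hZ]; linarith only [sq_nonneg x, hρ0]
    set β := 2 * h + h ^ 2 * (x ^ 2 + y ^ 2) with hβ
    have hβ0 : 0 ≤ β := by positivity
    clear_value β
    -- Although `h²` is of order `N⁻²`, the product `h²y² = τ²ρ/N` is only of order `N⁻¹`, because
    -- `y² = Nρ`. So `β`, and with it `u - 1`, is of order `N⁻¹`.
    have hβle : β ≤ τ * (2 + τ) * Z / N := by
      have h1 : h ^ 2 ≤ τ ^ 2 / N := by
        rw [hh, div_pow]; gcongr; nlinarith only [hN]
      calc β = 2 * h + h ^ 2 * x ^ 2 + h ^ 2 * y ^ 2 := by rw [hβ]; ring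
        _ ≤ 2 * (τ / N) * Z + τ ^ 2 / N * x ^ 2 + τ ^ 2 * ρ / N := by
          rw [hhy, ← hh]; nlinarith only [mul_le_mul_of_nonneg_left hZ1 hh0.le, mul_le_mul_of_nonneg_right h1 (sq_nonneg x)]
        _ ≤ 2 * (τ / N) * Z + τ ^ 2 / N * (x ^ 2 + ρ + 1) := by
          have : 0 ≤ τ ^ 2 / N := by positivity
          have e : τ ^ 2 * ρ / N = τ ^ 2 / N * ρ := by ring
          rw [e]
          linarith
        _ = τ * (2 + τ) * Z / N := by rw [hZ]; ring
    set u := √(1 + β * x ^ 2) with hu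
    have hu2 : u ^ 2 = 1 + β * x ^ 2 := Real.sq_sqrt (by positivity)
    have hu1 : 1 ≤ u := by
      rw [hu]; exact Real.one_le_sqrt.2 (by linarith only [mul_nonneg hβ0 (sq_nonneg x)])
    clear_value u
    have hδ0 : 0 ≤ u - 1 := by linarith
    have hδ : u - 1 ≤ τ * (2 + τ) * Z ^ 2 / N := by
      have h1 : u - 1 ≤ β * x ^ 2 := by
        nlinarith only [hu2, mul_nonneg (zero_le_one.trans hu1) hδ0]
      calc u - 1 ≤ β * x ^ 2 := h1
        _ ≤ (τ * (2 + τ) * Z / N) * Z := by gcongr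
        _ = _ := by ring
    have hZ23 : Z ^ 2 ≤ Z ^ 3 := pow_le_pow_right₀ hZ1 (by norm_num)
    have hZ13 : Z ≤ Z ^ 3 := le_self_pow₀ hZ1 (by norm_num)
    have hu0 : 0 < u := by linarith
    have hB : h * (u - 1) ≤ τ * (τ * (2 + τ)) / N ^ 2 * Z ^ 3 := by
      calc h * (u - 1) ≤ h * (τ * (2 + τ) * Z ^ 2 / N) := by gcongr
        _ = τ * (τ * (2 + τ)) / N ^ 2 * Z ^ 2 := by rw [hh]; field_simp
        _ ≤ _ := by gcongr
    have hC : h ^ 2 * x ^ 2 ≤ τ ^ 2 / N ^ 2 * Z ^ 3 := by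
      calc h ^ 2 * x ^ 2 = τ ^ 2 / N ^ 2 * x ^ 2 := by rw [hh]; field_simp
        _ ≤ _ := by gcongr; linarith
    have hD : h ^ 2 * y ^ 2 * (u - 1) ≤ τ ^ 2 * (τ * (2 + τ)) / N ^ 2 * Z ^ 3 := by
      calc h ^ 2 * y ^ 2 * (u - 1) ≤ τ ^ 2 * Z / N * (τ * (2 + τ) * Z ^ 2 / N) := by
            rw [hhy]; gcongr
        _ = _ := by field_simp
    have hN3 : 0 ≤ Z ^ 3 / N ^ 2 := by positivity
    constructor
    · have e1 : h / u - h = -(h * (u - 1) / u) := by field_simp; ring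
      rw [e1, abs_neg, abs_of_nonneg (by positivity)]
      calc h * (u - 1) / u ≤ h * (u - 1) := div_le_self (by positivity) hu1
        _ ≤ τ * (τ * (2 + τ)) / N ^ 2 * Z ^ 3 := hB
        _ ≤ _ := by
          gcongr
          have : 0 < τ ^ 2 * (τ * (2 + τ)) := by positivity
          have : 0 < τ ^ 2 := by positivity
          linarith
    · have e1 : h / u - β / (u * (u + 1)) + τ ^ 2 * ρ / (2 * N)
          = h * (u - 1) / (u * (u + 1)) - h ^ 2 * x ^ 2 / (u * (u + 1))
            + h ^ 2 * y ^ 2 * (u - 1) * ((u + 2) / (2 * (u * (u + 1)))) := by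
        rw [← fitCoeff_oja_aux h (x ^ 2) (y ^ 2) hu0, hhy, ← hβ]
        congr 1
        rw [div_div, mul_comm N 2]
      have hden : 1 ≤ u * (u + 1) := by nlinarith only [hu1]
      have hfr : (u + 2) / (2 * (u * (u + 1))) ≤ 1 := by
        rw [div_le_one (by positivity)]; nlinarith only [mul_nonneg hδ0 hδ0, hu1]
      have t1 : h * (u - 1) / (u * (u + 1)) ≤ h * (u - 1) := div_le_self (by positivity) hden
      have t2 : h ^ 2 * x ^ 2 / (u * (u + 1)) ≤ h ^ 2 * x ^ 2 := div_le_self (by positivity) hden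
      have t3 : h ^ 2 * y ^ 2 * (u - 1) * ((u + 2) / (2 * (u * (u + 1))))
          ≤ h ^ 2 * y ^ 2 * (u - 1) := mul_le_of_le_one_right (by positivity) hfr
      have p1 : 0 ≤ h * (u - 1) / (u * (u + 1)) := by positivity
      have p2 : 0 ≤ h ^ 2 * x ^ 2 / (u * (u + 1)) := by positivity
      have p3 : 0 ≤ h ^ 2 * y ^ 2 * (u - 1) * ((u + 2) / (2 * (u * (u + 1)))) := by positivity
      have hsum : (τ * (τ * (2 + τ)) + τ ^ 2 + τ ^ 2 * (τ * (2 + τ))) / N ^ 2 * Z ^ 3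
          = τ * (τ * (2 + τ)) / N ^ 2 * Z ^ 3 + τ ^ 2 / N ^ 2 * Z ^ 3
            + τ ^ 2 * (τ * (2 + τ)) / N ^ 2 * Z ^ 3 := by rw [add_div, add_div, add_mul, add_mul]
      rw [e1, hsum, abs_le]
      constructor <;> linarith only [hB, hC, hD, t1, t2, t3, p1, p2, p3]
  | grouse =>
    refine ⟨τ ^ 3 + τ ^ 4, by positivity, fun N hN x y => ?_⟩
    have hN0 : 0 < N := by linarith
    simp only [fitCoeff, residualCoeff]
    set h := τ / N with hh
    have hh0 : 0 < h := by positivity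
    set ρ := y ^ 2 / N with hρ
    have hρ0 : 0 ≤ ρ := by positivity
    have hy : y ^ 2 = N * ρ := by rw [hρ]; field_simp
    have hhy : h ^ 2 * y ^ 2 = τ ^ 2 * ρ / N := by rw [hy, hh]; field_simp
    set Z := 1 + x ^ 2 + ρ with hZ
    clear_value Z ρ h
    have hx2 : x ^ 2 ≤ Z := by rw [hZ]; linarith
    have hρZ : ρ ≤ Z := by rw [hZ]; linarith only [sq_nonneg x]
    have hZ1 : 1 ≤ Z := by rw [hZ]; linarith only [sq_nonneg x, hρ0]
    have hθ : (h * x * y) ^ 2 = τ ^ 2 * ρ / N * x ^ 2 := by rw [← hhy]; ring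
    have hZ23 : Z ^ 2 ≤ Z ^ 3 := pow_le_pow_right₀ hZ1 (by norm_num)
    have hθle : (h * x * y) ^ 2 ≤ τ ^ 2 / N * Z ^ 2 := by
      rw [hθ]
      calc τ ^ 2 * ρ / N * x ^ 2 ≤ τ ^ 2 * Z / N * Z := by gcongr
        _ = _ := by ring
    constructor
    · have h1 := @sq_sub_one_le_sinc (h * x * y)
      have h2 := Real.sinc_le_one (h * x * y)
      rw [show h * Real.sinc (h * x * y) - h = -(h * (1 - Real.sinc (h * x * y))) by ring, abs_neg,
        abs_of_nonneg (mul_nonneg hh0.le (by linarith))]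
      calc h * (1 - Real.sinc (h * x * y)) ≤ h * (τ ^ 2 / N * Z ^ 2) := by
            gcongr; linarith only [sq_nonneg (h * x * y), h1, hθle]
        _ = τ ^ 3 / N ^ 2 * Z ^ 2 := by rw [hh]; field_simp
        _ ≤ _ := by gcongr; linarith [pow_pos hτ 4]
    · have h1 := @sq_sub_one_le_sinc (h * x * y / 2)
      have h2 := Real.sinc_le_one (h * x * y / 2)
      have h3 := Real.neg_one_le_sinc (h * x * y / 2)
      have e1 : -(h ^ 2 * y ^ 2 / 2) * Real.sinc (h * x * y / 2) ^ 2 + τ ^ 2 * ρ / (2 * N)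
          = τ ^ 2 * ρ / (2 * N) * (1 - Real.sinc (h * x * y / 2) ^ 2) := by
        rw [hhy]; field_simp; ring
      have h4 : 1 - Real.sinc (h * x * y / 2) ^ 2 ≤ τ ^ 2 / N * Z ^ 2 := by
        nlinarith only [sq_nonneg (h * x * y), h1, h2, h3, hθle]
      have h5 : 0 ≤ 1 - Real.sinc (h * x * y / 2) ^ 2 := by nlinarith only [h2, h3]
      rw [e1, abs_of_nonneg (mul_nonneg (by positivity) h5)]
      calc τ ^ 2 * ρ / (2 * N) * (1 - Real.sinc (h * x * y / 2) ^ 2)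
          ≤ τ ^ 2 * Z / (1 * N) * (τ ^ 2 / N * Z ^ 2) := by gcongr; norm_num
        _ = τ ^ 4 / N ^ 2 * Z ^ 3 := by field_simp
        _ ≤ _ := by gcongr; linarith [pow_pos hτ 3]

/-! ### Inverse square root of a rank-one perturbation of the identity -/

theorem vecMulVec_self_isHermitian {d : ℕ} (w : Fin d → ℝ) : (vecMulVec w w).IsHermitian := by
  ext i j; simp [vecMulVec_apply, mul_comm]

theorem vecMulVec_mul_vecMulVec_self {d : ℕ} (w : Fin d → ℝ) :
    vecMulVec w w * vecMulVec w w = (w ⬝ᵥ w) • vecMulVec w w := by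
  rw [vecMulVec_mul_vecMulVec, vecMulVec_smul]

/-- The spectrum is contained in `{1, u²}`, so the functional calculus of `t ↦ t^(-1/2)` is that of
the affine function through its values `1` and `1/u` at these two points. -/
theorem invSqrt_one_add_vecMulVec {d : ℕ} {β : ℝ} (hβ : 0 ≤ β) (w : Fin d → ℝ) :
    invSqrt (1 + β • vecMulVec w w)
      = 1 - (β / (√(1 + β * (w ⬝ᵥ w)) * (√(1 + β * (w ⬝ᵥ w)) + 1))) • vecMulVec w w := by
  have hww : 0 ≤ w ⬝ᵥ w := Finset.sum_nonneg fun i _ => mul_self_nonneg _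
  set u := √(1 + β * (w ⬝ᵥ w)) with hu
  have hu2 : u ^ 2 = 1 + β * (w ⬝ᵥ w) := Real.sq_sqrt (by positivity)
  have hu0 : 0 < u := Real.sqrt_pos.2 (by positivity)
  set A : Matrix (Fin d) (Fin d) ℝ := 1 + β • vecMulVec w w with hA
  have hAH : A.IsHermitian := by
    rw [hA]
    exact isHermitian_one.add ((vecMulVec_self_isHermitian w).smul (IsSelfAdjoint.all β))
  have hAsa : IsSelfAdjoint A := hAH
  have hroot : (A - 1) * (A - algebraMap ℝ _ (u ^ 2)) = 0 := by
    rw [hu2, hA, Algebra.algebraMap_eq_smul_one, add_sub_cancel_left, add_smul, one_smul,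
      add_sub_add_left_eq_sub, mul_sub, smul_mul_smul_comm, vecMulVec_mul_vecMulVec_self,
      smul_mul_assoc, Matrix.mul_smul, Matrix.mul_one, smul_smul, smul_smul]
    rw [← sub_smul]
    convert zero_smul ℝ _ using 2
    ring
  have hspec : ∀ t ∈ spectrum ℝ A, t = 1 ∨ t = u ^ 2 := by
    intro t ht
    have h1 := spectrum.subset_polynomial_aeval A
      ((Polynomial.X - Polynomial.C 1) * (Polynomial.X - Polynomial.C (u ^ 2))) ⟨t, ht, rfl⟩
    have h2 : Polynomial.aeval A
        ((Polynomial.X - Polynomial.C 1) * (Polynomial.X - Polynomial.C (u ^ 2))) = 0 := by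
      rw [map_mul, map_sub, map_sub, Polynomial.aeval_X, Polynomial.aeval_C, Polynomial.aeval_C,
        map_one]
      exact hroot
    rw [h2] at h1
    -- For `d = 0` the matrix ring is trivial and the spectrum is empty.
    have hnt : Nontrivial (Matrix (Fin d) (Fin d) ℝ) := by
      by_contra hcon
      rw [not_nontrivial_iff_subsingleton] at hcon
      rw [spectrum.of_subsingleton] at ht
      exact ht
    rw [spectrum.zero_eq, Set.mem_singleton_iff] at h1
    simp only [Polynomial.eval_mul, Polynomial.eval_sub, Polynomial.eval_X, Polynomial.eval_C,
      mul_eq_zero, sub_eq_zero] at h1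
    exact h1
  have hcongr : invSqrt A = cfc (fun t : ℝ => (1 + 1 / (u * (u + 1))) + (-(1 / (u * (u + 1)))) * t) A := by
    refine cfc_congr fun t ht => ?_
    rcases hspec t ht with rfl | rfl
    · simp
    · rw [Real.sqrt_sq hu0.le]; field_simp; ring
  rw [hcongr, cfc_const_add (1 + 1 / (u * (u + 1))) (fun t : ℝ => -(1 / (u * (u + 1))) * t) A
    (by fun_prop) hAsa, cfc_const_mul_id _ A hAsa, hA,
    Algebra.algebraMap_eq_smul_one, smul_add, add_smul, one_smul, smul_smul]
  rw [show -(1 / (u * (u + 1))) * β = -(β / (u * (u + 1))) by ring, neg_smul, neg_smul]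
  abel

end

end SubspaceTracking

namespace SubspaceTracking

noncomputable section

open scoped Matrix.Norms.L2Operator

/-! ### The smallest eigenvalue -/

theorem le_dotProduct_mulVec_of_lt_lambdaMin {d : ℕ} {S : Matrix (Fin d) (Fin d) ℝ}
    (hS : Sᵀ = S) {ε : ℝ} (h : ε < lambdaMin S) (x : Fin d → ℝ) :
    ε * (x ⬝ᵥ x) ≤ x ⬝ᵥ (S *ᵥ x) := by
  have hH : S.IsHermitian := by rwa [IsHermitian, conjTranspose_eq_transpose_of_trivial]
  have hH' : (S - ε • 1).IsHermitian :=
    hH.sub (isHermitian_one.smul (IsSelfAdjoint.all ε))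
  have hpsd : (S - ε • (1 : Matrix (Fin d) (Fin d) ℝ)).PosSemidef := by
    rw [hH'.posSemidef_iff_eigenvalues_nonneg]
    intro i
    have hi := hH'.eigenvalues_mem_spectrum_real i
    simp only [Pi.zero_apply]
    generalize hH'.eigenvalues i = t at hi ⊢
    rw [← Algebra.algebraMap_eq_smul_one, sub_eq_neg_add, ← spectrum.add_mem_iff] at hi
    have hbdd : BddBelow (spectrum ℝ S) := by
      rw [hH.spectrum_real_eq_range_eigenvalues]; exact (Set.finite_range _).bddBelow
    have := csInf_le hbdd hi
    rw [← lambdaMin] at this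
    linarith
  have := hpsd.dotProduct_mulVec_nonneg x
  simp only [star_trivial, sub_mulVec, smul_mulVec, one_mulVec, dotProduct_sub,
    dotProduct_smul, smul_eq_mul] at this
  linarith

/-- Positivity of `d` matters: for the empty matrix `lambdaMin` is `sInf ∅ = 0`. Together with the
preceding lemma this replaces the spectral test by quadratic forms. -/
theorem lt_lambdaMin_of_forall {d : ℕ} (hd : 0 < d) {S : Matrix (Fin d) (Fin d) ℝ}
    (hS : Sᵀ = S) {ε ε' : ℝ} (hε : ε < ε') (h : ∀ x, ε' * (x ⬝ᵥ x) ≤ x ⬝ᵥ (S *ᵥ x)) :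
    ε < lambdaMin S := by
  have hH : S.IsHermitian := by rwa [IsHermitian, conjTranspose_eq_transpose_of_trivial]
  refine hε.trans_le ?_
  rw [lambdaMin, hH.spectrum_real_eq_range_eigenvalues]
  have : Nonempty (Fin d) := ⟨⟨0, hd⟩⟩
  refine le_csInf (Set.range_nonempty _) ?_
  rintro _ ⟨i, rfl⟩
  have h1 := h (hH.eigenvectorBasis i)
  rw [hH.mulVec_eigenvectorBasis, dotProduct_smul, smul_eq_mul] at h1
  have h2 : (hH.eigenvectorBasis i : Fin d → ℝ) ⬝ᵥ (hH.eigenvectorBasis i : Fin d → ℝ) = 1 := by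
    have := hH.eigenvectorBasis.orthonormal.1 i
    have h3 := l2norm_sq (hH.eigenvectorBasis i : Fin d → ℝ)
    rw [← h3, l2norm]
    simp [this]
  rw [h2] at h1
  simpa using h1

/-! ### The updates -/

theorem gram_isUnit_det {n d : ℕ} {X : Matrix (Fin n) (Fin d) ℝ} {v : Fin n → Bool} {ε : ℝ}
    (hε : 0 < ε) (h : ε < lambdaMin (gram X v)) : IsUnit (gram X v).det := by
  rw [← Matrix.isUnit_iff_isUnit_det]
  rw [← spectrum.zero_notMem_iff ℝ]
  intro h0
  have hH : (gram X v).IsHermitian := by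
    rw [IsHermitian, conjTranspose_eq_transpose_of_trivial, gram_transpose]
  have hbdd : BddBelow (spectrum ℝ (gram X v)) := by
    rw [hH.spectrum_real_eq_range_eigenvalues]; exact (Set.finite_range _).bddBelow
  have := csInf_le hbdd h0
  rw [← lambdaMin] at this
  linarith

/-- These are the normal equations. The residual lives on the observed coordinates, so orthogonality
to the observed part of `X` is orthogonality to `X` itself. -/
theorem transpose_mul_residualMatrix {n d : ℕ} {X : Matrix (Fin n) (Fin d) ℝ} {v : Fin n → Bool}
    (h : IsUnit (gram X v).det) : Xᵀ * residualMatrix X v = 0 := by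
  rw [residualMatrix, ← Matrix.mul_assoc, Matrix.mul_sub, Matrix.mul_one, ← Matrix.mul_assoc,
    ← gram, fitMatrix, Matrix.mul_nonsing_inv_cancel_left _ _ h, sub_self]

/-- The result of an update with step size `h`, in closed form. -/
def updateMatrix {n d : ℕ} (alg : Algorithm) (h : ℝ) (X : Matrix (Fin n) (Fin d) ℝ)
    (v : Fin n → Bool) (s : Fin n → ℝ) : Matrix (Fin n) (Fin d) ℝ :=
  X + vecMulVec
    (fitCoeff alg h (l2norm (fitMatrix X v *ᵥ s)) (l2norm (residualMatrix X v *ᵥ s)) •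
        (X *ᵥ (fitMatrix X v *ᵥ s)) +
      residualCoeff alg h (l2norm (fitMatrix X v *ᵥ s)) (l2norm (residualMatrix X v *ᵥ s)) •
        (residualMatrix X v *ᵥ s))
    (fitMatrix X v *ᵥ s)

/-- The update of either algorithm, in closed form. -/
def closedStep {n d : ℕ} (alg : Algorithm) (ε h : ℝ) (X : Matrix (Fin n) (Fin d) ℝ)
    (v : Fin n → Bool) (s : Fin n → ℝ) : Matrix (Fin n) (Fin d) ℝ :=
  if ε < lambdaMin (gram X v) then updateMatrix alg h X v s else X

theorem gram_add_vecMulVec {n d : ℕ} (X : Matrix (Fin n) (Fin d) ℝ) (q : Fin n → ℝ)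
    (w : Fin d → ℝ) :
    (X + vecMulVec q w)ᵀ * (X + vecMulVec q w) =
      Xᵀ * X + vecMulVec (Xᵀ *ᵥ q) w + vecMulVec w (Xᵀ *ᵥ q) + (q ⬝ᵥ q) • vecMulVec w w := by
  rw [transpose_add, transpose_vecMulVec, Matrix.add_mul, Matrix.mul_add, Matrix.mul_add,
    mul_vecMulVec, vecMulVec_mul, vecMulVec_mul_vecMulVec, vecMulVec_smul, ← mulVec_transpose]
  abel

theorem mulVec_dotProduct_mulVec {n d : ℕ} {X : Matrix (Fin n) (Fin d) ℝ} (hX : Xᵀ * X = 1)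
    (w w' : Fin d → ℝ) : (X *ᵥ w) ⬝ᵥ (X *ᵥ w') = w ⬝ᵥ w' := by
  rw [dotProduct_mulVec, ← mulVec_transpose, mulVec_mulVec, hX, one_mulVec]

theorem l2norm_mulVec {n d : ℕ} {X : Matrix (Fin n) (Fin d) ℝ} (hX : Xᵀ * X = 1)
    (w : Fin d → ℝ) : l2norm (X *ᵥ w) = l2norm w := by
  rw [← sq_eq_sq₀ (l2norm_nonneg _) (l2norm_nonneg _), l2norm_sq, l2norm_sq,
    mulVec_dotProduct_mulVec hX]

/-- Since `Xᵀ r = 0`, the Gram matrix changes only by a multiple of `wwᵀ`, and `coeff_sq_add_sq`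
says that this multiple vanishes. -/
theorem updateMatrix_transpose_mul {n d : ℕ} (alg : Algorithm) {h ε : ℝ} (hh : 0 ≤ h) (hε : 0 < ε)
    {X : Matrix (Fin n) (Fin d) ℝ} (hX : Xᵀ * X = 1) {v : Fin n → Bool}
    (hv : ε < lambdaMin (gram X v)) (s : Fin n → ℝ) :
    (updateMatrix alg h X v s)ᵀ * updateMatrix alg h X v s = 1 := by
  have hr : Xᵀ *ᵥ (residualMatrix X v *ᵥ s) = 0 := by
    rw [mulVec_mulVec, transpose_mul_residualMatrix (gram_isUnit_det hε hv), zero_mulVec]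
  rw [updateMatrix]
  set w := fitMatrix X v *ᵥ s
  set r := residualMatrix X v *ᵥ s
  have key := coeff_sq_add_sq alg hh (l2norm w) (l2norm r)
  set a := fitCoeff alg h (l2norm w) (l2norm r)
  set b := residualCoeff alg h (l2norm w) (l2norm r)
  have hp : Xᵀ *ᵥ (X *ᵥ w) = w := by rw [mulVec_mulVec, hX, one_mulVec]
  have hq : Xᵀ *ᵥ (a • (X *ᵥ w) + b • r) = a • w := by
    rw [mulVec_add, mulVec_smul, mulVec_smul, hr, hp, smul_zero, add_zero]
  have hpr : (X *ᵥ w) ⬝ᵥ r = 0 := by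
    rw [dotProduct_comm, dotProduct_mulVec, ← mulVec_transpose, hr, zero_dotProduct]
  have hqq : (a • (X *ᵥ w) + b • r) ⬝ᵥ (a • (X *ᵥ w) + b • r)
      = a ^ 2 * l2norm w ^ 2 + b ^ 2 * l2norm r ^ 2 := by
    simp only [add_dotProduct, dotProduct_add, smul_dotProduct, dotProduct_smul, smul_eq_mul,
      hpr, dotProduct_comm r, mulVec_dotProduct_mulVec hX, l2norm_sq]
    ring
  rw [gram_add_vecMulVec, hX, hq, hqq, smul_vecMulVec, vecMulVec_smul, add_assoc, add_assoc,
    ← add_smul, ← add_smul]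
  -- The scalar identity gives the coefficient only after multiplication by `‖w‖²`, hence the
  -- separate case `w = 0`.
  have h0 : (a + (a + (a ^ 2 * l2norm w ^ 2 + b ^ 2 * l2norm r ^ 2))) * l2norm w ^ 2 = 0 := by
    linear_combination key
  rcases mul_eq_zero.1 h0 with h1 | h1
  · rw [h1, zero_smul, add_zero]
  · have : w = 0 := by
      rw [l2norm_sq] at h1; exact dotProduct_self_eq_zero.1 h1
    rw [this, vecMulVec_zero, smul_zero, add_zero]

/-- The imputed vector is `Xw + r`, so the Gram matrix of the unnormalized update is `1 + β wwᵀ` and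
its inverse square root is explicit. -/
theorem ojaStep_eq {n d : ℕ} {τ ε : ℝ} (hτ : 0 ≤ τ) (hε : 0 < ε)
    {X : Matrix (Fin n) (Fin d) ℝ} (hX : Xᵀ * X = 1) {v : Fin n → Bool}
    (hv : ε < lambdaMin (gram X v)) (s : Fin n → ℝ) :
    ojaStep ε τ X v s = updateMatrix .oja (τ / n) X v s := by
  have hr : Xᵀ *ᵥ (residualMatrix X v *ᵥ s) = 0 := by
    rw [mulVec_mulVec, transpose_mul_residualMatrix (gram_isUnit_det hε hv), zero_mulVec]
  simp only [ojaStep]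
  rw [← gram, if_pos hv, leastSquares_eq, updateMatrix, sub_mulVec, one_mulVec]
  have hy : maskMatrix v *ᵥ s + (X *ᵥ (fitMatrix X v *ᵥ s)
      - maskMatrix v *ᵥ (X *ᵥ (fitMatrix X v *ᵥ s)))
      = X *ᵥ (fitMatrix X v *ᵥ s) + residualMatrix X v *ᵥ s := by
    rw [← residual_eq]; abel
  rw [hy]
  set w := fitMatrix X v *ᵥ s
  set r := residualMatrix X v *ᵥ s
  set h := τ / n
  have hh : 0 ≤ h := by positivity
  have hp : Xᵀ *ᵥ (X *ᵥ w) = w := by rw [mulVec_mulVec, hX, one_mulVec]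
  have hpr : (X *ᵥ w) ⬝ᵥ r = 0 := by
    rw [dotProduct_comm, dotProduct_mulVec, ← mulVec_transpose, hr, zero_dotProduct]
  have hgram : (X + h • vecMulVec (X *ᵥ w + r) w)ᵀ * (X + h • vecMulVec (X *ᵥ w + r) w)
      = 1 + (2 * h + h ^ 2 * (l2norm w ^ 2 + l2norm r ^ 2)) • vecMulVec w w := by
    rw [← smul_vecMulVec, gram_add_vecMulVec, hX, mulVec_smul, mulVec_add, hr, hp, add_zero,
      smul_vecMulVec, vecMulVec_smul, add_assoc, add_assoc, ← add_smul, ← add_smul]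
    congr 2
    simp only [add_dotProduct, dotProduct_add, smul_dotProduct, dotProduct_smul, smul_eq_mul,
      hpr, dotProduct_comm r, mulVec_dotProduct_mulVec hX, l2norm_sq]
    ring
  rw [orthonormalize, hgram, invSqrt_one_add_vecMulVec (by positivity), ← l2norm_sq]
  simp only [fitCoeff, residualCoeff]
  set β := 2 * h + h ^ 2 * (l2norm w ^ 2 + l2norm r ^ 2)
  have hβ : 0 ≤ β := by positivity
  set u := √(1 + β * l2norm w ^ 2) with hu
  have hu2 : u ^ 2 = 1 + β * l2norm w ^ 2 := Real.sq_sqrt (by positivity)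
  have hu0 : 0 < u := Real.sqrt_pos.2 (by positivity)
  have hγ : h * (β / (u * (u + 1))) * l2norm w ^ 2 = h - h / u := by
    have : β * l2norm w ^ 2 = (u - 1) * (u + 1) := by linear_combination -hu2
    field_simp
    linear_combination h * this
  rw [Matrix.mul_sub, Matrix.mul_one, Matrix.add_mul, Matrix.mul_smul, mul_vecMulVec, Matrix.smul_mul,
    Matrix.mul_smul, vecMulVec_mul_vecMulVec, ← l2norm_sq, vecMulVec_smul, smul_smul, smul_smul,
    hγ]
  generalize β / (u * (u + 1)) = γ
  rw [add_vecMulVec, add_vecMulVec, smul_vecMulVec, smul_vecMulVec]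
  module

theorem grouseStep_eq {n d : ℕ} {τ ε : ℝ} 
    {X : Matrix (Fin n) (Fin d) ℝ} (hX : Xᵀ * X = 1) {v : Fin n → Bool}
    (hv : ε < lambdaMin (gram X v)) (s : Fin n → ℝ) :
    grouseStep ε τ X v s = updateMatrix .grouse (τ / n) X v s := by
  simp only [grouseStep]
  rw [← gram, if_pos hv, leastSquares_eq, residual_eq, updateMatrix]
  set w := fitMatrix X v *ᵥ s with hw
  set r := residualMatrix X v *ᵥ s
  set h := τ / n
  rw [l2norm_mulVec hX]
  congr 1
  -- The degenerate cases `w = 0` and, below, `r = 0` are split off because the normalizations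
  -- divide by these norms.
  rcases eq_or_ne w 0 with hw0 | hw0
  · rw [hw0, smul_zero]
    ext i j
    simp [vecMulVec_apply]
  have hx : l2norm w ≠ 0 := by
    rw [l2norm, norm_ne_zero_iff]; simpa using hw0
  set x := l2norm w
  rw [vecMulVec_smul, ← smul_vecMulVec, smul_add, smul_smul, smul_smul]
  congr 2
  · congr 1
    simp only [fitCoeff]
    have e2 := mul_sinc (h * x * l2norm r / 2)
    have e3 : Real.cos (h * (l2norm r * x)) = 1 - 2 * Real.sin (h * x * l2norm r / 2) ^ 2 := by
      have := Real.cos_sq' (h * x * l2norm r / 2)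
      have h2 := Real.cos_two_mul (h * x * l2norm r / 2)
      rw [show 2 * (h * x * l2norm r / 2) = h * (l2norm r * x) by ring] at h2
      rw [h2, this]; ring
    rw [e3, ← e2]
    field_simp
    ring
  · rcases eq_or_ne r 0 with hr0 | hr0
    · rw [hr0, smul_zero, smul_zero]
    have hy : l2norm r ≠ 0 := by
      rw [l2norm, norm_ne_zero_iff]; simpa using hr0
    congr 1
    simp only [residualCoeff]
    rw [show h * (l2norm r * x) = h * x * l2norm r by ring, ← mul_sinc]
    field_simp

theorem step_eq_closedStep {n d : ℕ} (alg : Algorithm) {τ ε : ℝ} (hτ : 0 ≤ τ) (hε : 0 < ε)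
    {X : Matrix (Fin n) (Fin d) ℝ} (hX : Xᵀ * X = 1) (v : Fin n → Bool) (s : Fin n → ℝ) :
    alg.step ε τ X v s = closedStep alg ε (τ / n) X v s := by
  rw [closedStep]
  split_ifs with hv
  · cases alg
    · exact ojaStep_eq hτ hε hX hv s
    · exact grouseStep_eq hX hv s
  · rw [gram] at hv
    cases alg <;> simp only [Algorithm.step, ojaStep, grouseStep] <;> rw [if_neg hv]

theorem closedStep_transpose_mul {n d : ℕ} (alg : Algorithm) {h ε : ℝ} (hh : 0 ≤ h) (hε : 0 < ε)
    {X : Matrix (Fin n) (Fin d) ℝ} (hX : Xᵀ * X = 1) (v : Fin n → Bool) (s : Fin n → ℝ) :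
    (closedStep alg ε h X v s)ᵀ * closedStep alg ε h X v s = 1 := by
  rw [closedStep]
  split_ifs with hv
  · exact updateMatrix_transpose_mul alg hh hε hX hv s
  · exact hX

/-! ### Norm bounds -/

theorem l2norm_mulVec_le {m n : ℕ} (A : Matrix (Fin m) (Fin n) ℝ) (x : Fin n → ℝ) :
    l2norm (A *ᵥ x) ≤ ‖A‖ * l2norm x :=
  Matrix.l2_opNorm_mulVec A (WithLp.toLp 2 x)

theorem norm_le_of_forall_l2norm {m n : ℕ} (A : Matrix (Fin m) (Fin n) ℝ) {K : ℝ} (hK : 0 ≤ K)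
    (h : ∀ x, l2norm (A *ᵥ x) ≤ K * l2norm x) : ‖A‖ ≤ K := by
  rw [Matrix.l2_opNorm_def]
  exact ContinuousLinearMap.opNorm_le_bound _ hK fun x => h x.ofLp

theorem norm_le_one_of_transpose_mul {n d : ℕ} {X : Matrix (Fin n) (Fin d) ℝ} (hX : Xᵀ * X = 1) :
    ‖X‖ ≤ 1 :=
  norm_le_of_forall_l2norm X zero_le_one fun x => by rw [l2norm_mulVec hX, one_mul]

theorem norm_transpose {m n : ℕ} (A : Matrix (Fin m) (Fin n) ℝ) : ‖Aᵀ‖ = ‖A‖ := by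
  rw [← conjTranspose_eq_transpose_of_trivial, Matrix.l2_opNorm_conjTranspose]

theorem norm_maskMatrix_le {n : ℕ} (v : Fin n → Bool) : ‖maskMatrix v‖ ≤ 1 := by
  rw [maskMatrix, Matrix.l2_opNorm_diagonal, pi_norm_le_iff_of_nonneg zero_le_one]
  intro i
  split_ifs <;> simp

theorem norm_gram_inv_le {n d : ℕ} {X : Matrix (Fin n) (Fin d) ℝ} {v : Fin n → Bool} {ε : ℝ}
    (hε : 0 < ε) (hv : ε < lambdaMin (gram X v)) : ‖(gram X v)⁻¹‖ ≤ 1 / ε := by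
  refine norm_le_of_forall_l2norm _ (by positivity) fun x => ?_
  have hdet := gram_isUnit_det hε hv
  have h1 := le_dotProduct_mulVec_of_lt_lambdaMin (gram_transpose X v) hv ((gram X v)⁻¹ *ᵥ x)
  rw [mulVec_mulVec, Matrix.mul_nonsing_inv _ hdet, one_mulVec, ← l2norm_sq] at h1
  set y := (gram X v)⁻¹ *ᵥ x
  have h2 : y ⬝ᵥ x ≤ l2norm y * l2norm x := by
    have := real_inner_le_norm (WithLp.toLp 2 y) (WithLp.toLp 2 x)
    rw [EuclideanSpace.inner_eq_star_dotProduct] at this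
    simpa [dotProduct_comm, l2norm] using this
  rcases (l2norm_nonneg y).eq_or_lt with h0 | h0
  · rw [← h0]; have := l2norm_nonneg x; positivity
  · rw [div_mul_eq_mul_div, le_div_iff₀ hε]
    nlinarith

theorem norm_fitMatrix_le {n d : ℕ} {X : Matrix (Fin n) (Fin d) ℝ} (hX : Xᵀ * X = 1)
    {v : Fin n → Bool} {ε : ℝ} (hε : 0 < ε) (hv : ε < lambdaMin (gram X v)) :
    ‖fitMatrix X v‖ ≤ 1 / ε := by
  calc ‖fitMatrix X v‖ ≤ ‖(gram X v)⁻¹‖ * (‖Xᵀ‖ * ‖maskMatrix v‖) :=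
        (Matrix.l2_opNorm_mul _ _).trans (by gcongr; exact Matrix.l2_opNorm_mul _ _)
    _ ≤ 1 / ε * (1 * 1) := by
        rw [norm_transpose]
        gcongr
        · exact norm_gram_inv_le hε hv
        · exact norm_le_one_of_transpose_mul hX
        · exact norm_maskMatrix_le v
    _ = 1 / ε := by ring

theorem norm_residualMatrix_le {n d : ℕ} {X : Matrix (Fin n) (Fin d) ℝ} (hX : Xᵀ * X = 1)
    {v : Fin n → Bool} {ε : ℝ} (hε : 0 < ε) (hv : ε < lambdaMin (gram X v)) :
    ‖residualMatrix X v‖ ≤ 1 + 1 / ε := by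
  have hone : ‖(1 : Matrix (Fin n) (Fin n) ℝ)‖ ≤ 1 :=
    norm_le_of_forall_l2norm _ zero_le_one fun x => by rw [one_mulVec, one_mul]
  calc ‖residualMatrix X v‖ ≤ ‖maskMatrix v‖ * (‖(1 : Matrix (Fin n) (Fin n) ℝ)‖
          + ‖X‖ * ‖fitMatrix X v‖) :=
        (Matrix.l2_opNorm_mul _ _).trans (by
          gcongr
          exact (norm_sub_le _ _).trans (by gcongr; exact Matrix.l2_opNorm_mul _ _))
    _ ≤ 1 * (1 + 1 * (1 / ε)) := by
        gcongr
        · exact norm_maskMatrix_le v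
        · exact norm_le_one_of_transpose_mul hX
        · exact norm_fitMatrix_le hX hε hv
    _ = 1 + 1 / ε := by ring

end

end SubspaceTracking

namespace SubspaceTracking

noncomputable section

/-! ### Sorted eigenvalues and their perturbation -/

/-- `e` lists the eigenvalues of the symmetric matrix `P` in nonincreasing order. -/
def IsSortedSpectrum {d : ℕ} (P : Matrix (Fin d) (Fin d) ℝ) (e : Fin d → ℝ) : Prop :=
  Antitone e ∧ ∃ b : OrthonormalBasis (Fin d) ℝ (EuclideanSpace ℝ (Fin d)),
    ∀ x : EuclideanSpace ℝ (Fin d), x.ofLp ⬝ᵥ (P *ᵥ x.ofLp) = ∑ i, e i * inner ℝ (b i) x ^ 2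

/-- Courant–Fischer by counting dimensions: orthogonality to `b i` for `i > l` and to `b' i` for `i
< l` is `d - 1` conditions, so some `x ≠ 0` satisfies all of them. At this `x` the form of `P` is at
least `e l ‖x‖²` and that of `P'` at most `e' l ‖x‖²`. -/
theorem IsSortedSpectrum.le_add {d : ℕ} {P P' : Matrix (Fin d) (Fin d) ℝ} {e e' : Fin d → ℝ}
    (h : IsSortedSpectrum P e) (h' : IsSortedSpectrum P' e') {δ : ℝ}
    (hδ : ∀ x : Fin d → ℝ, x ⬝ᵥ (P *ᵥ x) ≤ x ⬝ᵥ (P' *ᵥ x) + δ * (x ⬝ᵥ x)) (l : Fin d) :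
    e l ≤ e' l + δ := by
  obtain ⟨he, b, hb⟩ := h
  obtain ⟨he', b', hb'⟩ := h'
  let f : EuclideanSpace ℝ (Fin d) →ₗ[ℝ] ({i : Fin d // i ≠ l} → ℝ) :=
    LinearMap.pi fun i => if l < i.1 then (innerₗ _ (b i.1)) else (innerₗ _ (b' i.1))
  have hker : LinearMap.ker f ≠ ⊥ := by
    refine LinearMap.ker_ne_bot_of_finrank_lt ?_
    rw [Module.finrank_fintype_fun_eq_card, finrank_euclideanSpace_fin]
    have := Fintype.card_subtype_compl (fun i : Fin d => i = l)
    have hd := l.pos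
    simp only [Fintype.card_fin, Fintype.card_subtype_eq] at this
    rw [this]; omega
  obtain ⟨x, hx, hx0⟩ := (Submodule.ne_bot_iff _).1 hker
  have hfx : ∀ i : Fin d, ∀ hi : i ≠ l, f x ⟨i, hi⟩ = 0 := fun i hi => by
    rw [LinearMap.mem_ker.1 hx]; rfl
  have h1 : ∀ i, l < i → inner ℝ (b i) x = 0 := fun i hi => by
    have := hfx i hi.ne'
    simpa [f, hi] using this
  have h2 : ∀ i, i < l → inner ℝ (b' i) x = 0 := fun i hi => by
    have := hfx i hi.ne
    simpa [f, not_lt.2 hi.le] using this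
  have hx2 : x.ofLp ⬝ᵥ x.ofLp = ‖x‖ ^ 2 := (l2norm_sq x.ofLp).symm
  have hxpos : 0 < ‖x‖ ^ 2 := by positivity
  have hn := b.sum_sq_norm_inner_right x
  have hn' := b'.sum_sq_norm_inner_right x
  simp only [Real.norm_eq_abs, sq_abs] at hn hn'
  have hlow : e l * ‖x‖ ^ 2 ≤ x.ofLp ⬝ᵥ (P *ᵥ x.ofLp) := by
    rw [hb, ← hn, Finset.mul_sum]
    refine Finset.sum_le_sum fun i _ => ?_
    rcases le_or_gt i l with hi | hi
    · gcongr; exact he hi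
    · rw [h1 i hi]; simp
  have hup : x.ofLp ⬝ᵥ (P' *ᵥ x.ofLp) ≤ e' l * ‖x‖ ^ 2 := by
    rw [hb', ← hn', Finset.mul_sum]
    refine Finset.sum_le_sum fun i _ => ?_
    rcases le_or_gt l i with hi | hi
    · gcongr; exact he' hi
    · rw [h2 i hi]; simp
  have := hδ x.ofLp
  rw [hx2] at this
  have h3 : e l * ‖x‖ ^ 2 ≤ (e' l + δ) * ‖x‖ ^ 2 := by linarith
  exact le_of_mul_le_mul_right h3 hxpos

theorem IsSortedSpectrum.abs_sub_le {d : ℕ} {P P' : Matrix (Fin d) (Fin d) ℝ} {e e' : Fin d → ℝ}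
    (h : IsSortedSpectrum P e) (h' : IsSortedSpectrum P' e') {δ : ℝ}
    (hδ : ∀ x : Fin d → ℝ, |x ⬝ᵥ (P *ᵥ x) - x ⬝ᵥ (P' *ᵥ x)| ≤ δ * (x ⬝ᵥ x)) (l : Fin d) :
    |e l - e' l| ≤ δ := by
  have h1 := h.le_add h' (δ := δ) (fun x => by linarith [(abs_le.1 (hδ x)).2]) l
  have h2 := h'.le_add h (δ := δ) (fun x => by linarith [(abs_le.1 (hδ x)).1]) l
  rw [abs_le]; constructor <;> linarith

theorem isSortedSpectrum_eigenvalues {d : ℕ} {P : Matrix (Fin d) (Fin d) ℝ}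
    (hT : (toEuclideanLin P).IsSymmetric) :
    IsSortedSpectrum P (hT.eigenvalues finrank_euclideanSpace_fin) := by
  refine ⟨hT.eigenvalues_antitone _, hT.eigenvectorBasis finrank_euclideanSpace_fin, fun x => ?_⟩
  have h1 : x.ofLp ⬝ᵥ (P *ᵥ x.ofLp) = inner ℝ (toEuclideanLin P x) x := by
    rw [EuclideanSpace.inner_eq_star_dotProduct]
    simp [toLpLin_apply]
  rw [h1, ← (hT.eigenvectorBasis finrank_euclideanSpace_fin).sum_inner_mul_inner]
  refine Finset.sum_congr rfl fun i _ => ?_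
  rw [hT, hT.apply_eigenvectorBasis, inner_smul_right, real_inner_comm x]
  simp only [RCLike.ofReal_real_eq_id, id_eq]
  ring

theorem isSymmetric_toEuclideanLin {d : ℕ} {P : Matrix (Fin d) (Fin d) ℝ} (hP : Pᵀ = P) :
    (toEuclideanLin P).IsSymmetric := by
  rw [Matrix.isSymmetric_toEuclideanLin_iff, IsHermitian, conjTranspose_eq_transpose_of_trivial, hP]

theorem exists_isSortedSpectrum {d : ℕ} {P : Matrix (Fin d) (Fin d) ℝ} (hP : Pᵀ = P) :
    ∃ e, IsSortedSpectrum P e :=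
  ⟨_, isSortedSpectrum_eigenvalues (isSymmetric_toEuclideanLin hP)⟩

theorem isSortedSpectrum_diagonal {d : ℕ} {p : Fin d → ℝ} (hp : Antitone p) :
    IsSortedSpectrum (diagonal p) p := by
  refine ⟨hp, EuclideanSpace.basisFun _ _, fun x => ?_⟩
  simp only [EuclideanSpace.basisFun_inner, dotProduct, mulVec_diagonal]
  exact Finset.sum_congr rfl fun i _ => by ring

theorem charpoly_toEuclideanLin {d : ℕ} (A : Matrix (Fin d) (Fin d) ℝ) :
    (toEuclideanLin A).charpoly = A.charpoly := by
  rw [toEuclideanLin, toLpLin_eq_toLin, charpoly_toLin]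

/-- Singular values are defined through `QᵀQ`, whereas the limiting equation closes in `QQᵀ`. The
two products have the same characteristic polynomial, hence the same sorted eigenvalues. -/
theorem isSortedSpectrum_mul_transpose {d : ℕ} (Q : Matrix (Fin d) (Fin d) ℝ) :
    IsSortedSpectrum (Q * Qᵀ) fun l => ((toEuclideanLin Q).singularValues (l : ℕ)) ^ 2 := by
  have hT := isSymmetric_toEuclideanLin (P := Q * Qᵀ) (by simp)
  have h := isSortedSpectrum_eigenvalues hT
  have hadj : LinearMap.adjoint (toEuclideanLin Q) ∘ₗ toEuclideanLin Q
      = toEuclideanLin (Qᵀ * Q) := by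
    rw [← toEuclideanLin_conjTranspose_eq_adjoint, conjTranspose_eq_transpose_of_trivial]
    exact (toLpLin_mul_same 2 Qᵀ Q).symm
  have hchar : (LinearMap.adjoint (toEuclideanLin Q) ∘ₗ toEuclideanLin Q).charpoly
      = (toEuclideanLin (Q * Qᵀ)).charpoly := by
    rw [hadj, charpoly_toEuclideanLin, charpoly_toEuclideanLin, charpoly_mul_comm]
  have key := (LinearMap.IsSymmetric.eigenvalues_eq_eigenvalues_iff
    (toEuclideanLin Q).isSymmetric_adjoint_comp_self finrank_euclideanSpace_fin hT
    finrank_euclideanSpace_fin).2 hchar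
  have hfun : (fun l : Fin d => ((toEuclideanLin Q).singularValues (l : ℕ)) ^ 2)
      = hT.eigenvalues finrank_euclideanSpace_fin := by
    rw [← key]
    funext l
    exact LinearMap.sq_singularValues_fin _ finrank_euclideanSpace_fin l
  rw [hfun]
  exact h

theorem orthonormalize_of_transpose_mul {n d : ℕ} {X : Matrix (Fin n) (Fin d) ℝ}
    (hX : Xᵀ * X = 1) : orthonormalize X = X := by
  have := invSqrt_one_add_vecMulVec (d := d) le_rfl 0
  rw [zero_smul, add_zero, vecMulVec_zero, smul_zero, sub_zero] at this
  rw [orthonormalize, hX, this, Matrix.mul_one]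

/-- Needed so that the cosine of `Real.arccos` returns the singular value. The form of `QQᵀ` is
compared with that of the identity. -/
theorem singularValue_le_one {n d : ℕ} {U X : Matrix (Fin n) (Fin d) ℝ} (hU : Uᵀ * U = 1)
    (hX : Xᵀ * X = 1) (l : Fin d) :
    (toEuclideanLin (Uᵀ * X)).singularValues (l : ℕ) ^ 2 ≤ 1 := by
  have h1 := isSortedSpectrum_mul_transpose (Uᵀ * X)
  have h2 := isSortedSpectrum_diagonal (p := fun _ : Fin d => (1 : ℝ)) (fun _ _ _ => le_rfl)
  have := h1.le_add h2 (δ := 0) (fun x => ?_) l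
  · simpa using this
  · rw [zero_mul, add_zero, show diagonal (fun _ : Fin d => (1 : ℝ)) = 1 from diagonal_one,
      one_mulVec, ← mulVec_mulVec, dotProduct_mulVec, ← mulVec_transpose, ← l2norm_sq, ← l2norm_sq]
    gcongr
    · exact l2norm_nonneg _
    · rw [transpose_mul, transpose_transpose, ← mulVec_mulVec]
      calc l2norm (Xᵀ *ᵥ (U *ᵥ x)) ≤ _ := l2norm_mulVec_le _ _
        _ ≤ 1 * l2norm (U *ᵥ x) := by
          gcongr
          · exact l2norm_nonneg _
          · rw [norm_transpose]; exact norm_le_one_of_transpose_mul hX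
        _ = l2norm x := by rw [one_mul, l2norm_mulVec hU]

theorem isSortedSpectrum_cos_sq_principalAngle {n d : ℕ} {U X : Matrix (Fin n) (Fin d) ℝ}
    (hU : Uᵀ * U = 1) (hX : Xᵀ * X = 1) :
    IsSortedSpectrum (Uᵀ * X * (Uᵀ * X)ᵀ) fun l => Real.cos (principalAngle U X l) ^ 2 := by
  convert isSortedSpectrum_mul_transpose (Uᵀ * X) using 2 with l
  have h1 := singularValue_le_one hU hX l
  have h0 := (toEuclideanLin (Uᵀ * X)).singularValues_nonneg (l : ℕ)
  rw [principalAngle, cosineSimilarity, orthonormalize_of_transpose_mul hX,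
    Real.cos_arccos (by linarith) (by nlinarith)]

end

end SubspaceTracking

namespace SubspaceTracking

noncomputable section

open scoped Matrix.Norms.L2Operator

/-! ### A matrix Riccati equation -/

/-- The vector field of the Riccati equation `P' = a P + P a - P g P` with diagonal `a`, `g`. -/
def riccatiField {d : ℕ} (a g : Fin d → ℝ) (P : Matrix (Fin d) (Fin d) ℝ) :
    Matrix (Fin d) (Fin d) ℝ :=
  diagonal a * P + P * diagonal a - P * diagonal g * P

/-- The scalar equation for a diagonal entry of `P⁻¹`. The function `c exp(-at)² + D t` is its
solution with initial value `c`; it tends to `g/(2a)` if `a > 0` and to infinity if `a ≤ 0`. -/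
theorem exists_scalar_solution (a : ℝ) {g : ℝ} (hg : 0 < g) :
    ∃ D : ℝ → ℝ, D 0 = 0 ∧ (∀ t, HasDerivAt D (-2 * a * D t + g) t) ∧ (∀ t, 0 ≤ t → 0 ≤ D t) ∧
      ∀ c, 0 < c → Tendsto (fun t => (c * Real.exp (-a * t) ^ 2 + D t)⁻¹) atTop
        (𝓝 (max 0 (2 * a / g))) := by
  rcases eq_or_ne a 0 with rfl | ha
  · refine ⟨fun t => g * t, by simp, fun t => ?_, fun t ht => by positivity, fun c hc => ?_⟩
    · simpa using (hasDerivAt_id t).const_mul g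
    · simp only [mul_zero, zero_div, max_self, neg_zero, zero_mul, Real.exp_zero, one_pow, mul_one]
      exact tendsto_inv_atTop_zero.comp
        (tendsto_atTop_add_const_left _ _ (tendsto_id.const_mul_atTop hg))
  have hE : ∀ t, Real.exp (-a * t) ^ 2 = Real.exp (-2 * a * t) := fun t => by
    rw [← Real.exp_nat_mul]; congr 1; push_cast; ring
  refine ⟨fun t => g / (2 * a) * (1 - Real.exp (-2 * a * t)), by simp, fun t => ?_,
    fun t ht => ?_, fun c hc => ?_⟩
  · have h1 : HasDerivAt (fun t : ℝ => -2 * a * t) (-2 * a) t := by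
      simpa using (hasDerivAt_id t).const_mul (-2 * a)
    have h2 := (h1.exp.const_sub 1).const_mul (g / (2 * a))
    refine h2.congr_deriv ?_
    field_simp
    ring
  · rcases lt_or_gt_of_ne ha with h | h
    · refine mul_nonneg_of_nonpos_of_nonpos (div_nonpos_of_nonneg_of_nonpos hg.le (by linarith)) ?_
      have : 1 ≤ Real.exp (-2 * a * t) := Real.one_le_exp (by nlinarith)
      linarith
    · refine mul_nonneg (by positivity) ?_
      have : Real.exp (-2 * a * t) ≤ 1 := Real.exp_le_one_iff.2 (by nlinarith)
      linarith
  · have hfun : ∀ t, c * Real.exp (-a * t) ^ 2 + g / (2 * a) * (1 - Real.exp (-2 * a * t))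
        = g / (2 * a) + (c - g / (2 * a)) * Real.exp (-2 * a * t) := fun t => by
      rw [hE]; ring
    simp only [hfun]
    rcases lt_or_gt_of_ne ha with h | h
    · have hneg : g / (2 * a) < 0 := div_neg_of_pos_of_neg hg (by linarith)
      rw [max_eq_left (div_nonpos_of_nonpos_of_nonneg (by linarith) hg.le)]
      refine tendsto_inv_atTop_zero.comp (tendsto_atTop_add_const_left _ _ ?_)
      refine Tendsto.const_mul_atTop (by linarith) ?_
      exact Real.tendsto_exp_atTop.comp (tendsto_id.const_mul_atTop (by linarith))
    · rw [max_eq_right (by positivity)]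
      have h0 : Tendsto (fun t : ℝ => Real.exp (-2 * a * t)) atTop (𝓝 0) := by
        refine Real.tendsto_exp_atBot.comp ?_
        exact tendsto_id.const_mul_atTop_of_neg (by linarith)
      have h1 : Tendsto (fun t : ℝ => g / (2 * a) + (c - g / (2 * a)) * Real.exp (-2 * a * t)) atTop
          (𝓝 (g / (2 * a))) := by
        simpa using (h0.const_mul (c - g / (2 * a))).const_add (g / (2 * a))
      have := h1.inv₀ (by positivity)
      rwa [inv_div] at this

theorem dotProduct_diagonal_mulVec {d : ℕ} (p x : Fin d → ℝ) :
    x ⬝ᵥ (diagonal p *ᵥ x) = ∑ i, p i * x i ^ 2 := by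
  simp only [dotProduct, mulVec_diagonal]
  exact Finset.sum_congr rfl fun i _ => by ring

/-- The quadratic form of the inverse of `R` is at least that of the inverse of a diagonal matrix
which dominates `R`. -/
theorem inv_quadratic_ge {d : ℕ} {R : Matrix (Fin d) (Fin d) ℝ} (hR : R.PosDef) {D : Fin d → ℝ}
    (hD : ∀ i, 0 < D i) (h : ∀ x : Fin d → ℝ, x ⬝ᵥ (R *ᵥ x) ≤ ∑ i, D i * x i ^ 2)
    (x : Fin d → ℝ) : ∑ i, (D i)⁻¹ * x i ^ 2 ≤ x ⬝ᵥ (R⁻¹ *ᵥ x) := by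
  have hdet : IsUnit R.det := (isUnit_iff_isUnit_det _).1 hR.isUnit
  have hRt : Rᵀ = R := by
    rw [← conjTranspose_eq_transpose_of_trivial]; exact hR.1
  set z := R⁻¹ *ᵥ x with hz
  have hRz : R *ᵥ z = x := by rw [hz, mulVec_mulVec, Matrix.mul_nonsing_inv _ hdet, one_mulVec]
  -- Positivity of the form of `R` at `y - z` gives `2 x·y - y·Ry ≤ x·z`; the choice `y = D⁻¹x`
  -- maximizes the resulting lower bound `2 x·y - y·Dy`.
  set y : Fin d → ℝ := fun i => (D i)⁻¹ * x i
  have h1 := hR.posSemidef.dotProduct_mulVec_nonneg (y - z)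
  rw [star_trivial, mulVec_sub, hRz, sub_dotProduct, dotProduct_sub, dotProduct_sub] at h1
  have h2 : z ⬝ᵥ (R *ᵥ y) = x ⬝ᵥ y := by
    rw [dotProduct_mulVec, ← mulVec_transpose, hRt, hRz]
  have h3 := h y
  have h4 : ∑ i, D i * y i ^ 2 = ∑ i, (D i)⁻¹ * x i ^ 2 :=
    Finset.sum_congr rfl fun i _ => by simp only [y]; field_simp [(hD i).ne']
  have h5 : x ⬝ᵥ y = ∑ i, (D i)⁻¹ * x i ^ 2 :=
    Finset.sum_congr rfl fun i _ => by simp only [y]; ring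
  rw [h2, dotProduct_comm y x, h5, dotProduct_comm z x] at h1
  linarith

/-- Young's inequality `2 x·z ≤ x·D⁻¹x + z·Dz` at `z = R⁻¹x`, where the last term is at most `z·Rz =
x·z`. -/
theorem inv_quadratic_le {d : ℕ} {R : Matrix (Fin d) (Fin d) ℝ} (hR : R.PosDef) {D : Fin d → ℝ}
    (hD : ∀ i, 0 < D i) (h : ∀ x : Fin d → ℝ, ∑ i, D i * x i ^ 2 ≤ x ⬝ᵥ (R *ᵥ x))
    (x : Fin d → ℝ) : x ⬝ᵥ (R⁻¹ *ᵥ x) ≤ ∑ i, (D i)⁻¹ * x i ^ 2 := by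
  have hdet : IsUnit R.det := (isUnit_iff_isUnit_det _).1 hR.isUnit
  set z := R⁻¹ *ᵥ x with hz
  have hRz : R *ᵥ z = x := by rw [hz, mulVec_mulVec, Matrix.mul_nonsing_inv _ hdet, one_mulVec]
  have h1 := h z
  rw [hRz, dotProduct_comm] at h1
  have h2 : 0 ≤ ∑ i, ((D i)⁻¹ * x i ^ 2 - 2 * (x i * z i) + D i * z i ^ 2) :=
    Finset.sum_nonneg fun i _ => by
      have : (D i)⁻¹ * x i ^ 2 - 2 * (x i * z i) + D i * z i ^ 2
          = (D i)⁻¹ * (x i - D i * z i) ^ 2 := by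
        field_simp [(hD i).ne']; ring
      rw [this]
      have := hD i
      positivity
  rw [Finset.sum_add_distrib, Finset.sum_sub_distrib, ← Finset.mul_sum] at h2
  change 0 ≤ _ - 2 * (x ⬝ᵥ z) + _ at h2
  linarith

theorem quadratic_le_norm {d : ℕ} (R : Matrix (Fin d) (Fin d) ℝ) (x : Fin d → ℝ) :
    |x ⬝ᵥ (R *ᵥ x)| ≤ ‖R‖ * (x ⬝ᵥ x) := by
  have h1 := abs_real_inner_le_norm (WithLp.toLp 2 (R *ᵥ x)) (WithLp.toLp 2 x)
  rw [EuclideanSpace.inner_eq_star_dotProduct] at h1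
  simp only [star_trivial] at h1
  change _ ≤ l2norm (R *ᵥ x) * l2norm x at h1
  calc _ ≤ l2norm (R *ᵥ x) * l2norm x := h1
    _ ≤ ‖R‖ * l2norm x * l2norm x := by
      gcongr
      · exact l2norm_nonneg _
      · exact l2norm_mulVec_le _ _
    _ = _ := by rw [← l2norm_sq]; ring

/-- Obtained from `inv_quadratic_ge` applied to `R⁻¹`, which is dominated by `‖R⁻¹‖` times the
identity; `d > 0` makes this norm nonzero. -/
theorem quadratic_ge_inv_norm {d : ℕ} (hd : 0 < d) {R : Matrix (Fin d) (Fin d) ℝ} (hR : R.PosDef)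
    (x : Fin d → ℝ) : ‖R⁻¹‖⁻¹ * (x ⬝ᵥ x) ≤ x ⬝ᵥ (R *ᵥ x) := by
  have hdet : IsUnit R.det := (isUnit_iff_isUnit_det _).1 hR.isUnit
  have : Nonempty (Fin d) := ⟨⟨0, hd⟩⟩
  have hpos : 0 < ‖R⁻¹‖ := by
    rw [norm_pos_iff]
    intro h0
    have := Matrix.mul_nonsing_inv R hdet
    rw [h0, Matrix.mul_zero] at this
    exact zero_ne_one this
  have h1 := inv_quadratic_ge hR.inv (D := fun _ => ‖R⁻¹‖) (fun _ => hpos) (fun y => by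
    rw [← Finset.mul_sum]
    have := (abs_le.1 (quadratic_le_norm R⁻¹ y)).2
    simpa [dotProduct, sq] using this) x
  rw [Matrix.nonsing_inv_nonsing_inv _ hdet, ← Finset.mul_sum] at h1
  simpa [dotProduct, sq] using h1

theorem hasDerivAt_diagonal {d : ℕ} {f : ℝ → Fin d → ℝ} {f' : Fin d → ℝ} {t : ℝ}
    (hf : ∀ i, HasDerivAt (fun t => f t i) (f' i) t) :
    HasDerivAt (fun t => diagonal (f t)) (diagonal f') t :=
  ((diagonalLinearMap (Fin d) ℝ ℝ).toContinuousLinearMap.hasFDerivAt).comp_hasDerivAt t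
    (hasDerivAt_pi.2 hf)

/-- Variation of constants for the linear equation `R' = -aR - Ra + g` satisfied by the inverse of a
Riccati solution. -/
theorem hasDerivAt_diagonal_conj {d : ℕ} (R₀ : Matrix (Fin d) (Fin d) ℝ) {a g : Fin d → ℝ}
    {E : ℝ → Fin d → ℝ} {D : Fin d → ℝ → ℝ} {t : ℝ}
    (hE : ∀ i, HasDerivAt (fun t => E t i) (-a i * E t i) t)
    (hD : ∀ i, HasDerivAt (D i) (-2 * a i * D i t + g i) t) :
    HasDerivAt (fun t => diagonal (E t) * R₀ * diagonal (E t) + diagonal fun i => D i t)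
      (-(diagonal a * (diagonal (E t) * R₀ * diagonal (E t) + diagonal fun i => D i t))
        - (diagonal (E t) * R₀ * diagonal (E t) + diagonal fun i => D i t) * diagonal a
        + diagonal g) t := by
  have h := (((hasDerivAt_diagonal hE).mul_const R₀).mul (hasDerivAt_diagonal hE)).add
    (hasDerivAt_diagonal (f := fun t i => D i t) hD)
  refine h.congr_deriv ?_
  have e1 : (diagonal fun i => -a i * E t i) = -(diagonal a * diagonal (E t)) := by
    rw [diagonal_mul_diagonal, diagonal_neg]; congr 1; funext i; simp
  have e2 : diagonal a * diagonal (E t) = diagonal (E t) * diagonal a := by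
    rw [diagonal_mul_diagonal, diagonal_mul_diagonal]; congr 1; funext i; ring
  have e3 : (diagonal fun i => -2 * a i * D i t + g i)
      = -(diagonal a * diagonal fun i => D i t) - (diagonal fun i => D i t) * diagonal a
        + diagonal g := by
    rw [diagonal_mul_diagonal, diagonal_mul_diagonal, diagonal_neg, diagonal_sub, diagonal_add]
    congr 1; funext i; simp; ring
  have e4 : diagonal (E t) * R₀ * -(diagonal a * diagonal (E t))
      = -(diagonal (E t) * R₀ * diagonal (E t) * diagonal a) := by
    rw [e2]; noncomm_ring
  rw [e3, e1, e4]
  noncomm_ring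

theorem hasDerivAt_matrix_inv {d : ℕ} {R : ℝ → Matrix (Fin d) (Fin d) ℝ}
    {R' : Matrix (Fin d) (Fin d) ℝ} {t : ℝ} (hR : HasDerivAt R R' t) (hu : IsUnit (R t)) :
    HasDerivAt (fun t => (R t)⁻¹) (-((R t)⁻¹ * R' * (R t)⁻¹)) t := by
  obtain ⟨u, hu⟩ := hu
  have h1 := hasFDerivAt_ringInverse (𝕜 := ℝ) u
  rw [hu] at h1
  have h2 := h1.comp_hasDerivAt t hR
  simp only [Function.comp_def, ← Matrix.nonsing_inv_eq_ringInverse] at h2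
  refine h2.congr_deriv ?_
  simp [ContinuousLinearMap.mulLeftRight_apply, Matrix.coe_units_inv, hu]

/-- The solution is `P = R⁻¹` with `R(t) = e^{-at} P₀⁻¹ e^{-at} + D(t)`, so no existence theory is
needed; positive definiteness of `P₀` makes the substitution possible. Bounds `k ≤ P₀⁻¹ ≤ K` put
`R(t)` between the diagonal matrices `kE² + D` and `KE² + D`, whose inverses have the same limit.
The conclusion is about quadratic forms because `IsSortedSpectrum.abs_sub_le` takes it in this
shape. -/
theorem exists_riccati_solution {d : ℕ} (hd : 0 < d) {a g : Fin d → ℝ} (hg : ∀ i, 0 < g i)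
    {P₀ : Matrix (Fin d) (Fin d) ℝ} (hP₀ : P₀.PosDef) :
    ∃ P : ℝ → Matrix (Fin d) (Fin d) ℝ, P 0 = P₀ ∧ (∀ t, 0 ≤ t → (P t)ᵀ = P t) ∧
      (∀ t, 0 ≤ t → HasDerivAt P (riccatiField a g (P t)) t) ∧
      ∃ δ : ℝ → ℝ, Tendsto δ atTop (𝓝 0) ∧ ∀ t, 0 ≤ t → ∀ x : Fin d → ℝ,
        |x ⬝ᵥ (P t *ᵥ x) - x ⬝ᵥ (diagonal (fun i => max 0 (2 * a i / g i)) *ᵥ x)|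
          ≤ δ t * (x ⬝ᵥ x) := by
  choose D hD0 hDderiv hDnn hDlim using fun i => exists_scalar_solution (a i) (hg i)
  set R₀ := P₀⁻¹ with hR₀
  have hR₀pd : R₀.PosDef := hP₀.inv
  have hP₀det : IsUnit P₀.det := (isUnit_iff_isUnit_det _).1 hP₀.isUnit
  have : Nonempty (Fin d) := ⟨⟨0, hd⟩⟩
  have hnz : ∀ M : Matrix (Fin d) (Fin d) ℝ, IsUnit M.det → 0 < ‖M‖ := fun M hM => by
    rw [norm_pos_iff]
    intro h0
    have := Matrix.mul_nonsing_inv M hM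
    rw [h0, Matrix.zero_mul] at this
    exact zero_ne_one this
  -- The numbers `k` and `K` bound the form of `R₀` from below and from above.
  set k := ‖R₀⁻¹‖⁻¹ with hk
  have hkpos : 0 < k := by
    rw [hk, hR₀, Matrix.nonsing_inv_nonsing_inv _ hP₀det]
    exact inv_pos.2 (hnz _ hP₀det)
  set K := ‖R₀‖ with hK
  have hKpos : 0 < K := hnz _ ((isUnit_iff_isUnit_det _).1 hR₀pd.isUnit)
  set E : ℝ → Fin d → ℝ := fun t i => Real.exp (-a i * t) with hE
  set R : ℝ → Matrix (Fin d) (Fin d) ℝ := fun t =>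
    diagonal (E t) * R₀ * diagonal (E t) + diagonal (fun i => D i t) with hR
  have hquad : ∀ t (x : Fin d → ℝ), x ⬝ᵥ (R t *ᵥ x) =
      (diagonal (E t) *ᵥ x) ⬝ᵥ (R₀ *ᵥ (diagonal (E t) *ᵥ x)) + ∑ i, D i t * x i ^ 2 := by
    intro t x
    simp only [hR]
    rw [add_mulVec, dotProduct_add, dotProduct_diagonal_mulVec, ← mulVec_mulVec, ← mulVec_mulVec,
      dotProduct_mulVec x, ← mulVec_transpose, diagonal_transpose]
  have hEE : ∀ t (x : Fin d → ℝ) c, c * ((diagonal (E t) *ᵥ x) ⬝ᵥ (diagonal (E t) *ᵥ x))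
      + ∑ i, D i t * x i ^ 2 = ∑ i, (c * E t i ^ 2 + D i t) * x i ^ 2 := by
    intro t x c
    simp only [dotProduct, mulVec_diagonal, Finset.mul_sum]
    rw [← Finset.sum_add_distrib]
    exact Finset.sum_congr rfl fun i _ => by ring
  have hlow : ∀ t (x : Fin d → ℝ), ∑ i, (k * E t i ^ 2 + D i t) * x i ^ 2 ≤ x ⬝ᵥ (R t *ᵥ x) := by
    intro t x
    rw [hquad, ← hEE]
    gcongr
    exact quadratic_ge_inv_norm hd hR₀pd _
  have hup : ∀ t (x : Fin d → ℝ), x ⬝ᵥ (R t *ᵥ x) ≤ ∑ i, (K * E t i ^ 2 + D i t) * x i ^ 2 := by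
    intro t x
    rw [hquad, ← hEE]
    gcongr
    exact (abs_le.1 (quadratic_le_norm _ _)).2
  have hpos : ∀ c, 0 < c → ∀ t, 0 ≤ t → ∀ i, 0 < c * E t i ^ 2 + D i t := fun c hc t ht i => by
    have h1 := hDnn i t ht
    have h2 : 0 < E t i := Real.exp_pos _
    positivity
  have hRt : ∀ t, (R t)ᵀ = R t := fun t => by
    have : R₀ᵀ = R₀ := by rw [← conjTranspose_eq_transpose_of_trivial]; exact hR₀pd.1
    simp only [hR, transpose_add, transpose_mul, diagonal_transpose, this, Matrix.mul_assoc]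
  have hRpd : ∀ t, 0 ≤ t → (R t).PosDef := fun t ht => by
    refine PosDef.of_dotProduct_mulVec_pos ?_ fun x hx => ?_
    · rw [IsHermitian, conjTranspose_eq_transpose_of_trivial, hRt]
    · rw [star_trivial]
      refine lt_of_lt_of_le ?_ (hlow t x)
      obtain ⟨i, hi⟩ := Function.ne_iff.1 hx
      refine Finset.sum_pos' (fun j _ => ?_) ⟨i, Finset.mem_univ _, ?_⟩
      · have := hpos k hkpos t ht j; positivity
      · have := hpos k hkpos t ht i
        have : 0 < x i ^ 2 := by have : x i ≠ 0 := hi; positivity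
        positivity
  have hRderiv : ∀ t, HasDerivAt R (-(diagonal a * R t) - R t * diagonal a + diagonal g) t := by
    intro t
    refine hasDerivAt_diagonal_conj R₀ (fun i => ?_) (fun i => hDderiv i t)
    have h2 : HasDerivAt (fun t : ℝ => -a i * t) (-a i) t := by
      simpa using (hasDerivAt_id t).const_mul (-a i)
    refine h2.exp.congr_deriv ?_
    simp only [hE]; ring
  refine ⟨fun t => (R t)⁻¹, ?_, fun t ht => ?_, fun t ht => ?_, ?_⟩
  · have : R 0 = R₀ := by
      simp only [hR, hE, mul_zero, Real.exp_zero, hD0]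
      simp
    simp only [this, hR₀]
    exact Matrix.nonsing_inv_nonsing_inv _ hP₀det
  · rw [transpose_nonsing_inv, hRt]
  · have hu := (hRpd t ht).isUnit
    have hdet := (isUnit_iff_isUnit_det _).1 hu
    refine (hasDerivAt_matrix_inv (hRderiv t) hu).congr_deriv ?_
    have hl := Matrix.nonsing_inv_mul _ hdet
    have hr := Matrix.mul_nonsing_inv _ hdet
    rw [riccatiField]
    have e1 : (R t)⁻¹ * (-(diagonal a * R t) - R t * diagonal a + diagonal g) * (R t)⁻¹
        = -((R t)⁻¹ * diagonal a * (R t * (R t)⁻¹)) - ((R t)⁻¹ * R t) * diagonal a * (R t)⁻¹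
          + (R t)⁻¹ * diagonal g * (R t)⁻¹ := by noncomm_ring
    rw [e1, hl, hr]
    noncomm_ring
  -- The sum dominates, for every index, the deviation of either diagonal comparison from its limit,
  -- so it serves for both sides of the sandwich.
  · refine ⟨fun t => ∑ i, (|(k * E t i ^ 2 + D i t)⁻¹ - max 0 (2 * a i / g i)|
      + |(K * E t i ^ 2 + D i t)⁻¹ - max 0 (2 * a i / g i)|), ?_, fun t ht x => ?_⟩
    · have h := tendsto_finsetSum Finset.univ fun i (_ : i ∈ Finset.univ) =>
        (((hDlim i k hkpos).sub_const (max 0 (2 * a i / g i))).abs).add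
          (((hDlim i K hKpos).sub_const (max 0 (2 * a i / g i))).abs)
      simpa only [sub_self, abs_zero, add_zero, Finset.sum_const_zero] using h
    · have hle := inv_quadratic_le (hRpd t ht) (hpos k hkpos t ht) (hlow t) x
      have hge := inv_quadratic_ge (hRpd t ht) (hpos K hKpos t ht) (hup t) x
      rw [dotProduct_diagonal_mulVec]
      set S := ∑ i, (|(k * E t i ^ 2 + D i t)⁻¹ - max 0 (2 * a i / g i)|
        + |(K * E t i ^ 2 + D i t)⁻¹ - max 0 (2 * a i / g i)|) with hS
      have hterm : ∀ i, |(k * E t i ^ 2 + D i t)⁻¹ - max 0 (2 * a i / g i)|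
        + |(K * E t i ^ 2 + D i t)⁻¹ - max 0 (2 * a i / g i)| ≤ S := fun i =>
        Finset.single_le_sum (f := fun i => |(k * E t i ^ 2 + D i t)⁻¹ - max 0 (2 * a i / g i)|
          + |(K * E t i ^ 2 + D i t)⁻¹ - max 0 (2 * a i / g i)|) (fun j _ => by positivity)
          (Finset.mem_univ i)
      have hxx : S * (x ⬝ᵥ x) = ∑ i, S * x i ^ 2 := by
        rw [← Finset.mul_sum]; simp [dotProduct, sq]
      rw [hxx, abs_le, neg_le_sub_iff_le_add, sub_le_iff_le_add]
      constructor
      · calc ∑ i, max 0 (2 * a i / g i) * x i ^ 2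
            ≤ ∑ i, ((K * E t i ^ 2 + D i t)⁻¹ * x i ^ 2 + S * x i ^ 2) :=
              Finset.sum_le_sum fun i _ => by
                rw [← add_mul]; gcongr
                have := hterm i
                have h1 := abs_nonneg ((k * E t i ^ 2 + D i t)⁻¹ - max 0 (2 * a i / g i))
                have h2 := neg_abs_le ((K * E t i ^ 2 + D i t)⁻¹ - max 0 (2 * a i / g i))
                linarith
          _ ≤ _ := by rw [Finset.sum_add_distrib]; linarith
      · calc x ⬝ᵥ ((R t)⁻¹ *ᵥ x) ≤ ∑ i, (k * E t i ^ 2 + D i t)⁻¹ * x i ^ 2 := hle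
          _ ≤ ∑ i, (S * x i ^ 2 + max 0 (2 * a i / g i) * x i ^ 2) :=
              Finset.sum_le_sum fun i _ => by
                rw [← add_mul]; gcongr
                have := hterm i
                have h1 := abs_nonneg ((K * E t i ^ 2 + D i t)⁻¹ - max 0 (2 * a i / g i))
                have h2 := le_abs_self ((k * E t i ^ 2 + D i t)⁻¹ - max 0 (2 * a i / g i))
                linarith
          _ = _ := Finset.sum_add_distrib

/-! ### Local Lipschitz bound for the field and regularity of solutions -/

theorem riccatiField_sub_le {d : ℕ} (a g : Fin d → ℝ) {M : ℝ} {P P' : Matrix (Fin d) (Fin d) ℝ}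
    (hP : ‖P‖ ≤ M) (hP' : ‖P'‖ ≤ M) :
    ‖riccatiField a g P - riccatiField a g P'‖
      ≤ (2 * ‖diagonal a‖ + 2 * M * ‖diagonal g‖) * ‖P - P'‖ := by
  have e : riccatiField a g P - riccatiField a g P' =
      diagonal a * (P - P') + (P - P') * diagonal a
        - ((P - P') * diagonal g * P + P' * diagonal g * (P - P')) := by
    simp only [riccatiField]; noncomm_ring
  rw [e]
  have hM : 0 ≤ M := (norm_nonneg _).trans hP
  calc _ ≤ ‖diagonal a‖ * ‖P - P'‖ + ‖P - P'‖ * ‖diagonal a‖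
        + (‖P - P'‖ * ‖diagonal g‖ * M + M * ‖diagonal g‖ * ‖P - P'‖) := by
        refine (norm_sub_le _ _).trans (add_le_add ((norm_add_le _ _).trans (add_le_add
          (norm_mul_le _ _) (norm_mul_le _ _))) ((norm_add_le _ _).trans (add_le_add ?_ ?_)))
        · refine (norm_mul_le _ _).trans ?_
          gcongr
          exact norm_mul_le _ _
        · refine (norm_mul_le _ _).trans ?_
          gcongr
          exact (norm_mul_le _ _).trans (by gcongr)
    _ = _ := by ring

/-- Consistency of Euler's scheme: the field is Lipschitz along the solution, so a step of length
`1/n` has an error of order `n⁻²`, which is harmless over `nT` steps. The Lipschitz bound also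
absorbs the rounding of `nt` to an integer. -/
theorem riccati_solution_estimates {d : ℕ} {a g : Fin d → ℝ} {P : ℝ → Matrix (Fin d) (Fin d) ℝ}
    (hP : ∀ t, 0 ≤ t → HasDerivAt P (riccatiField a g (P t)) t) (T : ℝ) :
    ∃ K, 0 < K ∧ ∀ s t, 0 ≤ s → s ≤ t → t ≤ T → ‖P s‖ ≤ K ∧ ‖P t - P s‖ ≤ K * (t - s) ∧
      ‖P t - P s - (t - s) • riccatiField a g (P s)‖ ≤ K * (t - s) ^ 2 := by
  have hcont : ContinuousOn P (Set.Icc 0 T) := fun t ht =>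
    (hP t ht.1).continuousAt.continuousWithinAt
  obtain ⟨M, hM⟩ := isCompact_Icc.exists_bound_of_continuousOn hcont
  have hGcont : ContinuousOn (fun t => riccatiField a g (P t)) (Set.Icc 0 T) := by
    unfold riccatiField
    fun_prop
  obtain ⟨M', hM'⟩ := isCompact_Icc.exists_bound_of_continuousOn hGcont
  set L := 2 * ‖diagonal a‖ + 2 * |M| * ‖diagonal g‖ with hL
  have hL0 : 0 ≤ L := by positivity
  refine ⟨|M| + |M'| + L * |M'| + 1, by positivity, fun s t hs hst htT => ?_⟩
  have hmem : ∀ u, s ≤ u → u ≤ t → u ∈ Set.Icc 0 T := fun u h1 h2 =>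
    ⟨hs.trans h1, h2.trans htT⟩
  have hlip : ∀ u, s ≤ u → u ≤ t → ‖P u - P s‖ ≤ |M'| * (u - s) := by
    intro u hu hut
    have := (convex_Icc s u).norm_image_sub_le_of_norm_hasDerivWithin_le (f := P)
      (f' := fun t => riccatiField a g (P t)) (C := |M'|) (x := s) (y := u)
      (fun x hx => (hP x (hs.trans hx.1)).hasDerivWithinAt)
      (fun x hx => (hM' x (hmem x hx.1 (hx.2.trans hut))).trans (le_abs_self _))
      ⟨le_rfl, hu⟩ ⟨hu, le_rfl⟩
    rwa [Real.norm_eq_abs, abs_of_nonneg (sub_nonneg.2 hu)] at this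
  have hts : 0 ≤ t - s := sub_nonneg.2 hst
  have hLM : 0 ≤ L * |M'| := by positivity
  refine ⟨?_, ?_, ?_⟩
  · have h1 := (hM s (hmem s le_rfl hst)).trans (le_abs_self _)
    have := abs_nonneg M'
    linarith
  · refine (hlip t hst le_rfl).trans ?_
    gcongr
    have := abs_nonneg M
    linarith
  · have hder : ∀ x ∈ Set.Icc s t, HasDerivWithinAt
        (fun u => P u - (u - s) • riccatiField a g (P s))
        (riccatiField a g (P x) - riccatiField a g (P s)) (Set.Icc s t) x := by
      intro x hx
      have h1 := (((hasDerivAt_id x).sub_const s).smul_const (riccatiField a g (P s)))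
      rw [one_smul] at h1
      exact ((hP x (hs.trans hx.1)).sub h1).hasDerivWithinAt
    have := (convex_Icc s t).norm_image_sub_le_of_norm_hasDerivWithin_le
      (C := L * |M'| * (t - s)) (x := s) (y := t) hder (fun x hx => by
        have h1 := riccatiField_sub_le a g (M := |M|)
          ((hM x (hmem x hx.1 hx.2)).trans (le_abs_self _))
          ((hM s (hmem s le_rfl hst)).trans (le_abs_self _))
        refine h1.trans ?_
        rw [← hL, mul_assoc]
        gcongr
        exact (hlip x hx.1 hx.2).trans (by gcongr; exact hx.2))
      ⟨le_rfl, hst⟩ ⟨hst, le_rfl⟩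
    rw [sub_self, zero_smul, sub_zero, Real.norm_eq_abs, abs_of_nonneg hts] at this
    rw [sub_right_comm]
    refine this.trans ?_
    rw [mul_assoc, ← sq]
    gcongr
    have := abs_nonneg M
    have := abs_nonneg M'
    linarith

end

end SubspaceTracking

namespace SubspaceTracking

noncomputable section

/-! ### Random variables with finite moments of all orders -/

/-- A real random variable with finite moments of all orders. -/
def HasMoments {Ω : Type*} [MeasurableSpace Ω] (f : Ω → ℝ) (μ : Measure Ω) : Prop :=
  Measurable f ∧ ∀ p : ℕ, Integrable (fun ω => |f ω| ^ p) μ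

namespace HasMoments

variable {Ω : Type*} [MeasurableSpace Ω] {μ : Measure Ω} {f g : Ω → ℝ}

theorem measurable (hf : HasMoments f μ) : Measurable f := hf.1

theorem of_le (hg : HasMoments g μ) (hf : Measurable f) (h : ∀ ω, |f ω| ≤ g ω) :
    HasMoments f μ := by
  refine ⟨hf, fun p => (hg.2 p).mono' (by fun_prop) (.of_forall fun ω => ?_)⟩
  rw [Real.norm_eq_abs, abs_pow, abs_abs]
  exact pow_le_pow_left₀ (abs_nonneg _) ((h ω).trans (le_abs_self _)) p

theorem integrable (hf : HasMoments f μ) : Integrable f μ := by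
  refine (hf.2 1).mono' hf.1.aestronglyMeasurable (.of_forall fun ω => ?_)
  simp

theorem mul (hf : HasMoments f μ) (hg : HasMoments g μ) : HasMoments (fun ω => f ω * g ω) μ := by
  refine ⟨hf.1.mul hg.1, fun p => ((hf.2 (2 * p)).add (hg.2 (2 * p))).mono'
    (by have := hf.1; have := hg.1; fun_prop) (.of_forall fun ω => ?_)⟩
  simp only [Real.norm_eq_abs, abs_mul, mul_pow, abs_pow, abs_abs, Pi.add_apply, pow_mul']
  nlinarith [sq_nonneg (|f ω| ^ p), sq_nonneg (|g ω| ^ p), sq_nonneg (|f ω| ^ p - |g ω| ^ p)]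

theorem add (hf : HasMoments f μ) (hg : HasMoments g μ) : HasMoments (fun ω => f ω + g ω) μ := by
  refine ⟨hf.1.add hg.1, fun p => (((hf.2 p).add (hg.2 p)).const_mul (2 ^ p)).mono'
    (by have := hf.1; have := hg.1; fun_prop) (.of_forall fun ω => ?_)⟩
  simp only [Real.norm_eq_abs, abs_pow, abs_abs, Pi.add_apply]
  calc |f ω + g ω| ^ p ≤ (2 * max |f ω| |g ω|) ^ p := by
        gcongr
        refine (abs_add_le _ _).trans ?_
        linarith [le_max_left |f ω| |g ω|, le_max_right |f ω| |g ω|]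
    _ = 2 ^ p * max |f ω| |g ω| ^ p := mul_pow _ _ _
    _ ≤ _ := by
        gcongr
        rcases max_choice |f ω| |g ω| with h | h <;> rw [h]
        · linarith [pow_nonneg (abs_nonneg (g ω)) p]
        · linarith [pow_nonneg (abs_nonneg (f ω)) p]

theorem const [IsFiniteMeasure μ] (c : ℝ) : HasMoments (fun _ : Ω => c) μ :=
  ⟨measurable_const, fun _ => integrable_const _⟩

theorem const_mul [IsFiniteMeasure μ] (c : ℝ) (hf : HasMoments f μ) :
    HasMoments (fun ω => c * f ω) μ := (const c).mul hf

theorem neg [IsFiniteMeasure μ] (hf : HasMoments f μ) : HasMoments (fun ω => -f ω) μ := by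
  simpa using hf.const_mul (-1)

theorem sub [IsFiniteMeasure μ] (hf : HasMoments f μ) (hg : HasMoments g μ) :
    HasMoments (fun ω => f ω - g ω) μ := by
  simpa [sub_eq_add_neg] using hf.add hg.neg

theorem abs (hf : HasMoments f μ) : HasMoments (fun ω => |f ω|) μ :=
  ⟨hf.1.abs, by simpa using hf.2⟩

theorem pow [IsFiniteMeasure μ] (hf : HasMoments f μ) (p : ℕ) : HasMoments (fun ω => f ω ^ p) μ := by
  induction p with
  | zero => simpa using const 1
  | succ p ih => simpa [pow_succ] using ih.mul hf

theorem sum [IsFiniteMeasure μ] {ι : Type*} (s : Finset ι) {f : ι → Ω → ℝ}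
    (hf : ∀ i ∈ s, HasMoments (f i) μ) : HasMoments (fun ω => ∑ i ∈ s, f i ω) μ := by
  classical
  induction s using Finset.induction_on with
  | empty => simpa using const 0
  | insert i s hi ih =>
    simp only [Finset.sum_insert hi]
    exact (hf i (by simp)).add (ih fun j hj => hf j (by simp [hj]))

theorem comp_map {Ω' : Type*} [MeasurableSpace Ω'] {ν : Measure Ω'} {φ : Ω' → Ω}
    (hφ : Measurable φ) (hμ : ν.map φ = μ) :
    HasMoments f μ → HasMoments (fun ω => f (φ ω)) ν := by
  rintro ⟨hf, h⟩
  refine ⟨hf.comp hφ, fun p => ?_⟩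
  have := h p
  rw [← hμ] at this
  exact this.comp_measurable hφ

end HasMoments

/-! ### Moments of linear forms in independent variables -/

/-- The term linear in `y` is kept exactly because it integrates to zero when `y` is centred and
independent of `x`. All later binomial terms contain `y²` and are bounded by the two extreme ones.
-/
theorem add_pow_even_le (x y : ℝ) (m : ℕ) :
    (x + y) ^ (2 * m + 2) ≤ x ^ (2 * m + 2) + (2 * m + 2 : ℕ) * (x ^ (2 * m + 1) * y)
      + 2 ^ (2 * m + 2) * (x ^ (2 * m) * y ^ 2 + y ^ (2 * m + 2)) := by
  have hbase : ∀ j, j ≤ 2 * m → y ^ (j + 2) * x ^ (2 * m - j) ≤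
      x ^ (2 * m) * y ^ 2 + y ^ (2 * m + 2) := by
    intro j hj
    have h1 : |y| ^ j * |x| ^ (2 * m - j) ≤ |x| ^ (2 * m) + |y| ^ (2 * m) := by
      rcases le_total |x| |y| with h | h
      · calc |y| ^ j * |x| ^ (2 * m - j) ≤ |y| ^ j * |y| ^ (2 * m - j) := by gcongr
          _ = |y| ^ (2 * m) := by rw [← pow_add]; congr 1; omega
          _ ≤ _ := by linarith [pow_nonneg (abs_nonneg x) (2 * m)]
      · calc |y| ^ j * |x| ^ (2 * m - j) ≤ |x| ^ j * |x| ^ (2 * m - j) := by gcongr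
          _ = |x| ^ (2 * m) := by rw [← pow_add]; congr 1; omega
          _ ≤ _ := by linarith [pow_nonneg (abs_nonneg y) (2 * m)]
    rw [Even.pow_abs ⟨m, two_mul m⟩, Even.pow_abs ⟨m, two_mul m⟩] at h1
    calc y ^ (j + 2) * x ^ (2 * m - j) ≤ |y ^ (j + 2) * x ^ (2 * m - j)| := le_abs_self _
      _ = (|y| ^ j * |x| ^ (2 * m - j)) * y ^ 2 := by
        rw [abs_mul, abs_pow, abs_pow, pow_add, sq_abs]; ring
      _ ≤ (x ^ (2 * m) + y ^ (2 * m)) * y ^ 2 := by gcongr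
      _ = _ := by ring
  have hnn : 0 ≤ x ^ (2 * m) * y ^ 2 + y ^ (2 * m + 2) := by
    have h1 : 0 ≤ x ^ (2 * m) := Even.pow_nonneg ⟨m, two_mul m⟩ x
    have h2 : 0 ≤ y ^ (2 * m + 2) := Even.pow_nonneg ⟨m + 1, by ring⟩ y
    positivity
  rw [add_comm x y, add_pow, Finset.sum_range_succ', Finset.sum_range_succ']
  have h3 : ∑ k ∈ Finset.range (2 * m + 1), y ^ (k + 1 + 1) * x ^ (2 * m + 2 - (k + 1 + 1)) *
      ((2 * m + 2).choose (k + 1 + 1) : ℝ)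
      ≤ 2 ^ (2 * m + 2) * (x ^ (2 * m) * y ^ 2 + y ^ (2 * m + 2)) := by
    calc _ ≤ ∑ k ∈ Finset.range (2 * m + 1), ((2 * m + 2).choose (k + 1 + 1) : ℝ) *
          (x ^ (2 * m) * y ^ 2 + y ^ (2 * m + 2)) := by
          refine Finset.sum_le_sum fun k hk => ?_
          rw [mul_comm]
          gcongr
          rw [show 2 * m + 2 - (k + 1 + 1) = 2 * m - k by omega]
          exact hbase k (by have := Finset.mem_range.1 hk; omega)
      _ = (∑ k ∈ Finset.range (2 * m + 1), ((2 * m + 2).choose (k + 1 + 1) : ℝ)) *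
          (x ^ (2 * m) * y ^ 2 + y ^ (2 * m + 2)) := by rw [Finset.sum_mul]
      _ ≤ _ := by
          gcongr
          have h4 := Nat.sum_range_choose (2 * m + 2)
          rw [Finset.sum_range_succ', Finset.sum_range_succ'] at h4
          have h5 : ((∑ k ∈ Finset.range (2 * m + 1), (2 * m + 2).choose (k + 1 + 1) : ℕ) : ℝ)
              ≤ ((2 ^ (2 * m + 2) : ℕ) : ℝ) := by
            exact_mod_cast (by omega)
          push_cast at h5
          exact h5
  have h6 : y ^ (0 + 1) * x ^ (2 * m + 2 - (0 + 1)) * ((2 * m + 2).choose (0 + 1) : ℝ)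
      = (2 * m + 2 : ℕ) * (x ^ (2 * m + 1) * y) := by
    rw [zero_add, Nat.choose_one_right, show 2 * m + 2 - 1 = 2 * m + 1 by omega]; ring
  rw [h6]
  simp only [pow_zero, one_mul, Nat.sub_zero, Nat.choose_zero_right, Nat.cast_one, mul_one]
  linarith

/-- The constants in the moment bounds for linear forms, where `M p` bounds the moments of order `p`
of the variables. -/
def momentConst (M : ℕ → ℝ) : ℕ → ℝ
  | 0 => 1
  | m + 1 => 2 * (2 ^ (2 * m + 2) * (momentConst M m * M 2 + M (2 * m + 2)))

theorem momentConst_nonneg {M : ℕ → ℝ} (hM : ∀ p, 0 ≤ M p) (m : ℕ) : 0 ≤ momentConst M m := by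
  induction m with
  | zero => simp [momentConst]
  | succ m ih =>
    have := hM 2
    have := hM (2 * m + 2)
    simp only [momentConst]; positivity

/-- A Marcinkiewicz–Zygmund type inequality whose constants do not depend on the number of
variables. The inner induction adds one variable at a time; the outer one, on `m`, supplies the
bound for the mixed term `S^{2m} y²`. -/
theorem linearForm_moment_le {Ω ι : Type*} [MeasurableSpace Ω] {μ : Measure Ω}
    [IsProbabilityMeasure μ] {z : ι → Ω → ℝ} (hind : iIndepFun z μ) {M : ℕ → ℝ}
    (hz : ∀ i, HasMoments (z i) μ) (hmean : ∀ i, ∫ ω, z i ω ∂μ = 0)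
    (hM : ∀ i p, ∫ ω, |z i ω| ^ p ∂μ ≤ M p) (hM0 : ∀ p, 0 ≤ M p) (h : ι → ℝ) (s : Finset ι)
    (m : ℕ) :
    ∫ ω, (∑ i ∈ s, h i * z i ω) ^ (2 * m) ∂μ ≤ momentConst M m * (∑ i ∈ s, h i ^ 2) ^ m := by
  classical
  induction m generalizing s with
  | zero => simp [momentConst]
  | succ m ihm =>
    induction s using Finset.induction_on with
    | empty => simp [mul_add]
    | insert i s hi ih =>
      have hS : HasMoments (fun ω => ∑ j ∈ s, h j * z j ω) μ :=
        HasMoments.sum s fun j _ => (hz j).const_mul _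
      have hindS : IndepFun (fun ω => ∑ j ∈ s, h j * z j ω) (z i) μ := by
        have h1 := (hind.indepFun_finset s {i} (by simpa using hi) fun j => (hz j).1)
        have hψ : Measurable fun u : ({i} : Finset ι) → ℝ => u ⟨i, by simp⟩ :=
          measurable_pi_apply _
        have h2 := h1.comp (φ := fun u : s → ℝ => ∑ j : s, h j * u j)
          (ψ := fun u : ({i} : Finset ι) → ℝ => u ⟨i, by simp⟩) (by fun_prop) hψ
        have e1 : (fun ω => ∑ j ∈ s, h j * z j ω)
            = (fun u : s → ℝ => ∑ j : s, h j * u j) ∘ fun ω (j : s) => z j ω := by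
          funext ω
          exact (Finset.sum_coe_sort s fun j => h j * z j ω).symm
        rw [e1]
        exact h2
      set S : Ω → ℝ := fun ω => ∑ j ∈ s, h j * z j ω with hSdef
      set T := ∑ j ∈ s, h j ^ 2 with hT
      have hT0 : 0 ≤ T := Finset.sum_nonneg fun j _ => sq_nonneg _
      have hy : HasMoments (fun ω => h i * z i ω) μ := (hz i).const_mul _
      have hfun : (fun ω => (∑ j ∈ insert i s, h j * z j ω) ^ (2 * (m + 1)))
          = fun ω => (S ω + h i * z i ω) ^ (2 * m + 2) := by
        funext ω
        rw [Finset.sum_insert hi, add_comm (h i * z i ω)]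
        ring
      have hcross : ∫ ω, S ω ^ (2 * m + 1) * (h i * z i ω) ∂μ = 0 := by
        have := IndepFun.integral_fun_comp_mul_comp hindS hS.1.aemeasurable (hz i).1.aemeasurable
          (f := fun x => x ^ (2 * m + 1)) (g := fun x => h i * x)
          (by fun_prop) (by fun_prop)
        rw [this, integral_const_mul, hmean i, mul_zero, mul_zero]
      have hsq : ∫ ω, S ω ^ (2 * m) * (h i * z i ω) ^ 2 ∂μ
          ≤ momentConst M m * T ^ m * (h i ^ 2 * M 2) := by
        have := IndepFun.integral_fun_comp_mul_comp hindS hS.1.aemeasurable (hz i).1.aemeasurable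
          (f := fun x => x ^ (2 * m)) (g := fun x => (h i * x) ^ 2)
          (by fun_prop) (by fun_prop)
        rw [this]
        simp only [mul_pow]
        rw [integral_const_mul]
        have h2 := hM i 2
        simp only [sq_abs] at h2
        have h3 := momentConst_nonneg hM0 m
        have h4 : 0 ≤ ∫ ω, z i ω ^ 2 ∂μ := integral_nonneg fun ω => by positivity
        have h5 := ihm s
        gcongr
      have hpow : ∫ ω, (h i * z i ω) ^ (2 * m + 2) ∂μ ≤ (h i ^ 2) ^ (m + 1) * M (2 * m + 2) := by
        simp only [mul_pow]
        rw [integral_const_mul]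
        have h2 := hM i (2 * m + 2)
        have he : ∀ ω, |z i ω| ^ (2 * m + 2) = z i ω ^ (2 * m + 2) := fun ω =>
          Even.pow_abs ⟨m + 1, by ring⟩ _
        simp only [he] at h2
        rw [← pow_mul, mul_add, mul_one]
        have : 0 ≤ h i ^ (2 * m + 2) := Even.pow_nonneg ⟨m + 1, by ring⟩ _
        gcongr
      have hint1 : Integrable (fun ω => S ω ^ (2 * m + 2)) μ := (hS.pow _).integrable
      have hint2 : Integrable (fun ω => S ω ^ (2 * m + 1) * (h i * z i ω)) μ :=
        ((hS.pow _).mul hy).integrable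
      have hint3 : Integrable (fun ω => S ω ^ (2 * m) * (h i * z i ω) ^ 2) μ :=
        ((hS.pow _).mul (hy.pow _)).integrable
      have hint4 : Integrable (fun ω => (h i * z i ω) ^ (2 * m + 2)) μ := (hy.pow _).integrable
      have hint : Integrable (fun ω => (S ω + h i * z i ω) ^ (2 * m + 2)) μ :=
        ((hS.add hy).pow _).integrable
      rw [hfun, Finset.sum_insert hi, ← hT]
      have hstep : ∫ ω, (S ω + h i * z i ω) ^ (2 * m + 2) ∂μ
          ≤ ∫ ω, S ω ^ (2 * m + 2) ∂μ + (2 * m + 2 : ℕ) * ∫ ω, S ω ^ (2 * m + 1) * (h i * z i ω) ∂μ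
            + 2 ^ (2 * m + 2) * (∫ ω, S ω ^ (2 * m) * (h i * z i ω) ^ 2 ∂μ
              + ∫ ω, (h i * z i ω) ^ (2 * m + 2) ∂μ) := by
        have hA : Integrable (fun ω => S ω ^ (2 * m + 2)
            + (2 * m + 2 : ℕ) * (S ω ^ (2 * m + 1) * (h i * z i ω))) μ :=
          hint1.add (hint2.const_mul _)
        have hB : Integrable (fun ω => (2 : ℝ) ^ (2 * m + 2) *
            (S ω ^ (2 * m) * (h i * z i ω) ^ 2 + (h i * z i ω) ^ (2 * m + 2))) μ :=
          (hint3.add hint4).const_mul _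
        rw [← integral_const_mul, ← integral_add hint3 hint4, ← integral_const_mul,
          ← integral_add hint1 (hint2.const_mul _), ← integral_add hA hB]
        exact integral_mono hint (hA.add hB) fun ω => add_pow_even_le _ _ _
      rw [hcross, mul_zero, add_zero] at hstep
      rw [show 2 * (m + 1) = 2 * m + 2 by ring] at ih
      have hC := momentConst_nonneg hM0 m
      have hM2 := hM0 2
      have hMN := hM0 (2 * m + 2)
      have hh : 0 ≤ h i ^ 2 := sq_nonneg _
      -- Both this sum and the next are at most `(h i ^ 2 + T) ^ (m + 1)`; the factor `2` in
      -- `momentConst` pays for using both.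
      have e1 : T ^ (m + 1) + T ^ m * h i ^ 2 ≤ (h i ^ 2 + T) ^ (m + 1) := by
        rw [pow_succ (h i ^ 2 + T), pow_succ, ← mul_add, add_comm T]
        gcongr
        linarith
      have e2 : T ^ (m + 1) + (h i ^ 2) ^ (m + 1) ≤ (h i ^ 2 + T) ^ (m + 1) := by
        rw [add_comm]
        exact pow_add_pow_le hh hT0 (by omega)
      simp only [momentConst] at ih ⊢
      set C := momentConst M m
      set A : ℝ := 2 ^ (2 * m + 2)
      have hA : 0 ≤ A := by positivity
      calc _ ≤ 2 * (A * (C * M 2 + M (2 * m + 2))) * T ^ (m + 1)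
            + A * (C * T ^ m * (h i ^ 2 * M 2) + (h i ^ 2) ^ (m + 1) * M (2 * m + 2)) :=
            hstep.trans (by gcongr)
        _ ≤ 2 * (A * (C * M 2 + M (2 * m + 2))) * T ^ (m + 1)
            + A * (C * M 2 + M (2 * m + 2)) * (T ^ m * h i ^ 2 + (h i ^ 2) ^ (m + 1)) := by
            have t1 : 0 ≤ A * (C * M 2) * (h i ^ 2) ^ (m + 1) := by positivity
            have t2 : 0 ≤ A * M (2 * m + 2) * (T ^ m * h i ^ 2) := by positivity
            linarith
        _ = A * (C * M 2 + M (2 * m + 2)) *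
              ((T ^ (m + 1) + T ^ m * h i ^ 2) + (T ^ (m + 1) + (h i ^ 2) ^ (m + 1))) := by ring
        _ ≤ A * (C * M 2 + M (2 * m + 2)) *
              ((h i ^ 2 + T) ^ (m + 1) + (h i ^ 2 + T) ^ (m + 1)) := by gcongr
        _ = _ := by ring

end

end SubspaceTracking

namespace SubspaceTracking

noncomputable section

set_option linter.unusedSectionVars false

/-! ### The law of a sample -/

/-- The covariance matrix of a sample. -/
def sampleCov {n d : ℕ} (U : Matrix (Fin n) (Fin d) ℝ) (lam : Fin d → ℝ) (σ : ℝ) :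
    Matrix (Fin n) (Fin n) ℝ :=
  U * diagonal (fun l => lam l ^ 2) * Uᵀ + σ ^ 2 • 1

/-- The properties of the law of a sample `U c + a` that matter; the constants `C` do not depend on
the ambient dimension. -/
structure IsSampleLaw {n d : ℕ} (U : Matrix (Fin n) (Fin d) ℝ) (lam : Fin d → ℝ) (σ : ℝ)
    (C : ℕ → ℝ) (ζ : Measure (Fin n → ℝ)) : Prop where
  prob : IsProbabilityMeasure ζ
  hasMoments : ∀ i, HasMoments (fun s : Fin n → ℝ => s i) ζ
  moment : ∀ (m : ℕ) (h : Fin n → ℝ), ∫ s, (h ⬝ᵥ s) ^ (2 * m) ∂ζ ≤ C m * (h ⬝ᵥ h) ^ m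
  cov : ∀ i j, ∫ s, s i * s j ∂ζ = sampleCov U lam σ i j
  energy : ∀ v : Fin n → Bool,
    ∫ s, ((∑ i, if v i then s i ^ 2 - σ ^ 2 else 0) / n) ^ 2 ∂ζ ≤ C 0 / n

theorem dotProduct_sq_le {m : ℕ} (x y : Fin m → ℝ) : (x ⬝ᵥ y) ^ 2 ≤ (x ⬝ᵥ x) * (y ⬝ᵥ y) := by
  have := Finset.sum_mul_sq_le_sq_mul_sq Finset.univ x y
  simpa [dotProduct, sq] using this

theorem dotProduct_self_nonneg' {m : ℕ} (x : Fin m → ℝ) : 0 ≤ x ⬝ᵥ x :=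
  Finset.sum_nonneg fun i _ => mul_self_nonneg (x i)

theorem transpose_mulVec_dotProduct_le {n d : ℕ} {U : Matrix (Fin n) (Fin d) ℝ} (hU : Uᵀ * U = 1)
    (h : Fin n → ℝ) : (Uᵀ *ᵥ h) ⬝ᵥ (Uᵀ *ᵥ h) ≤ h ⬝ᵥ h := by
  rw [← l2norm_sq, ← l2norm_sq]
  have h1 : l2norm (Uᵀ *ᵥ h) ≤ 1 * l2norm h := (l2norm_mulVec_le _ _).trans (by
    gcongr
    · exact l2norm_nonneg _
    · rw [norm_transpose]; exact norm_le_one_of_transpose_mul hU)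
  rw [one_mul] at h1
  gcongr
  exact l2norm_nonneg _

theorem add_pow_two_mul_le (x y : ℝ) (m : ℕ) :
    (x + y) ^ (2 * m) ≤ 4 ^ m * (x ^ (2 * m) + y ^ (2 * m)) := by
  rw [pow_mul, pow_mul, pow_mul]
  have h1 : (x + y) ^ 2 ≤ 4 * max (x ^ 2) (y ^ 2) := by
    nlinarith [le_max_left (x ^ 2) (y ^ 2), le_max_right (x ^ 2) (y ^ 2), sq_nonneg (x - y)]
  calc ((x + y) ^ 2) ^ m ≤ (4 * max (x ^ 2) (y ^ 2)) ^ m := by gcongr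
    _ = 4 ^ m * max (x ^ 2) (y ^ 2) ^ m := mul_pow _ _ _
    _ ≤ _ := by
      gcongr
      rcases max_choice (x ^ 2) (y ^ 2) with h | h <;> rw [h]
      · linarith [pow_nonneg (sq_nonneg y) m]
      · linarith [pow_nonneg (sq_nonneg x) m]

section

universe u

variable {d : ℕ} {lam : Fin d → ℝ} {σ : ℝ} {νc : Measure (Fin d → ℝ)} {νa : Measure ℝ}

/-- The moments of the squared length of the coefficient vector. -/
def coeffMoment (νc : Measure (Fin d → ℝ)) (m : ℕ) : ℝ := ∫ x, (x ⬝ᵥ x) ^ m ∂νc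

/-- The absolute moments of the noise. -/
def noiseMoment (νa : Measure ℝ) (p : ℕ) : ℝ := ∫ x, |x| ^ p ∂νa

/-- The absolute moments of the centered squares of the noise. -/
def noiseSqMoment (σ : ℝ) (νa : Measure ℝ) (p : ℕ) : ℝ := ∫ x, |x ^ 2 - σ ^ 2| ^ p ∂νa

theorem noiseMoment_nonneg (p : ℕ) : 0 ≤ noiseMoment νa p :=
  integral_nonneg fun x => by positivity

theorem noiseSqMoment_nonneg (p : ℕ) : 0 ≤ noiseSqMoment σ νa p :=
  integral_nonneg fun x => by positivity

theorem coeffMoment_nonneg (m : ℕ) : 0 ≤ coeffMoment νc m :=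
  integral_nonneg fun x => pow_nonneg (dotProduct_self_nonneg' x) m

/-- The constants in `IsSampleLaw`. -/
def sampleConst (σ : ℝ) (νc : Measure (Fin d → ℝ)) (νa : Measure ℝ) (m : ℕ) : ℝ :=
  4 ^ m * (coeffMoment νc m + momentConst (noiseMoment νa) m) +
    -- This summand does not depend on `m`: it is the constant of the energy bound, which
    -- `IsSampleLaw` reads off at `m = 0`.
    3 * (momentConst (noiseSqMoment σ νa) 1 + 4 * (coeffMoment νc 2 +
      d ^ 2 * momentConst (noiseMoment νa) 2) + coeffMoment νc 2)

theorem sampleConst_nonneg (m : ℕ) : 0 ≤ sampleConst σ νc νa m := by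
  have h1 := fun m => coeffMoment_nonneg (νc := νc) m
  have h2 := fun m => momentConst_nonneg (noiseMoment_nonneg (νa := νa)) m
  have h3 := momentConst_nonneg (noiseSqMoment_nonneg (σ := σ) (νa := νa)) 1
  have := h1 m; have := h1 2; have := h2 m; have := h2 2
  unfold sampleConst
  positivity

variable {n : ℕ} {Ω : Type u} [MeasurableSpace Ω] {μ : Measure Ω} [IsProbabilityMeasure μ]
  {c : Ω → Fin d → ℝ} {a : Ω → Fin n → ℝ}

theorem hasMoments_coeff (hνc : IsCoefficientLaw lam νc) (hc : Measurable c)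
    (hlaw : μ.map c = νc) (l : Fin d) : HasMoments (fun ω => c ω l) μ :=
  HasMoments.comp_map hc hlaw (f := fun x => x l) ⟨measurable_pi_apply l, fun p => hνc.moments p l⟩

theorem hasMoments_noise (hνa : IsNoiseLaw σ νa) (ha : Measurable a)
    (hlaw : ∀ i, μ.map (fun ω => a ω i) = νa) (i : Fin n) : HasMoments (fun ω => a ω i) μ :=
  HasMoments.comp_map (f := fun x => x) (ha.eval) (hlaw i)
    ⟨measurable_id, fun p => hνa.moments p⟩

theorem integral_coeff (hc : Measurable c) (hlaw : μ.map c = νc) {f : (Fin d → ℝ) → ℝ}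
    (hf : Measurable f) : ∫ ω, f (c ω) ∂μ = ∫ x, f x ∂νc := by
  rw [← hlaw, integral_map hc.aemeasurable hf.aestronglyMeasurable]

theorem integral_noise (ha : Measurable a) (hlaw : ∀ i, μ.map (fun ω => a ω i) = νa) (i : Fin n)
    {f : ℝ → ℝ} (hf : Measurable f) : ∫ ω, f (a ω i) ∂μ = ∫ x, f x ∂νa := by
  rw [← hlaw i, integral_map (ha.eval).aemeasurable hf.aestronglyMeasurable]

theorem noise_form_moment_le (hνa : IsNoiseLaw σ νa) (ha : Measurable a)
    (hlaw : ∀ i, μ.map (fun ω => a ω i) = νa) (hind : iIndepFun (fun i ω => a ω i) μ)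
    (h : Fin n → ℝ) (m : ℕ) :
    ∫ ω, (h ⬝ᵥ a ω) ^ (2 * m) ∂μ ≤ momentConst (noiseMoment νa) m * (h ⬝ᵥ h) ^ m := by
  have := linearForm_moment_le hind (M := noiseMoment νa)
    (fun i => hasMoments_noise hνa ha hlaw i)
    (fun i => (integral_noise ha hlaw i (f := fun x => x) measurable_id).trans hνa.mean)
    (fun i p => (integral_noise ha hlaw i (f := fun x => |x| ^ p) (by fun_prop)).le)
    noiseMoment_nonneg h Finset.univ m
  simpa only [dotProduct, sq] using this

theorem noise_sq_form_moment_le (hνa : IsNoiseLaw σ νa) (ha : Measurable a)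
    (hlaw : ∀ i, μ.map (fun ω => a ω i) = νa) (hind : iIndepFun (fun i ω => a ω i) μ)
    (h : Fin n → ℝ) :
    ∫ ω, (∑ i, h i * (a ω i ^ 2 - σ ^ 2)) ^ 2 ∂μ
      ≤ momentConst (noiseSqMoment σ νa) 1 * ∑ i, h i ^ 2 := by
  have hp := hνa.prob
  have := linearForm_moment_le (z := fun i ω => a ω i ^ 2 - σ ^ 2)
    (hind.comp (fun _ x => x ^ 2 - σ ^ 2) fun _ => by fun_prop) (M := noiseSqMoment σ νa)
    (fun i => ((hasMoments_noise hνa ha hlaw i).pow 2).sub (HasMoments.const _))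
    (fun i => by
      rw [integral_noise ha hlaw i (f := fun x => x ^ 2 - σ ^ 2) (by fun_prop),
        integral_sub (by simpa using hνa.moments 2) (integrable_const _), hνa.var]
      simp)
    (fun i p => (integral_noise ha hlaw i (f := fun x => |x ^ 2 - σ ^ 2| ^ p) (by fun_prop)).le)
    noiseSqMoment_nonneg h Finset.univ 1
  simpa using this

/-- The entries of `c` may be dependent, so Cauchy–Schwarz is used; the loss depends on the law of
`c` but not on the ambient dimension. -/
theorem coeff_form_moment_le (hνc : IsCoefficientLaw lam νc) (hc : Measurable c)
    (hlaw : μ.map c = νc) (h : Fin d → ℝ) (m : ℕ) :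
    ∫ ω, (h ⬝ᵥ c ω) ^ (2 * m) ∂μ ≤ coeffMoment νc m * (h ⬝ᵥ h) ^ m := by
  have hcm := hasMoments_coeff hνc hc hlaw
  have hcc : HasMoments (fun ω => c ω ⬝ᵥ c ω) μ :=
    HasMoments.sum _ fun l _ => (hcm l).mul (hcm l)
  have hhc : HasMoments (fun ω => h ⬝ᵥ c ω) μ :=
    HasMoments.sum _ fun l _ => (hcm l).const_mul _
  calc ∫ ω, (h ⬝ᵥ c ω) ^ (2 * m) ∂μ ≤ ∫ ω, (h ⬝ᵥ h) ^ m * (c ω ⬝ᵥ c ω) ^ m ∂μ := by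
        refine integral_mono (hhc.pow _).integrable ((hcc.pow m).const_mul _).integrable fun ω => ?_
        simp only [pow_mul]
        rw [← mul_pow]
        exact pow_le_pow_left₀ (sq_nonneg _) (dotProduct_sq_le _ _) m
    _ = coeffMoment νc m * (h ⬝ᵥ h) ^ m := by
        rw [integral_const_mul, integral_coeff hc hlaw (f := fun x => (x ⬝ᵥ x) ^ m)
          (by unfold dotProduct; fun_prop), mul_comm, coeffMoment]

theorem sample_moment_le (hνc : IsCoefficientLaw lam νc) (hνa : IsNoiseLaw σ νa)
    (hc : Measurable c) (hclaw : μ.map c = νc) (ha : Measurable a)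
    (halaw : ∀ i, μ.map (fun ω => a ω i) = νa) (hind : iIndepFun (fun i ω => a ω i) μ)
    {U : Matrix (Fin n) (Fin d) ℝ} (hU : Uᵀ * U = 1) (m : ℕ) (h : Fin n → ℝ) :
    ∫ ω, (h ⬝ᵥ (U *ᵥ c ω + a ω)) ^ (2 * m) ∂μ
      ≤ 4 ^ m * (coeffMoment νc m + momentConst (noiseMoment νa) m) * (h ⬝ᵥ h) ^ m := by
  have hcm := hasMoments_coeff hνc hc hclaw
  have ham := hasMoments_noise hνa ha halaw
  have h1 : HasMoments (fun ω => (Uᵀ *ᵥ h) ⬝ᵥ c ω) μ :=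
    HasMoments.sum _ fun l _ => (hcm l).const_mul _
  have h2 : HasMoments (fun ω => h ⬝ᵥ a ω) μ :=
    HasMoments.sum _ fun l _ => (ham l).const_mul _
  have hs : ∀ ω, h ⬝ᵥ (U *ᵥ c ω + a ω) = (Uᵀ *ᵥ h) ⬝ᵥ c ω + h ⬝ᵥ a ω := fun ω => by
    rw [dotProduct_add, dotProduct_mulVec, mulVec_transpose]
  simp only [hs]
  calc _ ≤ ∫ ω, 4 ^ m * (((Uᵀ *ᵥ h) ⬝ᵥ c ω) ^ (2 * m) + (h ⬝ᵥ a ω) ^ (2 * m)) ∂μ :=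
        integral_mono ((h1.add h2).pow _).integrable
          (((h1.pow _).add (h2.pow _)).const_mul _).integrable fun ω => add_pow_two_mul_le _ _ _
    _ = 4 ^ m * (∫ ω, ((Uᵀ *ᵥ h) ⬝ᵥ c ω) ^ (2 * m) ∂μ + ∫ ω, (h ⬝ᵥ a ω) ^ (2 * m) ∂μ) := by
        rw [integral_const_mul, integral_add (h1.pow _).integrable (h2.pow _).integrable]
    _ ≤ 4 ^ m * (coeffMoment νc m * (h ⬝ᵥ h) ^ m
          + momentConst (noiseMoment νa) m * (h ⬝ᵥ h) ^ m) := by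
        gcongr
        · refine (coeff_form_moment_le hνc hc hclaw _ m).trans ?_
          have := coeffMoment_nonneg (νc := νc) m
          have := dotProduct_self_nonneg' (Uᵀ *ᵥ h)
          gcongr
          exact transpose_mulVec_dotProduct_le hU h
        · exact noise_form_moment_le hνa ha halaw hind h m
    _ = _ := by ring

theorem sample_cov (hνc : IsCoefficientLaw lam νc) (hνa : IsNoiseLaw σ νa)
    (hc : Measurable c) (hclaw : μ.map c = νc) (ha : Measurable a)
    (halaw : ∀ i, μ.map (fun ω => a ω i) = νa) (hind : iIndepFun (fun i ω => a ω i) μ)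
    (hca : IndepFun c a μ) (U : Matrix (Fin n) (Fin d) ℝ) (i j : Fin n) :
    ∫ ω, (U *ᵥ c ω + a ω) i * (U *ᵥ c ω + a ω) j ∂μ = sampleCov U lam σ i j := by
  have hcm := hasMoments_coeff hνc hc hclaw
  have ham := hasMoments_noise hνa ha halaw
  have hU : ∀ i, HasMoments (fun ω => (U *ᵥ c ω) i) μ := fun i =>
    show HasMoments (fun ω => ∑ l, U i l * c ω l) μ from
      HasMoments.sum _ fun l _ => (hcm l).const_mul _
  have hmean : ∀ i, ∫ ω, a ω i ∂μ = 0 := fun i =>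
    (integral_noise ha halaw i (f := fun x => x) measurable_id).trans hνa.mean
  have hcross : ∀ i j, ∫ ω, (U *ᵥ c ω) i * a ω j ∂μ = 0 := fun i j => by
    have := IndepFun.integral_fun_comp_mul_comp hca hc.aemeasurable ha.aemeasurable
      (f := fun x => (U *ᵥ x) i) (g := fun x => x j)
      (Measurable.aestronglyMeasurable (by unfold mulVec dotProduct; fun_prop))
      (measurable_pi_apply j).aestronglyMeasurable
    rw [this, hmean, mul_zero]
  have hcc : ∫ ω, (U *ᵥ c ω) i * (U *ᵥ c ω) j ∂μ
      = (U * diagonal (fun l => lam l ^ 2) * Uᵀ) i j := by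
    have hexp : ∀ ω, (U *ᵥ c ω) i * (U *ᵥ c ω) j
        = ∑ l, ∑ m, U i l * U j m * (c ω l * c ω m) := fun ω => by
      simp only [mulVec, dotProduct, Finset.sum_mul_sum]
      exact Finset.sum_congr rfl fun l _ => Finset.sum_congr rfl fun m _ => by ring
    simp only [hexp]
    rw [integral_finsetSum _ fun l _ => (HasMoments.sum _ fun m _ =>
      ((hcm l).mul (hcm m)).const_mul _).integrable]
    rw [Matrix.mul_apply]
    refine Finset.sum_congr rfl fun l _ => ?_
    rw [integral_finsetSum _ fun m _ => (((hcm l).mul (hcm m)).const_mul _).integrable]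
    simp only [integral_const_mul]
    have : ∀ m, ∫ ω, c ω l * c ω m ∂μ = if l = m then lam l ^ 2 else 0 := fun m =>
      (integral_coeff hc hclaw (f := fun x => x l * x m) (by fun_prop)).trans (hνc.cov l m)
    simp only [this]
    simp [Matrix.mul_diagonal]
    ring
  have haa : ∫ ω, a ω i * a ω j ∂μ = (σ ^ 2 • (1 : Matrix (Fin n) (Fin n) ℝ)) i j := by
    rcases eq_or_ne i j with rfl | hij
    · have := (integral_noise ha halaw i (f := fun x => x * x) (by fun_prop)).trans
        (by simpa [sq] using hνa.var)
      rw [this]; simp [sq]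
    · have := IndepFun.integral_fun_mul_eq_mul_integral (hind.indepFun hij)
        (ham i).1.aestronglyMeasurable (ham j).1.aestronglyMeasurable
      rw [this, hmean, zero_mul]; simp [hij]
  have hexp : ∀ ω, (U *ᵥ c ω + a ω) i * (U *ᵥ c ω + a ω) j
      = (U *ᵥ c ω) i * (U *ᵥ c ω) j + (U *ᵥ c ω) i * a ω j
        + ((U *ᵥ c ω) j * a ω i + a ω i * a ω j) := fun ω => by
    simp only [Pi.add_apply]; ring
  simp only [hexp]
  rw [integral_add (((hU i).mul (hU j)).add ((hU i).mul (ham j))).integrable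
      (((hU j).mul (ham i)).add ((ham i).mul (ham j))).integrable,
    integral_add ((hU i).mul (hU j)).integrable ((hU i).mul (ham j)).integrable,
    integral_add ((hU j).mul (ham i)).integrable ((ham i).mul (ham j)).integrable,
    hcross, hcross, hcc, haa, sampleCov, Matrix.add_apply]
  ring

/-- A quantitative law of large numbers. In `s_i² - σ² = (a_i² - σ²) + 2 (Uc)_i a_i + (Uc)_i²` the
first part sums to a centred variable of variance `O(n)`. The other two sums have bounded second
moments: `‖Uc‖ = ‖c‖`, and the cross term pairs `c` with `d` noise forms of bounded norm. The
division by `n` leaves `O(1/n)`. -/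
theorem sample_energy (hνc : IsCoefficientLaw lam νc) (hνa : IsNoiseLaw σ νa)
    (hc : Measurable c) (hclaw : μ.map c = νc) (ha : Measurable a)
    (halaw : ∀ i, μ.map (fun ω => a ω i) = νa) (hind : iIndepFun (fun i ω => a ω i) μ)
    (hn : 0 < n) {U : Matrix (Fin n) (Fin d) ℝ} (hU : Uᵀ * U = 1) (v : Fin n → Bool) :
    ∫ ω, ((∑ i, if v i then (U *ᵥ c ω + a ω) i ^ 2 - σ ^ 2 else 0) / n) ^ 2 ∂μ
      ≤ 3 * (momentConst (noiseSqMoment σ νa) 1 + 4 * (coeffMoment νc 2 +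
      d ^ 2 * momentConst (noiseMoment νa) 2) + coeffMoment νc 2) / n := by
  have hcm := hasMoments_coeff hνc hc hclaw
  have ham := hasMoments_noise hνa ha halaw
  set V : Fin n → ℝ := fun i => if v i then 1 else 0 with hV
  have hV2 : ∀ i, V i ^ 2 = V i := fun i => by simp only [hV]; split_ifs <;> simp
  have hV0 : ∀ i, 0 ≤ V i := fun i => by simp only [hV]; split_ifs <;> simp
  have hV1 : ∀ i, V i ≤ 1 := fun i => by simp only [hV]; split_ifs <;> simp
  set F : Fin d → Fin n → ℝ := fun l i => V i * U i l with hF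
  set x1 : Ω → ℝ := fun ω => ∑ i, V i * (a ω i ^ 2 - σ ^ 2) with hx1
  set x4 : Ω → ℝ := fun ω => (c ω ⬝ᵥ c ω) ^ 2 with hx4
  set x5 : Ω → ℝ := fun ω => ∑ l, (F l ⬝ᵥ a ω) ^ (2 * 2) with hx5
  have hm1 : HasMoments x1 μ := HasMoments.sum _ fun i _ =>
    (((ham i).pow 2).sub (HasMoments.const _)).const_mul _
  have hm4 : HasMoments x4 μ :=
    (HasMoments.sum _ fun l _ => (hcm l).mul (hcm l)).pow 2
  have hm5' : ∀ l, HasMoments (fun ω => (F l ⬝ᵥ a ω) ^ (2 * 2)) μ := fun l =>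
    (HasMoments.sum _ fun i _ => (ham i).const_mul _).pow _
  have hm5 : HasMoments x5 μ := HasMoments.sum _ fun l _ => hm5' l
  have hpt : ∀ ω, ((∑ i, if v i then (U *ᵥ c ω + a ω) i ^ 2 - σ ^ 2 else 0) / n) ^ 2
      ≤ 3 / n ^ 2 * (x1 ω ^ 2 + 4 * (x4 ω + d * x5 ω) + x4 ω) := by
    intro ω
    set y2 := ∑ i, V i * ((U *ᵥ c ω) i * a ω i) with hy2
    set y3 := ∑ i, V i * (U *ᵥ c ω) i ^ 2 with hy3
    have hsum : (∑ i, if v i then (U *ᵥ c ω + a ω) i ^ 2 - σ ^ 2 else 0)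
        = x1 ω + 2 * y2 + y3 := by
      rw [hx1, hy2, hy3, Finset.mul_sum, ← Finset.sum_add_distrib, ← Finset.sum_add_distrib]
      refine Finset.sum_congr rfl fun i _ => ?_
      simp only [hV, Pi.add_apply]
      split_ifs <;> ring
    have hy3le : y3 ≤ c ω ⬝ᵥ c ω := by
      rw [← mulVec_dotProduct_mulVec hU]
      refine Finset.sum_le_sum fun i _ => ?_
      nlinarith [hV1 i, sq_nonneg ((U *ᵥ c ω) i)]
    have hy30 : 0 ≤ y3 := Finset.sum_nonneg fun i _ => mul_nonneg (hV0 i) (sq_nonneg _)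
    have hy2eq : y2 = (fun l => F l ⬝ᵥ a ω) ⬝ᵥ c ω := by
      simp only [hy2, hF, mulVec, dotProduct, Finset.sum_mul, Finset.mul_sum]
      rw [Finset.sum_comm]
      exact Finset.sum_congr rfl fun l _ => Finset.sum_congr rfl fun i _ => by ring
    have hff : ((fun l => F l ⬝ᵥ a ω) ⬝ᵥ (fun l => F l ⬝ᵥ a ω)) ^ 2 ≤ d * x5 ω := by
      have := sq_sum_le_card_mul_sum_sq (s := Finset.univ) (f := fun l => (F l ⬝ᵥ a ω) ^ 2)
      simp only [Finset.card_univ, Fintype.card_fin, ← pow_mul] at this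
      simpa [dotProduct, sq, hx5] using this
    have hy2le : y2 ^ 2 ≤ x4 ω + d * x5 ω := by
      rw [hy2eq]
      refine (dotProduct_sq_le _ _).trans ?_
      simp only [hx4]
      nlinarith [hff, sq_nonneg (((fun l => F l ⬝ᵥ a ω) ⬝ᵥ (fun l => F l ⬝ᵥ a ω))
        - c ω ⬝ᵥ c ω), sq_nonneg (((fun l => F l ⬝ᵥ a ω) ⬝ᵥ (fun l => F l ⬝ᵥ a ω))
        + c ω ⬝ᵥ c ω)]
    have hy3sq : y3 ^ 2 ≤ x4 ω := pow_le_pow_left₀ hy30 hy3le 2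
    rw [hsum, div_pow, div_mul_eq_mul_div]
    gcongr
    nlinarith [sq_nonneg (x1 ω - 2 * y2), sq_nonneg (x1 ω - y3), sq_nonneg (2 * y2 - y3)]
  have e1 : ∫ ω, x1 ω ^ 2 ∂μ ≤ momentConst (noiseSqMoment σ νa) 1 * n := by
    refine (noise_sq_form_moment_le hνa ha halaw hind V).trans ?_
    gcongr
    · exact momentConst_nonneg noiseSqMoment_nonneg 1
    · calc ∑ i, V i ^ 2 ≤ ∑ i : Fin n, (1 : ℝ) :=
          Finset.sum_le_sum fun i _ => by rw [hV2]; exact hV1 i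
        _ = n := by simp
  have e4 : ∫ ω, x4 ω ∂μ = coeffMoment νc 2 :=
    integral_coeff hc hclaw (f := fun x => (x ⬝ᵥ x) ^ 2) (by unfold dotProduct; fun_prop)
  have e5 : ∫ ω, x5 ω ∂μ ≤ d * momentConst (noiseMoment νa) 2 := by
    simp only [hx5]
    rw [integral_finsetSum _ fun l _ => (hm5' l).integrable]
    calc _ ≤ ∑ l : Fin d, momentConst (noiseMoment νa) 2 := by
          refine Finset.sum_le_sum fun l _ => ?_
          refine (noise_form_moment_le hνa ha halaw hind (F l) 2).trans ?_
          have h0 := momentConst_nonneg (noiseMoment_nonneg (νa := νa)) 2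
          have h1 : F l ⬝ᵥ F l ≤ 1 := by
            have h2 : (Uᵀ * U) l l = 1 := by rw [hU]; simp
            rw [← h2, Matrix.mul_apply]
            refine Finset.sum_le_sum fun i _ => ?_
            simp only [hF, transpose_apply]
            nlinarith [hV2 i, hV1 i, mul_self_nonneg (U i l), hV0 i]
          have h3 := pow_le_one₀ (n := 2) (dotProduct_self_nonneg' (F l)) h1
          nlinarith
      _ = _ := by simp
  have hrhs : HasMoments (fun ω => 3 / (n : ℝ) ^ 2 * (x1 ω ^ 2 + 4 * (x4 ω + d * x5 ω) + x4 ω)) μ :=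
    ((((hm1.pow 2).add ((hm4.add (hm5.const_mul _)).const_mul _)).add hm4)).const_mul _
  have hn1 : (1 : ℝ) ≤ n := by exact_mod_cast hn
  have hlhs : HasMoments
      (fun ω => ((∑ i, if v i then (U *ᵥ c ω + a ω) i ^ 2 - σ ^ 2 else 0) / n) ^ 2) μ := by
    refine hrhs.of_le ?_ fun ω => ?_
    · have h1 : Measurable fun ω => ∑ i, if v i then (U *ᵥ c ω + a ω) i ^ 2 - σ ^ 2 else 0 := by
        refine Finset.measurable_sum _ fun i _ => ?_
        split_ifs
        · simp only [Pi.add_apply, mulVec, dotProduct]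
          fun_prop
        · exact measurable_const
      exact (h1.div_const _).pow_const 2
    · rw [abs_of_nonneg (sq_nonneg _)]; exact hpt ω
  refine (integral_mono hlhs.integrable hrhs.integrable hpt).trans ?_
  rw [integral_const_mul, integral_add ((hm1.pow 2).add
      ((hm4.add (hm5.const_mul _)).const_mul _)).integrable hm4.integrable,
    integral_add (hm1.pow 2).integrable ((hm4.add (hm5.const_mul _)).const_mul _).integrable,
    integral_const_mul, integral_add hm4.integrable (hm5.const_mul _).integrable,
    integral_const_mul, e4]
  have hC1 := momentConst_nonneg (noiseSqMoment_nonneg (σ := σ) (νa := νa)) 1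
  have hC2 := momentConst_nonneg (noiseMoment_nonneg (νa := νa)) 2
  have hC3 := coeffMoment_nonneg (νc := νc) 2
  calc _ ≤ 3 / (n : ℝ) ^ 2 * (momentConst (noiseSqMoment σ νa) 1 * n + 4 * (coeffMoment νc 2
        + d * (d * momentConst (noiseMoment νa) 2)) + coeffMoment νc 2) := by gcongr
    _ ≤ 3 / (n : ℝ) ^ 2 * (momentConst (noiseSqMoment σ νa) 1 * n + 4 * (coeffMoment νc 2
        + d * (d * momentConst (noiseMoment νa) 2)) * n + coeffMoment νc 2 * n) := by
        have t1 : 0 ≤ 4 * (coeffMoment νc 2 + d * (d * momentConst (noiseMoment νa) 2)) := by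
          positivity
        have t2 := le_mul_of_one_le_right t1 hn1
        have t3 := le_mul_of_one_le_right hC3 hn1
        exact mul_le_mul_of_nonneg_left (by linarith) (by positivity)
    _ = _ := by field_simp

theorem isSampleLaw_map (hνc : IsCoefficientLaw lam νc) (hνa : IsNoiseLaw σ νa)
    (hc : Measurable c) (hclaw : μ.map c = νc) (ha : Measurable a)
    (halaw : ∀ i, μ.map (fun ω => a ω i) = νa) (hind : iIndepFun (fun i ω => a ω i) μ)
    (hca : IndepFun c a μ) (hn : 0 < n) {U : Matrix (Fin n) (Fin d) ℝ} (hU : Uᵀ * U = 1) :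
    IsSampleLaw U lam σ (sampleConst σ νc νa) (μ.map fun ω => U *ᵥ c ω + a ω) := by
  have hs : Measurable fun ω => U *ᵥ c ω + a ω := by
    refine measurable_pi_lambda _ fun i => ?_
    simp only [Pi.add_apply, mulVec, dotProduct]
    fun_prop
  have hm1 := fun m => coeffMoment_nonneg (νc := νc) m
  have hm2 := fun m => momentConst_nonneg (noiseMoment_nonneg (νa := νa)) m
  have hm3 := momentConst_nonneg (noiseSqMoment_nonneg (σ := σ) (νa := νa)) 1
  have hmono : 0 ≤ 3 * (momentConst (noiseSqMoment σ νa) 1 + 4 * (coeffMoment νc 2 +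
      d ^ 2 * momentConst (noiseMoment νa) 2) + coeffMoment νc 2) := by
    have := hm1 2; have := hm2 2; positivity
  refine ⟨Measure.isProbabilityMeasure_map hs.aemeasurable, fun i => ?_, fun m h => ?_,
    fun i j => ?_, fun v => ?_⟩
  · refine ⟨measurable_pi_apply i, fun p => ?_⟩
    rw [integrable_map_measure (Measurable.aestronglyMeasurable (by fun_prop)) hs.aemeasurable]
    have hcm := hasMoments_coeff hνc hc hclaw
    have ham := hasMoments_noise hνa ha halaw
    have : HasMoments (fun ω => (U *ᵥ c ω) i + a ω i) μ :=
      (show HasMoments (fun ω => ∑ l, U i l * c ω l) μ from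
        HasMoments.sum _ fun l _ => (hcm l).const_mul _).add (ham i)
    exact this.2 p
  · rw [integral_map hs.aemeasurable
      (Measurable.aestronglyMeasurable (by unfold dotProduct; fun_prop))]
    refine (sample_moment_le hνc hνa hc hclaw ha halaw hind hU m h).trans ?_
    have := pow_nonneg (dotProduct_self_nonneg' h) m
    unfold sampleConst
    gcongr
    linarith
  · rw [integral_map hs.aemeasurable (Measurable.aestronglyMeasurable (by fun_prop))]
    exact sample_cov hνc hνa hc hclaw ha halaw hind hca U i j
  · have hmeas : Measurable fun s : Fin n → ℝ =>
        ((∑ i, if v i then s i ^ 2 - σ ^ 2 else 0) / n) ^ 2 := by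
      have h1 : Measurable fun s : Fin n → ℝ => ∑ i, if v i then s i ^ 2 - σ ^ 2 else 0 := by
        refine Finset.measurable_sum _ fun i _ => ?_
        split_ifs
        · fun_prop
        · exact measurable_const
      exact (h1.div_const _).pow_const 2
    rw [integral_map hs.aemeasurable hmeas.aestronglyMeasurable]
    refine (sample_energy hνc hνa hc hclaw ha halaw hind hn hU v).trans ?_
    have := hm1 0
    have := hm2 0
    unfold sampleConst
    gcongr
    rw [pow_zero, one_mul]
    linarith

end

end

end SubspaceTracking

namespace SubspaceTracking

noncomputable section

open scoped Matrix.Norms.L2Operator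

/-! ### Pointwise bounds on the increments -/

theorem abs_apply_le_l2norm {m : ℕ} (x : Fin m → ℝ) (i : Fin m) : |x i| ≤ l2norm x := by
  rw [← Real.sqrt_sq (l2norm_nonneg x), l2norm_sq, ← Real.sqrt_sq_eq_abs, dotProduct]
  refine Real.sqrt_le_sqrt ?_
  rw [sq]
  exact Finset.single_le_sum (f := fun i => x i * x i) (fun i _ => mul_self_nonneg _)
    (Finset.mem_univ i)

theorem abs_apply_le_norm {m n : ℕ} (A : Matrix (Fin m) (Fin n) ℝ) (i : Fin m) (j : Fin n) :
    |A i j| ≤ ‖A‖ := by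
  have h1 := abs_apply_le_l2norm (A *ᵥ Pi.single j 1) i
  have h2 : l2norm (Pi.single j 1 : Fin n → ℝ) = 1 := by
    rw [← sq_eq_sq₀ (l2norm_nonneg _) zero_le_one, l2norm_sq]; simp
  have h3 := l2norm_mulVec_le A (Pi.single j 1)
  rw [h2, mul_one] at h3
  simpa using h1.trans h3

theorem abs_mulVec_apply_le {m n : ℕ} (A : Matrix (Fin m) (Fin n) ℝ) (x : Fin n → ℝ)
    (i : Fin m) : |(A *ᵥ x) i| ≤ (∑ j, |A i j|) * l2norm x := by
  rw [mulVec, dotProduct, Finset.sum_mul]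
  refine (Finset.abs_sum_le_sum_abs _ _).trans (Finset.sum_le_sum fun j _ => ?_)
  rw [abs_mul]
  gcongr
  exact abs_apply_le_l2norm x j

/-- A quantity that controls the size of an update. -/
def load {n d : ℕ} (U X : Matrix (Fin n) (Fin d) ℝ) (v : Fin n → Bool) (s : Fin n → ℝ) : ℝ :=
  1 + (fitMatrix X v *ᵥ s) ⬝ᵥ (fitMatrix X v *ᵥ s)
    + (Uᵀ *ᵥ (residualMatrix X v *ᵥ s)) ⬝ᵥ (Uᵀ *ᵥ (residualMatrix X v *ᵥ s)) + s ⬝ᵥ s / n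

section

variable {n d : ℕ} {U X : Matrix (Fin n) (Fin d) ℝ} {v : Fin n → Bool} {s : Fin n → ℝ} {ε τ : ℝ}

theorem one_le_load : 1 ≤ load U X v s := by
  have h1 := dotProduct_self_nonneg' (fitMatrix X v *ᵥ s)
  have h2 := dotProduct_self_nonneg' (Uᵀ *ᵥ (residualMatrix X v *ᵥ s))
  have h3 := div_nonneg (dotProduct_self_nonneg' s) (Nat.cast_nonneg (α := ℝ) n)
  unfold load
  linarith

theorem le_of_sq_le {x y : ℝ} (hy : 1 ≤ y) (h : x ^ 2 ≤ y) : x ≤ y := by nlinarith [sq_nonneg (x - 1)]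

theorem l2norm_fit_sq_le_load : l2norm (fitMatrix X v *ᵥ s) ^ 2 ≤ load U X v s := by
  have h2 := dotProduct_self_nonneg' (Uᵀ *ᵥ (residualMatrix X v *ᵥ s))
  have h3 := div_nonneg (dotProduct_self_nonneg' s) (Nat.cast_nonneg (α := ℝ) n)
  rw [l2norm_sq, load]
  linarith

theorem l2norm_residual_sq_le_load :
    l2norm (Uᵀ *ᵥ (residualMatrix X v *ᵥ s)) ^ 2 ≤ load U X v s := by
  have h1 := dotProduct_self_nonneg' (fitMatrix X v *ᵥ s)
  have h3 := div_nonneg (dotProduct_self_nonneg' s) (Nat.cast_nonneg (α := ℝ) n)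
  rw [l2norm_sq, load]
  linarith

theorem l2norm_sq_div_le_load : l2norm s ^ 2 / n ≤ load U X v s := by
  have h1 := dotProduct_self_nonneg' (fitMatrix X v *ᵥ s)
  have h2 := dotProduct_self_nonneg' (Uᵀ *ᵥ (residualMatrix X v *ᵥ s))
  rw [l2norm_sq, load]
  linarith

theorem abs_fit_le_load (j : Fin d) : |(fitMatrix X v *ᵥ s) j| ≤ load U X v s :=
  (abs_apply_le_l2norm _ j).trans (le_of_sq_le one_le_load l2norm_fit_sq_le_load)

theorem abs_transpose_mulVec_residual_le_load (j : Fin d) :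
    |(Uᵀ *ᵥ (residualMatrix X v *ᵥ s)) j| ≤ load U X v s :=
  (abs_apply_le_l2norm _ j).trans (le_of_sq_le one_le_load l2norm_residual_sq_le_load)

theorem residual_energy_le_load (hX : Xᵀ * X = 1) (hε : 0 < ε)
    (hv : ε < lambdaMin (gram X v)) :
    l2norm (residualMatrix X v *ᵥ s) ^ 2 / n ≤ (1 + 1 / ε) ^ 2 * load U X v s := by
  have h1 : l2norm (residualMatrix X v *ᵥ s) ≤ (1 + 1 / ε) * l2norm s :=
    (l2norm_mulVec_le _ _).trans (mul_le_mul_of_nonneg_right (norm_residualMatrix_le hX hε hv)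
      (l2norm_nonneg _))
  calc _ ≤ ((1 + 1 / ε) * l2norm s) ^ 2 / n := by
        gcongr
        exact l2norm_nonneg _
    _ = (1 + 1 / ε) ^ 2 * (l2norm s ^ 2 / n) := by ring
    _ ≤ _ := by gcongr; exact l2norm_sq_div_le_load

end

/-- The coefficients of an update as functions of the sample. -/
theorem exists_coeff_bounds (alg : Algorithm) {τ ε : ℝ} (hτ : 0 < τ) (hε : 0 < ε) :
    ∃ K : ℝ, 0 < K ∧ ∀ {n d : ℕ} {U X : Matrix (Fin n) (Fin d) ℝ} {v : Fin n → Bool}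
      (s : Fin n → ℝ) (A B ρ : ℝ), 0 < n → Xᵀ * X = 1 → ε < lambdaMin (gram X v) →
      A = fitCoeff alg (τ / n) (l2norm (fitMatrix X v *ᵥ s)) (l2norm (residualMatrix X v *ᵥ s)) →
      B = residualCoeff alg (τ / n) (l2norm (fitMatrix X v *ᵥ s))
        (l2norm (residualMatrix X v *ᵥ s)) →
      ρ = l2norm (residualMatrix X v *ᵥ s) ^ 2 / n →
      |B - τ / n| ≤ K / n ^ 2 * load U X v s ^ 3 ∧
      |A + τ ^ 2 * ρ / (2 * n)| ≤ K / n ^ 2 * load U X v s ^ 3 ∧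
      |B| ≤ K / n * load U X v s ^ 3 ∧ |A| ≤ K / n * load U X v s ^ 3 := by
  obtain ⟨K, hK, hbd⟩ := coeff_bounds alg hτ
  -- With `load` as unit, `1`, `‖w‖²` and `ρ` are at most `1`, `1` and `(1 + 1/ε)²`; their sum is
  -- `c`. The extra terms in the witness below account for the leading parts `τ/n` and `τ²ρ/(2n)` of
  -- the coefficients.
  set c := 2 + (1 + 1 / ε) ^ 2 with hc
  have hc0 : 0 < c := by positivity
  refine ⟨K * c ^ 3 + τ + τ ^ 2 * (1 + 1 / ε) ^ 2, by positivity, ?_⟩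
  intro n d U X v s A B ρ hn hX hv hA hB hρ
  have hn1 : (1 : ℝ) ≤ n := by exact_mod_cast hn
  set Y := load U X v s with hY
  have hY1 : 1 ≤ Y := one_le_load
  have hY3 : Y ≤ Y ^ 3 := le_self_pow₀ hY1 (by norm_num)
  have hY31 : 1 ≤ Y ^ 3 := one_le_pow₀ hY1
  have hx : l2norm (fitMatrix X v *ᵥ s) ^ 2 ≤ Y := l2norm_fit_sq_le_load
  have hρ' : ρ ≤ (1 + 1 / ε) ^ 2 * Y := by rw [hρ]; exact residual_energy_le_load hX hε hv
  have hρ0 : 0 ≤ ρ := by rw [hρ]; positivity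
  obtain ⟨h1, h2⟩ := hbd n hn1 (l2norm (fitMatrix X v *ᵥ s)) (l2norm (residualMatrix X v *ᵥ s))
  rw [← hB, ← hρ] at h1
  rw [← hA, ← hρ] at h2
  have hcube : (1 + l2norm (fitMatrix X v *ᵥ s) ^ 2 + ρ) ^ 3 ≤ c ^ 3 * Y ^ 3 := by
    rw [← mul_pow]
    gcongr
    rw [hc]; nlinarith
  have hbound : K / n ^ 2 * (1 + l2norm (fitMatrix X v *ᵥ s) ^ 2 + ρ) ^ 3
      ≤ K * c ^ 3 / n ^ 2 * Y ^ 3 := by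
    calc _ ≤ K / n ^ 2 * (c ^ 3 * Y ^ 3) := by gcongr
      _ = _ := by ring
  have hext : K * c ^ 3 / n ^ 2 * Y ^ 3
      ≤ (K * c ^ 3 + τ + τ ^ 2 * (1 + 1 / ε) ^ 2) / n ^ 2 * Y ^ 3 := by
    gcongr
    have : 0 ≤ τ ^ 2 * (1 + 1 / ε) ^ 2 := by positivity
    linarith
  have hsq : K * c ^ 3 / n ^ 2 * Y ^ 3 ≤ K * c ^ 3 / n * Y ^ 3 := by
    gcongr
    nlinarith
  refine ⟨h1.trans (hbound.trans hext), h2.trans (hbound.trans hext), ?_, ?_⟩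
  · have h3 : |B| ≤ |B - τ / n| + τ / n := by
      have := abs_add_le (B - τ / n) (τ / n)
      rwa [sub_add_cancel, abs_of_pos (a := τ / (n : ℝ)) (by positivity)] at this
    have h4 : τ / n ≤ τ / n * Y ^ 3 := le_mul_of_one_le_right (by positivity) hY31
    have h5 : 0 ≤ τ ^ 2 * (1 + 1 / ε) ^ 2 / n * Y ^ 3 := by positivity
    calc |B| ≤ K * c ^ 3 / n * Y ^ 3 + τ / n * Y ^ 3 + τ ^ 2 * (1 + 1 / ε) ^ 2 / n * Y ^ 3 := by
          linarith
      _ = _ := by ring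
  · have h3 : |A| ≤ |A + τ ^ 2 * ρ / (2 * n)| + τ ^ 2 * ρ / (2 * n) := by
      have := abs_sub (A + τ ^ 2 * ρ / (2 * n)) (τ ^ 2 * ρ / (2 * n))
      rwa [add_sub_cancel_right, abs_of_nonneg (a := τ ^ 2 * ρ / (2 * n)) (by positivity)] at this
    have h4 : τ ^ 2 * ρ / (2 * n) ≤ τ ^ 2 * (1 + 1 / ε) ^ 2 / n * Y ^ 3 := by
      have : ρ ≤ (1 + 1 / ε) ^ 2 * Y ^ 3 := hρ'.trans (by gcongr)
      calc τ ^ 2 * ρ / (2 * n) ≤ τ ^ 2 * ((1 + 1 / ε) ^ 2 * Y ^ 3) / (1 * n) := by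
            gcongr; norm_num
        _ = _ := by ring
    have h5 : 0 ≤ τ / n * Y ^ 3 := by positivity
    calc |A| ≤ K * c ^ 3 / n * Y ^ 3 + τ / n * Y ^ 3 + τ ^ 2 * (1 + 1 / ε) ^ 2 / n * Y ^ 3 := by
          linarith
      _ = _ := by ring

theorem residual_apply {n d : ℕ} (X : Matrix (Fin n) (Fin d) ℝ) (v : Fin n → Bool)
    (s : Fin n → ℝ) (i : Fin n) : (residualMatrix X v *ᵥ s) i
      = (if v i then 1 else 0) * (s i - (X *ᵥ (fitMatrix X v *ᵥ s)) i) := by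
  rw [← residual_eq, ← mulVec_sub, maskMatrix, mulVec_diagonal, Pi.sub_apply]

theorem updateMatrix_apply {n d : ℕ} (alg : Algorithm) (h : ℝ) (X : Matrix (Fin n) (Fin d) ℝ)
    (v : Fin n → Bool) (s : Fin n → ℝ) (i : Fin n) (j : Fin d) :
    updateMatrix alg h X v s i j = X i j +
      (fitCoeff alg h (l2norm (fitMatrix X v *ᵥ s)) (l2norm (residualMatrix X v *ᵥ s)) *
        (X *ᵥ (fitMatrix X v *ᵥ s)) i +
      residualCoeff alg h (l2norm (fitMatrix X v *ᵥ s)) (l2norm (residualMatrix X v *ᵥ s)) *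
        (residualMatrix X v *ᵥ s) i) * (fitMatrix X v *ᵥ s) j := by
  simp [updateMatrix, vecMulVec_apply]

theorem transpose_mul_updateMatrix_apply {n d : ℕ} (alg : Algorithm) (h : ℝ)
    (U X : Matrix (Fin n) (Fin d) ℝ) (v : Fin n → Bool) (s : Fin n → ℝ) (i j : Fin d) :
    (Uᵀ * updateMatrix alg h X v s) i j = (Uᵀ * X) i j +
      (fitCoeff alg h (l2norm (fitMatrix X v *ᵥ s)) (l2norm (residualMatrix X v *ᵥ s)) *
        ((Uᵀ * X) *ᵥ (fitMatrix X v *ᵥ s)) i +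
      residualCoeff alg h (l2norm (fitMatrix X v *ᵥ s)) (l2norm (residualMatrix X v *ᵥ s)) *
        (Uᵀ *ᵥ (residualMatrix X v *ᵥ s)) i) * (fitMatrix X v *ᵥ s) j := by
  rw [updateMatrix, Matrix.mul_add, mul_vecMulVec, mulVec_add, mulVec_smul, mulVec_smul,
    ← mulVec_mulVec _ Uᵀ X]
  simp [vecMulVec_apply]

theorem abs_add_mul_le {A B q z w a b Y : ℝ} (hA : |A| ≤ a) (hB : |B| ≤ b) (hq : |q| ≤ Y)
    (hz : |z| ≤ Y) (hw : |w| ≤ Y) : |(A * q + B * z) * w| ≤ (a + b) * Y ^ 2 := by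
  have hY := (abs_nonneg _).trans hq
  have ha := (abs_nonneg _).trans hA
  have hb := (abs_nonneg _).trans hB
  calc |(A * q + B * z) * w| ≤ (|A| * |q| + |B| * |z|) * |w| := by
        rw [abs_mul, ← abs_mul A, ← abs_mul B]
        gcongr
        exact abs_add_le _ _
    _ ≤ (a * Y + b * Y) * Y := by gcongr
    _ = _ := by ring

/-- Bounds on the increments of the cosine similarity matrix and of the estimate. -/
theorem exists_increment_bounds (alg : Algorithm) {τ ε : ℝ} (hτ : 0 < τ) (hε : 0 < ε) :
    ∃ K : ℝ, 0 < K ∧ ∀ {n d : ℕ} {U X : Matrix (Fin n) (Fin d) ℝ} {v : Fin n → Bool},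
      0 < n → Uᵀ * U = 1 → Xᵀ * X = 1 → ε < lambdaMin (gram X v) → ∀ s : Fin n → ℝ,
      (∀ i j, |(Uᵀ * updateMatrix alg (τ / n) X v s) i j - (Uᵀ * X) i j
          - τ / n * (((Uᵀ *ᵥ (residualMatrix X v *ᵥ s)) i
            - τ / 2 * (l2norm (residualMatrix X v *ᵥ s) ^ 2 / n) *
              ((Uᵀ * X) *ᵥ (fitMatrix X v *ᵥ s)) i) * (fitMatrix X v *ᵥ s) j)|
          ≤ K / n ^ 2 * load U X v s ^ 5) ∧
      (∀ i j, |(Uᵀ * updateMatrix alg (τ / n) X v s) i j - (Uᵀ * X) i j|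
          ≤ K / n * load U X v s ^ 5) ∧
      (∀ i j, |updateMatrix alg (τ / n) X v s i j - X i j
          - τ / n * ((if v i then 1 else 0) * (s i * (fitMatrix X v *ᵥ s) j))|
          ≤ K / n * (∑ k, |X i k|) * load U X v s ^ 5 + K / n ^ 2 * (load U X v s + s i ^ 2) ^ 5) ∧
      (∀ i j, |updateMatrix alg (τ / n) X v s i j - X i j|
          ≤ K / n * (load U X v s + s i ^ 2) ^ 5) := by
  obtain ⟨K, hK, hbd⟩ := exists_coeff_bounds alg hτ hε
  refine ⟨3 * K, by positivity, ?_⟩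
  intro n d U X v hn hU hX hv s
  have hn1 : (1 : ℝ) ≤ n := by exact_mod_cast hn
  obtain ⟨hB1, hA1, hB, hA⟩ := hbd (U := U) s _ _ _ hn hX hv rfl rfl rfl
  simp only [updateMatrix_apply, transpose_mul_updateMatrix_apply]
  set A := fitCoeff alg (τ / n) (l2norm (fitMatrix X v *ᵥ s)) (l2norm (residualMatrix X v *ᵥ s))
  set B := residualCoeff alg (τ / n) (l2norm (fitMatrix X v *ᵥ s))
    (l2norm (residualMatrix X v *ᵥ s))
  set ρ := l2norm (residualMatrix X v *ᵥ s) ^ 2 / n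
  have hY1 : 1 ≤ load U X v s := one_le_load
  have hw : ∀ j, |(fitMatrix X v *ᵥ s) j| ≤ load U X v s := abs_fit_le_load
  have hz : ∀ i, |(Uᵀ *ᵥ (residualMatrix X v *ᵥ s)) i| ≤ load U X v s :=
    abs_transpose_mulVec_residual_le_load
  have hwY : l2norm (fitMatrix X v *ᵥ s) ≤ load U X v s :=
    le_of_sq_le one_le_load l2norm_fit_sq_le_load
  have hXw : ∀ i, |(X *ᵥ (fitMatrix X v *ᵥ s)) i| ≤ load U X v s := fun i =>
    (abs_apply_le_l2norm _ i).trans ((l2norm_mulVec hX _).trans_le hwY)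
  have hXw' : ∀ i, |(X *ᵥ (fitMatrix X v *ᵥ s)) i| ≤ (∑ k, |X i k|) * load U X v s := fun i =>
    (abs_mulVec_apply_le X _ i).trans (by gcongr)
  have hQ : ‖Uᵀ * X‖ ≤ 1 := by
    refine (Matrix.l2_opNorm_mul _ _).trans (mul_le_one₀ ?_ (norm_nonneg _)
      (norm_le_one_of_transpose_mul hX))
    rw [norm_transpose]
    exact norm_le_one_of_transpose_mul hU
  have hq : ∀ i, |((Uᵀ * X) *ᵥ (fitMatrix X v *ᵥ s)) i| ≤ load U X v s := fun i =>
    (abs_apply_le_l2norm _ i).trans <| (l2norm_mulVec_le _ _).trans <|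
      (mul_le_of_le_one_left (l2norm_nonneg _) hQ).trans hwY
  set Y := load U X v s
  have hvi : ∀ i, |(if v i then 1 else 0 : ℝ)| ≤ 1 := fun i => by split_ifs <;> simp
  have hres : ∀ i, |(residualMatrix X v *ᵥ s) i| ≤ |s i| + |(X *ᵥ (fitMatrix X v *ᵥ s)) i| :=
    fun i => by
      rw [residual_apply, abs_mul]
      exact (mul_le_of_le_one_left (abs_nonneg _) (hvi i)).trans (abs_sub _ _)
  refine ⟨fun i j => ?_, fun i j => ?_, fun i j => ?_, fun i j => ?_⟩
  · have := abs_add_mul_le hA1 hB1 (hq i) (hz i) (hw j)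
    calc _ = |((A + τ ^ 2 * ρ / (2 * n)) * ((Uᵀ * X) *ᵥ (fitMatrix X v *ᵥ s)) i
          + (B - τ / n) * (Uᵀ *ᵥ (residualMatrix X v *ᵥ s)) i) * (fitMatrix X v *ᵥ s) j| := by
          congr 1; field_simp; ring
      _ ≤ _ := this
      _ = 2 * (K / n ^ 2 * Y ^ 5) := by ring
      _ ≤ 3 * (K / n ^ 2 * Y ^ 5) := by gcongr; norm_num
      _ = _ := by ring
  · rw [add_sub_cancel_left]
    calc _ ≤ _ := abs_add_mul_le hA hB (hq i) (hz i) (hw j)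
      _ = 2 * (K / n * Y ^ 5) := by ring
      _ ≤ 3 * (K / n * Y ^ 5) := by gcongr; norm_num
      _ = _ := by ring
  -- All terms containing `(Xw)_i` are kept proportional to the row sum of `|X i k|`. This factor,
  -- rather than a mere `O(1/n)`, is what the fourth moment estimate needs.
  · set u : ℝ := if v i then 1 else 0 with hu
    set Z := Y + s i ^ 2 with hZ
    have hYZ : Y ≤ Z := by rw [hZ]; nlinarith
    have hsZ : |s i| ≤ Z := le_of_sq_le (hY1.trans hYZ) (by rw [sq_abs, hZ]; linarith)
    have hξ : 0 ≤ ∑ k, |X i k| := Finset.sum_nonneg fun k _ => abs_nonneg _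
    have hAB : |A - B * u| ≤ 2 * (K / n * Y ^ 3) := by
      calc |A - B * u| ≤ |A| + |B| * |u| := by rw [← abs_mul]; exact abs_sub _ _
        _ ≤ K / n * Y ^ 3 + K / n * Y ^ 3 * 1 := by gcongr; exact hvi i
        _ = _ := by ring
    calc _ = |(A - B * u) * (X *ᵥ (fitMatrix X v *ᵥ s)) i * (fitMatrix X v *ᵥ s) j
          + (B - τ / n) * u * s i * (fitMatrix X v *ᵥ s) j| := by
          rw [residual_apply]; congr 1; ring
      _ ≤ |A - B * u| * |(X *ᵥ (fitMatrix X v *ᵥ s)) i| * |(fitMatrix X v *ᵥ s) j|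
          + |B - τ / n| * |u| * |s i| * |(fitMatrix X v *ᵥ s) j| := by
          rw [← abs_mul, ← abs_mul, ← abs_mul, ← abs_mul, ← abs_mul]; exact abs_add_le _ _
      _ ≤ 2 * (K / n * Y ^ 3) * ((∑ k, |X i k|) * Y) * Y + K / n ^ 2 * Z ^ 3 * 1 * Z * Z := by
          have hB1' : |B - τ / n| ≤ K / n ^ 2 * Z ^ 3 := hB1.trans (by gcongr)
          gcongr
          · exact hXw' i
          · exact hw j
          · exact hvi i
          · exact (hw j).trans hYZ
      _ = 2 * (K / n * (∑ k, |X i k|) * Y ^ 5) + K / n ^ 2 * Z ^ 5 := by ring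
      _ ≤ 3 * (K / n * (∑ k, |X i k|) * Y ^ 5) + 3 * (K / n ^ 2 * Z ^ 5) := by
          have : 0 ≤ K / n ^ 2 * Z ^ 5 := by positivity
          have : 0 ≤ K / n * (∑ k, |X i k|) * Y ^ 5 := by positivity
          linarith
      _ = _ := by ring
  · set Z := Y + s i ^ 2 with hZ
    have hYZ : Y ≤ Z := by rw [hZ]; nlinarith
    have hZ1 := hY1.trans hYZ
    have hsZ : |s i| ≤ Z := le_of_sq_le (hY1.trans hYZ) (by rw [sq_abs, hZ]; linarith)
    have hr2 : |(residualMatrix X v *ᵥ s) i| ≤ 2 * Z :=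
      (hres i).trans (by linarith [hXw i])
    rw [add_sub_cancel_left]
    calc _ ≤ (|A| * |(X *ᵥ (fitMatrix X v *ᵥ s)) i| + |B| * |(residualMatrix X v *ᵥ s) i|) *
          |(fitMatrix X v *ᵥ s) j| := by
          rw [abs_mul, ← abs_mul A, ← abs_mul B]
          gcongr
          exact abs_add_le _ _
      _ ≤ (K / n * Z ^ 3 * Z + K / n * Z ^ 3 * (2 * Z)) * Z := by
          have hA' : |A| ≤ K / n * Z ^ 3 := hA.trans (by gcongr)
          have hB' : |B| ≤ K / n * Z ^ 3 := hB.trans (by gcongr)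
          gcongr
          · exact (hXw i).trans hYZ
          · exact (hw j).trans hYZ
      _ = _ := by ring

end

end SubspaceTracking

namespace SubspaceTracking

noncomputable section

open scoped Matrix.Norms.L2Operator

/-! ### Moments of the quantities that enter an update -/

theorem add_five_pow_le {a b c e f : ℝ} (ha : 0 ≤ a) (hb : 0 ≤ b) (hc : 0 ≤ c) (he : 0 ≤ e)
    (hf : 0 ≤ f) (m : ℕ) :
    (a + b + c + e + f) ^ m ≤ 5 ^ m * (a ^ m + b ^ m + c ^ m + e ^ m + f ^ m) := by
  have h := Real.pow_arith_mean_le_arith_mean_pow Finset.univ (fun _ : Fin 5 => (1 / 5 : ℝ))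
    ![a, b, c, e, f] (fun _ _ => by norm_num) (by simp)
    (fun i _ => by fin_cases i <;> simpa) m
  simp only [Fin.sum_univ_five] at h
  simp only [Matrix.cons_val] at h
  have h0 : 0 ≤ a ^ m + b ^ m + c ^ m + e ^ m + f ^ m := by positivity
  calc (a + b + c + e + f) ^ m
      = 5 ^ m * (1 / 5 * a + 1 / 5 * b + 1 / 5 * c + 1 / 5 * e + 1 / 5 * f) ^ m := by
        rw [← mul_pow]; congr 1; ring
    _ ≤ 5 ^ m * (1 / 5 * a ^ m + 1 / 5 * b ^ m + 1 / 5 * c ^ m + 1 / 5 * e ^ m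
          + 1 / 5 * f ^ m) := by gcongr
    _ ≤ _ := mul_le_mul_of_nonneg_left (by linarith) (by positivity)

theorem row_dotProduct_self_le {m n : ℕ} (A : Matrix (Fin m) (Fin n) ℝ) (k : Fin m) :
    A k ⬝ᵥ A k ≤ ‖A‖ ^ 2 := by
  have h1 := l2norm_mulVec_le Aᵀ (Pi.single k 1)
  have h2 : l2norm (Pi.single k 1 : Fin m → ℝ) = 1 := by
    rw [← sq_eq_sq₀ (l2norm_nonneg _) zero_le_one, l2norm_sq]; simp
  rw [h2, mul_one, norm_transpose, mulVec_single_one] at h1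
  calc A k ⬝ᵥ A k = l2norm (Aᵀ.col k) ^ 2 := by rw [l2norm_sq]; rfl
    _ ≤ ‖A‖ ^ 2 := by gcongr; exact l2norm_nonneg _

theorem mul_transpose_apply {l m n : ℕ} (A : Matrix (Fin l) (Fin n) ℝ)
    (B : Matrix (Fin m) (Fin n) ℝ) (i : Fin l) (j : Fin m) : (A * Bᵀ) i j = ∑ k, A i k * B j k := by
  simp [Matrix.mul_apply]

section

variable {n d : ℕ} {U : Matrix (Fin n) (Fin d) ℝ} {lam : Fin d → ℝ} {σ : ℝ} {C : ℕ → ℝ}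
  {ζ : Measure (Fin n → ℝ)}

namespace IsSampleLaw

theorem hasMoments_dotProduct (hζ : IsSampleLaw U lam σ C ζ) (h : Fin n → ℝ) :
    HasMoments (fun s => h ⬝ᵥ s) ζ := by
  have := hζ.prob
  exact HasMoments.sum _ fun i _ => (hζ.hasMoments i).const_mul _

theorem hasMoments_mulVec (hζ : IsSampleLaw U lam σ C ζ) {m : ℕ} (A : Matrix (Fin m) (Fin n) ℝ)
    (i : Fin m) : HasMoments (fun s => (A *ᵥ s) i) ζ :=
  hζ.hasMoments_dotProduct (A i)

theorem hasMoments_mulVec_dotProduct_self (hζ : IsSampleLaw U lam σ C ζ) {m : ℕ}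
    (A : Matrix (Fin m) (Fin n) ℝ) : HasMoments (fun s => (A *ᵥ s) ⬝ᵥ (A *ᵥ s)) ζ := by
  have := hζ.prob
  exact HasMoments.sum _ fun i _ => (hζ.hasMoments_mulVec A i).mul (hζ.hasMoments_mulVec A i)

/-- Jensen's inequality for the average over `j`, so that the bound is free of `k`. This is
essential for the energy `s·s/n`, where `k = n`. -/
theorem mean_square_moment_le (hζ : IsSampleLaw U lam σ C ζ) (hC : ∀ m, 0 ≤ C m) {k : ℕ}
    (hk : 0 < k) (g : Fin k → Fin n → ℝ) {L : ℝ} (hL : ∀ j, g j ⬝ᵥ g j ≤ L) (m : ℕ) :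
    ∫ s, ((∑ j, (g j ⬝ᵥ s) ^ 2) / k) ^ m ∂ζ ≤ C m * L ^ m := by
  have := hζ.prob
  have hk0 : (0 : ℝ) < k := by exact_mod_cast hk
  have hm := fun j => hζ.hasMoments_dotProduct (g j)
  have hsum : HasMoments (fun s => ((∑ j, (g j ⬝ᵥ s) ^ 2) / k) ^ m) ζ := by
    have := ((HasMoments.sum Finset.univ fun j _ => (hm j).pow 2).const_mul (k : ℝ)⁻¹).pow m
    simpa only [div_eq_inv_mul] using this
  have hsum' : HasMoments (fun s => (∑ j, (g j ⬝ᵥ s) ^ (2 * m))) ζ :=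
    HasMoments.sum Finset.univ fun j _ => (hm j).pow _
  calc _ ≤ ∫ s, (k : ℝ)⁻¹ * ∑ j, (g j ⬝ᵥ s) ^ (2 * m) ∂ζ := by
        refine integral_mono hsum.integrable (hsum'.const_mul _).integrable fun s => ?_
        have h := Real.pow_arith_mean_le_arith_mean_pow Finset.univ (fun _ : Fin k => (k : ℝ)⁻¹)
          (fun j => (g j ⬝ᵥ s) ^ 2) (fun _ _ => by positivity) (by simp [hk0.ne'])
          (fun j _ => sq_nonneg _) m
        simp only [← Finset.mul_sum, ← pow_mul] at h
        simpa only [div_eq_inv_mul] using h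
    _ = (k : ℝ)⁻¹ * ∑ j, ∫ s, (g j ⬝ᵥ s) ^ (2 * m) ∂ζ := by
        rw [integral_const_mul, integral_finsetSum _ fun j _ => ((hm j).pow _).integrable]
    _ ≤ (k : ℝ)⁻¹ * ∑ j : Fin k, C m * L ^ m := by
        gcongr with j
        refine (hζ.moment m (g j)).trans ?_
        have := hC m
        have := dotProduct_self_nonneg' (g j)
        gcongr
        exact hL j
    _ = _ := by
        rw [Finset.sum_const, Finset.card_univ, Fintype.card_fin, nsmul_eq_mul]
        field_simp

theorem norm_sq_moment_le (hζ : IsSampleLaw U lam σ C ζ) (hC : ∀ m, 0 ≤ C m) {k : ℕ}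
    (hk : 0 < k) (A : Matrix (Fin k) (Fin n) ℝ) {L : ℝ} (hL : ‖A‖ ≤ L) (m : ℕ) :
    ∫ s, ((A *ᵥ s) ⬝ᵥ (A *ᵥ s)) ^ m ∂ζ ≤ k ^ m * (C m * (L ^ 2) ^ m) := by
  have hk0 : (0 : ℝ) < k := by exact_mod_cast hk
  have h := hζ.mean_square_moment_le hC hk (fun j => A j) (L := L ^ 2)
    (fun j => (row_dotProduct_self_le A j).trans (by gcongr)) m
  calc _ = ∫ s, k ^ m * ((∑ j, (A j ⬝ᵥ s) ^ 2) / k) ^ m ∂ζ := by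
        congr 1
        ext s
        rw [← mul_pow, mul_div_cancel₀ _ hk0.ne', dotProduct]
        simp only [mulVec, ← sq]
    _ = k ^ m * ∫ s, ((∑ j, (A j ⬝ᵥ s) ^ 2) / k) ^ m ∂ζ := integral_const_mul _ _
    _ ≤ _ := by gcongr

theorem hasMoments_energy (hζ : IsSampleLaw U lam σ C ζ) :
    HasMoments (fun s => s ⬝ᵥ s / n) ζ := by
  have := hζ.prob
  have h1 : HasMoments (fun s : Fin n → ℝ => s ⬝ᵥ s) ζ :=
    HasMoments.sum _ fun i _ => (hζ.hasMoments i).mul (hζ.hasMoments i)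
  simpa only [div_eq_inv_mul] using h1.const_mul (n : ℝ)⁻¹

theorem energy_moment_le (hζ : IsSampleLaw U lam σ C ζ) (hC : ∀ m, 0 ≤ C m) (hn : 0 < n) (m : ℕ) :
    ∫ s, (s ⬝ᵥ s / n) ^ m ∂ζ ≤ C m := by
  have h := hζ.mean_square_moment_le hC hn (fun i => Pi.single i 1) (L := 1) (fun i => by simp) m
  simp only [single_dotProduct, one_mul, one_pow, mul_one] at h
  simpa only [dotProduct, ← sq] using h

theorem hasMoments_load (hζ : IsSampleLaw U lam σ C ζ) (X : Matrix (Fin n) (Fin d) ℝ)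
    (v : Fin n → Bool) : HasMoments (fun s => load U X v s) ζ := by
  have := hζ.prob
  unfold load
  simp only [mulVec_mulVec]
  exact (((HasMoments.const 1).add (hζ.hasMoments_mulVec_dotProduct_self _)).add
    (hζ.hasMoments_mulVec_dotProduct_self _)).add hζ.hasMoments_energy

theorem hasMoments_load_add (hζ : IsSampleLaw U lam σ C ζ) (X : Matrix (Fin n) (Fin d) ℝ)
    (v : Fin n → Bool) (i : Fin n) : HasMoments (fun s => load U X v s + s i ^ 2) ζ := by
  have := hζ.prob
  exact (hζ.hasMoments_load X v).add ((hζ.hasMoments i).pow 2)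

theorem coord_moment_le (hζ : IsSampleLaw U lam σ C ζ) (i : Fin n) (m : ℕ) :
    ∫ s, (s i ^ 2) ^ m ∂ζ ≤ C m := by
  have h := hζ.moment m (Pi.single i 1)
  simpa [← pow_mul] using h

/-- The covariance of linear functions of a sample. -/
theorem integral_mulVec_mul_mulVec (hζ : IsSampleLaw U lam σ C ζ) {k l : ℕ}
    (A : Matrix (Fin k) (Fin n) ℝ) (B : Matrix (Fin l) (Fin n) ℝ) (i : Fin k) (j : Fin l) :
    ∫ s, (A *ᵥ s) i * (B *ᵥ s) j ∂ζ = (A * sampleCov U lam σ * Bᵀ) i j := by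
  have := hζ.prob
  have hm := fun p q => ((hζ.hasMoments p).mul (hζ.hasMoments q)).const_mul (A i p * B j q)
  calc _ = ∫ s, ∑ p, ∑ q, A i p * B j q * (s p * s q) ∂ζ := by
        congr 1
        ext s
        simp only [mulVec, dotProduct, Finset.sum_mul_sum]
        exact Finset.sum_congr rfl fun p _ => Finset.sum_congr rfl fun q _ => by ring
    _ = ∑ p, ∑ q, A i p * B j q * sampleCov U lam σ p q := by
        rw [integral_finsetSum _ fun p _ => (HasMoments.sum _ fun q _ => hm p q).integrable]
        refine Finset.sum_congr rfl fun p _ => ?_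
        rw [integral_finsetSum _ fun q _ => (hm p q).integrable]
        exact Finset.sum_congr rfl fun q _ => by rw [integral_const_mul, hζ.cov]
    _ = _ := by
        simp only [Matrix.mul_apply, Finset.sum_mul, transpose_apply]
        rw [Finset.sum_comm]
        exact Finset.sum_congr rfl fun p _ => Finset.sum_congr rfl fun q _ => by ring

/-- Measurability is read off the closed form, and the increment is dominated by a power of `load`
plus `s_i²`. -/
theorem hasMoments_updateMatrix (hζ : IsSampleLaw U lam σ C ζ) (alg : Algorithm) {τ ε : ℝ}
    (hτ : 0 < τ) (hε : 0 < ε) (hn : 0 < n) (hU : Uᵀ * U = 1) {X : Matrix (Fin n) (Fin d) ℝ}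
    (hX : Xᵀ * X = 1) {v : Fin n → Bool} (hv : ε < lambdaMin (gram X v)) (i : Fin n) (j : Fin d) :
    HasMoments (fun s => updateMatrix alg (τ / n) X v s i j) ζ := by
  have := hζ.prob
  obtain ⟨K, hK, hbd⟩ := exists_increment_bounds alg hτ hε
  have hb := fun s => (hbd hn hU hX hv s).2.2.2 i j
  have hlin : ∀ {m : ℕ} (A : Matrix (Fin m) (Fin n) ℝ) (i : Fin m),
      Measurable fun s : Fin n → ℝ => (A *ᵥ s) i := fun A i => by
    unfold mulVec dotProduct; fun_prop
  have hl2 : ∀ {m : ℕ} (A : Matrix (Fin m) (Fin n) ℝ),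
      Measurable fun s : Fin n → ℝ => l2norm (A *ᵥ s) := fun A => by
    have : (fun s : Fin n → ℝ => l2norm (A *ᵥ s)) = fun s => √(∑ i, (A *ᵥ s) i * (A *ᵥ s) i) := by
      ext s
      rw [← Real.sqrt_sq (l2norm_nonneg (A *ᵥ s)), l2norm_sq, dotProduct]
    rw [this]
    exact (Finset.measurable_sum _ fun i _ => (hlin A i).mul (hlin A i)).sqrt
  have hmeas : Measurable fun s => updateMatrix alg (τ / n) X v s i j := by
    simp only [updateMatrix_apply, mulVec_mulVec]
    have h1 := hl2 (fitMatrix X v)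
    have h2 := hl2 (residualMatrix X v)
    have h3 := hlin (X * fitMatrix X v) i
    have h4 := hlin (residualMatrix X v) i
    have h5 := hlin (fitMatrix X v) j
    have h6 : Measurable Real.sinc := Real.continuous_sinc.measurable
    cases alg <;> simp only [fitCoeff, residualCoeff] <;> fun_prop
  have hdiff : HasMoments (fun s => updateMatrix alg (τ / n) X v s i j - X i j) ζ :=
    (((hζ.hasMoments_load_add X v i).pow 5).const_mul (K / n)).of_le
      (hmeas.sub_const _) hb
  simpa using hdiff.add (HasMoments.const (X i j))

end IsSampleLaw

end

/-- The moments of the load are bounded uniformly in the dimension. -/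
theorem exists_load_moment_le {d : ℕ} (hd : 0 < d) {ε : ℝ} (hε : 0 < ε) {C : ℕ → ℝ}
    (hC : ∀ m, 0 ≤ C m) (m : ℕ) :
    ∃ K : ℝ, 0 < K ∧ ∀ {n : ℕ} {U X : Matrix (Fin n) (Fin d) ℝ} {lam : Fin d → ℝ} {σ : ℝ}
      {v : Fin n → Bool} {ζ : Measure (Fin n → ℝ)}, IsSampleLaw U lam σ C ζ →
      0 < n → Uᵀ * U = 1 → Xᵀ * X = 1 → ε < lambdaMin (gram X v) →
      (∀ i, ∫ s, (load U X v s + s i ^ 2) ^ m ∂ζ ≤ K) ∧ ∫ s, load U X v s ^ m ∂ζ ≤ K := by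
  refine ⟨5 ^ m * (1 + d ^ m * (C m * ((1 / ε) ^ 2) ^ m) + d ^ m * (C m * ((1 + 1 / ε) ^ 2) ^ m)
    + C m + C m), by have := hC m; positivity, ?_⟩
  intro n U X lam σ v ζ hζ hn hU hX hv
  have hp := hζ.prob
  have key : ∀ i, ∫ s, (load U X v s + s i ^ 2) ^ m ∂ζ ≤ 5 ^ m * (1 +
      d ^ m * (C m * ((1 / ε) ^ 2) ^ m) + d ^ m * (C m * ((1 + 1 / ε) ^ 2) ^ m)
      + C m + C m) := by
    intro i
    set M1 : (Fin n → ℝ) → ℝ := fun s => (fitMatrix X v *ᵥ s) ⬝ᵥ (fitMatrix X v *ᵥ s) with hM1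
    set M2 : (Fin n → ℝ) → ℝ := fun s => ((Uᵀ * residualMatrix X v) *ᵥ s) ⬝ᵥ
      ((Uᵀ * residualMatrix X v) *ᵥ s) with hM2
    set M3 : (Fin n → ℝ) → ℝ := fun s => s ⬝ᵥ s / n with hM3
    have h1 : HasMoments M1 ζ := hζ.hasMoments_mulVec_dotProduct_self _
    have h2 : HasMoments M2 ζ := hζ.hasMoments_mulVec_dotProduct_self _
    have h3 : HasMoments M3 ζ := hζ.hasMoments_energy
    have h4 := (hζ.hasMoments i).pow 2
    have hUR : ‖Uᵀ * residualMatrix X v‖ ≤ 1 + 1 / ε := by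
      refine (Matrix.l2_opNorm_mul _ _).trans ?_
      rw [norm_transpose]
      calc _ ≤ 1 * (1 + 1 / ε) := by
            gcongr
            · exact norm_le_one_of_transpose_mul hU
            · exact norm_residualMatrix_le hX hε hv
        _ = _ := one_mul _
    have hpt : ∀ s, (load U X v s + s i ^ 2) ^ m
        ≤ 5 ^ m * (1 + M1 s ^ m + M2 s ^ m + M3 s ^ m + (s i ^ 2) ^ m) := fun s => by
      have := add_five_pow_le zero_le_one (dotProduct_self_nonneg' (fitMatrix X v *ᵥ s))
        (dotProduct_self_nonneg' ((Uᵀ * residualMatrix X v) *ᵥ s))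
        (div_nonneg (dotProduct_self_nonneg' s) (Nat.cast_nonneg (α := ℝ) n))
        (sq_nonneg (s i)) m
      rw [one_pow] at this
      simpa only [load, mulVec_mulVec] using this
    have g := (((((HasMoments.const 1).add (h1.pow m)).add (h2.pow m)).add (h3.pow m)).add
      (h4.pow m))
    refine (integral_mono ((hζ.hasMoments_load_add X v i).pow m).integrable
      (g.const_mul _).integrable hpt).trans ?_
    rw [integral_const_mul, integral_add
        ((((HasMoments.const 1).add (h1.pow m)).add (h2.pow m)).add (h3.pow m)).integrable
        (h4.pow m).integrable,
      integral_add (((HasMoments.const 1).add (h1.pow m)).add (h2.pow m)).integrable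
        (h3.pow m).integrable,
      integral_add ((HasMoments.const 1).add (h1.pow m)).integrable (h2.pow m).integrable,
      integral_add (HasMoments.const 1).integrable (h1.pow m).integrable]
    gcongr
    · simp
    · exact hζ.norm_sq_moment_le hC hd _ (norm_fitMatrix_le hX hε hv) m
    · exact hζ.norm_sq_moment_le hC hd _ hUR m
    · exact hζ.energy_moment_le hC hn m
    · exact hζ.coord_moment_le i m
  refine ⟨key, le_trans ?_ (key ⟨0, hn⟩)⟩
  refine integral_mono ((hζ.hasMoments_load X v).pow m).integrable
    ((hζ.hasMoments_load_add X v ⟨0, hn⟩).pow m).integrable fun s => ?_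
  have : 1 ≤ load U X v s := one_le_load
  have := sq_nonneg (s ⟨0, hn⟩)
  dsimp only
  gcongr
  linarith

end

end SubspaceTracking

namespace SubspaceTracking

noncomputable section

open scoped Matrix.Norms.L2Operator

/-! ### The drift of the cosine similarity matrix -/

theorem norm_one_matrix_le {m : ℕ} : ‖(1 : Matrix (Fin m) (Fin m) ℝ)‖ ≤ 1 :=
  norm_le_of_forall_l2norm _ zero_le_one fun x => by rw [one_mulVec, one_mul]

theorem norm_mul_sub_mul_le {k l m : ℕ} {A A' : Matrix (Fin k) (Fin l) ℝ}
    {B B' : Matrix (Fin l) (Fin m) ℝ} {a b p q η : ℝ} (hA : ‖A - A'‖ ≤ a * η)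
    (hB : ‖B - B'‖ ≤ b * η) (hA' : ‖A'‖ ≤ p) (hB' : ‖B‖ ≤ q) :
    ‖A * B - A' * B'‖ ≤ (a * q + p * b) * η := by
  have e : A * B - A' * B' = (A - A') * B + A' * (B - B') := by
    rw [Matrix.sub_mul, Matrix.mul_sub]; abel
  have haη := (norm_nonneg _).trans hA
  have hp := (norm_nonneg _).trans hA'
  calc ‖A * B - A' * B'‖ ≤ ‖A - A'‖ * ‖B‖ + ‖A'‖ * ‖B - B'‖ := by
        rw [e]
        exact (norm_add_le _ _).trans (add_le_add (Matrix.l2_opNorm_mul _ _)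
          (Matrix.l2_opNorm_mul _ _))
    _ ≤ a * η * q + p * (b * η) := by gcongr
    _ = _ := by ring

theorem norm_mul_le_of_le {k l m : ℕ} {A : Matrix (Fin k) (Fin l) ℝ}
    {B : Matrix (Fin l) (Fin m) ℝ} {a b : ℝ} (hA : ‖A‖ ≤ a) (hB : ‖B‖ ≤ b) :
    ‖A * B‖ ≤ a * b :=
  (Matrix.l2_opNorm_mul _ _).trans (mul_le_mul hA hB (norm_nonneg _) ((norm_nonneg _).trans hA))

/-- The covariances between residual, fit and similarity are close to their limits when the observed
Gram matrices are close to multiples of the full ones. -/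
theorem exists_covariance_limit_bound {α ε L : ℝ} (σ : ℝ) (hα : 0 < α) (hα1 : α ≤ 1) (hε : 0 < ε)
    (hL : 0 ≤ L) :
    ∃ K : ℝ, 0 < K ∧ ∀ {d : ℕ} {S N B D Q Γ : Matrix (Fin d) (Fin d) ℝ} {η : ℝ}, N * S = 1 →
      ‖N‖ ≤ 1 / ε → ‖B‖ ≤ 1 → ‖Q‖ ≤ 1 → ‖Γ‖ ≤ L → ‖S - α • 1‖ ≤ η →
      ‖B - α • Q‖ ≤ η → ‖D - α • 1‖ ≤ η →
      ‖(D - B * (B * N)ᵀ) * (Γ * (B * N)) - α • ((1 - Q * Qᵀ) * (Γ * Q))‖ ≤ K * η ∧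
      ‖Q * ((B * N)ᵀ * (Γ * (B * N)) + σ ^ 2 • N) - Q * (Qᵀ * (Γ * Q) + (σ ^ 2 / α) • 1)‖
        ≤ K * η := by
  -- `S`, `B`, `D` play the observed versions of `XᵀX`, `UᵀX`, `UᵀU`, close to `α`, `αQ`, `α`, and
  -- `N` is the inverse of `S`. The constants `k0`, `k1`, `k2`, `k3` measure the errors of `N`
  -- against `α⁻¹`, of `BN` against `Q`, of `D - B(BN)ᵀ` against `α(1 - QQᵀ)` and of `ΓBN` against
  -- `ΓQ`.
  set e := 1 / ε with he
  have he0 : 0 < e := by positivity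
  set k0 := α⁻¹ * e with hk0
  set k1 := 1 * e + 1 * k0 with hk1
  set k2 := 1 + (1 * e + 1 * k1) with hk2
  set k3 := L * k1 with hk3
  have hk0' : 0 < k0 := by positivity
  refine ⟨(k2 * (L * e) + 2 * k3) + ((k1 * (L * e) + 1 * k3) + σ ^ 2 * k0) + 1,
    by positivity, ?_⟩
  intro d S N B D Q Γ η hNS hN hB hQ hΓ hS hBQ hD
  have hη : 0 ≤ η := (norm_nonneg _).trans hS
  have hNα : ‖N - α⁻¹ • 1‖ ≤ k0 * η := by
    have e1 : N - α⁻¹ • 1 = -(α⁻¹ • (N * (S - α • 1))) := by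
      rw [Matrix.mul_sub, hNS, Matrix.mul_smul, Matrix.mul_one, smul_sub, smul_smul,
        inv_mul_cancel₀ hα.ne', one_smul]; abel
    rw [e1, norm_neg, norm_smul, Real.norm_of_nonneg (by positivity), hk0, mul_assoc]
    gcongr
    exact norm_mul_le_of_le hN hS
  have hαQ : ‖α • Q‖ ≤ 1 := by
    rw [norm_smul, Real.norm_of_nonneg hα.le]
    exact mul_le_one₀ hα1 (norm_nonneg _) hQ
  have hM : ‖B * N‖ ≤ e := (norm_mul_le_of_le hB hN).trans_eq (one_mul _)
  have hMQ : ‖B * N - Q‖ ≤ k1 * η := by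
    have := norm_mul_sub_mul_le (a := 1) (B' := α⁻¹ • (1 : Matrix (Fin d) (Fin d) ℝ))
      (by simpa using hBQ) hNα hαQ hN
    rwa [smul_mul_smul_comm, Matrix.mul_one, mul_inv_cancel₀ hα.ne', one_smul] at this
  have hMt : ‖(B * N)ᵀ‖ ≤ e := by rwa [norm_transpose]
  have hMQt : ‖(B * N)ᵀ - Qᵀ‖ ≤ k1 * η := by rwa [← transpose_sub, norm_transpose]
  have hQt : ‖Qᵀ‖ ≤ 1 := by rwa [norm_transpose]
  have hBM : ‖B * (B * N)ᵀ - (α • Q) * Qᵀ‖ ≤ (1 * e + 1 * k1) * η :=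
    norm_mul_sub_mul_le (by simpa using hBQ) hMQt hαQ hMt
  have hDB : ‖(D - B * (B * N)ᵀ) - α • (1 - Q * Qᵀ)‖ ≤ k2 * η := by
    have e1 : (D - B * (B * N)ᵀ) - α • (1 - Q * Qᵀ)
        = (D - α • 1) - (B * (B * N)ᵀ - (α • Q) * Qᵀ) := by
      rw [smul_sub, Matrix.smul_mul]; abel
    rw [e1, hk2, add_mul, one_mul]
    exact (norm_sub_le _ _).trans (add_le_add hD hBM)
  have hΓM : ‖Γ * (B * N) - Γ * Q‖ ≤ k3 * η := by
    rw [← Matrix.mul_sub, hk3, mul_assoc]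
    exact norm_mul_le_of_le hΓ hMQ
  have hΓM' : ‖Γ * (B * N)‖ ≤ L * e := norm_mul_le_of_le hΓ hM
  have hI : ‖α • (1 - Q * Qᵀ)‖ ≤ 2 := by
    rw [norm_smul, Real.norm_of_nonneg hα.le]
    have h1 : ‖1 - Q * Qᵀ‖ ≤ 1 + 1 * 1 :=
      (norm_sub_le _ _).trans (add_le_add norm_one_matrix_le (norm_mul_le_of_le hQ hQt))
    calc α * ‖1 - Q * Qᵀ‖ ≤ 1 * (1 + 1 * 1) := by gcongr
      _ = 2 := by norm_num
  have hk3' : 0 ≤ k3 := by positivity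
  constructor
  · have h1 := norm_mul_sub_mul_le hDB hΓM hI hΓM'
    rw [Matrix.smul_mul] at h1
    refine h1.trans ?_
    have : 0 ≤ (k1 * (L * e) + 1 * k3 + σ ^ 2 * k0 + 1) * η := by positivity
    linarith
  · have h1 := norm_mul_sub_mul_le hMQt hΓM hQt hΓM'
    have h2 : ‖σ ^ 2 • N - (σ ^ 2 / α) • (1 : Matrix (Fin d) (Fin d) ℝ)‖ ≤ σ ^ 2 * k0 * η := by
      rw [div_eq_mul_inv, ← smul_smul, ← smul_sub, norm_smul, Real.norm_of_nonneg (by positivity),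
        mul_assoc]
      gcongr
    rw [← Matrix.mul_sub]
    have e1 : (B * N)ᵀ * (Γ * (B * N)) + σ ^ 2 • N - (Qᵀ * (Γ * Q) + (σ ^ 2 / α) • 1)
        = ((B * N)ᵀ * (Γ * (B * N)) - Qᵀ * (Γ * Q))
          + (σ ^ 2 • N - (σ ^ 2 / α) • (1 : Matrix (Fin d) (Fin d) ℝ)) := by abel
    have h3 := (norm_add_le (((B * N)ᵀ * (Γ * (B * N)) - Qᵀ * (Γ * Q)))
      (σ ^ 2 • N - (σ ^ 2 / α) • (1 : Matrix (Fin d) (Fin d) ℝ))).trans (add_le_add h1 h2)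
    rw [← e1] at h3
    refine (norm_mul_le_of_le hQ h3).trans ?_
    have : 0 ≤ (k2 * (L * e) + 2 * k3 + 1) * η := by positivity
    linarith

/-! ### Covariances of fit, residual and sample for a fixed mask -/

section

variable {n d : ℕ} {U X : Matrix (Fin n) (Fin d) ℝ} {v : Fin n → Bool}

theorem gram_inv_transpose : ((gram X v)⁻¹)ᵀ = (gram X v)⁻¹ := by
  rw [transpose_nonsing_inv, gram_transpose]

theorem fitMatrix_mul : fitMatrix X v * U = ((Uᵀ * maskMatrix v * X) * (gram X v)⁻¹)ᵀ := by
  rw [transpose_mul, gram_inv_transpose, transpose_mul, transpose_mul, transpose_transpose,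
    maskMatrix_transpose, fitMatrix, Matrix.mul_assoc, Matrix.mul_assoc]

theorem fitMatrix_transpose : (fitMatrix X v)ᵀ = maskMatrix v * X * (gram X v)⁻¹ := by
  rw [fitMatrix, transpose_mul, gram_inv_transpose, transpose_mul, transpose_transpose,
    maskMatrix_transpose]

theorem fitMatrix_mul_transpose (h : IsUnit (gram X v).det) :
    fitMatrix X v * (fitMatrix X v)ᵀ = (gram X v)⁻¹ := by
  have h1 : Xᵀ * maskMatrix v * (maskMatrix v * X * (gram X v)⁻¹) = 1 := by
    rw [← Matrix.mul_assoc, ← Matrix.mul_assoc, Matrix.mul_assoc Xᵀ, maskMatrix_mul_self, ← gram,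
      Matrix.mul_nonsing_inv _ h]
  rw [fitMatrix_transpose, fitMatrix, Matrix.mul_assoc, h1, Matrix.mul_one]

theorem mulVec_dotProduct {m k : ℕ} (A : Matrix (Fin m) (Fin k) ℝ) (x : Fin k → ℝ)
    (y : Fin m → ℝ) : (A *ᵥ x) ⬝ᵥ y = x ⬝ᵥ (Aᵀ *ᵥ y) := by
  rw [mulVec_transpose, dotProduct_comm, dotProduct_mulVec, dotProduct_comm]

/-- The signal enters through `Uᵀ` times the transposed fit, the noise through the fit times its
transpose, which is the inverse Gram matrix. -/
theorem fit_covariance (h : IsUnit (gram X v).det) (lam : Fin d → ℝ) (σ : ℝ) :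
    fitMatrix X v * sampleCov U lam σ * (fitMatrix X v)ᵀ =
      ((Uᵀ * maskMatrix v * X) * (gram X v)⁻¹)ᵀ *
        (diagonal (fun l => lam l ^ 2) * ((Uᵀ * maskMatrix v * X) * (gram X v)⁻¹))
      + σ ^ 2 • (gram X v)⁻¹ := by
  have h1 : Uᵀ * (fitMatrix X v)ᵀ = (Uᵀ * maskMatrix v * X) * (gram X v)⁻¹ := by
    rw [← transpose_transpose ((Uᵀ * maskMatrix v * X) * (gram X v)⁻¹), ← fitMatrix_mul,
      transpose_mul]
  rw [sampleCov, Matrix.mul_add, Matrix.add_mul, Matrix.mul_smul, Matrix.mul_one, Matrix.smul_mul,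
    fitMatrix_mul_transpose h, ← fitMatrix_mul, ← h1]
  simp only [Matrix.mul_assoc]

/-- The noise does not contribute: the rows of the fit lie in the observed column space of `X`,
which the residual annihilates. -/
theorem residual_fit_covariance (h : IsUnit (gram X v).det) (lam : Fin d → ℝ) (σ : ℝ) :
    Uᵀ * residualMatrix X v * sampleCov U lam σ * (fitMatrix X v)ᵀ =
      (Uᵀ * maskMatrix v * U - (Uᵀ * maskMatrix v * X) *
          ((Uᵀ * maskMatrix v * X) * (gram X v)⁻¹)ᵀ) *
        (diagonal (fun l => lam l ^ 2) * ((Uᵀ * maskMatrix v * X) * (gram X v)⁻¹)) := by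
  have h1 : Uᵀ * (fitMatrix X v)ᵀ = (Uᵀ * maskMatrix v * X) * (gram X v)⁻¹ := by
    rw [← transpose_transpose ((Uᵀ * maskMatrix v * X) * (gram X v)⁻¹), ← fitMatrix_mul,
      transpose_mul]
  have h2 : residualMatrix X v * (fitMatrix X v)ᵀ = 0 := by
    rw [residualMatrix, Matrix.mul_assoc, Matrix.sub_mul, Matrix.one_mul, Matrix.mul_assoc X,
      fitMatrix_mul_transpose h, fitMatrix_transpose, Matrix.mul_sub, ← Matrix.mul_assoc,
      ← Matrix.mul_assoc, ← Matrix.mul_assoc, maskMatrix_mul_self, sub_self]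
  have h3 : Uᵀ * residualMatrix X v * U = Uᵀ * maskMatrix v * U - (Uᵀ * maskMatrix v * X) *
      ((Uᵀ * maskMatrix v * X) * (gram X v)⁻¹)ᵀ := by
    rw [← fitMatrix_mul, residualMatrix, Matrix.mul_sub, Matrix.mul_one, Matrix.mul_sub,
      Matrix.sub_mul]
    simp only [Matrix.mul_assoc]
  rw [sampleCov, Matrix.mul_add, Matrix.add_mul, Matrix.mul_smul, Matrix.mul_one, Matrix.smul_mul,
    Matrix.mul_assoc Uᵀ (residualMatrix X v) (fitMatrix X v)ᵀ, h2, Matrix.mul_zero, smul_zero, add_zero, ← h3, ← h1]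
  simp only [Matrix.mul_assoc]

theorem sample_fit_covariance (lam : Fin d → ℝ) (σ : ℝ) :
    sampleCov U lam σ * (fitMatrix X v)ᵀ =
      U * (diagonal (fun l => lam l ^ 2) * ((Uᵀ * maskMatrix v * X) * (gram X v)⁻¹))
        + σ ^ 2 • (maskMatrix v * (X * (gram X v)⁻¹)) := by
  have h1 : Uᵀ * (fitMatrix X v)ᵀ = (Uᵀ * maskMatrix v * X) * (gram X v)⁻¹ := by
    rw [← transpose_transpose ((Uᵀ * maskMatrix v * X) * (gram X v)⁻¹), ← fitMatrix_mul,
      transpose_mul]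
  rw [sampleCov, Matrix.add_mul, Matrix.smul_mul, Matrix.one_mul, ← h1, fitMatrix_transpose]
  simp only [Matrix.mul_assoc]

/-- The energy of the residual. -/
theorem l2norm_residual_sq (h : IsUnit (gram X v).det) (s : Fin n → ℝ) (σ : ℝ) :
    l2norm (residualMatrix X v *ᵥ s) ^ 2 =
      (∑ i, if v i then s i ^ 2 - σ ^ 2 else 0) + σ ^ 2 * (∑ i, if v i then 1 else 0)
        - (fitMatrix X v *ᵥ s) ⬝ᵥ (gram X v *ᵥ (fitMatrix X v *ᵥ s)) := by
  set w := fitMatrix X v *ᵥ s with hw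
  have h1 : (maskMatrix v *ᵥ s) ⬝ᵥ (maskMatrix v *ᵥ s) =
      (∑ i, if v i then s i ^ 2 - σ ^ 2 else 0) + σ ^ 2 * (∑ i, if v i then 1 else 0) := by
    rw [Finset.mul_sum, ← Finset.sum_add_distrib, dotProduct]
    refine Finset.sum_congr rfl fun i _ => ?_
    rw [maskMatrix, mulVec_diagonal]
    split_ifs <;> ring
  have hgram : gram X v = (maskMatrix v * X)ᵀ * (maskMatrix v * X) := by
    rw [transpose_mul, maskMatrix_transpose, Matrix.mul_assoc, ← Matrix.mul_assoc (maskMatrix v),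
      maskMatrix_mul_self, gram, Matrix.mul_assoc]
  have h2 : (maskMatrix v *ᵥ (X *ᵥ w)) ⬝ᵥ (maskMatrix v *ᵥ (X *ᵥ w)) = w ⬝ᵥ (gram X v *ᵥ w) := by
    rw [mulVec_mulVec, mulVec_dotProduct, mulVec_mulVec, hgram]
  have h3 : (maskMatrix v *ᵥ s) ⬝ᵥ (maskMatrix v *ᵥ (X *ᵥ w)) = w ⬝ᵥ (gram X v *ᵥ w) := by
    have h4 : gram X v *ᵥ w = (Xᵀ * maskMatrix v) *ᵥ s := by
      rw [hw, mulVec_mulVec, fitMatrix, Matrix.mul_nonsing_inv_cancel_left _ _ h]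
    have h5 : (maskMatrix v * X)ᵀ * maskMatrix v = Xᵀ * maskMatrix v := by
      rw [transpose_mul, maskMatrix_transpose, Matrix.mul_assoc, maskMatrix_mul_self]
    rw [h4, ← h5, mulVec_mulVec w (maskMatrix v), dotProduct_comm, mulVec_dotProduct,
      mulVec_mulVec]
  rw [l2norm_sq, ← residual_eq, ← hw, sub_dotProduct, dotProduct_sub, dotProduct_sub, h1, h2, h3,
    dotProduct_comm (maskMatrix v *ᵥ (X *ᵥ w)) (maskMatrix v *ᵥ s), h3]
  ring

end

end

end SubspaceTracking

namespace SubspaceTracking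

noncomputable section

open scoped Matrix.Norms.L2Operator

/-! ### Mean increment of the similarity matrix -/

theorem norm_transpose_mul_le_one {n d : ℕ} {U X : Matrix (Fin n) (Fin d) ℝ} (hU : Uᵀ * U = 1)
    (hX : Xᵀ * X = 1) : ‖Uᵀ * X‖ ≤ 1 :=
  (norm_mul_le_of_le (by rw [norm_transpose]; exact norm_le_one_of_transpose_mul hU)
    (norm_le_one_of_transpose_mul hX)).trans_eq (one_mul 1)

theorem norm_transpose_mul_maskMatrix_mul_le_one {n d : ℕ} {U X : Matrix (Fin n) (Fin d) ℝ}
    (hU : Uᵀ * U = 1) (hX : Xᵀ * X = 1) (v : Fin n → Bool) : ‖Uᵀ * maskMatrix v * X‖ ≤ 1 :=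
  have h1 : ‖Uᵀ‖ ≤ 1 := by rw [norm_transpose]; exact norm_le_one_of_transpose_mul hU
  (norm_mul_le_of_le (norm_mul_le_of_le h1 (norm_maskMatrix_le v))
    (norm_le_one_of_transpose_mul hX)).trans_eq (by norm_num)

/-- The mean increment, multiplied by the dimension, of the cosine similarity matrix in the
high-dimensional limit. -/
def driftField {d : ℕ} (α σ τ : ℝ) (lam : Fin d → ℝ) (Q : Matrix (Fin d) (Fin d) ℝ) :
    Matrix (Fin d) (Fin d) ℝ :=
  τ • (α • ((1 - Q * Qᵀ) * (diagonal (fun l => lam l ^ 2) * Q)) -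
    (τ * (α * σ ^ 2) / 2) • (Q * (Qᵀ * (diagonal (fun l => lam l ^ 2) * Q) + (σ ^ 2 / α) • 1)))

theorem abs_integral_sub_le {Ω : Type*} [MeasurableSpace Ω] {μ : Measure Ω} {f g h : Ω → ℝ}
    (hf : Integrable f μ) (hg : Integrable g μ) (hh : Integrable h μ)
    (hle : ∀ ω, |f ω - g ω| ≤ h ω) : |∫ ω, f ω ∂μ - ∫ ω, g ω ∂μ| ≤ ∫ ω, h ω ∂μ := by
  rw [← integral_sub hf hg]
  exact (abs_integral_le_integral_abs).trans (integral_mono (hf.sub hg).abs hh hle)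

theorem one_div_le_of_one_div_sqrt_le {n : ℕ} (hn : 0 < n) {η : ℝ} (h : 1 / √(n : ℝ) ≤ η) :
    1 / (n : ℝ) ≤ η := by
  refine le_trans ?_ h
  have hn1 : (1 : ℝ) ≤ n := by exact_mod_cast hn
  gcongr
  exact Real.sqrt_le_iff.2 ⟨by positivity, by nlinarith⟩

section

variable {d : ℕ} {C : ℕ → ℝ} {lam : Fin d → ℝ} {σ ε α τ : ℝ}

/-- In the mean, the energy of the residual may be replaced by its limit. -/
theorem exists_residual_energy_bound (hd : 0 < d) (hε : 0 < ε) (hC : ∀ m, 0 ≤ C m)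
    (σ : ℝ) :
    ∃ K : ℝ, 0 < K ∧ ∀ {n : ℕ} {U X : Matrix (Fin n) (Fin d) ℝ} {lam : Fin d → ℝ}
      {v : Fin n → Bool} {ζ : Measure (Fin n → ℝ)} {η : ℝ}, IsSampleLaw U lam σ C ζ →
      0 < n → Uᵀ * U = 1 → Xᵀ * X = 1 → ε < lambdaMin (gram X v) →
      |(∑ i, if v i then 1 else 0) / (n : ℝ) - α| ≤ η → 1 / √(n : ℝ) ≤ η → ∀ i j,
      |∫ s, l2norm (residualMatrix X v *ᵥ s) ^ 2 / n *
          (((Uᵀ * X) *ᵥ (fitMatrix X v *ᵥ s)) i * (fitMatrix X v *ᵥ s) j) ∂ζ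
        - α * σ ^ 2 * ∫ s, ((Uᵀ * X) *ᵥ (fitMatrix X v *ᵥ s)) i * (fitMatrix X v *ᵥ s) j ∂ζ|
        ≤ K * η := by
  obtain ⟨K2, hK2, h2⟩ := exists_load_moment_le hd hε hC 2
  obtain ⟨K3, hK3, h3⟩ := exists_load_moment_le hd hε hC 3
  obtain ⟨K4, hK4, h4⟩ := exists_load_moment_le hd hε hC 4
  refine ⟨C 0 + K4 + σ ^ 2 * K2 + K3, by have := hC 0; positivity, ?_⟩
  intro n U X lam v ζ η hζ hn hU hX hv htr hη i j
  have hp := hζ.prob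
  have hn0 : (0 : ℝ) < n := by exact_mod_cast hn
  have hsq : 0 < √(n : ℝ) := Real.sqrt_pos.2 hn0
  have hη0 : 0 ≤ η := (by positivity : 0 ≤ 1 / √(n : ℝ)).trans hη
  have hdet := gram_isUnit_det hε hv
  set ρ : (Fin n → ℝ) → ℝ := fun s => l2norm (residualMatrix X v *ᵥ s) ^ 2 / n with hρ
  set f : (Fin n → ℝ) → ℝ := fun s =>
    ((Uᵀ * X) *ᵥ (fitMatrix X v *ᵥ s)) i * (fitMatrix X v *ᵥ s) j with hf
  set e : (Fin n → ℝ) → ℝ := fun s => (∑ i, if v i then s i ^ 2 - σ ^ 2 else 0) / n with he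
  set t : ℝ := (∑ i, if v i then 1 else 0) / (n : ℝ) with ht
  have hfm : HasMoments f ζ := by
    simp only [hf, mulVec_mulVec]
    exact (hζ.hasMoments_mulVec _ i).mul (hζ.hasMoments_mulVec _ j)
  have hρm : HasMoments ρ ζ := by
    have := (hζ.hasMoments_mulVec_dotProduct_self (residualMatrix X v)).const_mul (n : ℝ)⁻¹
    simpa only [hρ, l2norm_sq, div_eq_inv_mul] using this
  have hem : HasMoments e ζ := by
    have h1 : HasMoments (fun s : Fin n → ℝ => ∑ i, if v i then s i ^ 2 - σ ^ 2 else 0) ζ := by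
      refine HasMoments.sum _ fun k _ => ?_
      split_ifs
      · exact ((hζ.hasMoments k).pow 2).sub (HasMoments.const _)
      · exact HasMoments.const _
    simpa only [he, div_eq_inv_mul] using h1.const_mul (n : ℝ)⁻¹
  have hY := hζ.hasMoments_load X v
  have hfb : ∀ s, |f s| ≤ load U X v s ^ 2 := fun s => by
    have h1 : |((Uᵀ * X) *ᵥ (fitMatrix X v *ᵥ s)) i| ≤ load U X v s :=
      (abs_apply_le_l2norm _ i).trans <| (l2norm_mulVec_le _ _).trans <|
        (mul_le_of_le_one_left (l2norm_nonneg _) (norm_transpose_mul_le_one hU hX)).trans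
          (le_of_sq_le one_le_load l2norm_fit_sq_le_load)
    have h2 : |(fitMatrix X v *ᵥ s) j| ≤ load U X v s := abs_fit_le_load j
    rw [hf, abs_mul, sq]
    exact mul_le_mul h1 h2 (abs_nonneg _) ((abs_nonneg _).trans h1)
  have hSle : ‖gram X v‖ ≤ 1 := norm_transpose_mul_maskMatrix_mul_le_one hX hX v
  -- Three deviations: `e` is the fluctuation of the observed energy, `t - α` that of the observed
  -- fraction, and `q/n` the energy absorbed by the fit.
  have hρb : ∀ s, |ρ s - α * σ ^ 2| ≤ |e s| + σ ^ 2 * η + load U X v s / n := fun s => by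
    set q := (fitMatrix X v *ᵥ s) ⬝ᵥ (gram X v *ᵥ (fitMatrix X v *ᵥ s)) with hq
    have h1 : ρ s = e s + σ ^ 2 * t - q / n := by
      simp only [hρ, he, ht]
      rw [l2norm_residual_sq hdet s σ]
      ring
    have h2 : |q| ≤ load U X v s := by
      refine (quadratic_le_norm _ _).trans ?_
      rw [← l2norm_sq]
      exact (mul_le_of_le_one_left (sq_nonneg _) hSle).trans l2norm_fit_sq_le_load
    have h3 : ρ s - α * σ ^ 2 = e s + σ ^ 2 * (t - α) - q / n := by rw [h1]; ring
    rw [h3]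
    calc |e s + σ ^ 2 * (t - α) - q / n| ≤ |e s| + |σ ^ 2 * (t - α)| + |q / n| :=
          (abs_sub _ _).trans (add_le_add_left (abs_add_le _ _) _)
      _ ≤ _ := by
        rw [abs_mul, abs_of_nonneg (sq_nonneg σ), abs_div q, abs_of_pos hn0]
        gcongr
  rw [← integral_const_mul]
  have hdom : HasMoments (fun s => √(n : ℝ) * e s ^ 2 + (1 / √(n : ℝ)) * load U X v s ^ 4
      + σ ^ 2 * η * load U X v s ^ 2 + 1 / n * load U X v s ^ 3) ζ :=
    ((((hem.pow 2).const_mul _).add ((hY.pow 4).const_mul _)).add ((hY.pow 2).const_mul _)).add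
      ((hY.pow 3).const_mul _)
  refine (abs_integral_sub_le (hρm.mul hfm).integrable (hfm.const_mul _).integrable
    hdom.integrable fun s => ?_).trans ?_
  · have hY1 : 1 ≤ load U X v s := one_le_load
    set Y := load U X v s
    -- Weighted so that both terms have mean `O(1/√n)`, given that `e²` has mean `O(1/n)`.
    have h5 : |e s| * Y ^ 2 ≤ √(n : ℝ) * e s ^ 2 + (1 / √(n : ℝ)) * Y ^ 4 := by
      have h6 : √(n : ℝ) * (1 / √(n : ℝ)) = 1 := by field_simp
      rw [← sq_abs (e s)]
      have h7 := sq_nonneg (√(n : ℝ) * |e s| - Y ^ 2)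
      have h8 : 0 ≤ |e s| * Y ^ 2 := by positivity
      have h9 : |e s| * Y ^ 2 * √(n : ℝ) ≤ √(n : ℝ) ^ 2 * |e s| ^ 2 + Y ^ 4 := by
        nlinarith [sq_nonneg (√(n : ℝ) * |e s|), sq_nonneg (Y ^ 2)]
      have h10 : |e s| * Y ^ 2 ≤ (√(n : ℝ) ^ 2 * |e s| ^ 2 + Y ^ 4) / √(n : ℝ) := by
        rwa [le_div_iff₀ hsq]
      refine h10.trans_eq ?_
      field_simp
    calc |ρ s * f s - α * σ ^ 2 * f s| = |ρ s - α * σ ^ 2| * |f s| := by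
          rw [← abs_mul]; ring_nf
      _ ≤ (|e s| + σ ^ 2 * η + Y / n) * Y ^ 2 := by
          have := hρb s
          have := hfb s
          gcongr
      _ = |e s| * Y ^ 2 + σ ^ 2 * η * Y ^ 2 + 1 / n * Y ^ 3 := by ring
      _ ≤ _ := by linarith
  · rw [integral_add ((((hem.pow 2).const_mul _).add ((hY.pow 4).const_mul _)).add
        ((hY.pow 2).const_mul _)).integrable ((hY.pow 3).const_mul _).integrable,
      integral_add (((hem.pow 2).const_mul _).add ((hY.pow 4).const_mul _)).integrable
        ((hY.pow 2).const_mul _).integrable,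
      integral_add ((hem.pow 2).const_mul _).integrable ((hY.pow 4).const_mul _).integrable,
      integral_const_mul, integral_const_mul, integral_const_mul, integral_const_mul]
    have e1 : √(n : ℝ) * ∫ s, e s ^ 2 ∂ζ ≤ C 0 * η := by
      calc _ ≤ √(n : ℝ) * (C 0 / n) := by gcongr; exact hζ.energy v
        _ = C 0 * (1 / √(n : ℝ)) := by
          nth_rewrite 2 [← Real.sq_sqrt hn0.le]
          field_simp
        _ ≤ _ := mul_le_mul_of_nonneg_left hη (hC 0)
    have e2 : 1 / √(n : ℝ) * ∫ s, load U X v s ^ 4 ∂ζ ≤ η * K4 :=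
      mul_le_mul hη (h4 hζ hn hU hX hv).2 (integral_nonneg fun s => by positivity) hη0
    have e3 : σ ^ 2 * η * ∫ s, load U X v s ^ 2 ∂ζ ≤ σ ^ 2 * η * K2 :=
      mul_le_mul_of_nonneg_left (h2 hζ hn hU hX hv).2 (by positivity)
    have e4 : 1 / (n : ℝ) * ∫ s, load U X v s ^ 3 ∂ζ ≤ η * K3 :=
      mul_le_mul (one_div_le_of_one_div_sqrt_le hn hη) (h3 hζ hn hU hX hv).2
        (integral_nonneg fun s => by
          have : 1 ≤ load U X v s := one_le_load
          simp only [Pi.zero_apply]; positivity) hη0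
    linarith

/-- The mean increment of the cosine similarity matrix. -/
theorem exists_drift_bound (alg : Algorithm) (hd : 0 < d) (hα : 0 < α) (hα1 : α ≤ 1)
    (hτ : 0 < τ) (hε : 0 < ε) (hC : ∀ m, 0 ≤ C m) (σ : ℝ) (lam : Fin d → ℝ) :
    ∃ K : ℝ, 0 < K ∧ ∀ {n : ℕ} {U X : Matrix (Fin n) (Fin d) ℝ}
      {v : Fin n → Bool} {ζ : Measure (Fin n → ℝ)} {η : ℝ}, IsSampleLaw U lam σ C ζ →
      0 < n → Uᵀ * U = 1 → Xᵀ * X = 1 → ε < lambdaMin (gram X v) →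
      ‖gram X v - α • 1‖ ≤ η → ‖Uᵀ * maskMatrix v * X - α • (Uᵀ * X)‖ ≤ η →
      ‖Uᵀ * maskMatrix v * U - α • 1‖ ≤ η →
      |(∑ i, if v i then 1 else 0) / (n : ℝ) - α| ≤ η → 1 / √(n : ℝ) ≤ η → ∀ i j,
      |∫ s, ((Uᵀ * updateMatrix alg (τ / n) X v s) i j - (Uᵀ * X) i j) ∂ζ
        - 1 / n * driftField α σ τ lam (Uᵀ * X) i j| ≤ K / n * η := by
  obtain ⟨K1, hK1, h1⟩ := exists_increment_bounds alg hτ hε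
  obtain ⟨K5, hK5, h5⟩ := exists_load_moment_le hd hε hC 5
  obtain ⟨K2, hK2, h2⟩ := exists_residual_energy_bound (α := α) hd hε hC σ
  obtain ⟨K3, hK3, h3⟩ := exists_covariance_limit_bound σ hα hα1 hε
    (norm_nonneg (diagonal (fun l => lam l ^ 2) : Matrix (Fin d) (Fin d) ℝ))
  refine ⟨K1 * K5 + τ * (τ / 2 * K2) + τ * (K3 + τ * (α * σ ^ 2) / 2 * K3), by positivity, ?_⟩
  intro n U X v ζ η hζ hn hU hX hv hS hB hD htr hη i j
  have hp := hζ.prob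
  have hn0 : (0 : ℝ) < n := by exact_mod_cast hn
  have hη0 : 0 ≤ η := (norm_nonneg _).trans hS
  have hdet := gram_isUnit_det hε hv
  have hY := hζ.hasMoments_load X v
  have hinc := fun s => (h1 hn hU hX hv s).1 i j
  set z : (Fin n → ℝ) → ℝ := fun s => (Uᵀ *ᵥ (residualMatrix X v *ᵥ s)) i with hz
  set ρ : (Fin n → ℝ) → ℝ := fun s => l2norm (residualMatrix X v *ᵥ s) ^ 2 / n with hρ
  set q : (Fin n → ℝ) → ℝ := fun s => ((Uᵀ * X) *ᵥ (fitMatrix X v *ᵥ s)) i with hq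
  set w : (Fin n → ℝ) → ℝ := fun s => (fitMatrix X v *ᵥ s) j with hw
  set δ : (Fin n → ℝ) → ℝ := fun s =>
    (Uᵀ * updateMatrix alg (τ / n) X v s) i j - (Uᵀ * X) i j with hδ
  have hzm : HasMoments z ζ := by
    simp only [hz, mulVec_mulVec]; exact hζ.hasMoments_mulVec _ i
  have hqm : HasMoments q ζ := by
    simp only [hq, mulVec_mulVec]; exact hζ.hasMoments_mulVec _ i
  have hwm : HasMoments w ζ := hζ.hasMoments_mulVec _ j
  have hρm : HasMoments ρ ζ := by
    have := (hζ.hasMoments_mulVec_dotProduct_self (residualMatrix X v)).const_mul (n : ℝ)⁻¹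
    simpa only [hρ, l2norm_sq, div_eq_inv_mul] using this
  have hδm : HasMoments δ ζ := by
    refine HasMoments.sub ?_ (HasMoments.const _)
    simp only [Matrix.mul_apply]
    exact HasMoments.sum _ fun k _ =>
      (hζ.hasMoments_updateMatrix alg hτ hε hn hU hX hv k j).const_mul _
  have hgm : HasMoments (fun s => τ / n * ((z s - τ / 2 * ρ s * q s) * w s)) ζ :=
    ((hzm.sub ((hρm.const_mul _).mul hqm)).mul hwm).const_mul _
  have s1 : |∫ s, δ s ∂ζ - ∫ s, τ / n * ((z s - τ / 2 * ρ s * q s) * w s) ∂ζ| ≤ K1 * K5 / n * η := by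
    refine (abs_integral_sub_le hδm.integrable hgm.integrable
      ((hY.pow 5).const_mul (K1 / n ^ 2)).integrable hinc).trans ?_
    rw [integral_const_mul]
    calc _ ≤ K1 / n ^ 2 * K5 := by gcongr; exact (h5 hζ hn hU hX hv).2
      _ = K1 * K5 / n * (1 / n) := by ring
      _ ≤ _ := by gcongr; exact one_div_le_of_one_div_sqrt_le hn hη
  have s2 := h2 hζ hn hU hX hv htr hη i j
  have c1 : ∫ s, z s * w s ∂ζ = (Uᵀ * residualMatrix X v * sampleCov U lam σ
      * (fitMatrix X v)ᵀ) i j := by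
    rw [← hζ.integral_mulVec_mul_mulVec]
    simp only [hz, hw, mulVec_mulVec]
  have c2 : ∫ s, q s * w s ∂ζ = (Uᵀ * X * (fitMatrix X v * sampleCov U lam σ
      * (fitMatrix X v)ᵀ)) i j := by
    rw [← Matrix.mul_assoc, ← Matrix.mul_assoc, ← hζ.integral_mulVec_mul_mulVec]
    simp only [hq, hw, mulVec_mulVec]
  obtain ⟨m1, m2⟩ := h3 (Γ := diagonal (fun l => lam l ^ 2)) (Matrix.nonsing_inv_mul _ hdet)
    (norm_gram_inv_le hε hv) (norm_transpose_mul_maskMatrix_mul_le_one hU hX v)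
    (norm_transpose_mul_le_one hU hX) le_rfl hS hB hD
  rw [residual_fit_covariance hdet] at c1
  rw [fit_covariance hdet] at c2
  have m1' := (abs_apply_le_norm _ i j).trans m1
  have m2' := (abs_apply_le_norm _ i j).trans m2
  rw [Matrix.sub_apply, ← c1] at m1'
  rw [Matrix.sub_apply, ← c2] at m2'
  have s3 : ∫ s, τ / n * ((z s - τ / 2 * ρ s * q s) * w s) ∂ζ
      = τ / n * (∫ s, z s * w s ∂ζ - τ / 2 * ∫ s, ρ s * (q s * w s) ∂ζ) := by
    rw [integral_const_mul, ← integral_const_mul (τ / 2),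
      ← integral_sub (hzm.mul hwm).integrable ((hρm.mul (hqm.mul hwm)).const_mul _).integrable]
    congr 1
    refine integral_congr_ae (.of_forall fun s => ?_)
    simp only
    ring
  rw [s3] at s1
  set Y1 : Matrix (Fin d) (Fin d) ℝ :=
    α • ((1 - (Uᵀ * X) * (Uᵀ * X)ᵀ) * (diagonal (fun l => lam l ^ 2) * (Uᵀ * X))) with hY1
  set Y2 : Matrix (Fin d) (Fin d) ℝ :=
    (Uᵀ * X) * ((Uᵀ * X)ᵀ * (diagonal (fun l => lam l ^ 2) * (Uᵀ * X)) + (σ ^ 2 / α) • 1) with hY2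
  have hF : driftField α σ τ lam (Uᵀ * X) i j
      = τ * (Y1 i j - τ * (α * σ ^ 2) / 2 * Y2 i j) := by
    simp only [driftField, Matrix.smul_apply, Matrix.sub_apply, smul_eq_mul, hY1, hY2]
  rw [hF]
  set x1 := ∫ s, z s * w s ∂ζ
  set x2 := ∫ s, q s * w s ∂ζ
  set x3 := ∫ s, ρ s * (q s * w s) ∂ζ
  set y1 := Y1 i j
  set y2 := Y2 i j
  have s2' : |x3 - α * σ ^ 2 * x2| ≤ K2 * η := s2
  -- The error splits into the expansion of the coefficients, the replacement of the residual energy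
  -- by `ασ²`, and the replacement of the covariances by their limits.
  have e1 : ∫ s, δ s ∂ζ - 1 / n * (τ * (y1 - τ * (α * σ ^ 2) / 2 * y2))
      = (∫ s, δ s ∂ζ - τ / n * (x1 - τ / 2 * x3))
        + (-(τ / n * (τ / 2)) * (x3 - α * σ ^ 2 * x2) + τ / n * ((x1 - y1)
        - τ * (α * σ ^ 2) / 2 * (x2 - y2))) := by
    field_simp
    ring
  rw [e1]
  have t1 : |-(τ / n * (τ / 2)) * (x3 - α * σ ^ 2 * x2)| ≤ τ / n * (τ / 2) * (K2 * η) := by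
    rw [abs_mul, abs_neg, abs_of_nonneg (by positivity)]
    gcongr
  have t2 : |τ / n * ((x1 - y1) - τ * (α * σ ^ 2) / 2 * (x2 - y2))|
      ≤ τ / n * (K3 * η + τ * (α * σ ^ 2) / 2 * (K3 * η)) := by
    rw [abs_mul, abs_of_nonneg (a := τ / (n : ℝ)) (by positivity)]
    gcongr
    refine (abs_sub _ _).trans ?_
    rw [abs_mul (τ * (α * σ ^ 2) / 2), abs_of_nonneg (a := τ * (α * σ ^ 2) / 2) (by positivity)]
    gcongr
  calc _ ≤ K1 * K5 / n * η + (τ / n * (τ / 2) * (K2 * η)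
        + τ / n * (K3 * η + τ * (α * σ ^ 2) / 2 * (K3 * η))) :=
        (abs_add_le _ _).trans (add_le_add s1 ((abs_add_le _ _).trans (add_le_add t1 t2)))
    _ = _ := by ring

end

end

end SubspaceTracking

namespace SubspaceTracking

noncomputable section

open scoped Matrix.Norms.L2Operator

/-! ### Preservation of incoherence -/

/-- The sum of the fourth powers of the entries of a matrix. -/
def fourthMoment {n d : ℕ} (X : Matrix (Fin n) (Fin d) ℝ) : ℝ := ∑ i, ∑ j, X i j ^ 4

theorem fourthMoment_nonneg {n d : ℕ} (X : Matrix (Fin n) (Fin d) ℝ) : 0 ≤ fourthMoment X :=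
  Finset.sum_nonneg fun i _ => Finset.sum_nonneg fun j _ => by positivity

theorem sum_sq_eq {n d : ℕ} {X : Matrix (Fin n) (Fin d) ℝ} (hX : Xᵀ * X = 1) :
    ∑ i, ∑ j, X i j ^ 2 = d := by
  rw [Finset.sum_comm]
  have : ∀ j, ∑ i, X i j ^ 2 = 1 := fun j => by
    have h : (Xᵀ * X) j j = 1 := by rw [hX]; simp
    rw [← h, Matrix.mul_apply]
    exact Finset.sum_congr rfl fun i _ => by rw [transpose_apply, sq]
  simp [this]

theorem abs_cube_mul_le (x y : ℝ) : |x| ^ 3 * |y| ≤ x ^ 4 + y ^ 4 := by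
  rw [← Even.pow_abs (n := 4) ⟨2, rfl⟩ x, ← Even.pow_abs (n := 4) ⟨2, rfl⟩ y]
  have hx := abs_nonneg x
  have hy := abs_nonneg y
  rcases le_total |x| |y| with h | h
  · calc |x| ^ 3 * |y| ≤ |y| ^ 3 * |y| := by gcongr
      _ = |y| ^ 4 := by ring
      _ ≤ _ := by linarith [pow_nonneg hx 4]
  · calc |x| ^ 3 * |y| ≤ |x| ^ 3 * |x| := by gcongr
      _ = |x| ^ 4 := by ring
      _ ≤ _ := by linarith [pow_nonneg hy 4]

theorem abs_mul_apply_le {k l m : ℕ} (A : Matrix (Fin k) (Fin l) ℝ) (B : Matrix (Fin l) (Fin m) ℝ)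
    (i : Fin k) (j : Fin m) : |(A * B) i j| ≤ (∑ p, |A i p|) * ‖B‖ := by
  rw [Matrix.mul_apply, Finset.sum_mul]
  refine (Finset.abs_sum_le_sum_abs _ _).trans (Finset.sum_le_sum fun p _ => ?_)
  rw [abs_mul]
  gcongr
  exact abs_apply_le_norm B p j

section

variable {d : ℕ} {C : ℕ → ℝ} {ε τ : ℝ}

/-- In `sample_fit_covariance` row `i` of the first term is a combination of row `i` of `U`, and of
the second a multiple of a combination of row `i` of `X`. Hence the mean drift of a row is bounded
by the rows themselves, which preserves incoherence. -/
theorem abs_integral_sample_mul_fit_le {n : ℕ} {U X : Matrix (Fin n) (Fin d) ℝ} {lam : Fin d → ℝ}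
    {σ : ℝ} {v : Fin n → Bool} {ζ : Measure (Fin n → ℝ)} (hζ : IsSampleLaw U lam σ C ζ)
    (hε : 0 < ε) (hU : Uᵀ * U = 1) (hX : Xᵀ * X = 1) (hv : ε < lambdaMin (gram X v))
    (i : Fin n) (j : Fin d) :
    |∫ s, s i * (fitMatrix X v *ᵥ s) j ∂ζ| ≤
      (‖diagonal (fun l => lam l ^ 2)‖ * (1 / ε) + σ ^ 2 * (1 / ε)) *
        ((∑ k, |X i k|) + ∑ k, |U i k|) := by
  have h1 : ∫ s, s i * (fitMatrix X v *ᵥ s) j ∂ζ = (sampleCov U lam σ * (fitMatrix X v)ᵀ) i j := by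
    rw [← Matrix.one_mul (sampleCov U lam σ), ← hζ.integral_mulVec_mul_mulVec]
    simp only [one_mulVec]
  have hN := norm_gram_inv_le hε hv
  have hM : ‖diagonal (fun l => lam l ^ 2) * ((Uᵀ * maskMatrix v * X) * (gram X v)⁻¹)‖
      ≤ ‖diagonal (fun l => lam l ^ 2)‖ * (1 / ε) :=
    norm_mul_le_of_le le_rfl ((norm_mul_le_of_le (norm_transpose_mul_maskMatrix_mul_le_one hU hX v)
      hN).trans_eq (one_mul _))
  rw [h1, sample_fit_covariance, Matrix.add_apply, Matrix.smul_apply, smul_eq_mul]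
  have hu : 0 ≤ ∑ k, |U i k| := Finset.sum_nonneg fun k _ => abs_nonneg _
  have hx : 0 ≤ ∑ k, |X i k| := Finset.sum_nonneg fun k _ => abs_nonneg _
  have h2 : |(U * (diagonal (fun l => lam l ^ 2) * ((Uᵀ * maskMatrix v * X) *
      (gram X v)⁻¹))) i j| ≤ (∑ k, |U i k|) * (‖diagonal (fun l => lam l ^ 2)‖ * (1 / ε)) :=
    (abs_mul_apply_le _ _ i j).trans (by gcongr)
  have h3 : |(maskMatrix v * (X * (gram X v)⁻¹)) i j| ≤ (∑ k, |X i k|) * (1 / ε) := by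
    rw [maskMatrix, diagonal_mul, abs_mul]
    have h4 : |(if v i then 1 else 0 : ℝ)| ≤ 1 := by split_ifs <;> simp
    refine (mul_le_of_le_one_left (abs_nonneg _) h4).trans ?_
    exact (abs_mul_apply_le _ _ i j).trans (by gcongr)
  have hL : 0 ≤ ‖(diagonal (fun l => lam l ^ 2) : Matrix (Fin d) (Fin d) ℝ)‖ := norm_nonneg _
  calc _ ≤ (∑ k, |U i k|) * (‖diagonal (fun l => lam l ^ 2)‖ * (1 / ε))
        + σ ^ 2 * ((∑ k, |X i k|) * (1 / ε)) := by
        refine (abs_add_le _ _).trans (add_le_add h2 ?_)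
        rw [abs_mul, abs_of_nonneg (sq_nonneg σ)]
        gcongr
    _ ≤ _ := by
        have t1 : 0 ≤ (∑ k, |X i k|) * (‖diagonal (fun l => lam l ^ 2)‖ * (1 / ε)) := by positivity
        have t2 : 0 ≤ σ ^ 2 * ((∑ k, |U i k|) * (1 / ε)) := by positivity
        linarith

/-- The fourth moment of the estimate grows slowly in the mean. -/
theorem exists_fourthMoment_bound (alg : Algorithm) (hd : 0 < d)
    (hτ : 0 < τ) (hε : 0 < ε) (hC : ∀ m, 0 ≤ C m) (σ : ℝ) (lam : Fin d → ℝ) :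
    ∃ K : ℝ, 0 < K ∧ ∀ {n : ℕ} {U X : Matrix (Fin n) (Fin d) ℝ}
      {v : Fin n → Bool} {ζ : Measure (Fin n → ℝ)}, IsSampleLaw U lam σ C ζ →
      0 < n → Uᵀ * U = 1 → Xᵀ * X = 1 → ε < lambdaMin (gram X v) →
      ∫ s, fourthMoment (updateMatrix alg (τ / n) X v s) ∂ζ
        ≤ fourthMoment X + K / n * (fourthMoment X + fourthMoment U) + K / n ^ 2 := by
  obtain ⟨K1, hK1, h1⟩ := exists_increment_bounds alg hτ hε
  obtain ⟨K5, hK5, h5⟩ := exists_load_moment_le hd hε hC 5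
  obtain ⟨K10, hK10, h10⟩ := exists_load_moment_le hd hε hC 10
  obtain ⟨K20, hK20, h20⟩ := exists_load_moment_le hd hε hC 20
  set L := ‖(diagonal (fun l => lam l ^ 2) : Matrix (Fin d) (Fin d) ℝ)‖ * (1 / ε)
    + σ ^ 2 * (1 / ε) with hL
  have hL0 : 0 ≤ L := by positivity
  set k1 := τ * L + K1 * K5 with hk1
  have hk10 : 0 < k1 := by positivity
  have hd0 : (0 : ℝ) < d := by exact_mod_cast hd
  refine ⟨4 * k1 * (4 * d) + (4 * k1 * d + 16 * (K1 ^ 2 * K10 * d + K1 ^ 4 * K20 * d)),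
    by positivity, ?_⟩
  intro n U X v ζ hζ hn hU hX hv
  have hp := hζ.prob
  have hn0 : (0 : ℝ) < n := by exact_mod_cast hn
  have hn1 : (1 : ℝ) ≤ n := by exact_mod_cast hn
  have hY := hζ.hasMoments_load X v
  have hXm := fun i j => hζ.hasMoments_updateMatrix alg hτ hε hn hU hX hv i j
  have hδm : ∀ i j, HasMoments (fun s => updateMatrix alg (τ / n) X v s i j - X i j) ζ :=
    fun i j => (hXm i j).sub (HasMoments.const _)
  set ξ : Fin n → ℝ := fun i => ∑ k, |X i k| with hξ
  set υ : Fin n → ℝ := fun i => ∑ k, |U i k| with hυ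
  have hξ0 : ∀ i, 0 ≤ ξ i := fun i => Finset.sum_nonneg fun k _ => abs_nonneg _
  have hυ0 : ∀ i, 0 ≤ υ i := fun i => Finset.sum_nonneg fun k _ => abs_nonneg _
  -- The increment itself is only `O(1/n)`; its mean has the additional row factor, up to `n⁻²`.
  have mean : ∀ i j, |∫ s, (updateMatrix alg (τ / n) X v s i j - X i j) ∂ζ|
      ≤ k1 / n * (ξ i + υ i) + k1 / n ^ 2 := by
    intro i j
    have hZ := hζ.hasMoments_load_add X v i
    set u : ℝ := if v i then 1 else 0 with hu
    have hu1 : |u| ≤ 1 := by rw [hu]; split_ifs <;> simp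
    have hsw : HasMoments (fun s => s i * (fitMatrix X v *ᵥ s) j) ζ :=
      (hζ.hasMoments i).mul (hζ.hasMoments_mulVec _ j)
    have e1 := abs_integral_sub_le (hδm i j).integrable
      ((hsw.const_mul u).const_mul (τ / n)).integrable
      (((hY.pow 5).const_mul (K1 / n * ξ i)).add ((hZ.pow 5).const_mul (K1 / n ^ 2))).integrable
      (fun s => (h1 hn hU hX hv s).2.2.1 i j)
    rw [integral_add ((hY.pow 5).const_mul (K1 / n * ξ i)).integrable
      ((hZ.pow 5).const_mul (K1 / n ^ 2)).integrable, integral_const_mul, integral_const_mul,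
      integral_const_mul, integral_const_mul] at e1
    have e2 : |τ / n * (u * ∫ s, s i * (fitMatrix X v *ᵥ s) j ∂ζ)| ≤ τ / n * (L * (ξ i + υ i)) := by
      rw [abs_mul, abs_mul, abs_of_nonneg (a := τ / (n : ℝ)) (by positivity)]
      refine mul_le_mul_of_nonneg_left ?_ (by positivity)
      exact (mul_le_of_le_one_left (abs_nonneg _) hu1).trans
        (abs_integral_sample_mul_fit_le hζ hε hU hX hv i j)
    have e3 : K1 / n * ξ i * ∫ s, load U X v s ^ 5 ∂ζ ≤ K1 / n * ξ i * K5 := by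
      have := hξ0 i
      gcongr
      exact (h5 hζ hn hU hX hv).2
    have e4 : K1 / n ^ 2 * ∫ s, (load U X v s + s i ^ 2) ^ 5 ∂ζ ≤ K1 / n ^ 2 * K5 := by
      gcongr
      exact (h5 hζ hn hU hX hv).1 i
    have e5 : 0 ≤ K1 / n * K5 * υ i + τ * L / n ^ 2 := by have := hυ0 i; positivity
    have e6 := abs_add_le (∫ s, (updateMatrix alg (τ / n) X v s i j - X i j) ∂ζ
      - τ / n * (u * ∫ s, s i * (fitMatrix X v *ᵥ s) j ∂ζ))
      (τ / n * (u * ∫ s, s i * (fitMatrix X v *ᵥ s) j ∂ζ))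
    rw [sub_add_cancel] at e6
    have e7 : k1 / n * (ξ i + υ i) + k1 / n ^ 2 = τ / n * (L * (ξ i + υ i)) + K1 / n * ξ i * K5
        + K1 / n ^ 2 * K5 + (K1 / n * K5 * υ i + τ * L / n ^ 2) := by rw [hk1]; ring
    rw [e7]
    linarith
  have hδb : ∀ i j s, |updateMatrix alg (τ / n) X v s i j - X i j|
      ≤ K1 / n * (load U X v s + s i ^ 2) ^ 5 := fun i j s => (h1 hn hU hX hv s).2.2.2 i j
  have second : ∀ i j, ∫ s, (updateMatrix alg (τ / n) X v s i j - X i j) ^ 2 ∂ζ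
      ≤ K1 ^ 2 * K10 / n ^ 2 := by
    intro i j
    have hZ := hζ.hasMoments_load_add X v i
    calc _ ≤ ∫ s, (K1 / n) ^ 2 * (load U X v s + s i ^ 2) ^ 10 ∂ζ := by
          refine integral_mono ((hδm i j).pow 2).integrable
            ((hZ.pow 10).const_mul _).integrable fun s => ?_
          have := pow_le_pow_left₀ (abs_nonneg _) (hδb i j s) 2
          rw [sq_abs, mul_pow, ← pow_mul] at this
          exact this
      _ ≤ (K1 / n) ^ 2 * K10 := by
          rw [integral_const_mul]
          gcongr
          exact (h10 hζ hn hU hX hv).1 i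
      _ = _ := by ring
  -- The bound `n⁻⁴` is available, but `n⁻³` suffices: the sum over `n` rows then leaves `n⁻²`.
  have fourth : ∀ i j, ∫ s, (updateMatrix alg (τ / n) X v s i j - X i j) ^ 4 ∂ζ
      ≤ K1 ^ 4 * K20 / n ^ 3 := by
    intro i j
    have hZ := hζ.hasMoments_load_add X v i
    calc _ ≤ ∫ s, (K1 / n) ^ 4 * (load U X v s + s i ^ 2) ^ 20 ∂ζ := by
          refine integral_mono ((hδm i j).pow 4).integrable
            ((hZ.pow 20).const_mul _).integrable fun s => ?_
          have := pow_le_pow_left₀ (abs_nonneg _) (hδb i j s) 4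
          rw [Even.pow_abs ⟨2, rfl⟩, mul_pow, ← pow_mul] at this
          exact this
      _ ≤ (K1 / n) ^ 4 * K20 := by
          rw [integral_const_mul]
          gcongr
          exact (h20 hζ hn hU hX hv).1 i
      _ = K1 ^ 4 * K20 / n ^ 4 := by ring
      _ ≤ _ := by
          gcongr
          norm_num
  -- From `add_pow_even_le` at exponent four, whence `16 = 2⁴`: only the mean of the increment meets
  -- `X³`, while the second and fourth moments cover the rest.
  have entry : ∀ i j, ∫ s, updateMatrix alg (τ / n) X v s i j ^ 4 ∂ζ ≤
      X i j ^ 4 + 4 * |X i j| ^ 3 * (k1 / n * (ξ i + υ i) + k1 / n ^ 2)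
        + 16 * (X i j ^ 2 * (K1 ^ 2 * K10 / n ^ 2) + K1 ^ 4 * K20 / n ^ 3) := by
    intro i j
    set δ : (Fin n → ℝ) → ℝ := fun s => updateMatrix alg (τ / n) X v s i j - X i j with hδ
    have m1 : HasMoments δ ζ := hδm i j
    have hdom := (((HasMoments.const (μ := ζ) (X i j ^ 4)).add
      (m1.const_mul (4 * X i j ^ 3))).add
      ((((m1.pow 2).const_mul (X i j ^ 2)).add (m1.pow 4)).const_mul 16))
    calc _ ≤ ∫ s, (X i j ^ 4 + 4 * X i j ^ 3 * δ s + 16 * (X i j ^ 2 * δ s ^ 2 + δ s ^ 4)) ∂ζ := by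
          refine integral_mono ((hXm i j).pow 4).integrable hdom.integrable fun s => ?_
          have := add_pow_even_le (X i j) (δ s) 1
          norm_num at this
          have e : X i j + δ s = updateMatrix alg (τ / n) X v s i j := by rw [hδ]; ring
          rw [e] at this
          simp only
          linarith
      _ = X i j ^ 4 + 4 * X i j ^ 3 * ∫ s, δ s ∂ζ
          + 16 * (X i j ^ 2 * ∫ s, δ s ^ 2 ∂ζ + ∫ s, δ s ^ 4 ∂ζ) := by
          rw [integral_add ((HasMoments.const (μ := ζ) (X i j ^ 4)).add
            (m1.const_mul (4 * X i j ^ 3))).integrable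
            ((((m1.pow 2).const_mul (X i j ^ 2)).add (m1.pow 4)).const_mul 16).integrable,
            integral_add (HasMoments.const _).integrable (m1.const_mul _).integrable,
            integral_const_mul, integral_const_mul,
            integral_add ((m1.pow 2).const_mul _).integrable (m1.pow 4).integrable,
            integral_const_mul]
          simp
      _ ≤ _ := by
          have t1 : 4 * X i j ^ 3 * ∫ s, δ s ∂ζ
              ≤ 4 * |X i j| ^ 3 * (k1 / n * (ξ i + υ i) + k1 / n ^ 2) := by
            refine (le_abs_self _).trans ?_
            rw [abs_mul, abs_mul, abs_pow, abs_of_pos (a := (4 : ℝ)) (by norm_num)]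
            gcongr
            exact mean i j
          have t2 := second i j
          have t3 := fourth i j
          gcongr
  have hX1 : ∀ i j, |X i j| ≤ 1 := fun i j =>
    (abs_apply_le_norm X i j).trans (norm_le_one_of_transpose_mul hX)
  -- The remainder `|X|³ n⁻²` is weakened to `X² n⁻²` by `|X| ≤ 1`, since the squares of the entries
  -- sum to `d`.
  have entry' : ∀ i j, ∫ s, updateMatrix alg (τ / n) X v s i j ^ 4 ∂ζ ≤
      X i j ^ 4 + 4 * k1 / n * (2 * d * X i j ^ 4 + ∑ k, X i k ^ 4 + ∑ k, U i k ^ 4)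
        + (4 * k1 + 16 * (K1 ^ 2 * K10)) / n ^ 2 * X i j ^ 2 + 16 * (K1 ^ 4 * K20 / n ^ 3) := by
    intro i j
    have t1 : |X i j| ^ 3 * ξ i ≤ d * X i j ^ 4 + ∑ k, X i k ^ 4 := by
      calc |X i j| ^ 3 * ξ i = ∑ k, |X i j| ^ 3 * |X i k| := by rw [hξ, Finset.mul_sum]
        _ ≤ ∑ k, (X i j ^ 4 + X i k ^ 4) :=
          Finset.sum_le_sum fun k _ => abs_cube_mul_le _ _
        _ = _ := by simp [Finset.sum_add_distrib]
    have t2 : |X i j| ^ 3 * υ i ≤ d * X i j ^ 4 + ∑ k, U i k ^ 4 := by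
      calc |X i j| ^ 3 * υ i = ∑ k, |X i j| ^ 3 * |U i k| := by rw [hυ, Finset.mul_sum]
        _ ≤ ∑ k, (X i j ^ 4 + U i k ^ 4) :=
          Finset.sum_le_sum fun k _ => abs_cube_mul_le _ _
        _ = _ := by simp [Finset.sum_add_distrib]
    have t3 : |X i j| ^ 3 ≤ X i j ^ 2 := by
      rw [← sq_abs]
      exact pow_le_pow_of_le_one (abs_nonneg _) (hX1 i j) (by norm_num)
    calc _ ≤ _ := entry i j
      _ = X i j ^ 4 + 4 * k1 / n * (|X i j| ^ 3 * ξ i + |X i j| ^ 3 * υ i)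
          + (4 * k1 / n ^ 2 * |X i j| ^ 3 + 16 * (K1 ^ 2 * K10) / n ^ 2 * X i j ^ 2)
          + 16 * (K1 ^ 4 * K20 / n ^ 3) := by ring
      _ ≤ X i j ^ 4 + 4 * k1 / n * ((d * X i j ^ 4 + ∑ k, X i k ^ 4)
            + (d * X i j ^ 4 + ∑ k, U i k ^ 4))
          + (4 * k1 / n ^ 2 * X i j ^ 2 + 16 * (K1 ^ 2 * K10) / n ^ 2 * X i j ^ 2)
          + 16 * (K1 ^ 4 * K20 / n ^ 3) := by gcongr
      _ = _ := by ring
  unfold fourthMoment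
  rw [integral_finsetSum _ fun i _ => (HasMoments.sum _ fun j _ => (hXm i j).pow 4).integrable]
  have hsplit : ∀ i, ∫ s, ∑ j, updateMatrix alg (τ / n) X v s i j ^ 4 ∂ζ
      = ∑ j, ∫ s, updateMatrix alg (τ / n) X v s i j ^ 4 ∂ζ := fun i =>
    integral_finsetSum _ fun j _ => ((hXm i j).pow 4).integrable
  simp only [hsplit]
  set SX := ∑ i, ∑ j, X i j ^ 4 with hSX
  set SU := ∑ i, ∑ j, U i j ^ 4 with hSU
  have hSX0 : 0 ≤ SX := fourthMoment_nonneg X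
  have hSU0 : 0 ≤ SU := fourthMoment_nonneg U
  calc _ ≤ ∑ i, ∑ j, (X i j ^ 4 + 4 * k1 / n * (2 * d * X i j ^ 4 + ∑ k, X i k ^ 4 + ∑ k, U i k ^ 4)
        + (4 * k1 + 16 * (K1 ^ 2 * K10)) / n ^ 2 * X i j ^ 2 + 16 * (K1 ^ 4 * K20 / n ^ 3)) :=
        Finset.sum_le_sum fun i _ => Finset.sum_le_sum fun j _ => entry' i j
    _ = SX + 4 * k1 / n * (2 * d * SX + d * SX + d * SU)
        + (4 * k1 + 16 * (K1 ^ 2 * K10)) / n ^ 2 * d + n * (d * (16 * (K1 ^ 4 * K20 / n ^ 3))) := by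
        have hsq := sum_sq_eq hX
        simp only [Finset.sum_add_distrib, ← Finset.mul_sum, Finset.sum_const, Finset.card_univ,
          Fintype.card_fin, nsmul_eq_mul]
        rw [hsq]
        ring
    _ = SX + 4 * k1 / n * d * (3 * SX + SU) + (4 * k1 * d + 16 * (K1 ^ 2 * K10 * d
          + K1 ^ 4 * K20 * d)) / n ^ 2 := by
        field_simp
        ring
    _ ≤ SX + (4 * k1 * (4 * d)) / n * (SX + SU) + (4 * k1 * d + 16 * (K1 ^ 2 * K10 * d
          + K1 ^ 4 * K20 * d)) / n ^ 2 := by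
        have : 4 * k1 / n * d * (3 * SX + SU) ≤ 4 * k1 / n * d * (4 * (SX + SU)) := by
          gcongr
          linarith
        have e : 4 * k1 / n * d * (4 * (SX + SU)) = (4 * k1 * (4 * d)) / n * (SX + SU) := by ring
        linarith
    _ ≤ _ := by
        have tB : 0 ≤ 4 * k1 * d + 16 * (K1 ^ 2 * K10 * d + K1 ^ 4 * K20 * d) := by positivity
        have tA : 0 ≤ 4 * k1 * (4 * d) := by positivity
        refine add_le_add (add_le_add le_rfl (mul_le_mul_of_nonneg_right
          (div_le_div_of_nonneg_right ?_ hn0.le) (by positivity)))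
          (div_le_div_of_nonneg_right ?_ (by positivity)) <;> linarith

end

end

end SubspaceTracking

namespace SubspaceTracking

noncomputable section

open scoped Matrix.Norms.L2Operator

/-! ### The mean of one step for a fixed observation pattern -/

/-- The squared Frobenius distance. -/
def distSq {k l : ℕ} (A B : Matrix (Fin k) (Fin l) ℝ) : ℝ := ∑ i, ∑ j, (A i j - B i j) ^ 2

theorem distSq_nonneg {k l : ℕ} (A B : Matrix (Fin k) (Fin l) ℝ) : 0 ≤ distSq A B :=
  Finset.sum_nonneg fun _ _ => Finset.sum_nonneg fun _ _ => sq_nonneg _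

theorem norm_sub_sq_le_distSq {k l : ℕ} (A B : Matrix (Fin k) (Fin l) ℝ) :
    ‖A - B‖ ^ 2 ≤ distSq A B := by
  have h : ‖A - B‖ ≤ √(distSq A B) := by
    refine norm_le_of_forall_l2norm _ (Real.sqrt_nonneg _) fun x => ?_
    rw [← Real.sqrt_sq (l2norm_nonneg ((A - B) *ᵥ x)), ← Real.sqrt_sq (l2norm_nonneg x),
      ← Real.sqrt_mul (distSq_nonneg _ _)]
    refine Real.sqrt_le_sqrt ?_
    rw [l2norm_sq, l2norm_sq, distSq, Finset.sum_mul, dotProduct]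
    refine Finset.sum_le_sum fun i _ => ?_
    have := dotProduct_sq_le ((A - B) i) x
    simpa only [mulVec, dotProduct, ← sq, Matrix.sub_apply] using this
  calc _ ≤ √(distSq A B) ^ 2 := by gcongr
    _ = _ := Real.sq_sqrt (distSq_nonneg _ _)

/-- How far the observed Gram matrices are from their means. -/
def patternError {n d : ℕ} (U X : Matrix (Fin n) (Fin d) ℝ) (α : ℝ) (v : Fin n → Bool) : ℝ :=
  distSq (Xᵀ * maskMatrix v * X) (α • (Xᵀ * X)) + distSq (Uᵀ * maskMatrix v * X) (α • (Uᵀ * X))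
    + distSq (Uᵀ * maskMatrix v * U) (α • (Uᵀ * U))
    + ((∑ i, if v i then 1 else 0) / (n : ℝ) - α) ^ 2

theorem patternError_nonneg {n d : ℕ} (U X : Matrix (Fin n) (Fin d) ℝ) (α : ℝ)
    (v : Fin n → Bool) : 0 ≤ patternError U X α v := by
  have := distSq_nonneg (Xᵀ * maskMatrix v * X) (α • (Xᵀ * X))
  have := distSq_nonneg (Uᵀ * maskMatrix v * X) (α • (Uᵀ * X))
  have := distSq_nonneg (Uᵀ * maskMatrix v * U) (α • (Uᵀ * U))
  unfold patternError
  positivity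

/-! ### From the drift of the similarity to the Riccati equation -/

/-- The coefficients of the Riccati equation for the limiting similarity. -/
def riccatiLinear {d : ℕ} (α σ τ : ℝ) (lam : Fin d → ℝ) (l : Fin d) : ℝ :=
  τ * (α * lam l ^ 2 - τ * σ ^ 4 / 2)

/-- The coefficients of the Riccati equation for the limiting similarity. -/
def riccatiQuadratic {d : ℕ} (α σ τ : ℝ) (lam : Fin d → ℝ) (l : Fin d) : ℝ :=
  2 * τ * α * (1 + τ * σ ^ 2 / 2) * lam l ^ 2

/-- The drift is `τα ΓQ - τα(1 + τσ²/2) QQᵀΓQ - (τ²σ⁴/2) Q`, in which `Q` is always the last factor.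
Multiplication by `Qᵀ` on the right therefore leaves a function of `QQᵀ` alone, and symmetrization
gives the Riccati field. -/
theorem driftField_mul_transpose {d : ℕ} {α : ℝ} (hα : α ≠ 0) (σ τ : ℝ) (lam : Fin d → ℝ)
    (Q : Matrix (Fin d) (Fin d) ℝ) :
    driftField α σ τ lam Q * Qᵀ + Q * (driftField α σ τ lam Q)ᵀ
      = riccatiField (riccatiLinear α σ τ lam) (riccatiQuadratic α σ τ lam) (Q * Qᵀ) := by
  set Γ : Matrix (Fin d) (Fin d) ℝ := diagonal (fun l => lam l ^ 2) with hΓ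
  have hΓt : Γᵀ = Γ := diagonal_transpose _
  have ha : diagonal (riccatiLinear α σ τ lam) = (τ * α) • Γ - (τ ^ 2 * σ ^ 4 / 2) • 1 := by
    rw [hΓ, ← diagonal_one, ← diagonal_smul, ← diagonal_smul, diagonal_sub]
    congr 1
    ext l
    simp [riccatiLinear]
    ring
  have hg : diagonal (riccatiQuadratic α σ τ lam) = (2 * τ * α * (1 + τ * σ ^ 2 / 2)) • Γ := by
    rw [hΓ, ← diagonal_smul]
    congr 1
  have hF : driftField α σ τ lam Q = (τ * α) • (Γ * Q)
      - (τ * α * (1 + τ * σ ^ 2 / 2)) • (Q * Qᵀ * Γ * Q) - (τ ^ 2 * σ ^ 4 / 2) • Q := by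
    have e : τ * (α * σ ^ 2) / 2 * (σ ^ 2 / α) = τ * σ ^ 4 / 2 := by field_simp
    rw [driftField, ← hΓ, Matrix.sub_mul, Matrix.one_mul, Matrix.mul_add, Matrix.mul_smul,
      Matrix.mul_one, smul_add, smul_smul _ _ Q, e]
    simp only [Matrix.mul_assoc]
    module
  have hFt : (driftField α σ τ lam Q)ᵀ = (τ * α) • (Qᵀ * Γ)
      - (τ * α * (1 + τ * σ ^ 2 / 2)) • (Qᵀ * Γ * Q * Qᵀ) - (τ ^ 2 * σ ^ 4 / 2) • Qᵀ := by
    rw [hF]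
    simp only [transpose_sub, transpose_smul, transpose_mul, transpose_transpose, hΓt,
      Matrix.mul_assoc]
  rw [hFt, hF, riccatiField, ha, hg]
  simp only [Matrix.sub_mul, Matrix.mul_sub, Matrix.smul_mul, Matrix.mul_smul, Matrix.mul_assoc,
    Matrix.one_mul, Matrix.mul_one]
  module

section

variable {d : ℕ} {C : ℕ → ℝ} {ε τ α : ℝ}

/-- Used in contrapositive form: a failed test forces a Gram error above `(α - ε)/2`, so the steps
without update can be charged to the mask error. -/
theorem lt_lambdaMin_of_norm_sub_le {n : ℕ} {X : Matrix (Fin n) (Fin d) ℝ} {v : Fin n → Bool}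
    (hd : 0 < d) (hεα : ε < α) (h : ‖gram X v - α • 1‖ ≤ (α - ε) / 2) :
    ε < lambdaMin (gram X v) := by
  refine lt_lambdaMin_of_forall hd (gram_transpose X v) (ε' := (α + ε) / 2) (by linarith)
    fun x => ?_
  have h1 := abs_le.1 (quadratic_le_norm (gram X v - α • 1) x)
  have h2 : x ⬝ᵥ ((gram X v - α • 1) *ᵥ x) = x ⬝ᵥ (gram X v *ᵥ x) - α * (x ⬝ᵥ x) := by
    rw [sub_mulVec, dotProduct_sub, smul_mulVec, one_mulVec, dotProduct_smul, smul_eq_mul]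
  rw [h2] at h1
  have h3 := mul_le_mul_of_nonneg_right h (dotProduct_self_nonneg' x)
  linarith [h1.1]

/-- The first two moments of the increment of the similarity, when the pattern is informative. -/
theorem exists_similarity_step_bound (alg : Algorithm) (hd : 0 < d) (hα : 0 < α) (hα1 : α ≤ 1)
    (hτ : 0 < τ) (hε : 0 < ε) (hC : ∀ m, 0 ≤ C m) (σ : ℝ) (lam : Fin d → ℝ) :
    ∃ K : ℝ, 0 < K ∧ ∀ {n : ℕ} {U X : Matrix (Fin n) (Fin d) ℝ}
      {v : Fin n → Bool} {ζ : Measure (Fin n → ℝ)} {η : ℝ}, IsSampleLaw U lam σ C ζ →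
      0 < n → Uᵀ * U = 1 → Xᵀ * X = 1 → ε < lambdaMin (gram X v) →
      η = √(patternError U X α v + 1 / n) → ∀ i j,
      HasMoments (fun s => (Uᵀ * updateMatrix alg (τ / n) X v s *
          (Uᵀ * updateMatrix alg (τ / n) X v s)ᵀ) i j) ζ ∧
      |∫ s, ((Uᵀ * updateMatrix alg (τ / n) X v s *
          (Uᵀ * updateMatrix alg (τ / n) X v s)ᵀ) i j - (Uᵀ * X * (Uᵀ * X)ᵀ) i j) ∂ζ
        - 1 / n * riccatiField (riccatiLinear α σ τ lam) (riccatiQuadratic α σ τ lam)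
            (Uᵀ * X * (Uᵀ * X)ᵀ) i j| ≤ K / n * η ∧
      ∫ s, ((Uᵀ * updateMatrix alg (τ / n) X v s *
          (Uᵀ * updateMatrix alg (τ / n) X v s)ᵀ) i j - (Uᵀ * X * (Uᵀ * X)ᵀ) i j) ^ 2 ∂ζ
        ≤ K / n ^ 2 := by
  obtain ⟨K1, hK1, h1⟩ := exists_increment_bounds alg hτ hε
  obtain ⟨K2, hK2, h2⟩ := exists_drift_bound alg hd hα hα1 hτ hε hC σ lam
  obtain ⟨K10, hK10, h10⟩ := exists_load_moment_le hd hε hC 10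
  obtain ⟨K20, hK20, h20⟩ := exists_load_moment_le hd hε hC 20
  have hd0 : (0 : ℝ) < d := by exact_mod_cast hd
  refine ⟨d * (2 * K2 + K1 ^ 2 * K10) + (d * (2 * K1 + K1 ^ 2)) ^ 2 * K20, by positivity, ?_⟩
  intro n U X v ζ η hζ hn hU hX hv hη
  have hp := hζ.prob
  have hn0 : (0 : ℝ) < n := by exact_mod_cast hn
  have hn1 : (1 : ℝ) ≤ n := by exact_mod_cast hn
  have hpe := patternError_nonneg U X α v
  have hη0 : 0 ≤ η := by rw [hη]; exact Real.sqrt_nonneg _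
  -- The single quantity `η` dominates every error of the drift bound: each squared Gram deviation
  -- is controlled by a summand of `patternError`, and the summand `1/n` gives `1/√n ≤ η`.
  have hle : ∀ {x : ℝ}, x ^ 2 ≤ patternError U X α v + 1 / n → x ≤ η := fun {x} h => by
    rw [hη]; exact Real.le_sqrt_of_sq_le h
  have n1 := distSq_nonneg (Xᵀ * maskMatrix v * X) (α • (Xᵀ * X))
  have n2 := distSq_nonneg (Uᵀ * maskMatrix v * X) (α • (Uᵀ * X))
  have n3 := distSq_nonneg (Uᵀ * maskMatrix v * U) (α • (Uᵀ * U))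
  have n4 := sq_nonneg ((∑ i, if v i then 1 else 0) / (n : ℝ) - α)
  have n5 : 0 ≤ 1 / (n : ℝ) := by positivity
  have hS : ‖gram X v - α • 1‖ ≤ η := by
    rw [← hX]
    refine hle ?_
    have := norm_sub_sq_le_distSq (Xᵀ * maskMatrix v * X) (α • (Xᵀ * X))
    unfold patternError gram
    linarith
  have hB : ‖Uᵀ * maskMatrix v * X - α • (Uᵀ * X)‖ ≤ η := hle <| by
    have := norm_sub_sq_le_distSq (Uᵀ * maskMatrix v * X) (α • (Uᵀ * X))
    unfold patternError
    linarith
  have hD : ‖Uᵀ * maskMatrix v * U - α • 1‖ ≤ η := by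
    rw [← hU]
    refine hle ?_
    have := norm_sub_sq_le_distSq (Uᵀ * maskMatrix v * U) (α • (Uᵀ * U))
    unfold patternError
    linarith
  have htr : |(∑ i, if v i then 1 else 0) / (n : ℝ) - α| ≤ η := hle <| by
    rw [sq_abs]
    unfold patternError
    linarith
  have hnη : 1 / √(n : ℝ) ≤ η := hle <| by
    rw [div_pow, Real.sq_sqrt hn0.le, one_pow]
    linarith
  set Q := Uᵀ * X with hQ
  have hQ1 : ∀ i j, |Q i j| ≤ 1 := fun i j =>
    (abs_apply_le_norm Q i j).trans (norm_transpose_mul_le_one hU hX)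
  set δ : Fin d → Fin d → (Fin n → ℝ) → ℝ := fun i j s =>
    (Uᵀ * updateMatrix alg (τ / n) X v s) i j - Q i j with hδ
  have hQm : ∀ i j, HasMoments (fun s => (Uᵀ * updateMatrix alg (τ / n) X v s) i j) ζ := by
    intro i j
    simp only [Matrix.mul_apply]
    exact HasMoments.sum _ fun k _ =>
      (hζ.hasMoments_updateMatrix alg hτ hε hn hU hX hv k j).const_mul _
  have hδm : ∀ i j, HasMoments (δ i j) ζ := fun i j => (hQm i j).sub (HasMoments.const _)
  have hY := hζ.hasMoments_load X v
  have hδb : ∀ i j s, |δ i j s| ≤ K1 / n * load U X v s ^ 5 := fun i j s =>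
    (h1 hn hU hX hv s).2.1 i j
  intro i j
  have hPm : HasMoments (fun s => (Uᵀ * updateMatrix alg (τ / n) X v s *
          (Uᵀ * updateMatrix alg (τ / n) X v s)ᵀ) i j) ζ := by
    simp only [mul_transpose_apply]
    exact HasMoments.sum _ fun k _ => (hQm i k).mul (hQm j k)
  -- Exact product rule. The quadratic term has mean `O(n⁻²)`, so the step contributes no
  -- second-order correction to the limiting equation.
  have hexp : ∀ s, (Uᵀ * updateMatrix alg (τ / n) X v s *
          (Uᵀ * updateMatrix alg (τ / n) X v s)ᵀ) i j - (Q * Qᵀ) i j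
      = ∑ k, (δ i k s * Q j k + Q i k * δ j k s + δ i k s * δ j k s) := fun s => by
    rw [mul_transpose_apply, mul_transpose_apply, ← Finset.sum_sub_distrib]
    exact Finset.sum_congr rfl fun k _ => by simp only [hδ]; ring
  refine ⟨hPm, ?_, ?_⟩
  · rw [← driftField_mul_transpose hα.ne']
    simp only [hexp]
    have hmk : ∀ k, HasMoments (fun s => δ i k s * Q j k + Q i k * δ j k s + δ i k s * δ j k s) ζ :=
      fun k => (((hδm i k).mul (HasMoments.const _)).add ((hδm j k).const_mul _)).add
        ((hδm i k).mul (hδm j k))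
    rw [integral_finsetSum _ fun k _ => (hmk k).integrable, Matrix.add_apply, mul_transpose_apply,
      mul_transpose_apply, ← Finset.sum_add_distrib, Finset.mul_sum, ← Finset.sum_sub_distrib]
    refine (Finset.abs_sum_le_sum_abs _ _).trans ?_
    have hk : ∀ k, |∫ s, (δ i k s * Q j k + Q i k * δ j k s + δ i k s * δ j k s) ∂ζ
        - 1 / n * (driftField α σ τ lam Q i k * Q j k + Q i k * driftField α σ τ lam Q j k)|
        ≤ (2 * K2 + K1 ^ 2 * K10) / n * η := by
      intro k
      rw [integral_add (((hδm i k).mul (HasMoments.const _)).add ((hδm j k).const_mul _)).integrable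
        ((hδm i k).mul (hδm j k)).integrable,
        integral_add ((hδm i k).mul (HasMoments.const _)).integrable
          ((hδm j k).const_mul _).integrable, integral_mul_const, integral_const_mul]
      have a1 := h2 hζ hn hU hX hv hS hB hD htr hnη i k
      have a2 := h2 hζ hn hU hX hv hS hB hD htr hnη j k
      have a3 : |∫ s, δ i k s * δ j k s ∂ζ| ≤ K1 ^ 2 * K10 / n * η := by
        calc _ ≤ ∫ s, |δ i k s * δ j k s| ∂ζ := abs_integral_le_integral_abs
          _ ≤ ∫ s, K1 ^ 2 / n ^ 2 * load U X v s ^ 10 ∂ζ := by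
            refine integral_mono ((hδm i k).mul (hδm j k)).abs.integrable
              ((hY.pow 10).const_mul _).integrable fun s => ?_
            simp only [abs_mul]
            refine (mul_le_mul (hδb i k s) (hδb j k s) (abs_nonneg _)
              ((abs_nonneg _).trans (hδb i k s))).trans_eq (by ring)
          _ ≤ K1 ^ 2 / n ^ 2 * K10 := by
            rw [integral_const_mul]
            gcongr
            exact (h10 hζ hn hU hX hv).2
          _ = K1 ^ 2 * K10 / n * (1 / n) := by ring
          _ ≤ _ := by gcongr; exact one_div_le_of_one_div_sqrt_le hn hnη
      have e : ∀ A B D F G : ℝ, A * Q j k + Q i k * B + D - 1 / n * (F * Q j k + Q i k * G)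
          = (A - 1 / n * F) * Q j k + Q i k * (B - 1 / n * G) + D := fun A B D F G => by ring
      rw [e]
      refine (abs_add_le _ _).trans ((add_le_add (abs_add_le _ _) le_rfl).trans ?_)
      rw [abs_mul, abs_mul]
      have b1 := mul_le_mul a1 (hQ1 j k) (abs_nonneg _) ((abs_nonneg _).trans a1)
      have b2 := mul_le_mul (hQ1 i k) a2 (abs_nonneg _) zero_le_one
      calc _ ≤ K2 / n * η * 1 + 1 * (K2 / n * η) + K1 ^ 2 * K10 / n * η := by
            exact add_le_add (add_le_add b1 b2) a3
        _ = _ := by ring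
    calc _ ≤ ∑ k : Fin d, (2 * K2 + K1 ^ 2 * K10) / n * η := Finset.sum_le_sum fun k _ => hk k
      _ = (d * (2 * K2 + K1 ^ 2 * K10)) / n * η := by
        rw [Finset.sum_const, Finset.card_univ, Fintype.card_fin, nsmul_eq_mul]; ring
      _ ≤ _ := by
        refine mul_le_mul_of_nonneg_right (div_le_div_of_nonneg_right ?_ hn0.le) hη0
        have : 0 ≤ (d * (2 * K1 + K1 ^ 2)) ^ 2 * K20 := by positivity
        linarith
  · have hb : ∀ s, |(Uᵀ * updateMatrix alg (τ / n) X v s *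
          (Uᵀ * updateMatrix alg (τ / n) X v s)ᵀ) i j - (Q * Qᵀ) i j|
        ≤ (d * (2 * K1 + K1 ^ 2)) / n * load U X v s ^ 10 := by
      intro s
      have hY1 : 1 ≤ load U X v s := one_le_load
      rw [hexp]
      refine (Finset.abs_sum_le_sum_abs _ _).trans ?_
      calc _ ≤ ∑ k : Fin d, (2 * K1 + K1 ^ 2) / n * load U X v s ^ 10 := by
            refine Finset.sum_le_sum fun k _ => ?_
            have c1 := hδb i k s
            have c2 := hδb j k s
            set Y := load U X v s
            calc _ ≤ |δ i k s| * |Q j k| + |Q i k| * |δ j k s| + |δ i k s| * |δ j k s| := by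
                  rw [← abs_mul, ← abs_mul, ← abs_mul]
                  exact (abs_add_le _ _).trans (add_le_add (abs_add_le _ _) le_rfl)
              _ ≤ K1 / n * Y ^ 5 * 1 + 1 * (K1 / n * Y ^ 5) + K1 / n * Y ^ 5 * (K1 / 1 * Y ^ 5) := by
                  have := hQ1 j k
                  have := hQ1 i k
                  have c3 : |δ j k s| ≤ K1 / 1 * Y ^ 5 := c2.trans (by gcongr)
                  gcongr
              _ ≤ K1 / n * Y ^ 10 * 1 + 1 * (K1 / n * Y ^ 10) + K1 / n * Y ^ 5 * (K1 / 1 * Y ^ 5) := by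
                  gcongr <;> first | exact hY1 | norm_num
              _ = _ := by ring
        _ = _ := by rw [Finset.sum_const, Finset.card_univ, Fintype.card_fin, nsmul_eq_mul]; ring
    calc _ ≤ ∫ s, ((d * (2 * K1 + K1 ^ 2)) / n) ^ 2 * load U X v s ^ 20 ∂ζ := by
          refine integral_mono ((hPm.sub (HasMoments.const _)).pow 2).integrable
            ((hY.pow 20).const_mul _).integrable fun s => ?_
          have := pow_le_pow_left₀ (abs_nonneg _) (hb s) 2
          rw [sq_abs, mul_pow, ← pow_mul] at this
          exact this
      _ ≤ ((d * (2 * K1 + K1 ^ 2)) / n) ^ 2 * K20 := by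
          rw [integral_const_mul]
          gcongr
          exact (h20 hζ hn hU hX hv).2
      _ = ((d * (2 * K1 + K1 ^ 2)) ^ 2 * K20) / n ^ 2 := by ring
      _ ≤ _ := by
          refine div_le_div_of_nonneg_right ?_ (by positivity)
          have : 0 ≤ d * (2 * K2 + K1 ^ 2 * K10) := by positivity
          linarith

end

end

end SubspaceTracking

namespace SubspaceTracking

noncomputable section

open scoped Matrix.Norms.L2Operator

/-! ### The Lyapunov function and its growth for a fixed mask -/

/-- The distance of the similarity of an estimate from a reference value, together with the
incoherence of the estimate. -/
def lyapunov {n d : ℕ} (U : Matrix (Fin n) (Fin d) ℝ) (p : Matrix (Fin d) (Fin d) ℝ)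
    (X : Matrix (Fin n) (Fin d) ℝ) : ℝ :=
  distSq (Uᵀ * X * (Uᵀ * X)ᵀ) p + fourthMoment X

theorem lyapunov_nonneg {n d : ℕ} (U : Matrix (Fin n) (Fin d) ℝ) (p : Matrix (Fin d) (Fin d) ℝ)
    (X : Matrix (Fin n) (Fin d) ℝ) : 0 ≤ lyapunov U p X :=
  add_nonneg (distSq_nonneg _ _) (fourthMoment_nonneg X)

theorem riccatiField_zero {d : ℕ} (a g : Fin d → ℝ) : riccatiField a g 0 = 0 := by
  simp [riccatiField]

/-- The mean of the squared deviation after a random step `x` and a reference step `Δ`. -/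
theorem integral_sq_deviation_le {Ω : Type*} [MeasurableSpace Ω] {μ : Measure Ω}
    [IsProbabilityMeasure μ] {x : Ω → ℝ} (hx : HasMoments x μ) {e Δ f η k k' L M G g N : ℝ}
    (hN : 1 ≤ N) (hM : 0 ≤ M) (hk : 0 ≤ k) (hf : 0 ≤ f)
    (he : |e| ≤ f)
    (hm : |∫ ω, x ω ∂μ - 1 / N * G| ≤ k / N * η) (hsq : ∫ ω, x ω ^ 2 ∂μ ≤ k / N ^ 2)
    (hΔ : |Δ - 1 / N * g| ≤ M / N ^ 2) (hGg : |G - g| ≤ L * f) (hg : |g| ≤ k') :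
    ∫ ω, (e + x ω - Δ) ^ 2 ∂μ ≤ e ^ 2 + ((k + 2 * L + M) * f ^ 2 + k * η ^ 2) / N
      + (M + 2 * k + 2 * (k' + M) ^ 2) / N ^ 2 := by
  have hN0 : 0 < N := by linarith
  set m := ∫ ω, x ω ∂μ with hmdef
  have hΔ' : |Δ| ≤ (k' + M) / N := by
    have h1 := abs_add_le (Δ - 1 / N * g) (1 / N * g)
    rw [sub_add_cancel, abs_mul, abs_of_pos (a := 1 / N) (by positivity)] at h1
    calc |Δ| ≤ M / N ^ 2 + 1 / N * k' := by
          refine h1.trans (add_le_add hΔ ?_)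
          gcongr
      _ ≤ M / N + 1 / N * k' := by
          gcongr
          nlinarith
      _ = _ := by ring
  -- Three errors: of the mean against the field at the current point, of the field between current
  -- and reference point, and of the Euler step of the reference.
  have hmΔ : |m - Δ| ≤ (k * η + L * f + M / N) / N := by
    have h1 : m - Δ = (m - 1 / N * G) + 1 / N * (G - g) - (Δ - 1 / N * g) := by ring
    rw [h1]
    calc _ ≤ |m - 1 / N * G| + |1 / N * (G - g)| + |Δ - 1 / N * g| :=
          (abs_sub _ _).trans (add_le_add (abs_add_le _ _) le_rfl)
      _ ≤ k / N * η + 1 / N * (L * f) + M / N ^ 2 := by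
          rw [abs_mul (1 / N), abs_of_pos (a := 1 / N) (by positivity)]
          gcongr
      _ = _ := by ring
  have hdom := ((HasMoments.const (μ := μ) (e ^ 2 - 2 * e * Δ + 2 * Δ ^ 2)).add
    (hx.const_mul (2 * e))).add ((hx.pow 2).const_mul 2)
  have hint : HasMoments (fun ω => (e + x ω - Δ) ^ 2) μ :=
    (((HasMoments.const e).add hx).sub (HasMoments.const Δ)).pow 2
  have hΔ2 : Δ ^ 2 ≤ (k' + M) ^ 2 / N ^ 2 := by
    rw [← sq_abs, ← div_pow]
    gcongr
  calc _ ≤ ∫ ω, (e ^ 2 - 2 * e * Δ + 2 * Δ ^ 2 + 2 * e * x ω + 2 * x ω ^ 2) ∂μ := by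
        refine integral_mono hint.integrable hdom.integrable fun ω => ?_
        simp only
        nlinarith [sq_nonneg (x ω + Δ)]
    _ = e ^ 2 + 2 * e * (m - Δ) + 2 * ∫ ω, x ω ^ 2 ∂μ + 2 * Δ ^ 2 := by
        rw [integral_add ((HasMoments.const (μ := μ) (e ^ 2 - 2 * e * Δ + 2 * Δ ^ 2)).add
          (hx.const_mul (2 * e))).integrable ((hx.pow 2).const_mul 2).integrable,
          integral_add (HasMoments.const _).integrable (hx.const_mul _).integrable,
          integral_const_mul, integral_const_mul]
        simp
        ring
    _ ≤ e ^ 2 + 2 * (f * ((k * η + L * f + M / N) / N)) + 2 * (k / N ^ 2)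
          + 2 * ((k' + M) ^ 2 / N ^ 2) := by
        have h1 : e * (m - Δ) ≤ f * ((k * η + L * f + M / N) / N) := by
          refine (le_abs_self _).trans ?_
          rw [abs_mul]
          gcongr
        linarith
    _ = e ^ 2 + (k * (2 * f * η) + 2 * L * f ^ 2 + M * (2 * f * (1 / N))) / N + 2 * (k / N ^ 2)
          + 2 * ((k' + M) ^ 2 / N ^ 2) := by ring
    _ ≤ e ^ 2 + (k * (f ^ 2 + η ^ 2) + 2 * L * f ^ 2 + M * (f ^ 2 + 1 / N)) / N + 2 * (k / N ^ 2)
          + 2 * ((k' + M) ^ 2 / N ^ 2) := by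
        -- Products are split into squares, since Grönwall's inequality needs `f²`, and the average
        -- over masks is available for `η²`.
        have h1 : 2 * f * η ≤ f ^ 2 + η ^ 2 := two_mul_le_add_sq f η
        have h2 : 2 * f * (1 / N) ≤ f ^ 2 + 1 / N := by
          have h3 := two_mul_le_add_sq f (1 / N)
          have h4 : (1 / N) ^ 2 ≤ 1 / N := by
            have : 1 / N ≤ 1 := by rw [div_le_one hN0]; exact hN
            exact pow_le_of_le_one (by positivity) this (by norm_num)
          linarith
        gcongr
    _ = _ := by ring

section

variable {d : ℕ} {C : ℕ → ℝ} {ε τ α : ℝ}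

/-- The mean growth of the Lyapunov function in one step for a fixed observation pattern. -/
theorem exists_lyapunov_pattern_bound (alg : Algorithm) (hd : 0 < d) (hα : 0 < α) (hα1 : α ≤ 1)
    (hτ : 0 < τ) (hε : 0 < ε) (hεα : ε < α) (hC : ∀ m, 0 ≤ C m) (σ : ℝ) (lam : Fin d → ℝ) {M : ℝ}
    (hM : 0 < M) :
    ∃ K : ℝ, 0 < K ∧ ∀ {n : ℕ} {U X : Matrix (Fin n) (Fin d) ℝ}
      (v : Fin n → Bool) {ζ : Measure (Fin n → ℝ)} {p p' : Matrix (Fin d) (Fin d) ℝ},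
      IsSampleLaw U lam σ C ζ → 0 < n → Uᵀ * U = 1 → Xᵀ * X = 1 → ‖p‖ ≤ M →
      ‖p' - p - (1 / n : ℝ) •
        riccatiField (riccatiLinear α σ τ lam) (riccatiQuadratic α σ τ lam) p‖ ≤ M / n ^ 2 →
      HasMoments (fun s => lyapunov U p' (closedStep alg ε (τ / n) X v s)) ζ ∧
      ∫ s, lyapunov U p' (closedStep alg ε (τ / n) X v s) ∂ζ ≤ lyapunov U p X
        + K / n * (lyapunov U p X + fourthMoment U + patternError U X α v) + K / n ^ 2 := by
  obtain ⟨K1, hK1, h1⟩ := exists_similarity_step_bound alg hd hα hα1 hτ hε hC σ lam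
  obtain ⟨K2, hK2, h2⟩ := exists_fourthMoment_bound alg hd hτ hε hC σ lam
  set a := riccatiLinear α σ τ lam with ha
  set g := riccatiQuadratic α σ τ lam with hg
  -- A Lipschitz constant on the ball of radius `M + 1`, which contains both the current `QQᵀ`, of
  -- norm at most `1`, and the reference `p`. As the field vanishes at `0`, the number `k'` below
  -- bounds it there.
  set L := 2 * ‖diagonal a‖ + 2 * (M + 1) * ‖diagonal g‖ with hL
  have hL0 : 0 ≤ L := by positivity
  have hκ : 0 < (α - ε) / 2 := by linarith
  set k' := L * (M + 1) with hk'
  -- The second term handles a failed test: the increment is then zero instead of the field divided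
  -- by `n`, an error of at most `k'/n`, but in this case `η ≥ (α - ε)/2`.
  set k := K1 + k' / ((α - ε) / 2) with hk
  have hk'0 : 0 ≤ k' := by positivity
  have hk0 : 0 < k := by positivity
  have hd0 : (0 : ℝ) < d := by exact_mod_cast hd
  set A := d ^ 2 * (k + 2 * L + M) with hA
  set B := d ^ 2 * (k + M + 2 * k + 2 * (k' + M) ^ 2) with hB
  have hA0 : 0 ≤ A := by positivity
  have hB0 : 0 ≤ B := by positivity
  have hkA : d ^ 2 * k ≤ A := by rw [hA]; gcongr; linarith
  refine ⟨A + B + K2, by positivity, ?_⟩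
  intro n U X v ζ p p' hζ hn hU hX hp hp'
  have hprob := hζ.prob
  have hn0 : (0 : ℝ) < n := by exact_mod_cast hn
  have hn1 : (1 : ℝ) ≤ n := by exact_mod_cast hn
  have hpe := patternError_nonneg U X α v
  set η := √(patternError U X α v + 1 / n) with hη
  have hη0 : 0 ≤ η := Real.sqrt_nonneg _
  have hη2 : η ^ 2 = patternError U X α v + 1 / n := Real.sq_sqrt (by positivity)
  set P := Uᵀ * X * (Uᵀ * X)ᵀ with hP
  have hP1 : ‖P‖ ≤ 1 := (norm_mul_le_of_le (norm_transpose_mul_le_one hU hX)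
    (by rw [norm_transpose]; exact norm_transpose_mul_le_one hU hX)).trans_eq (one_mul 1)
  have hGlip : ∀ P' : Matrix (Fin d) (Fin d) ℝ, ‖P'‖ ≤ M + 1 →
      ‖riccatiField a g P - riccatiField a g P'‖ ≤ L * ‖P - P'‖ := fun P' h =>
    riccatiField_sub_le a g (hP1.trans (by linarith)) h
  have hGbd : ∀ P' : Matrix (Fin d) (Fin d) ℝ, ‖P'‖ ≤ M + 1 → ‖riccatiField a g P'‖ ≤ k' :=
    fun P' h => by
    have := riccatiField_sub_le a g h (P' := 0) (by rw [norm_zero]; positivity)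
    rw [riccatiField_zero, sub_zero, sub_zero] at this
    exact this.trans (mul_le_mul_of_nonneg_left h hL0)
  have hFr : ‖P - p‖ ^ 2 ≤ distSq P p := norm_sub_sq_le_distSq _ _
  have hFr0 := distSq_nonneg P p
  set f := √(distSq P p) with hf
  have hf2 : f ^ 2 = distSq P p := Real.sq_sqrt hFr0
  have hPp : ‖P - p‖ ≤ f := Real.le_sqrt_of_sq_le hFr
  set P' : (Fin n → ℝ) → Matrix (Fin d) (Fin d) ℝ := fun s =>
    Uᵀ * closedStep alg ε (τ / n) X v s * (Uᵀ * closedStep alg ε (τ / n) X v s)ᵀ with hP'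
  have hmom : ∀ i j, HasMoments (fun s => P' s i j) ζ ∧
      |∫ s, (P' s i j - P i j) ∂ζ - 1 / n * riccatiField a g P i j| ≤ k / n * η ∧
      ∫ s, (P' s i j - P i j) ^ 2 ∂ζ ≤ k / n ^ 2 := by
    intro i j
    by_cases hv : ε < lambdaMin (gram X v)
    · simp only [hP', closedStep, if_pos hv]
      obtain ⟨t1, t2, t3⟩ := h1 hζ hn hU hX hv hη i j
      have hkk : K1 ≤ k := by rw [hk]; linarith [div_nonneg hk'0 hκ.le]
      exact ⟨t1, t2.trans (by gcongr), t3.trans (by gcongr)⟩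
    · simp only [hP', closedStep, if_neg hv]
      refine ⟨HasMoments.const _, ?_, ?_⟩
      · have hηκ : (α - ε) / 2 ≤ η := by
          by_contra hlt
          refine hv (lt_lambdaMin_of_norm_sub_le hd hεα (le_trans ?_ (not_le.1 hlt).le))
          rw [hη]
          refine Real.le_sqrt_of_sq_le ?_
          have := norm_sub_sq_le_distSq (Xᵀ * maskMatrix v * X) (α • (Xᵀ * X))
          have n2 := distSq_nonneg (Uᵀ * maskMatrix v * X) (α • (Uᵀ * X))
          have n3 := distSq_nonneg (Uᵀ * maskMatrix v * U) (α • (Uᵀ * U))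
          have n4 := sq_nonneg ((∑ i, if v i then 1 else 0) / (n : ℝ) - α)
          have n5 : 0 ≤ 1 / (n : ℝ) := by positivity
          rw [← hX]
          unfold patternError gram
          linarith
        have hb := (abs_apply_le_norm _ i j).trans (hGbd P (hP1.trans (by linarith)))
        have hkk : k' ≤ k * η := by
          calc k' = k' / ((α - ε) / 2) * ((α - ε) / 2) := (div_mul_cancel₀ _ hκ.ne').symm
            _ ≤ k * η := by
              gcongr
              rw [hk]
              linarith
        change |∫ _, (P i j - P i j) ∂ζ - _| ≤ _
        simp only [sub_self, integral_zero, zero_sub, abs_neg]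
        rw [abs_mul, abs_of_pos (a := 1 / (n : ℝ)) (by positivity)]
        calc _ ≤ 1 / n * (k * η) := by gcongr; exact hb.trans hkk
          _ = _ := by ring
      · have : 0 ≤ k / n ^ 2 := by positivity
        change ∫ _, (P i j - P i j) ^ 2 ∂ζ ≤ _
        simpa using this
  have hXm : ∀ i j, HasMoments (fun s => closedStep alg ε (τ / n) X v s i j) ζ := by
    intro i j
    by_cases hv : ε < lambdaMin (gram X v)
    · simp only [closedStep, if_pos hv]
      exact hζ.hasMoments_updateMatrix alg hτ hε hn hU hX hv i j
    · simp only [closedStep, if_neg hv]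
      exact HasMoments.const _
  have hfour : ∫ s, fourthMoment (closedStep alg ε (τ / n) X v s) ∂ζ
      ≤ fourthMoment X + K2 / n * (fourthMoment X + fourthMoment U) + K2 / n ^ 2 := by
    by_cases hv : ε < lambdaMin (gram X v)
    · simp only [closedStep, if_pos hv]
      exact h2 hζ hn hU hX hv
    · simp only [closedStep, if_neg hv]
      have := fourthMoment_nonneg X
      have := fourthMoment_nonneg U
      have h3 : 0 ≤ K2 / n * (fourthMoment X + fourthMoment U) + K2 / n ^ 2 := by positivity
      simp only [integral_const, probReal_univ, one_smul]
      linarith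
  have hm4 : HasMoments (fun s => fourthMoment (closedStep alg ε (τ / n) X v s)) ζ :=
    HasMoments.sum _ fun i _ => HasMoments.sum _ fun j _ => (hXm i j).pow 4
  have hmij : ∀ i j, HasMoments (fun s => (P' s i j - p' i j) ^ 2) ζ := fun i j =>
    ((hmom i j).1.sub (HasMoments.const _)).pow 2
  have hmd : HasMoments (fun s => distSq (P' s) p') ζ :=
    HasMoments.sum _ fun i _ => HasMoments.sum _ fun j _ => hmij i j
  refine ⟨hmd.add hm4, ?_⟩
  have hentry : ∀ i j, ∫ s, (P' s i j - p' i j) ^ 2 ∂ζ ≤ (P i j - p i j) ^ 2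
      + ((k + 2 * L + M) * f ^ 2 + k * η ^ 2) / n + (M + 2 * k + 2 * (k' + M) ^ 2) / n ^ 2 := by
    intro i j
    obtain ⟨t1, t2, t3⟩ := hmom i j
    have := integral_sq_deviation_le (e := P i j - p i j) (Δ := p' i j - p i j)
      (t1.sub (HasMoments.const (P i j))) hn1 hM.le hk0.le
      (Real.sqrt_nonneg _) (f := f) (L := L) (g := riccatiField a g p i j) (k' := k')
      ((abs_apply_le_norm (P - p) i j).trans hPp) t2 t3
      ((abs_apply_le_norm (p' - p - (1 / n : ℝ) • riccatiField a g p) i j).trans hp')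
      (((abs_apply_le_norm (riccatiField a g P - riccatiField a g p) i j).trans
        (hGlip p (by linarith))).trans (mul_le_mul_of_nonneg_left hPp hL0))
      ((abs_apply_le_norm _ i j).trans (hGbd p (by linarith)))
    refine le_trans (le_of_eq ?_) this
    congr 1
    ext s
    ring
  have hdist : ∫ s, distSq (P' s) p' ∂ζ ≤ distSq P p
      + d ^ 2 * (((k + 2 * L + M) * f ^ 2 + k * η ^ 2) / n
        + (M + 2 * k + 2 * (k' + M) ^ 2) / n ^ 2) := by
    unfold distSq
    rw [integral_finsetSum _ fun i _ => (HasMoments.sum _ fun j _ => hmij i j).integrable]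
    have hsplit : ∀ i, ∫ s, ∑ j, (P' s i j - p' i j) ^ 2 ∂ζ
        = ∑ j, ∫ s, (P' s i j - p' i j) ^ 2 ∂ζ := fun i =>
      integral_finsetSum _ fun j _ => (hmij i j).integrable
    simp only [hsplit]
    refine (Finset.sum_le_sum fun i _ => Finset.sum_le_sum fun j _ => hentry i j).trans_eq ?_
    simp only [Finset.sum_add_distrib, Finset.sum_const, Finset.card_univ, Fintype.card_fin,
      nsmul_eq_mul]
    ring
  have hsum : ∫ s, lyapunov U p' (closedStep alg ε (τ / n) X v s) ∂ζ
      = ∫ s, distSq (P' s) p' ∂ζ + ∫ s, fourthMoment (closedStep alg ε (τ / n) X v s) ∂ζ :=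
    integral_add hmd.integrable hm4.integrable
  rw [hsum]
  have hSX := fourthMoment_nonneg X
  have hSU := fourthMoment_nonneg U
  rw [hf2, hη2] at hdist
  set F := distSq P p
  set E := patternError U X α v
  have hlyap : lyapunov U p X = F + fourthMoment X := rfl
  rw [hlyap]
  have u1 : d ^ 2 * (((k + 2 * L + M) * F + k * (E + 1 / n)) / n
        + (M + 2 * k + 2 * (k' + M) ^ 2) / n ^ 2) = A / n * F + d ^ 2 * k / n * E + B / n ^ 2 := by
    rw [hA, hB]
    field_simp
    ring
  rw [u1] at hdist
  have u2 : d ^ 2 * k / n * E ≤ A / n * E := by gcongr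
  have u3 : 0 ≤ (A + B) / n * (fourthMoment X + fourthMoment U) + B / n * (F + E) + K2 / n * (F + E)
    + A / n ^ 2 := by positivity
  have u4 : (A + B + K2) / n * (F + fourthMoment X + fourthMoment U + E) + (A + B + K2) / n ^ 2
      = A / n * F + A / n * E + B / n ^ 2 + (K2 / n * (fourthMoment X + fourthMoment U)
        + K2 / n ^ 2) + ((A + B) / n * (fourthMoment X + fourthMoment U) + B / n * (F + E)
        + K2 / n * (F + E) + A / n ^ 2) := by ring
  linarith

end

end

end SubspaceTracking

namespace SubspaceTracking

noncomputable section

open scoped Matrix.Norms.L2Operator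

/-! ### The average over the observation patterns -/

/-- The law of an observation pattern. -/
structure IsPatternLaw {n : ℕ} (α : ℝ) (β : Measure (Fin n → Bool)) : Prop where
  prob : IsProbabilityMeasure β
  indep : iIndepFun (fun i (v : Fin n → Bool) => v i) β
  observed : ∀ i, β {v | v i = true} = ENNReal.ofReal α

section

variable {n d : ℕ} {α : ℝ} {β : Measure (Fin n → Bool)}

/-- The centred mask entries are bounded by `1`, so all their absolute moments are. -/
theorem IsPatternLaw.integral_sq_form_le (hβ : IsPatternLaw α β) (hα : 0 < α) (hα1 : α ≤ 1)
    (h : Fin n → ℝ) :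
    ∫ v, (∑ i, h i * ((if v i then 1 else 0) - α)) ^ 2 ∂β
      ≤ momentConst (fun _ => 1) 1 * ∑ i, h i ^ 2 := by
  have hp := hβ.prob
  have hb : Measurable fun b : Bool => ((if b then 1 else 0) - α : ℝ) := measurable_of_countable _
  have habs : ∀ b : Bool, |((if b then 1 else 0) - α : ℝ)| ≤ 1 := fun b => by
    cases b
    · simp [abs_of_pos hα, hα1]
    · simp only [if_true]; rw [abs_of_nonneg] <;> linarith
  have := linearForm_moment_le (z := fun i (v : Fin n → Bool) => ((if v i then 1 else 0) - α : ℝ))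
    (hβ.indep.comp (fun _ b => ((if b then 1 else 0) - α : ℝ)) fun _ => hb) (M := fun _ => 1)
    (fun i => ⟨measurable_of_countable _, fun p => Integrable.of_finite⟩)
    (fun i => by
      rw [integral_sub Integrable.of_finite Integrable.of_finite]
      have h1 : (fun v : Fin n → Bool => (if v i then 1 else 0 : ℝ))
          = Set.indicator {v | v i = true} 1 := by
        ext v; simp [Set.indicator_apply]
      rw [h1, integral_indicator_one (MeasurableSet.of_discrete), measureReal_def, hβ.observed,
        ENNReal.toReal_ofReal hα.le]
      simp)
    (fun i p => by
      calc _ ≤ ∫ v : Fin n → Bool, (1 : ℝ) ∂β := by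
            refine integral_mono Integrable.of_finite Integrable.of_finite fun v => ?_
            exact pow_le_one₀ (abs_nonneg _) (habs (v i))
        _ = 1 := by simp)
    (fun _ => zero_le_one) h Finset.univ 1
  simpa using this

theorem transpose_mul_maskMatrix_mul_sub (X Y : Matrix (Fin n) (Fin d) ℝ) (v : Fin n → Bool)
    (α : ℝ) (k l : Fin d) : (Xᵀ * maskMatrix v * Y) k l - (α • (Xᵀ * Y)) k l =
      ∑ i, X i k * Y i l * ((if v i then 1 else 0) - α) := by
  rw [Matrix.smul_apply, Matrix.mul_apply, Matrix.mul_apply, smul_eq_mul, Finset.mul_sum,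
    ← Finset.sum_sub_distrib]
  refine Finset.sum_congr rfl fun i _ => ?_
  rw [maskMatrix, mul_diagonal, transpose_apply]
  ring

/-- Each entry of the error is a linear form in the independent variables `v_i - α` with
coefficients `X i k * Y i l`. Its variance is at most a constant times the sum of `X i k ^ 4 + Y i l
^ 4`; this is where incoherence enters. -/
theorem IsPatternLaw.integral_distSq_le (hβ : IsPatternLaw α β) (hα : 0 < α) (hα1 : α ≤ 1)
    (X Y : Matrix (Fin n) (Fin d) ℝ) :
    ∫ v, distSq (Xᵀ * maskMatrix v * Y) (α • (Xᵀ * Y)) ∂β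
      ≤ momentConst (fun _ => 1) 1 * (d * (fourthMoment X + fourthMoment Y)) := by
  have hp := hβ.prob
  have hκ := momentConst_nonneg (M := fun _ => 1) (fun _ => zero_le_one) 1
  unfold distSq
  rw [integral_finsetSum _ fun _ _ => Integrable.of_finite]
  have hsplit : ∀ k, ∫ v, ∑ l, ((Xᵀ * maskMatrix v * Y) k l - (α • (Xᵀ * Y)) k l) ^ 2 ∂β
      = ∑ l, ∫ v, ((Xᵀ * maskMatrix v * Y) k l - (α • (Xᵀ * Y)) k l) ^ 2 ∂β := fun k =>
    integral_finsetSum _ fun _ _ => Integrable.of_finite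
  simp only [hsplit]
  simp only [transpose_mul_maskMatrix_mul_sub]
  calc _ ≤ ∑ k : Fin d, ∑ l : Fin d, momentConst (fun _ => 1) 1 * ∑ i, (X i k ^ 4 + Y i l ^ 4) := by
        refine Finset.sum_le_sum fun k _ => Finset.sum_le_sum fun l _ => ?_
        refine (hβ.integral_sq_form_le hα hα1 _).trans ?_
        gcongr with i
        nlinarith [sq_nonneg (X i k ^ 2 - Y i l ^ 2), sq_nonneg (X i k ^ 2), sq_nonneg (Y i l ^ 2)]
    _ = _ := by
        have e1 : ∑ k : Fin d, ∑ i, X i k ^ 4 = fourthMoment X := Finset.sum_comm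
        have e2 : ∑ k : Fin d, ∑ i, Y i k ^ 4 = fourthMoment Y := Finset.sum_comm
        simp only [Finset.sum_add_distrib, ← Finset.mul_sum, Finset.sum_const, Finset.card_univ,
          Fintype.card_fin, nsmul_eq_mul, e1, e2]
        ring

theorem IsPatternLaw.integral_patternError_le (hβ : IsPatternLaw α β) (hα : 0 < α) (hα1 : α ≤ 1)
    (hn : 0 < n) (U X : Matrix (Fin n) (Fin d) ℝ) :
    ∫ v, patternError U X α v ∂β ≤
      momentConst (fun _ => 1) 1 * (3 * d * (fourthMoment X + fourthMoment U) + 1 / n) := by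
  have hp := hβ.prob
  have hn0 : (0 : ℝ) < n := by exact_mod_cast hn
  have h1 := hβ.integral_distSq_le hα hα1 X X
  have h2 := hβ.integral_distSq_le hα hα1 U X
  have h3 := hβ.integral_distSq_le hα hα1 U U
  have h4 : ∫ v : Fin n → Bool, ((∑ i, if v i then 1 else 0) / (n : ℝ) - α) ^ 2 ∂β
      ≤ momentConst (fun _ => 1) 1 * (1 / n) := by
    have := hβ.integral_sq_form_le hα hα1 (fun _ => (1 : ℝ) / n)
    have e : ∀ v : Fin n → Bool, ∑ i, (1 : ℝ) / n * ((if v i then 1 else 0) - α)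
        = (∑ i, if v i then 1 else 0) / (n : ℝ) - α := fun v => by
      rw [← Finset.mul_sum, Finset.sum_sub_distrib]
      simp only [Finset.sum_const, Finset.card_univ, Fintype.card_fin, nsmul_eq_mul]
      field_simp
    simp only [e] at this
    refine this.trans_eq ?_
    simp only [Finset.sum_const, Finset.card_univ, Fintype.card_fin, nsmul_eq_mul]
    field_simp
  unfold patternError
  rw [integral_add Integrable.of_finite Integrable.of_finite,
    integral_add Integrable.of_finite Integrable.of_finite,
    integral_add Integrable.of_finite Integrable.of_finite]
  linarith

end

/-- The mean growth of the Lyapunov function in one step. -/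
theorem exists_lyapunov_step_bound (alg : Algorithm) {d : ℕ} {C : ℕ → ℝ} {ε τ α : ℝ} (hd : 0 < d)
    (hα : 0 < α) (hα1 : α ≤ 1) (hτ : 0 < τ) (hε : 0 < ε) (hεα : ε < α) (hC : ∀ m, 0 ≤ C m) (σ : ℝ)
    (lam : Fin d → ℝ) {M : ℝ} (hM : 0 < M) :
    ∃ K : ℝ, 0 < K ∧ ∀ {n : ℕ} {U X : Matrix (Fin n) (Fin d) ℝ}
      {β : Measure (Fin n → Bool)} {ζ : Measure (Fin n → ℝ)} {p p' : Matrix (Fin d) (Fin d) ℝ},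
      IsPatternLaw α β → IsSampleLaw U lam σ C ζ → 0 < n → Uᵀ * U = 1 → Xᵀ * X = 1 →
      fourthMoment U ≤ M / n → ‖p‖ ≤ M →
      ‖p' - p - (1 / n : ℝ) •
        riccatiField (riccatiLinear α σ τ lam) (riccatiQuadratic α σ τ lam) p‖ ≤ M / n ^ 2 →
      ∫⁻ v, ∫⁻ s, ENNReal.ofReal (lyapunov U p' (closedStep alg ε (τ / n) X v s)) ∂ζ ∂β ≤
        ENNReal.ofReal ((1 + K / n) * lyapunov U p X + K / n ^ 2) := by
  obtain ⟨K, hK, h1⟩ := exists_lyapunov_pattern_bound alg hd hα hα1 hτ hε hεα hC σ lam hM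
  set κ := momentConst (fun _ => 1) 1 with hκdef
  have hκ : 0 ≤ κ := momentConst_nonneg (fun _ => zero_le_one) 1
  have hd0 : (0 : ℝ) < d := by exact_mod_cast hd
  set b := 1 + 3 * d * κ with hb
  refine ⟨K * b + K * (b * M + κ + 1), by positivity, ?_⟩
  intro n U X β ζ p p' hβ hζ hn hU hX hUM hp hp'
  have hpβ := hβ.prob
  have hpζ := hζ.prob
  have hn0 : (0 : ℝ) < n := by exact_mod_cast hn
  have hstep := fun v => h1 v hζ hn hU hX hp hp'
  set V := lyapunov U p X with hV
  have hV0 : 0 ≤ V := lyapunov_nonneg U p X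
  -- The mean mask error involves the fourth moment of `X`. As this is part of the Lyapunov
  -- function, the recursion closes.
  have hfV : fourthMoment X ≤ V := by
    rw [hV, lyapunov]; linarith [distSq_nonneg (Uᵀ * X * (Uᵀ * X)ᵀ) p]
  have hfU := fourthMoment_nonneg U
  calc _ ≤ ∫⁻ v, ENNReal.ofReal (V + K / n * (V + fourthMoment U + patternError U X α v)
        + K / n ^ 2) ∂β := by
        refine lintegral_mono fun v => ?_
        rw [← ofReal_integral_eq_lintegral_ofReal (hstep v).1.integrable
          (.of_forall fun s => lyapunov_nonneg _ _ _)]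
        exact ENNReal.ofReal_le_ofReal (hstep v).2
    _ = ENNReal.ofReal (∫ v, (V + K / n * (V + fourthMoment U + patternError U X α v)
        + K / n ^ 2) ∂β) := by
        rw [ofReal_integral_eq_lintegral_ofReal Integrable.of_finite]
        refine .of_forall fun v => ?_
        have := patternError_nonneg U X α v
        simp only [Pi.zero_apply]
        positivity
    _ ≤ _ := by
        refine ENNReal.ofReal_le_ofReal ?_
        have hpe := hβ.integral_patternError_le hα hα1 hn U X
        rw [← hκdef] at hpe
        have e1 : ∫ v, (V + K / n * (V + fourthMoment U + patternError U X α v) + K / n ^ 2) ∂β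
            = V + K / n * (V + fourthMoment U + ∫ v, patternError U X α v ∂β) + K / n ^ 2 := by
          rw [integral_add Integrable.of_finite Integrable.of_finite,
            integral_add Integrable.of_finite Integrable.of_finite, integral_const_mul,
            integral_add Integrable.of_finite Integrable.of_finite]
          simp
        rw [e1]
        calc _ ≤ V + K / n * (V + M / n + κ * (3 * d * (V + M / n) + 1 / n)) + K / n ^ 2 := by
              have : κ * (3 * d * (fourthMoment X + fourthMoment U) + 1 / n)
                  ≤ κ * (3 * d * (V + M / n) + 1 / n) := by gcongr
              gcongr
              exact hpe.trans this
          _ = (1 + K * b / n) * V + K * (b * M + κ + 1) / n ^ 2 := by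
              rw [hb]; field_simp; ring
          _ ≤ _ := by
              have t1 : 0 ≤ K * b := by positivity
              have t2 : 0 ≤ K * (b * M + κ + 1) := by positivity
              refine add_le_add (mul_le_mul_of_nonneg_right (add_le_add le_rfl
                (div_le_div_of_nonneg_right (by linarith) hn0.le)) hV0)
                (div_le_div_of_nonneg_right (by linarith) (by positivity))

/-! ### Measurability -/

/-- A rational threshold strictly above `ε` turns the strict test into a countable union of
conditions on quadratic forms, each of which is closed in `X`. -/
theorem measurableSet_lt_lambdaMin {n d : ℕ} (hd : 0 < d) (ε : ℝ) (v : Fin n → Bool) :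
    MeasurableSet {x : Fin n → Fin d → ℝ | ε < lambdaMin (gram (Matrix.of x) v)} := by
  have e : {x : Fin n → Fin d → ℝ | ε < lambdaMin (gram (Matrix.of x) v)} =
      ⋃ q : {q : ℚ // ε < q}, ⋂ y : Fin d → ℝ,
        {x : Fin n → Fin d → ℝ | ((q : ℚ) : ℝ) * (y ⬝ᵥ y) ≤ y ⬝ᵥ (gram (Matrix.of x) v *ᵥ y)} := by
    ext x
    simp only [Set.mem_ofPred_eq, Set.mem_iUnion, Set.mem_iInter]
    constructor
    · intro h
      obtain ⟨q, h1, h2⟩ := exists_rat_btwn h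
      exact ⟨⟨q, h1⟩, fun y => le_dotProduct_mulVec_of_lt_lambdaMin (gram_transpose _ v) h2 y⟩
    · rintro ⟨⟨q, hq⟩, h⟩
      exact lt_lambdaMin_of_forall hd (gram_transpose _ v) hq h
  rw [e]
  refine MeasurableSet.iUnion fun q => IsClosed.measurableSet (isClosed_iInter fun y => ?_)
  refine isClosed_le continuous_const ?_
  have hc : Continuous fun x : Fin n → Fin d → ℝ => gram (Matrix.of x) v := by
    unfold gram
    have : Continuous fun x : Fin n → Fin d → ℝ => Matrix.of x := continuous_id
    fun_prop
  fun_prop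

theorem measurable_gram_inv {n d : ℕ} (v : Fin n → Bool) (k l : Fin d) :
    Measurable fun x : Fin n → Fin d → ℝ => (gram (Matrix.of x) v)⁻¹ k l := by
  have hc : Continuous fun x : Fin n → Fin d → ℝ => gram (Matrix.of x) v := by
    unfold gram
    have : Continuous fun x : Fin n → Fin d → ℝ => Matrix.of x := continuous_id
    fun_prop
  simp only [Matrix.inv_def, Matrix.smul_apply, smul_eq_mul, Ring.inverse_eq_inv']
  have h1 : Measurable fun x : Fin n → Fin d → ℝ => (gram (Matrix.of x) v).det :=
    hc.matrix_det.measurable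
  have h2 : Measurable fun x : Fin n → Fin d → ℝ => (gram (Matrix.of x) v).adjugate k l :=
    (hc.matrix_adjugate.matrix_elem k l).measurable
  exact h1.inv.mul h2

theorem measurable_closedStep {n d : ℕ} (alg : Algorithm) (hd : 0 < d) (ε h : ℝ) (i : Fin n)
    (j : Fin d) : Measurable fun q : ((Fin n → Fin d → ℝ) × (Fin n → ℝ)) × (Fin n → Bool) =>
      closedStep alg ε h (Matrix.of q.1.1) q.2 q.1.2 i j := by
  refine measurable_from_prod_countable_left fun v => ?_
  simp only [closedStep]
  have hx : ∀ i j, Measurable fun q : (Fin n → Fin d → ℝ) × (Fin n → ℝ) => q.1 i j := fun i j => by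
    fun_prop
  have hs : ∀ i, Measurable fun q : (Fin n → Fin d → ℝ) × (Fin n → ℝ) => q.2 i := fun i => by
    fun_prop
  have hfit : ∀ k, Measurable fun q : (Fin n → Fin d → ℝ) × (Fin n → ℝ) =>
      (fitMatrix (Matrix.of q.1) v *ᵥ q.2) k := fun k => by
    simp only [mulVec, dotProduct, fitMatrix, Matrix.mul_apply, transpose_apply, Matrix.of_apply]
    refine Finset.measurable_sum _ fun i _ => Measurable.mul ?_ (hs i)
    refine Finset.measurable_sum _ fun l _ => Measurable.mul
      ((measurable_gram_inv v k l).comp measurable_fst) ?_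
    exact Finset.measurable_sum _ fun m _ => (hx _ _).mul_const _
  have hXw : ∀ i, Measurable fun q : (Fin n → Fin d → ℝ) × (Fin n → ℝ) =>
      (Matrix.of q.1 *ᵥ (fitMatrix (Matrix.of q.1) v *ᵥ q.2)) i := fun i =>
    show Measurable fun q : (Fin n → Fin d → ℝ) × (Fin n → ℝ) =>
      ∑ k, q.1 i k * (fitMatrix (Matrix.of q.1) v *ᵥ q.2) k from Finset.measurable_sum _ fun k _ => (hx i k).mul (hfit k)
  have hres : ∀ i, Measurable fun q : (Fin n → Fin d → ℝ) × (Fin n → ℝ) =>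
      (residualMatrix (Matrix.of q.1) v *ᵥ q.2) i := fun i => by
    simp only [residual_apply]
    exact ((hs i).sub (hXw i)).const_mul _
  have hnorm : ∀ {m : ℕ} {f : (Fin n → Fin d → ℝ) × (Fin n → ℝ) → Fin m → ℝ},
      (∀ i, Measurable fun q => f q i) → Measurable fun q => l2norm (f q) := fun {m f} hf => by
    have : (fun q => l2norm (f q)) = fun q => √(∑ i, f q i * f q i) := by
      ext q
      rw [← Real.sqrt_sq (l2norm_nonneg (f q)), l2norm_sq, dotProduct]
    rw [this]
    exact (Finset.measurable_sum _ fun i _ => (hf i).mul (hf i)).sqrt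
  have h1 := hnorm hfit
  have h2 := hnorm hres
  have h3 := hXw i
  have h4 := hres i
  have h5 := hfit j
  have h6 : Measurable Real.sinc := Real.continuous_sinc.measurable
  have hupd : Measurable fun q : (Fin n → Fin d → ℝ) × (Fin n → ℝ) =>
      updateMatrix alg h (Matrix.of q.1) v q.2 i j := by
    simp only [updateMatrix_apply, Matrix.of_apply]
    have := hx i j
    cases alg <;> simp only [fitCoeff, residualCoeff] <;> fun_prop
  have hite : (fun q : (Fin n → Fin d → ℝ) × (Fin n → ℝ) =>
      (if ε < lambdaMin (gram (Matrix.of q.1) v) then updateMatrix alg h (Matrix.of q.1) v q.2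
        else Matrix.of q.1) i j) = fun q =>
      if ε < lambdaMin (gram (Matrix.of q.1) v) then updateMatrix alg h (Matrix.of q.1) v q.2 i j
        else q.1 i j := by
    ext q
    split_ifs <;> rfl
  rw [hite]
  exact Measurable.ite (measurable_fst (measurableSet_lt_lambdaMin hd ε v)) hupd (hx i j)

theorem measurable_lyapunov {n d : ℕ} (U : Matrix (Fin n) (Fin d) ℝ)
    (p : Matrix (Fin d) (Fin d) ℝ) :
    Measurable fun x : Fin n → Fin d → ℝ => lyapunov U p (Matrix.of x) := by
  simp only [lyapunov, distSq, fourthMoment, Matrix.mul_apply, transpose_apply, Matrix.of_apply]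
  fun_prop

end

end SubspaceTracking

namespace SubspaceTracking

noncomputable section

set_option linter.unusedSectionVars false

/-! ### Independence -/

section

variable {Ω α₁ α₂ β₁ β₂ : Type*} [MeasurableSpace Ω] [MeasurableSpace α₁] [MeasurableSpace α₂]
  [MeasurableSpace β₁] [MeasurableSpace β₂]

theorem map_prod_prod_comm (μ₁ : Measure α₁) (μ₂ : Measure α₂) (ν₁ : Measure β₁) (ν₂ : Measure β₂)
    [IsProbabilityMeasure μ₁] [IsProbabilityMeasure μ₂] [IsProbabilityMeasure ν₁]
    [IsProbabilityMeasure ν₂] :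
    ((μ₁.prod μ₂).prod (ν₁.prod ν₂)).map (fun q => ((q.1.1, q.2.1), (q.1.2, q.2.2)))
      = (μ₁.prod ν₁).prod (μ₂.prod ν₂) := by
  have hm : Measurable fun q : (α₁ × α₂) × (β₁ × β₂) => ((q.1.1, q.2.1), (q.1.2, q.2.2)) := by
    fun_prop
  refine Measure.ext_of_lintegral _ fun f hf => ?_
  have hfm : Measurable fun q : (α₁ × α₂) × (β₁ × β₂) => f ((q.1.1, q.2.1), (q.1.2, q.2.2)) :=
    hf.comp hm
  rw [lintegral_map hf hm, lintegral_prod _ hfm.aemeasurable, lintegral_prod _ hf.aemeasurable]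
  rw [lintegral_prod _ hfm.lintegral_prod_right'.aemeasurable,
    lintegral_prod _ hf.lintegral_prod_right'.aemeasurable]
  refine lintegral_congr fun x₁ => ?_
  have hR : ∀ y₁ : β₁, ∫⁻ z, f ((x₁, y₁), z) ∂(μ₂.prod ν₂)
      = ∫⁻ x₂, ∫⁻ y₂, f ((x₁, y₁), (x₂, y₂)) ∂ν₂ ∂μ₂ := fun y₁ =>
    lintegral_prod _ (hf.comp (by fun_prop)).aemeasurable
  have hL : ∀ x₂ : α₂, ∫⁻ z : β₁ × β₂, f ((x₁, z.1), (x₂, z.2)) ∂(ν₁.prod ν₂)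
      = ∫⁻ y₁, ∫⁻ y₂, f ((x₁, y₁), (x₂, y₂)) ∂ν₂ ∂ν₁ := fun x₂ =>
    lintegral_prod (fun z : β₁ × β₂ => f ((x₁, z.1), (x₂, z.2)))
      (hf.comp (by fun_prop)).aemeasurable
  simp only [hR, hL]
  rw [lintegral_lintegral_swap]
  have : Measurable fun q : (α₂ × β₁) × β₂ => f ((x₁, q.1.2), (q.1.1, q.2)) :=
    hf.comp (by fun_prop)
  exact this.lintegral_prod_right'.aemeasurable

/-- Regrouping of independent pairs. -/
theorem indepFun_prodMk_prodMk_of_indepFun {μ : Measure Ω} [IsProbabilityMeasure μ] {A₁ : Ω → α₁}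
    {A₂ : Ω → α₂} {B₁ : Ω → β₁} {B₂ : Ω → β₂} (hA₁ : Measurable A₁) (hA₂ : Measurable A₂)
    (hB₁ : Measurable B₁) (hB₂ : Measurable B₂)
    (h : IndepFun (fun ω => (A₁ ω, A₂ ω)) (fun ω => (B₁ ω, B₂ ω)) μ) (hA : IndepFun A₁ A₂ μ)
    (hB : IndepFun B₁ B₂ μ) :
    IndepFun (fun ω => (A₁ ω, B₁ ω)) (fun ω => (A₂ ω, B₂ ω)) μ := by
  have p1 := Measure.isProbabilityMeasure_map (μ := μ) hA₁.aemeasurable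
  have p2 := Measure.isProbabilityMeasure_map (μ := μ) hA₂.aemeasurable
  have p3 := Measure.isProbabilityMeasure_map (μ := μ) hB₁.aemeasurable
  have p4 := Measure.isProbabilityMeasure_map (μ := μ) hB₂.aemeasurable
  have h1 : IndepFun A₁ B₁ μ := h.comp measurable_fst measurable_fst
  have h2 : IndepFun A₂ B₂ μ := h.comp measurable_snd measurable_snd
  rw [indepFun_iff_map_prod_eq_prod_map_map (by fun_prop) (by fun_prop)] at h h1 h2 hA hB ⊢
  rw [h1, h2, ← map_prod_prod_comm, ← hA, ← hB, ← h, Measure.map_map (by fun_prop) (by fun_prop)]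
  rfl

/-- The filler value `b` makes the finite past a function on the whole index set, as needed for
feeding it to `closedIterate`, which takes infinite sequences. -/
theorem indepFun_truncation {ι β : Type*} [DecidableEq ι] [MeasurableSpace β] {μ : Measure Ω}
    {f : ι → Ω → β} (hf : iIndepFun f μ) (hm : ∀ i, Measurable (f i)) (S T : Finset ι)
    (hST : Disjoint S T) (b : β) :
    IndepFun (fun ω i => if i ∈ S then f i ω else b) (fun ω (i : T) => f i ω) μ := by
  have h := hf.indepFun_finset S T hST hm
  have h1 : Measurable fun (x : S → β) (i : ι) => if hi : i ∈ S then x ⟨i, hi⟩ else b := by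
    refine measurable_pi_lambda _ fun i => ?_
    by_cases hi : i ∈ S
    · simp only [hi, dif_pos]; exact measurable_pi_apply _
    · simp only [hi]; exact measurable_const
  have h2 := h.comp h1 measurable_id
  convert h2 using 1
  · ext ω i
    by_cases hi : i ∈ S <;> simp [hi]
  · rfl

end

/-! ### The iterates in closed form -/

/-- The iterates, in closed form. -/
def closedIterate {n d : ℕ} (alg : Algorithm) (ε h : ℝ) (X₀ : Matrix (Fin n) (Fin d) ℝ)
    (v : ℕ → Fin n → Bool) (s : ℕ → Fin n → ℝ) : ℕ → Matrix (Fin n) (Fin d) ℝ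
  | 0 => X₀
  | k + 1 => closedStep alg ε h (closedIterate alg ε h X₀ v s k) (v k) (s k)

section

variable {n d : ℕ} (alg : Algorithm) {ε h τ : ℝ}

theorem closedIterate_transpose_mul (hh : 0 ≤ h) (hε : 0 < ε) {X₀ : Matrix (Fin n) (Fin d) ℝ}
    (hX : X₀ᵀ * X₀ = 1) (v : ℕ → Fin n → Bool) (s : ℕ → Fin n → ℝ) (k : ℕ) :
    (closedIterate alg ε h X₀ v s k)ᵀ * closedIterate alg ε h X₀ v s k = 1 := by
  induction k with
  | zero => exact hX
  | succ k ih => exact closedStep_transpose_mul alg hh hε ih _ _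

theorem iterate_eq_closedIterate (hτ : 0 ≤ τ) (hε : 0 < ε) {X₀ : Matrix (Fin n) (Fin d) ℝ}
    (hX : X₀ᵀ * X₀ = 1) (v : ℕ → Fin n → Bool) (s : ℕ → Fin n → ℝ) (k : ℕ) :
    iterate alg ε (fun _ => τ) X₀ v s k = closedIterate alg ε (τ / n) X₀ v s k := by
  induction k with
  | zero => rfl
  | succ k ih =>
    rw [iterate, closedIterate, ih]
    exact step_eq_closedStep alg hτ hε (closedIterate_transpose_mul alg (by positivity) hε hX v s k)
      _ _

theorem closedIterate_congr {X₀ : Matrix (Fin n) (Fin d) ℝ}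
    {v v' : ℕ → Fin n → Bool} {s s' : ℕ → Fin n → ℝ} (k : ℕ) (hv : ∀ j < k, v j = v' j)
    (hs : ∀ j < k, s j = s' j) :
    closedIterate alg ε h X₀ v s k = closedIterate alg ε h X₀ v' s' k := by
  induction k with
  | zero => rfl
  | succ k ih =>
    rw [closedIterate, closedIterate, ih (fun j hj => hv j (by omega)) fun j hj => hs j (by omega),
      hv k (by omega), hs k (by omega)]

theorem measurable_closedIterate (hd : 0 < d) {Ω : Type*} [MeasurableSpace Ω]
    {X₀ : Ω → Matrix (Fin n) (Fin d) ℝ} {v : ℕ → Ω → Fin n → Bool} {s : ℕ → Ω → Fin n → ℝ}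
    (hX : ∀ i j, Measurable fun ω => X₀ ω i j) (hv : ∀ k, Measurable (v k))
    (hs : ∀ k, Measurable (s k)) (k : ℕ) :
    Measurable fun ω i j =>
      closedIterate alg ε h (X₀ ω) (fun k => v k ω) (fun k => s k ω) k i j := by
  induction k with
  | zero => exact measurable_pi_lambda _ fun i => measurable_pi_lambda _ fun j => hX i j
  | succ k ih =>
    refine measurable_pi_lambda _ fun i => measurable_pi_lambda _ fun j => ?_
    generalize hY : (fun ω i j =>
      closedIterate alg ε h (X₀ ω) (fun k => v k ω) (fun k => s k ω) k i j) = Y at ih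
    have hstep : ∀ ω, closedIterate alg ε h (X₀ ω) (fun k => v k ω) (fun k => s k ω) (k + 1) i j
        = closedStep alg ε h (Matrix.of (Y ω)) (v k ω) (s k ω) i j := fun ω => by
      rw [closedIterate, ← hY]
      rfl
    simp only [hstep]
    have hF := measurable_closedStep (n := n) alg hd ε h i j
    generalize hFd : (fun q : ((Fin n → Fin d → ℝ) × (Fin n → ℝ)) × (Fin n → Bool) =>
      closedStep alg ε h (Matrix.of q.1.1) q.2 q.1.2 i j) = F at hF
    have hFe : ∀ y w s, closedStep alg ε h (Matrix.of y) w s i j = F ((y, s), w) :=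
      fun y w s => by rw [← hFd]
    simp only [hFe]
    exact hF.comp ((ih.prodMk (hs k)).prodMk (hv k))

end

section

variable {n d : ℕ} {Ω : Type*} [MeasurableSpace Ω] {μ : Measure Ω} [IsProbabilityMeasure μ]
  {νc : Measure (Fin d → ℝ)} {νa : Measure ℝ} {α σ : ℝ} {lam : Fin d → ℝ}
  {X₀ : Ω → Matrix (Fin n) (Fin d) ℝ} {c : ℕ → Ω → Fin d → ℝ} {a : ℕ → Ω → Fin n → ℝ}
  {v : ℕ → Ω → Fin n → Bool}

namespace IsDataStream

theorem measurable_sample (hs : IsDataStream μ νc νa α X₀ c a v) (U : Matrix (Fin n) (Fin d) ℝ)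
    (k : ℕ) : Measurable fun ω => U *ᵥ c k ω + a k ω := by
  have h1 := hs.measurable_c k
  have h2 := hs.measurable_a k
  refine measurable_pi_lambda _ fun i => ?_
  simp only [Pi.add_apply, mulVec, dotProduct]
  fun_prop

theorem isPatternLaw_map (hs : IsDataStream μ νc νa α X₀ c a v) (k : ℕ) :
    IsPatternLaw α (μ.map (v k)) := by
  have hm := hs.measurable_v k
  have hp : IsProbabilityMeasure (μ.map (v k)) :=
    Measure.isProbabilityMeasure_map hm.aemeasurable
  have hi : iIndepFun (fun i ω => v k ω i) μ :=
    hs.indep_v.precomp (g := fun i => (k, i)) fun i j h => by simpa using h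
  refine ⟨hp, ?_, fun i => ?_⟩
  · rw [iIndepFun_iff_map_fun_eq_pi_map fun i => (measurable_pi_apply i).aemeasurable]
    rw [iIndepFun_iff_map_fun_eq_pi_map fun i => hm.eval.aemeasurable] at hi
    rw [Measure.map_map (by fun_prop) hm]
    refine hi.trans ?_
    congr 1
    ext1 i
    rw [Measure.map_map (measurable_pi_apply i) hm]
    rfl
  · rw [Measure.map_apply hm .of_discrete]
    exact hs.law_v k i

theorem isSampleLaw_map (hs : IsDataStream μ νc νa α X₀ c a v) (hνc : IsCoefficientLaw lam νc)
    (hνa : IsNoiseLaw σ νa) (hn : 0 < n) {U : Matrix (Fin n) (Fin d) ℝ} (hU : Uᵀ * U = 1) (k : ℕ) :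
    IsSampleLaw U lam σ (sampleConst σ νc νa) (μ.map fun ω => U *ᵥ c k ω + a k ω) := by
  have hi : iIndepFun (fun i ω => a k ω i) μ :=
    hs.indep_a.precomp (g := fun i => (k, i)) fun i j h => by simpa using h
  have hca : IndepFun (c k) (a k) μ :=
    hs.indep_c_av.comp (measurable_pi_apply k) ((measurable_pi_apply k).comp measurable_fst)
  exact SubspaceTracking.isSampleLaw_map hνc hνa (hs.measurable_c k) (hs.law_c k)
    (hs.measurable_a k) (hs.law_a k) hi hca hn hU

theorem indepFun_sample_pattern (hs : IsDataStream μ νc νa α X₀ c a v)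
    (U : Matrix (Fin n) (Fin d) ℝ) (k : ℕ) :
    IndepFun (fun ω => U *ᵥ c k ω + a k ω) (v k) μ := by
  have h1 : IndepFun (fun ω => (c k ω, ())) (fun ω => (a k ω, v k ω)) μ :=
    hs.indep_c_av.comp (φ := fun x => (x k, ())) (ψ := fun x => (x.1 k, x.2 k)) (by fun_prop)
      (by fun_prop)
  have h2 : IndepFun (a k) (v k) μ :=
    hs.indep_a_v.comp (measurable_pi_apply k) (measurable_pi_apply k)
  have h3 := indepFun_prodMk_prodMk_of_indepFun (hs.measurable_c k) measurable_const
    (hs.measurable_a k) (hs.measurable_v k) h1 (indepFun_const_right _ _) h2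
  refine h3.comp (φ := fun x => U *ᵥ x.1 + x.2) (ψ := fun x => x.2) ?_ measurable_snd
  refine measurable_pi_lambda _ fun i => ?_
  simp only [Pi.add_apply, mulVec, dotProduct]
  fun_prop

/-- By `closedIterate_congr` the iterate is a function of `X₀` and of the stream truncated before
time `k`. Past and present are independent for `c`, `a` and `v` separately, and the mutual
independence of the sources allows regrouping into one past and one present. -/
theorem indepFun_closedIterate (hs : IsDataStream μ νc νa α X₀ c a v) (alg : Algorithm)
    (hd : 0 < d) (ε h : ℝ) (U : Matrix (Fin n) (Fin d) ℝ) (k : ℕ) :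
    IndepFun (fun ω i j => closedIterate alg ε h (X₀ ω) (fun k => v k ω)
        (fun k => U *ᵥ c k ω + a k ω) k i j)
      (fun ω => (U *ᵥ c k ω + a k ω, v k ω)) μ := by
  have mc := hs.measurable_c
  have ma := hs.measurable_a
  have mv := hs.measurable_v
  have hdisj : Disjoint (Finset.range k ×ˢ (Finset.univ : Finset (Fin n)))
      ({k} ×ˢ Finset.univ) := by
    rw [Finset.disjoint_left]
    rintro ⟨j, i⟩ h1 h2
    simp at h1 h2
    omega
  have hmem : ∀ i : Fin n, (k, i) ∈ ({k} ×ˢ Finset.univ : Finset (ℕ × Fin n)) := fun i => by simp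
  have tc : IndepFun (fun ω j => if j < k then c j ω else 0) (c k) μ := by
    have := indepFun_truncation hs.indep_c mc (Finset.range k) {k} (by simp) 0
    have := this.comp measurable_id (measurable_pi_apply ⟨k, by simp⟩)
    simp only [Finset.mem_range] at this
    exact this
  have ta : IndepFun (fun ω j i => if j < k then a j ω i else 0) (a k) μ := by
    have := indepFun_truncation hs.indep_a (fun q => (ma q.1).eval) _ _ hdisj 0
    have := this.comp (φ := fun x j i => x (j, i)) (ψ := fun x i => x ⟨(k, i), hmem i⟩)
      (by fun_prop) (by fun_prop)
    simpa [Function.comp_def] using this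
  have tv : IndepFun (fun ω j i => if j < k then v j ω i else false) (v k) μ := by
    have := indepFun_truncation hs.indep_v (fun q => (mv q.1).eval) _ _ hdisj false
    have := this.comp (φ := fun x j i => x (j, i)) (ψ := fun x i => x ⟨(k, i), hmem i⟩)
      (by fun_prop) (by fun_prop)
    simpa [Function.comp_def] using this
  set C₁ : Ω → ℕ → Fin d → ℝ := fun ω j => if j < k then c j ω else 0 with hC₁
  set A₁ : Ω → ℕ → Fin n → ℝ := fun ω j i => if j < k then a j ω i else 0 with hA₁
  set V₁ : Ω → ℕ → Fin n → Bool := fun ω j i => if j < k then v j ω i else false with hV₁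
  have trc : Measurable fun (x : ℕ → Fin d → ℝ) j => if j < k then x j else 0 := by
    refine measurable_pi_lambda _ fun j => ?_
    split_ifs
    · exact measurable_pi_apply j
    · exact measurable_const
  have tra : Measurable fun (x : ℕ → Fin n → ℝ) j i => if j < k then x j i else 0 := by
    refine measurable_pi_lambda _ fun j => measurable_pi_lambda _ fun i => ?_
    split_ifs
    · fun_prop
    · exact measurable_const
  have trv : Measurable fun (x : ℕ → Fin n → Bool) j i => if j < k then x j i else false := by
    refine measurable_pi_lambda _ fun j => measurable_pi_lambda _ fun i => ?_
    split_ifs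
    · fun_prop
    · exact measurable_const
  have mC₁ : Measurable C₁ := trc.comp (measurable_pi_lambda _ mc)
  have mA₁ : Measurable A₁ := tra.comp (measurable_pi_lambda _ ma)
  have mV₁ : Measurable V₁ := trv.comp (measurable_pi_lambda _ mv)
  have I1 : IndepFun (fun ω => (A₁ ω, V₁ ω)) (fun ω => (a k ω, v k ω)) μ :=
    indepFun_prodMk_prodMk_of_indepFun mA₁ (ma k) mV₁ (mv k)
      (hs.indep_a_v.comp (tra.prodMk (measurable_pi_apply k)) (trv.prodMk (measurable_pi_apply k)))
      ta tv
  have I2 : IndepFun (fun ω => (C₁ ω, (A₁ ω, V₁ ω))) (fun ω => (c k ω, (a k ω, v k ω))) μ :=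
    indepFun_prodMk_prodMk_of_indepFun mC₁ (mc k) (mA₁.prodMk mV₁) ((ma k).prodMk (mv k))
      (hs.indep_c_av.comp (trc.prodMk (measurable_pi_apply k))
        (((tra.comp measurable_fst).prodMk (trv.comp measurable_snd)).prodMk
          (((measurable_pi_apply k).comp measurable_fst).prodMk
            ((measurable_pi_apply k).comp measurable_snd)))) tc I1
  have mX : Measurable fun ω i j => X₀ ω i j :=
    measurable_pi_lambda _ fun i => measurable_pi_lambda _ fun j => hs.measurable_X₀ i j
  -- The unit component lets the regrouping lemma adjoin `X₀` to the past alone.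
  have I3 : IndepFun (fun ω => ((fun i j => X₀ ω i j), (C₁ ω, (A₁ ω, V₁ ω))))
      (fun ω => ((), (c k ω, (a k ω, v k ω)))) μ := by
    refine indepFun_prodMk_prodMk_of_indepFun mX measurable_const (mC₁.prodMk (mA₁.prodMk mV₁))
      ((mc k).prodMk ((ma k).prodMk (mv k))) ?_ (indepFun_const_right _ _) I2
    refine hs.indep_X₀_cav.comp (φ := fun x => (x, ()))
      (ψ := fun x => (((fun j => if j < k then x.1 j else 0),
        ((fun j i => if j < k then x.2.1 j i else 0),
          (fun j i => if j < k then x.2.2 j i else false))),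
        (x.1 k, (x.2.1 k, x.2.2 k)))) (by fun_prop) ?_
    have p1 : Measurable fun x : (ℕ → Fin d → ℝ) × ((ℕ → Fin n → ℝ) × (ℕ → Fin n → Bool)) => x.1 :=
      measurable_fst
    have p2 : Measurable fun x : (ℕ → Fin d → ℝ) × ((ℕ → Fin n → ℝ) × (ℕ → Fin n → Bool)) =>
      x.2.1 := by fun_prop
    have p3 : Measurable fun x : (ℕ → Fin d → ℝ) × ((ℕ → Fin n → ℝ) × (ℕ → Fin n → Bool)) =>
      x.2.2 := by fun_prop
    have m1 := trc.comp p1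
    have m2 := tra.comp p2
    have m3 := trv.comp p3
    exact (m1.prodMk (m2.prodMk m3)).prodMk (by fun_prop)
  have hG : Measurable fun (q : (Fin n → Fin d → ℝ) × ((ℕ → Fin d → ℝ) × ((ℕ → Fin n → ℝ) ×
      (ℕ → Fin n → Bool)))) i j => closedIterate alg ε h (Matrix.of q.1) (fun k => q.2.2.2 k)
        (fun k => U *ᵥ q.2.1 k + q.2.2.1 k) k i j := by
    refine measurable_closedIterate alg hd
      (Ω := (Fin n → Fin d → ℝ) × ((ℕ → Fin d → ℝ) × ((ℕ → Fin n → ℝ) × (ℕ → Fin n → Bool))))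
      (X₀ := fun q => Matrix.of q.1)
      (v := fun k q => q.2.2.2 k) (s := fun k q => U *ᵥ q.2.1 k + q.2.2.1 k) (fun i j => ?_)
      (fun k => ?_) (fun k => ?_) k
    · simp only [Matrix.of_apply]; fun_prop
    · fun_prop
    · refine measurable_pi_lambda _ fun i => ?_
      simp only [Pi.add_apply, mulVec, dotProduct]
      fun_prop
  have hH : Measurable fun q : Unit × ((Fin d → ℝ) × ((Fin n → ℝ) × (Fin n → Bool))) =>
      (U *ᵥ q.2.1 + q.2.2.1, q.2.2.2) := by
    refine Measurable.prodMk (measurable_pi_lambda _ fun i => ?_) (by fun_prop)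
    simp only [Pi.add_apply, mulVec, dotProduct]
    fun_prop
  have I4 := I3.comp hG hH
  convert I4 using 1
  swap
  · rfl
  ext ω i j
  simp only [Function.comp_apply]
  have := closedIterate_congr alg (ε := ε) (h := h) (X₀ := X₀ ω) (v := fun k => v k ω)
    (v' := V₁ ω) (s := fun k => U *ᵥ c k ω + a k ω) (s' := fun k => U *ᵥ C₁ ω k + A₁ ω k) k
    (fun j hj => by simp [hV₁, hj]) (fun j hj => by simp [hC₁, hA₁, hj])
  rw [this]
  rfl

end IsDataStream

end

end

end SubspaceTracking

open scoped Matrix.Norms.L2Operator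

namespace SubspaceTracking

noncomputable section

/-! ### The mean of the Lyapunov function along the iterates -/

/-- Discrete Grönwall inequality, in `ENNReal` so that no finiteness of the initial mean is needed.
-/
theorem le_pow_mul_of_succ_le {E : ℕ → ENNReal} {x y : ENNReal} (hx : 1 ≤ x) {N : ℕ}
    (h : ∀ k < N, E (k + 1) ≤ x * E k + y) : ∀ k ≤ N, E k ≤ x ^ k * (E 0 + k * y) := by
  intro k
  induction k with
  | zero => simp
  | succ k ih =>
    intro hk
    calc E (k + 1) ≤ x * E k + y := h k (by omega)
      _ ≤ x * (x ^ k * (E 0 + k * y)) + x ^ (k + 1) * y := by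
          gcongr
          · exact ih (by omega)
          · exact le_mul_of_one_le_left zero_le (one_le_pow₀ hx)
      _ = _ := by push_cast; ring

/-- The sample is the innermost variable of integration, because the one-step bounds are first
proved for a fixed mask. -/
theorem lintegral_comp_of_indepFun {Ω α β γ : Type*} [MeasurableSpace Ω] [MeasurableSpace α]
    [MeasurableSpace β] [MeasurableSpace γ] {μ : Measure Ω} [IsProbabilityMeasure μ]
    {F : α × (β × γ) → ENNReal} (hF : Measurable F) {Y : Ω → α} {S : Ω → β} {V : Ω → γ}
    (hY : Measurable Y) (hS : Measurable S) (hV : Measurable V)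
    (hI : IndepFun Y (fun ω => (S ω, V ω)) μ) (hJ : IndepFun S V μ) :
    ∫⁻ ω, F (Y ω, (S ω, V ω)) ∂μ = ∫⁻ ω, ∫⁻ w, ∫⁻ s, F (Y ω, (s, w)) ∂(μ.map S) ∂(μ.map V) ∂μ := by
  rw [indepFun_iff_map_prod_eq_prod_map_map hS.aemeasurable hV.aemeasurable] at hJ
  rw [indepFun_iff_map_prod_eq_prod_map_map hY.aemeasurable (hS.prodMk hV).aemeasurable, hJ] at hI
  have q1 := Measure.isProbabilityMeasure_map (μ := μ) hS.aemeasurable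
  have q2 := Measure.isProbabilityMeasure_map (μ := μ) hV.aemeasurable
  have hG := hF.lintegral_prod_right' (ν := (μ.map S).prod (μ.map V))
  have e1 := lintegral_map (μ := μ) hF (hY.prodMk (hS.prodMk hV))
  rw [hI, lintegral_prod _ hF.aemeasurable, lintegral_map hG hY] at e1
  rw [← e1]
  refine lintegral_congr fun ω => ?_
  have hFω : Measurable fun q : β × γ => F (Y ω, q) := hF.comp (measurable_const.prodMk measurable_id)
  exact lintegral_prod_symm _ hFω.aemeasurable

section

variable {n d : ℕ} {Ω : Type*} [MeasurableSpace Ω] {μ : Measure Ω} [IsProbabilityMeasure μ]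
  {νc : Measure (Fin d → ℝ)} {νa : Measure ℝ} {α : ℝ}
  {X₀ : Ω → Matrix (Fin n) (Fin d) ℝ} {c : ℕ → Ω → Fin d → ℝ} {a : ℕ → Ω → Fin n → ℝ}
  {v : ℕ → Ω → Fin n → Bool}

/-- The Markov property: a bound for every deterministic orthonormal `X` transfers to the random
iterate, which is almost surely orthonormal and independent of the next sample and mask. -/
theorem IsDataStream.lintegral_lyapunov_step (hs : IsDataStream μ νc νa α X₀ c a v)
    (alg : Algorithm) (hd : 0 < d) {ε h : ℝ} (hε : 0 < ε) (hh : 0 ≤ h)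
    (hX₀ : ∀ᵐ ω ∂μ, (X₀ ω)ᵀ * X₀ ω = 1) (U : Matrix (Fin n) (Fin d) ℝ)
    {p p' : Matrix (Fin d) (Fin d) ℝ} {x y : ℝ} (k : ℕ)
    (hstep : ∀ X : Matrix (Fin n) (Fin d) ℝ, Xᵀ * X = 1 →
      ∫⁻ w, ∫⁻ s, ENNReal.ofReal (lyapunov U p' (closedStep alg ε h X w s))
        ∂(μ.map fun ω => U *ᵥ c k ω + a k ω) ∂(μ.map (v k)) ≤
        ENNReal.ofReal (x * lyapunov U p X + y)) :
    ∫⁻ ω, ENNReal.ofReal (lyapunov U p' (closedIterate alg ε h (X₀ ω) (fun k => v k ω)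
        (fun k => U *ᵥ c k ω + a k ω) (k + 1))) ∂μ ≤
      ∫⁻ ω, ENNReal.ofReal (x * lyapunov U p (closedIterate alg ε h (X₀ ω) (fun k => v k ω)
        (fun k => U *ᵥ c k ω + a k ω) k) + y) ∂μ := by
  have hms := hs.measurable_sample U
  have hmv := hs.measurable_v
  have hI := hs.indepFun_closedIterate alg hd ε h U k
  have hJ := hs.indepFun_sample_pattern U k
  have hY := measurable_closedIterate alg (ε := ε) (h := h) hd hs.measurable_X₀ hmv hms k
  have hF : Measurable fun q : (Fin n → Fin d → ℝ) × ((Fin n → ℝ) × (Fin n → Bool)) =>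
      ENNReal.ofReal (lyapunov U p' (closedStep alg ε h (Matrix.of q.1) q.2.2 q.2.1)) := by
    have hr : Measurable fun q : (Fin n → Fin d → ℝ) × ((Fin n → ℝ) × (Fin n → Bool)) =>
        ((q.1, q.2.1), q.2.2) := by fun_prop
    have hc : Measurable fun (q : (Fin n → Fin d → ℝ) × ((Fin n → ℝ) × (Fin n → Bool))) i j =>
        closedStep alg ε h (Matrix.of q.1) q.2.2 q.2.1 i j := by
      refine measurable_pi_lambda _ fun i => measurable_pi_lambda _ fun j => ?_
      have hF := measurable_closedStep (n := n) alg hd ε h i j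
      generalize hFd : (fun q : ((Fin n → Fin d → ℝ) × (Fin n → ℝ)) × (Fin n → Bool) =>
        closedStep alg ε h (Matrix.of q.1.1) q.2 q.1.2 i j) = F at hF
      have hFe : ∀ y w s, closedStep alg ε h (Matrix.of y) w s i j = F ((y, s), w) :=
        fun y w s => by rw [← hFd]
      simp only [hFe]
      exact hF.comp hr
    have hL := measurable_lyapunov U p'
    generalize hLd : (fun x : Fin n → Fin d → ℝ => lyapunov U p' (Matrix.of x)) = L at hL
    have hLe : ∀ Z, lyapunov U p' Z = L fun i j => Z i j := fun Z => by rw [← hLd]; rfl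
    simp only [hLe]
    exact (hL.comp hc).ennreal_ofReal
  have hrw := lintegral_comp_of_indepFun hF hY (hms k) (hmv k) hI hJ
  refine le_trans (le_of_eq hrw) (lintegral_mono_ae ?_)
  filter_upwards [hX₀] with ω hω
  have hX := closedIterate_transpose_mul alg hh hε hω (fun k => v k ω)
    (fun k => U *ᵥ c k ω + a k ω) k
  exact hstep _ hX

end

/-- The mean of the Lyapunov function stays of the order of its initial value plus `1 / n`. -/
theorem exists_lintegral_lyapunov_le (alg : Algorithm) {d : ℕ} {ε τ α σ : ℝ} (hd : 0 < d)
    (hα : 0 < α) (hα1 : α ≤ 1) (hτ : 0 < τ) (hε : 0 < ε) (hεα : ε < α) {lam : Fin d → ℝ}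
    {νc : Measure (Fin d → ℝ)} (hνc : IsCoefficientLaw lam νc) {νa : Measure ℝ}
    (hνa : IsNoiseLaw σ νa) (C : ℝ) {P : ℝ → Matrix (Fin d) (Fin d) ℝ}
    (hP : ∀ t, 0 ≤ t → HasDerivAt P (riccatiField (riccatiLinear α σ τ lam)
      (riccatiQuadratic α σ τ lam) (P t)) t) {T : ℝ} (hT : 0 ≤ T) :
    ∃ K : ℝ, 0 < K ∧ ∀ {n : ℕ} {Ω : Type*} [MeasurableSpace Ω] {μ : Measure Ω}
      [IsProbabilityMeasure μ] {U : Matrix (Fin n) (Fin d) ℝ}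
      {X₀ : Ω → Matrix (Fin n) (Fin d) ℝ} {c : ℕ → Ω → Fin d → ℝ} {a : ℕ → Ω → Fin n → ℝ}
      {v : ℕ → Ω → Fin n → Bool}, IsDataStream μ νc νa α X₀ c a v → 0 < n → Uᵀ * U = 1 →
      fourthMoment U ≤ C / n → (∀ᵐ ω ∂μ, (X₀ ω)ᵀ * X₀ ω = 1) → ∀ N : ℕ, (N : ℝ) ≤ n * T →
      ∫⁻ ω, ENNReal.ofReal (lyapunov U (P (N / n)) (closedIterate alg ε (τ / n) (X₀ ω)
          (fun k => v k ω) (fun k => U *ᵥ c k ω + a k ω) N)) ∂μ ≤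
        ENNReal.ofReal K *
          (∫⁻ ω, ENNReal.ofReal (lyapunov U (P 0) (X₀ ω)) ∂μ + ENNReal.ofReal (K / n)) := by
  obtain ⟨M, hM, hPM⟩ := riccati_solution_estimates hP T
  obtain ⟨K, hK, hstep⟩ := exists_lyapunov_step_bound alg (C := sampleConst σ νc νa) hd hα hα1 hτ hε
    hεα (fun m => sampleConst_nonneg m) σ lam (M := M + |C|) (by positivity)
  -- `exp(KT)` bounds `(1 + K/n)^N` for `N ≤ nT`, and `KT/n` bounds the accumulated error `N K/n²`.
  refine ⟨Real.exp (K * T) + K * T, by positivity, ?_⟩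
  intro n Ω _ μ _ U X₀ c a v hs hn hU hUC hX₀ N hN
  have hn0 : (0 : ℝ) < n := by exact_mod_cast hn
  set E : ℕ → ENNReal := fun k => ∫⁻ ω, ENNReal.ofReal (lyapunov U (P (k / n))
    (closedIterate alg ε (τ / n) (X₀ ω) (fun k => v k ω) (fun k => U *ᵥ c k ω + a k ω) k)) ∂μ
  have hMC : M ≤ M + |C| := le_add_of_nonneg_right (abs_nonneg C)
  have hrec : ∀ k < N, E (k + 1) ≤ ENNReal.ofReal (1 + K / n) * E k + ENNReal.ofReal (K / n ^ 2) := by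
    intro k hk
    have hk' : ((k + 1 : ℕ) : ℝ) / n ≤ T := by
      rw [div_le_iff₀ hn0]
      have : ((k + 1 : ℕ) : ℝ) ≤ N := by exact_mod_cast hk
      linarith
    have hdiff : ((k + 1 : ℕ) : ℝ) / n - k / n = 1 / n := by push_cast; ring
    have hle : (k : ℝ) / n ≤ ((k + 1 : ℕ) : ℝ) / n := by
      have : (0 : ℝ) < 1 / n := by positivity
      linarith
    obtain ⟨b1, -, b3⟩ := hPM (k / n) ((k + 1 : ℕ) / n) (by positivity) hle hk'
    rw [hdiff] at b3
    have hmain := hs.lintegral_lyapunov_step alg hd hε (h := τ / n) (by positivity) hX₀ U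
      (p := P (k / n)) (p' := P ((k + 1 : ℕ) / n)) (x := 1 + K / n) (y := K / n ^ 2) k
      fun X hX => hstep (hs.isPatternLaw_map k) (hs.isSampleLaw_map hνc hνa hn hU k) hn hU hX
        (hUC.trans (by gcongr; linarith [le_abs_self C])) (b1.trans hMC)
        (b3.trans (by rw [div_pow, one_pow, mul_one_div]; gcongr))
    refine hmain.trans (le_of_eq ?_)
    have hV : ∀ X : Matrix (Fin n) (Fin d) ℝ, ENNReal.ofReal ((1 + K / n) * lyapunov U (P (k / n)) X
        + K / n ^ 2) = ENNReal.ofReal (1 + K / n) * ENNReal.ofReal (lyapunov U (P (k / n)) X) +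
          ENNReal.ofReal (K / n ^ 2) := fun X => by
      have := lyapunov_nonneg U (P (k / n)) X
      rw [ENNReal.ofReal_add (by positivity) (by positivity), ENNReal.ofReal_mul (by positivity)]
    simp only [hV]
    rw [lintegral_add_right _ measurable_const, lintegral_const, measure_univ, mul_one,
      lintegral_const_mul' _ _ ENNReal.ofReal_ne_top]
  have hgron := le_pow_mul_of_succ_le (ENNReal.one_le_ofReal.2
    (le_add_of_nonneg_right (by positivity))) hrec N le_rfl
  have hE0 : E 0 = ∫⁻ ω, ENNReal.ofReal (lyapunov U (P 0) (X₀ ω)) ∂μ := by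
    simp only [E, Nat.cast_zero, zero_div, closedIterate]
  rw [hE0] at hgron
  refine hgron.trans ?_
  have hKT : 0 ≤ K * T := by positivity
  gcongr
  · rw [← ENNReal.ofReal_pow (by positivity)]
    refine ENNReal.ofReal_le_ofReal ?_
    calc (1 + K / n) ^ N ≤ (Real.exp (K / n)) ^ N := by
          gcongr
          linarith [Real.add_one_le_exp (K / n)]
      _ = Real.exp (N * (K / n)) := (Real.exp_nat_mul _ _).symm
      _ ≤ Real.exp (K * T) := by
          refine Real.exp_le_exp.2 ?_
          calc (N : ℝ) * (K / n) ≤ n * T * (K / n) := by gcongr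
            _ = K * T := by field_simp
      _ ≤ _ := le_add_of_nonneg_right hKT
  · rw [← ENNReal.ofReal_natCast, ← ENNReal.ofReal_mul (by positivity)]
    refine ENNReal.ofReal_le_ofReal ?_
    calc (N : ℝ) * (K / n ^ 2) ≤ n * T * (K / n ^ 2) := by gcongr
      _ = K * T / n := by field_simp
      _ ≤ _ := by gcongr; exact le_add_of_nonneg_left (Real.exp_pos _).le

end

end SubspaceTracking

open scoped Matrix.Norms.L2Operator

namespace SubspaceTracking

noncomputable section

/-! ### Limits in probability -/

section

variable {Ω : ℕ → Type*} [∀ n, MeasurableSpace (Ω n)] {μ : ∀ n, Measure (Ω n)}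
  [∀ n, IsProbabilityMeasure (μ n)]

theorem ConvergesInProbability.unique {Y : ∀ n, Ω n → ℝ} {y y' : ℝ}
    (h : ConvergesInProbability μ Y y) (h' : ConvergesInProbability μ Y y') : y = y' := by
  by_contra hne
  have hδ : 0 < |y - y'| / 2 := by
    have := abs_pos.2 (sub_ne_zero.2 hne)
    positivity
  have hsum := (h _ hδ).add (h' _ hδ)
  rw [add_zero] at hsum
  have h1 : ∀ n, (1 : ENNReal) ≤ μ n {ω | |y - y'| / 2 ≤ |Y n ω - y|} +
      μ n {ω | |y - y'| / 2 ≤ |Y n ω - y'|} := by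
    intro n
    rw [← measure_univ (μ := μ n)]
    refine (measure_mono fun ω _ => ?_).trans (measure_union_le _ _)
    by_contra hω
    simp only [Set.mem_union, Set.mem_ofPred_eq, not_or, not_le] at hω
    have := abs_sub_le y (Y n ω) y'
    rw [abs_sub_comm y (Y n ω)] at this
    linarith [hω.1, hω.2]
  exact absurd (le_of_tendsto_of_tendsto' tendsto_const_nhds hsum h1) (by simp)

/-- `AsymptoticallyInformative` asserts only that some positive limits exist; uniqueness identifies
them with the computed ones. -/
theorem HasIteratedLimit.unique {Y : ∀ n, ℝ → Ω n → ℝ} {L L' : ℝ} (h : HasIteratedLimit μ Y L)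
    (h' : HasIteratedLimit μ Y L') : L = L' := by
  obtain ⟨y, hy, hL⟩ := h
  obtain ⟨y', hy', hL'⟩ := h'
  refine tendsto_nhds_unique (hL.congr' ?_) hL'
  filter_upwards [eventually_ge_atTop 0] with t ht
  exact (hy t ht).unique (hy' t ht)

end

theorem continuous_distSq_mul_transpose {d : ℕ} (p : Matrix (Fin d) (Fin d) ℝ) :
    Continuous fun x : Fin d → Fin d → ℝ => distSq (Matrix.of x * (Matrix.of x)ᵀ) p := by
  simp only [distSq, Matrix.mul_apply, transpose_apply, Matrix.of_apply]
  fun_prop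

theorem distSq_le_of_norm_le {d : ℕ} {A B : Matrix (Fin d) (Fin d) ℝ} {b : ℝ}
    (hA : ‖A‖ ≤ 1) (hB : ‖B‖ ≤ b) : distSq A B ≤ (d : ℝ) * d * (1 + b) ^ 2 := by
  have hterm : ∀ i j, (A i j - B i j) ^ 2 ≤ (1 + b) ^ 2 := fun i j => by
    have h1 := (abs_apply_le_norm A i j).trans hA
    have h2 := (abs_apply_le_norm B i j).trans hB
    refine sq_le_sq' ?_ ?_ <;> linarith [abs_le.1 h1, abs_le.1 h2, (abs_le.1 h1).1, (abs_le.1 h1).2,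
      (abs_le.1 h2).1, (abs_le.1 h2).2]
  calc distSq A B ≤ ∑ _i : Fin d, ∑ _j : Fin d, (1 + b) ^ 2 :=
        Finset.sum_le_sum fun i _ => Finset.sum_le_sum fun j _ => hterm i j
    _ = _ := by simp [mul_assoc]

theorem abs_quadratic_sub_le {d : ℕ} (A B : Matrix (Fin d) (Fin d) ℝ) (x : Fin d → ℝ) :
    |x ⬝ᵥ (A *ᵥ x) - x ⬝ᵥ (B *ᵥ x)| ≤ ‖A - B‖ * (x ⬝ᵥ x) := by
  rw [← dotProduct_sub, ← sub_mulVec]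
  exact quadratic_le_norm _ _

section

variable {d : ℕ} {Ω : ℕ → Type*} [∀ n, MeasurableSpace (Ω n)] {μ : ∀ n, Measure (Ω n)}
  [∀ n, IsProbabilityMeasure (μ n)] {U : ∀ n, Matrix (Fin n) (Fin d) ℝ}
  {X₀ : ∀ n, Ω n → Matrix (Fin n) (Fin d) ℝ} {C : ℝ}

/-- The fourth moment is at most `C/n`. The distance term is a continuous function of the
similarity, vanishing at `Q₀` and bounded uniformly in `n` by `b`, so convergence in probability
gives convergence in mean. -/
theorem tendsto_lintegral_lyapunov_zero (hU : ∀ n, d ≤ n → (U n)ᵀ * U n = 1)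
    (hX₀ : ∀ n, d ≤ n → ∀ᵐ ω ∂(μ n), (X₀ n ω)ᵀ * X₀ n ω = 1)
    (hX₀C : ∀ n, d ≤ n → ∀ᵐ ω ∂(μ n), ∑ i, ∑ j, X₀ n ω i j ^ 4 ≤ C / n)
    {Q₀ : Matrix (Fin d) (Fin d) ℝ}
    (hQ₀ : ∀ i j,
      ConvergesInProbability μ (fun n ω => cosineSimilarity (U n) (X₀ n ω) i j) (Q₀ i j)) :
    Tendsto (fun n => ∫⁻ ω, ENNReal.ofReal (lyapunov (U n) (Q₀ * Q₀ᵀ) (X₀ n ω)) ∂(μ n)) atTop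
      (𝓝 0) := by
  set p := Q₀ * Q₀ᵀ with hp
  set b := (d : ℝ) * d * (1 + ‖p‖) ^ 2 with hb
  rw [ENNReal.tendsto_nhds_zero]
  intro η hη
  obtain ⟨r, hr0, hrη⟩ : ∃ r : ℝ, 0 < r ∧ ENNReal.ofReal r ≤ η / 2 := by
    rcases eq_or_ne η ⊤ with rfl | hne
    · exact ⟨1, one_pos, by simp [ENNReal.top_div]⟩
    · refine ⟨(η / 2).toReal, ENNReal.toReal_pos (by simpa using hη.ne') (by finiteness), ?_⟩
      exact ENNReal.ofReal_toReal_le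
  have hnhds : {x : Fin d → Fin d → ℝ | distSq (Matrix.of x * (Matrix.of x)ᵀ) p < r} ∈
      𝓝 (fun i j => Q₀ i j) := by
    refine (isOpen_lt (continuous_distSq_mul_transpose p) continuous_const).mem_nhds ?_
    have h0 : (Matrix.of fun i j => Q₀ i j) = Q₀ := rfl
    simpa [h0, distSq, hp] using hr0
  obtain ⟨δ, hδ, hball⟩ := Metric.mem_nhds_iff.1 hnhds
  set S : ∀ n, Set (Ω n) := fun n =>
    ⋃ i, ⋃ j, {ω | δ ≤ |cosineSimilarity (U n) (X₀ n ω) i j - Q₀ i j|} with hS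
  have hSlim : Tendsto (fun n : ℕ => ENNReal.ofReal (C / n) + ENNReal.ofReal b *
      ∑ i, ∑ j, μ n {ω | δ ≤ |cosineSimilarity (U n) (X₀ n ω) i j - Q₀ i j|}) atTop (𝓝 0) := by
    have h1 : Tendsto (fun n => ∑ i, ∑ j,
        μ n {ω | δ ≤ |cosineSimilarity (U n) (X₀ n ω) i j - Q₀ i j|}) atTop (𝓝 0) := by
      simpa using tendsto_finsetSum Finset.univ fun i _ =>
        tendsto_finsetSum Finset.univ fun j _ => hQ₀ i j δ hδ
    have h2 := ENNReal.Tendsto.const_mul (a := ENNReal.ofReal b) h1 (Or.inr ENNReal.ofReal_ne_top)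
    have h3 := ENNReal.tendsto_ofReal (tendsto_const_div_atTop_nhds_zero_nat C)
    simpa using h3.add h2
  have hη2 : 0 < η / 2 := by simpa using hη.ne'
  filter_upwards [(ENNReal.tendsto_nhds_zero.1 hSlim) _ hη2, eventually_ge_atTop d] with n hn hdn
  have hpt : ∀ᵐ ω ∂(μ n), ENNReal.ofReal (lyapunov (U n) p (X₀ n ω)) ≤
      (S n).indicator (fun _ => ENNReal.ofReal b) ω +
        (ENNReal.ofReal r + ENNReal.ofReal (C / n)) := by
    filter_upwards [hX₀ n hdn, hX₀C n hdn] with ω hω hωC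
    have hcos : cosineSimilarity (U n) (X₀ n ω) = (U n)ᵀ * X₀ n ω := by
      rw [cosineSimilarity, orthonormalize_of_transpose_mul hω]
    by_cases hmem : ω ∈ S n
    · rw [Set.indicator_of_mem hmem]
      have hnorm := norm_transpose_mul_le_one (hU n hdn) hω
      have h1 : ‖(U n)ᵀ * X₀ n ω * ((U n)ᵀ * X₀ n ω)ᵀ‖ ≤ 1 := by
        refine (norm_mul_le _ _).trans ?_
        rw [norm_transpose]
        exact mul_le_one₀ hnorm (norm_nonneg _) hnorm
      have h2 := distSq_le_of_norm_le h1 (le_refl ‖p‖)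
      refine (ENNReal.ofReal_le_ofReal (add_le_add h2 hωC)).trans ?_
      refine ENNReal.ofReal_add_le.trans ?_
      gcongr
      exact le_add_self
    · rw [Set.indicator_of_notMem hmem, zero_add]
      simp only [hS, Set.mem_iUnion, Set.mem_ofPred_eq, not_exists, not_le] at hmem
      have hin : (fun i j => cosineSimilarity (U n) (X₀ n ω) i j) ∈
          Metric.ball (fun i j => Q₀ i j) δ := by
        rw [Metric.mem_ball, dist_pi_lt_iff hδ]
        intro i
        rw [dist_pi_lt_iff hδ]
        exact fun j => hmem i j
      have h2 := hball hin
      simp only [Set.mem_ofPred_eq, hcos] at h2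
      exact (ENNReal.ofReal_le_ofReal (add_le_add (le_of_lt h2) hωC)).trans ENNReal.ofReal_add_le
  have hμS : μ n (S n) ≤
      ∑ i, ∑ j, μ n {ω | δ ≤ |cosineSimilarity (U n) (X₀ n ω) i j - Q₀ i j|} :=
    (measure_iUnion_fintype_le _ _).trans
      (Finset.sum_le_sum fun i _ => measure_iUnion_fintype_le _ _)
  calc _ ≤ ∫⁻ ω, ((S n).indicator (fun _ => ENNReal.ofReal b) ω +
        (ENNReal.ofReal r + ENNReal.ofReal (C / n))) ∂(μ n) := lintegral_mono_ae hpt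
    _ = ∫⁻ ω, (S n).indicator (fun _ => ENNReal.ofReal b) ω ∂(μ n) +
        (ENNReal.ofReal r + ENNReal.ofReal (C / n)) := by
      rw [lintegral_add_right _ measurable_const, lintegral_const, measure_univ, mul_one]
    _ ≤ ENNReal.ofReal b * μ n (S n) + (η / 2 + ENNReal.ofReal (C / n)) := by
      gcongr
      exact lintegral_indicator_const_le _ _
    _ ≤ η / 2 + (ENNReal.ofReal (C / n) + ENNReal.ofReal b *
        ∑ i, ∑ j, μ n {ω | δ ≤ |cosineSimilarity (U n) (X₀ n ω) i j - Q₀ i j|}) := by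
      rw [add_left_comm, add_comm (ENNReal.ofReal b * _)]
      gcongr
    _ ≤ η / 2 + η / 2 := by gcongr
    _ = η := ENNReal.add_halves η

end

end

end SubspaceTracking

open scoped Matrix.Norms.L2Operator

namespace SubspaceTracking

noncomputable section

/-! ### The limit of the principal angles -/

theorem IsDataStream.measurable_lyapunov_closedIterate {n d : ℕ} {Ω : Type*} [MeasurableSpace Ω]
    {μ : Measure Ω} [IsProbabilityMeasure μ] {νc : Measure (Fin d → ℝ)} {νa : Measure ℝ} {α : ℝ}
    {X₀ : Ω → Matrix (Fin n) (Fin d) ℝ} {c : ℕ → Ω → Fin d → ℝ} {a : ℕ → Ω → Fin n → ℝ}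
    {v : ℕ → Ω → Fin n → Bool} (hs : IsDataStream μ νc νa α X₀ c a v)
    (alg : Algorithm) (hd : 0 < d) (ε h : ℝ) (U : Matrix (Fin n) (Fin d) ℝ)
    (p : Matrix (Fin d) (Fin d) ℝ) (k : ℕ) :
    Measurable fun ω => lyapunov U p (closedIterate alg ε h (X₀ ω) (fun k => v k ω)
      (fun k => U *ᵥ c k ω + a k ω) k) := by
  have hY := measurable_closedIterate alg (ε := ε) (h := h) hd hs.measurable_X₀ hs.measurable_v
    (hs.measurable_sample U) k
  have hL := measurable_lyapunov U p
  generalize hLd : (fun x : Fin n → Fin d → ℝ => lyapunov U p (Matrix.of x)) = L at hL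
  have hLe : ∀ Z, lyapunov U p Z = L fun i j => Z i j := fun Z => by rw [← hLd]; rfl
  simp only [hLe]
  exact hL.comp hY

/-- The squared cosines of the principal angles are close to the sorted eigenvalues of any matrix
at which the Lyapunov function is small. -/
theorem abs_cos_sq_principalAngle_sub_le {n d : ℕ} {U X : Matrix (Fin n) (Fin d) ℝ}
    (hU : Uᵀ * U = 1) (hX : Xᵀ * X = 1) {p p' : Matrix (Fin d) (Fin d) ℝ} {e : Fin d → ℝ}
    (he : IsSortedSpectrum p' e) (l : Fin d) :
    |Real.cos (principalAngle U X l) ^ 2 - e l| ≤ √(lyapunov U p X) + ‖p' - p‖ := by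
  set A := Uᵀ * X * (Uᵀ * X)ᵀ
  refine ((isSortedSpectrum_cos_sq_principalAngle hU hX).abs_sub_le he (δ := ‖A - p'‖)
    (fun x => abs_quadratic_sub_le _ _ x) l).trans ?_
  have h1 : ‖A - p‖ ≤ √(lyapunov U p X) := Real.le_sqrt_of_sq_le
    ((norm_sub_sq_le_distSq A p).trans (le_add_of_nonneg_right (fourthMoment_nonneg X)))
  have h2 := norm_sub_le_norm_sub_add_norm_sub A p p'
  rw [norm_sub_rev p] at h2
  linarith

section

variable {d : ℕ} {α σ τ ε C : ℝ} {lam : Fin d → ℝ} {νc : Measure (Fin d → ℝ)} {νa : Measure ℝ}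
  {Ω : ℕ → Type*} [∀ n, MeasurableSpace (Ω n)] {μ : ∀ n, Measure (Ω n)}
  [∀ n, IsProbabilityMeasure (μ n)] {U : ∀ n, Matrix (Fin n) (Fin d) ℝ}
  {X₀ : ∀ n, Ω n → Matrix (Fin n) (Fin d) ℝ} {c : ∀ n, ℕ → Ω n → Fin d → ℝ}
  {a : ∀ n, ℕ → Ω n → Fin n → ℝ} {v : ∀ n, ℕ → Ω n → Fin n → Bool}

/-- A deviation of at least `δ` at step `N = ⌊nt⌋` forces the Lyapunov function at reference
`P(N/n)` to be at least `(δ/2)²`, once `‖P t - P(N/n)‖ ≤ M/n` is below `δ/2`. Markov's inequality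
bounds the probability of this event. -/
theorem convergesInProbability_cos_sq_angleAt (alg : Algorithm) (hd : 0 < d) (hα : 0 < α)
    (hα1 : α ≤ 1) (hτ : 0 < τ) (hε : 0 < ε) (hεα : ε < α) (hνc : IsCoefficientLaw lam νc)
    (hνa : IsNoiseLaw σ νa)
    (hstream : ∀ n, d ≤ n → IsDataStream (μ n) νc νa α (X₀ n) (c n) (a n) (v n))
    (hU : ∀ n, d ≤ n → (U n)ᵀ * U n = 1)
    (hX₀ : ∀ n, d ≤ n → ∀ᵐ ω ∂(μ n), (X₀ n ω)ᵀ * X₀ n ω = 1)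
    (hUC : ∀ n, d ≤ n → ∑ i, ∑ j, U n i j ^ 4 ≤ C / n)
    (hX₀C : ∀ n, d ≤ n → ∀ᵐ ω ∂(μ n), ∑ i, ∑ j, X₀ n ω i j ^ 4 ≤ C / n)
    {Q₀ : Matrix (Fin d) (Fin d) ℝ}
    (hQ₀ : ∀ i j,
      ConvergesInProbability μ (fun n ω => cosineSimilarity (U n) (X₀ n ω) i j) (Q₀ i j))
    {P : ℝ → Matrix (Fin d) (Fin d) ℝ} (hP0 : P 0 = Q₀ * Q₀ᵀ)
    (hP : ∀ t, 0 ≤ t → HasDerivAt P (riccatiField (riccatiLinear α σ τ lam)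
      (riccatiQuadratic α σ τ lam) (P t)) t) {t : ℝ} (ht : 0 ≤ t) {e : Fin d → ℝ}
    (he : IsSortedSpectrum (P t) e) (l : Fin d) :
    ConvergesInProbability μ (fun n ω => Real.cos (angleAt alg ε τ (U n) (X₀ n ω)
      (fun k => c n k ω) (fun k => a n k ω) (fun k => v n k ω) t l) ^ 2) (e l) := by
  obtain ⟨K, hK, hmean⟩ :=
    exists_lintegral_lyapunov_le alg hd hα hα1 hτ hε hεα hνc hνa C hP ht
  obtain ⟨M, hM, hPM⟩ := riccati_solution_estimates hP t
  have hinit := tendsto_lintegral_lyapunov_zero hU hX₀ hX₀C hQ₀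
  rw [← hP0] at hinit
  intro δ hδ
  have hb : ENNReal.ofReal ((δ / 2) ^ 2) ≠ 0 := by simpa using by positivity
  have hlim : Tendsto (fun n : ℕ => ENNReal.ofReal K *
      (∫⁻ ω, ENNReal.ofReal (lyapunov (U n) (P 0) (X₀ n ω)) ∂(μ n) + ENNReal.ofReal (K / n)) /
        ENNReal.ofReal ((δ / 2) ^ 2)) atTop (𝓝 0) := by
    have h1 := ENNReal.tendsto_ofReal (tendsto_const_div_atTop_nhds_zero_nat K)
    have h2 := ENNReal.Tendsto.const_mul (a := ENNReal.ofReal K) (hinit.add h1)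
      (Or.inr ENNReal.ofReal_ne_top)
    simpa using ENNReal.Tendsto.div_const h2 (Or.inr hb)
  refine tendsto_of_tendsto_of_tendsto_of_le_of_le' tendsto_const_nhds hlim
    (Eventually.of_forall fun _ => zero_le) ?_
  have hMn := (tendsto_const_div_atTop_nhds_zero_nat M).eventually (gt_mem_nhds (half_pos hδ))
  filter_upwards [eventually_ge_atTop d, hMn] with n hdn hn
  have hn0 : 0 < n := hd.trans_le hdn
  have hn0' : (0 : ℝ) < n := by exact_mod_cast hn0
  set N := ⌊(n : ℝ) * t⌋₊ with hN
  have hNle : (N : ℝ) ≤ n * t := Nat.floor_le (by positivity)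
  have hN1 : (n : ℝ) * t < N + 1 := Nat.lt_floor_add_one _
  have hm := hmean (hstream n hdn) hn0 (hU n hdn) (hUC n hdn) (hX₀ n hdn) N hNle
  have hNt : (N : ℝ) / n ≤ t := by rw [div_le_iff₀ hn0']; linarith
  obtain ⟨-, hPd, -⟩ := hPM (N / n) t (by positivity) hNt le_rfl
  have hPd' : ‖P t - P (N / n)‖ < δ / 2 := by
    refine hPd.trans_lt (lt_of_le_of_lt ?_ hn)
    rw [div_eq_mul_one_div M]
    gcongr
    rw [sub_le_iff_le_add, ← add_div, le_div_iff₀ hn0']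
    linarith
  have hmeas := ((hstream n hdn).measurable_lyapunov_closedIterate alg hd ε (τ / n) (U n)
    (P (N / n)) N).ennreal_ofReal
  refine le_trans (measure_mono_ae ?_) ((meas_ge_le_lintegral_div hmeas.aemeasurable hb
    ENNReal.ofReal_ne_top).trans (ENNReal.div_le_div_right hm _))
  filter_upwards [hX₀ n hdn] with ω hω hmem
  replace hmem : δ ≤ |Real.cos (angleAt alg ε τ (U n) (X₀ n ω) (fun k => c n k ω)
    (fun k => a n k ω) (fun k => v n k ω) t l) ^ 2 - e l| := hmem
  change ENNReal.ofReal _ ≤ ENNReal.ofReal _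
  refine ENNReal.ofReal_le_ofReal ?_
  have hX := closedIterate_transpose_mul alg (h := τ / n) (by positivity) hε hω (fun k => v n k ω)
    (fun k => U n *ᵥ c n k ω + a n k ω) N
  have habs := abs_cos_sq_principalAngle_sub_le (hU n hdn) hX (p := P (N / n)) he l
  rw [angleAt, iterate_eq_closedIterate alg hτ.le hε hω] at hmem
  rw [← Real.le_sqrt' (half_pos hδ)]
  linarith [hmem.trans habs]

end

/-! ### The limiting value and the criterion for positivity -/

/-- The limiting value of the squared cosine of a principal angle. -/
def limitCosSq (α σ τ x : ℝ) : ℝ :=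
  max 0 ((2 * α * x ^ 2 - τ * σ ^ 4) / (α * x ^ 2 * (2 + τ * σ ^ 2)))

theorem max_riccati_eq_limitCosSq {d : ℕ} {α σ τ : ℝ} (hα : 0 < α) (hτ : 0 < τ)
    {lam : Fin d → ℝ} (hlam : ∀ l, 0 < lam l) (l : Fin d) :
    max 0 (2 * riccatiLinear α σ τ lam l / riccatiQuadratic α σ τ lam l) =
      limitCosSq α σ τ (lam l) := by
  have h1 := hlam l
  have h2 : 0 < 2 + τ * σ ^ 2 := by positivity
  unfold limitCosSq riccatiLinear riccatiQuadratic
  congr 1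
  rw [div_eq_div_iff (by positivity) (by positivity)]
  ring

/-- Ensures that the diagonal limit matrix lists its eigenvalues in nonincreasing order, so that the
`l`-th angle is matched with `lam l`. -/
theorem limitCosSq_mono {α σ τ x y : ℝ} (hα : 0 < α) (hτ : 0 < τ) (hx : 0 < x) (hxy : x ≤ y) :
    limitCosSq α σ τ x ≤ limitCosSq α σ τ y := by
  have hy := hx.trans_le hxy
  refine max_le_max_left 0 ?_
  rw [div_le_div_iff₀ (by positivity) (by positivity)]
  have h1 : x ^ 2 ≤ y ^ 2 := by gcongr
  have h2 : 0 ≤ τ * σ ^ 4 * (α * (2 + τ * σ ^ 2)) * (y ^ 2 - x ^ 2) :=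
    mul_nonneg (by positivity) (by linarith)
  linarith

theorem limitCosSq_pos_iff {α σ τ x : ℝ} (hα : 0 < α) (hσ : 0 < σ) (hτ : 0 < τ) (hx : 0 < x) :
    0 < limitCosSq α σ τ x ↔ τ < 2 * α / σ ^ 4 * x ^ 2 := by
  rw [limitCosSq, lt_max_iff, div_pos_iff_of_pos_right (by positivity), div_mul_eq_mul_div,
    lt_div_iff₀ (by positivity), sub_pos]
  simp

end

end SubspaceTracking

open SubspaceTracking
-- The theorem
theorem proposition1 (alg : Algorithm) {d : ℕ} (hd : 0 < d)
    (α σ τ ε C : ℝ) (hα : 0 < α) (hα1 : α < 1) (hσ : 0 < σ) (hτ : 0 < τ)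
    (hε : 0 < ε) (hεα : ε < α)
    (lam : Fin d → ℝ) (hlam : ∀ l, 0 < lam l) (hlam_anti : Antitone lam)
    (νc : Measure (Fin d → ℝ)) (hνc : IsCoefficientLaw lam νc)
    (νa : Measure ℝ) (hνa : IsNoiseLaw σ νa)
    (Ω : ℕ → Type*) [∀ n, MeasurableSpace (Ω n)]
    (μ : ∀ n, Measure (Ω n)) [∀ n, IsProbabilityMeasure (μ n)]
    (U : ∀ n, Matrix (Fin n) (Fin d) ℝ) (X₀ : ∀ n, Ω n → Matrix (Fin n) (Fin d) ℝ)
    (c : ∀ n, ℕ → Ω n → Fin d → ℝ) (a : ∀ n, ℕ → Ω n → Fin n → ℝ)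
    (v : ∀ n, ℕ → Ω n → Fin n → Bool)
    (hstream : ∀ n, d ≤ n → IsDataStream (μ n) νc νa α (X₀ n) (c n) (a n) (v n))
    (hU : ∀ n, d ≤ n → (U n)ᵀ * U n = 1)
    (hX₀ : ∀ n, d ≤ n → ∀ᵐ ω ∂(μ n), (X₀ n ω)ᵀ * X₀ n ω = 1)
    (hU_incoherent : ∀ n, d ≤ n → ∑ i, ∑ j, U n i j ^ 4 ≤ C / n)
    (hX₀_incoherent : ∀ n, d ≤ n → ∀ᵐ ω ∂(μ n), ∑ i, ∑ j, X₀ n ω i j ^ 4 ≤ C / n)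
    (Q₀ : Matrix (Fin d) (Fin d) ℝ) (hQ₀_inv : IsUnit Q₀)
    (hQ₀ : ∀ i j,
      ConvergesInProbability μ (fun n ω => cosineSimilarity (U n) (X₀ n ω) i j) (Q₀ i j)) :
    (∀ l : Fin d,
      HasIteratedLimit μ
        (fun n t ω => Real.cos (angleAt alg ε τ (U n) (X₀ n ω) (fun k => c n k ω)
          (fun k => a n k ω) (fun k => v n k ω) t l) ^ 2)
        (max 0 ((2 * α * lam l ^ 2 - τ * σ ^ 4) / (α * lam l ^ 2 * (2 + τ * σ ^ 2))))) ∧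
    (AsymptoticallyInformative μ
        (fun (l : Fin d) n t ω => angleAt alg ε τ (U n) (X₀ n ω) (fun k => c n k ω)
          (fun k => a n k ω) (fun k => v n k ω) t l) ↔
      τ < 2 * α / σ ^ 4 * ⨅ l : Fin d, lam l ^ 2) := by
  have : Nonempty (Fin d) := ⟨⟨0, hd⟩⟩
  have hmain : ∀ l : Fin d, HasIteratedLimit μ
      (fun n t ω => Real.cos (angleAt alg ε τ (U n) (X₀ n ω) (fun k => c n k ω)
        (fun k => a n k ω) (fun k => v n k ω) t l) ^ 2) (limitCosSq α σ τ (lam l)) := by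
    have hg : ∀ i, 0 < riccatiQuadratic α σ τ lam i := fun i => by
      have := hlam i
      unfold riccatiQuadratic
      positivity
    -- Invertibility of `Q₀` enters here: without it some direction could start, and remain, at zero
    -- similarity.
    have hpd : (Q₀ * Q₀ᵀ).PosDef := by
      have h := PosDef.mul_conjTranspose_self Q₀ (vecMul_injective_of_isUnit hQ₀_inv)
      rwa [conjTranspose_eq_transpose_of_trivial] at h
    obtain ⟨P, hP0, hPsymm, hP, δ, hδ, hlim⟩ :=
      exists_riccati_solution hd (a := riccatiLinear α σ τ lam) hg hpd
    -- The implication makes the choice total in `t`; values at negative times are irrelevant.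
    have hspec : ∀ t, ∃ e, 0 ≤ t → IsSortedSpectrum (P t) e := fun t => by
      by_cases ht : 0 ≤ t
      · exact (exists_isSortedSpectrum (hPsymm t ht)).imp fun e he _ => he
      · exact ⟨0, fun h => absurd h ht⟩
    choose e he using hspec
    intro l
    refine ⟨fun t => e t l, fun t ht => convergesInProbability_cos_sq_angleAt alg hd hα hα1.le hτ hε
      hεα hνc hνa hstream hU hX₀ hU_incoherent hX₀_incoherent hQ₀ hP0 hP ht (he t ht) l, ?_⟩
    simp only [max_riccati_eq_limitCosSq hα hτ hlam] at hlim
    have hdiag : IsSortedSpectrum (diagonal fun i => limitCosSq α σ τ (lam i))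
        (fun i => limitCosSq α σ τ (lam i)) :=
      isSortedSpectrum_diagonal fun i j hij => limitCosSq_mono hα hτ (hlam j) (hlam_anti hij)
    rw [tendsto_iff_dist_tendsto_zero]
    refine squeeze_zero' (Eventually.of_forall fun _ => dist_nonneg) ?_ hδ
    filter_upwards [eventually_ge_atTop 0] with t ht
    exact (he t ht).abs_sub_le hdiag (hlim t ht) l
  refine ⟨hmain, fun h => ?_, fun h l => ⟨_, ?_, hmain l⟩⟩
  -- The infimum over the finite index set is attained, so positivity at the minimizing index
  -- already gives the bound on `τ`.
  · obtain ⟨l, hl⟩ := exists_eq_ciInf_of_finite (f := fun l : Fin d => lam l ^ 2)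
    obtain ⟨L, hL, hlimL⟩ := h l
    rw [hlimL.unique (hmain l), limitCosSq_pos_iff hα hσ hτ (hlam l)] at hL
    rwa [← hl]
  · rw [limitCosSq_pos_iff hα hσ hτ (hlam l)]
    refine h.trans_le ?_
    gcongr
    exact ciInf_le (Set.finite_range _).bddBelow l
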